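/- Let $V$ be a finite-dimensional real vector space with a rational structure $V(\mathbb Q)$, and let $C\subset V$ be an open nondegenerate convex cone (nonempty, containing no affine line). Let $C^*\subset V^*$ be the cone of linear forms that are $\ge 0$ on $C$, let the open dual $C^\circ$ be its interior, let $C_+$ be the convex hull of $\overline C\cap V(\mathbb Q)$, and let $C^\circ_+$ be the convex hull of $\overline{C^\circ}\cap V^*(\mathbb Q)$. Let $\Gamma\subset \mathrm{GL}(V)$ be a subgroup that stabilizes $C$ and some lattice in $V(\mathbb Q)$, and suppose that $(V(\mathbb Q),C,\Gamma)$ is a polyhedral triple, i.e. there is a polyhedral cone $\Pi\subset C_+$ (a cone spanned by a finite set) with $\Gamma\cdot\Pi=C_+$. A face of a convex set $X$ is a nonempty convex subset $Y\subset X$ such that every segment in $X$ with a relatively interior point in $Y$ lies in $Y$. For a face $F$ of $C_+$ let $F^\dagger$ be the set of $\xi\in C^\circ_+$ that vanish on $F$, let $V_F$ be the linear span of $F$, let $V^F\subset V$ be the annihilator of $F^\dagger$, and let $\pi_F:V\to V/V_F$ and $\pi^F:V\to V/V^F$ be the projections. For a face $H$ of $C^\circ_+$ let $H^\dagger$ be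 the set of $x\in C_+$ at which all elements of $H$ vanish, let $(V^*)^H\subset V^*$ be the annihilator of $H^\dagger$, and let $\pi^H:V^*\to V^*/(V^*)^H$ be the projection. Then: (i) For all faces $F\subset G$ of $C_+$, the common zero set of the rational linear forms on $V_G$ that are $\ge 0$ on $G$ and vanish on $F$ is $V^F\cap V_G$. (ii) $F\mapsto F^\dagger$ is an inclusion-reversing bijection from the set of faces of $C_+$ onto the set of faces of $C^\circ_+$. Every face $F$ of $C_+$ satisfies $F^{\dagger\dagger}=F$ and is an exposed face of $C_+$. (iii) For every face $F$ of $C_+$, the assignment $G\mapsto \pi_F(G)$ is a bijection from the set of faces of $C_+$ that contain $F$ onto the set of faces of $\pi_F(C_+)$, and $G\mapsto\pi^F(G)$ is a bijection from the same set onto the set of faces of $\pi^F(C_+)$. (iv) For all faces $F\subset G$ of $C_+$, with $\dot G$ the relative interior of $G$, the dual cone of $\pi^F(\dot G)$ (the linear forms on the span $\pi^F(V_G)$ of $\pi^F(\dot G)$ that are $\ge 0$ on it) is naturally identified with the closure of $\pi^{G^\dagger}(F^\dagger)$ in $V^*/(V^*)^{G^\dagger}$. Precisely, there is an injective linear map $e:(\pi^F(V_G))^*\to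 V^*/(V^*)^{G^\dagger}$, characterized by $e(\eta)=\pi^{G^\dagger}(\xi)\iff \xi(x)=\eta(\pi^F(x))$ for all $x\in V_G$, and $e$ maps this dual cone onto that closure. -/

import Mathlib

namespace PolyCone

section General

variable {V : Type*} [NormedAddCommGroup V] [NormedSpace ℝ V]

/-- A rational structure on a finite dimensional real vector space `V`: the rational span of some
real basis of `V`. -/
def IsRationalStructure [Module ℚ V] (VQ : Submodule ℚ V) : Prop :=
  ∃ b : Module.Basis (Fin (Module.finrank ℝ V)) ℝ V, VQ = Submodule.span ℚ (Set.range b)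

/-- The dual rational structure `V*(ℚ)`: the linear forms that are rational on `V(ℚ)`. -/
def dualRat [Module ℚ V] (VQ : Submodule ℚ V) : Set (StrongDual ℝ V) :=
  {ξ | ∀ v ∈ VQ, ∃ q : ℚ, ξ v = (q : ℝ)}

/-- The dual cone `C*`: the linear forms that are nonnegative on `C`. -/
def dualCone (C : Set V) : Set (StrongDual ℝ V) :=
  {ξ | ∀ x ∈ C, 0 ≤ ξ x}

/-- The open dual `C°`: the interior of the dual cone. -/
def openDual (C : Set V) : Set (StrongDual ℝ V) :=
  interior (dualCone C)

/-- `C₊`: the convex hull of the set of rational points of the closure of `C`. Here `Q` is the set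
of rational points of the ambient space. -/
def ratHull (Q : Set V) (C : Set V) : Set V :=
  convexHull ℝ (closure C ∩ Q)

/-- An open nondegenerate convex cone: nonempty, open, convex, stable under multiplication by
positive scalars, and containing no affine line. -/
structure IsOpenNondegenerateCone (C : Set V) : Prop where
  nonempty : C.Nonempty
  isOpen : IsOpen C
  convex : Convex ℝ C
  smul_mem : ∀ x ∈ C, ∀ t : ℝ, 0 < t → t • x ∈ C
  no_line : ∀ x v : V, v ≠ 0 → ∃ t : ℝ, x + t • v ∉ C

/-- A lattice in `V(ℚ)`: a discrete subgroup of `V`, spanning `V` over `ℝ`, whose elements are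
rational. -/
def IsRationalLattice [Module ℚ V] (VQ : Submodule ℚ V) (L : Submodule ℤ V) : Prop :=
  (∃ _ : DiscreteTopology L, IsZLattice ℝ L) ∧ (L : Set V) ⊆ VQ

/-- A polyhedral cone: a convex cone spanned by a finite set. -/
def IsPolyhedralCone (P : Set V) : Prop :=
  ∃ S : Finset V, P = (PointedCone.hull ℝ (S : Set V) : Set V)

/-- `(V(ℚ), C, Γ)` is a polyhedral triple (a triple of polyhedral type): `V(ℚ)` is a rational
structure on `V`, `C` is an open nondegenerate convex cone, `Γ` is a subgroup of `GL(V)` that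
stabilizes `C` and some lattice in `V(ℚ)`, and `C₊` is the union of the `Γ`-translates of some
polyhedral cone contained in `C₊`. -/
structure IsPolyhedralTriple [Module ℚ V] (VQ : Submodule ℚ V) (C : Set V)
    (Γ : Subgroup (V ≃ₗ[ℝ] V)) : Prop where
  rational : IsRationalStructure VQ
  cone : IsOpenNondegenerateCone C
  stabilizes_cone : ∀ γ ∈ Γ, γ '' C = C
  stabilizes_lattice : ∃ L : Submodule ℤ V, IsRationalLattice VQ L ∧
    ∀ γ ∈ Γ, γ '' (L : Set V) = (L : Set V)
  polyhedral : ∃ P : Set V, IsPolyhedralCone P ∧ P ⊆ ratHull VQ C ∧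
    ⋃ γ ∈ Γ, γ '' P = ratHull VQ C

/-- The annihilator in `V` of a set of linear forms. -/
def annih (S : Set (StrongDual ℝ V)) : Submodule ℝ V where
  carrier := {x | ∀ ξ ∈ S, ξ x = 0}
  add_mem' := by
    intro x y hx hy ξ hξ
    rw [map_add, hx ξ hξ, hy ξ hξ, add_zero]
  zero_mem' := fun ξ _ => map_zero ξ
  smul_mem' := by
    intro c x hx ξ hξ
    rw [map_smul, hx ξ hξ, smul_zero]

/-- The annihilator in `V*` of a set of vectors. -/
def coannih (S : Set V) : Submodule ℝ (StrongDual ℝ V) where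
  carrier := {ξ | ∀ x ∈ S, ξ x = 0}
  add_mem' := by
    intro ξ η hξ hη x hx
    change ξ x + η x = 0
    rw [hξ x hx, hη x hx, add_zero]
  zero_mem' := fun _ _ => rfl
  smul_mem' := by
    intro c ξ hξ x hx
    change c • ξ x = 0
    rw [hξ x hx, smul_zero]

/-- `C°₊`, the analogue of `C₊` for the open dual cone `C°` in `V*` with the dual rational
structure. -/
def dualRatHull [Module ℚ V] (VQ : Submodule ℚ V) (C : Set V) : Set (StrongDual ℝ V) :=
  ratHull (dualRat VQ) (openDual C)

/-- `F† = {ξ ∈ C°₊ : ξ vanishes on F}`, for `F ⊆ C₊`. -/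
def dagger [Module ℚ V] (VQ : Submodule ℚ V) (C : Set V) (F : Set V) : Set (StrongDual ℝ V) :=
  {ξ ∈ dualRatHull VQ C | ∀ x ∈ F, ξ x = 0}

/-- The operation `†` for the dual cone: `H† = {x ∈ C₊ : every element of H vanishes on x}`, for
`H ⊆ C°₊`. Here `V**` is identified with `V`, and hence `(C°)°₊` with `C₊`. -/
def codagger [Module ℚ V] (VQ : Submodule ℚ V) (C : Set V) (H : Set (StrongDual ℝ V)) : Set V :=
  {x ∈ ratHull VQ C | ∀ ξ ∈ H, ξ x = 0}

/-- `V_F`, the linear span of `F`. -/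
abbrev lowerSpace (F : Set V) : Submodule ℝ V :=
  Submodule.span ℝ F

/-- `V^F`, the annihilator of `F†` in `V`. -/
abbrev upperSpace [Module ℚ V] (VQ : Submodule ℚ V) (C : Set V) (F : Set V) : Submodule ℝ V :=
  annih (dagger VQ C F)

/-- `(V*)^H`, the annihilator of `H†` in `V*`. -/
abbrev dualUpperSpace [Module ℚ V] (VQ : Submodule ℚ V) (C : Set V)
    (H : Set (StrongDual ℝ V)) : Submodule ℝ (StrongDual ℝ V) :=
  coannih (codagger VQ C H)

/-- The projection `π_F : V → V / V_F`. -/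
abbrev lowerProj (F : Set V) : V →ₗ[ℝ] V ⧸ lowerSpace F :=
  (lowerSpace F).mkQ

/-- The projection `π^F : V → V / V^F`. -/
abbrev upperProj [Module ℚ V] (VQ : Submodule ℚ V) (C : Set V) (F : Set V) :
    V →ₗ[ℝ] V ⧸ upperSpace VQ C F :=
  (upperSpace VQ C F).mkQ

/-- The projection `π^H : V* → V* / (V*)^H`. -/
abbrev dualUpperProj [Module ℚ V] (VQ : Submodule ℚ V) (C : Set V)
    (H : Set (StrongDual ℝ V)) :
    StrongDual ℝ V →ₗ[ℝ] StrongDual ℝ V ⧸ dualUpperSpace VQ C H :=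
  (dualUpperSpace VQ C H).mkQ

/-- A linear form on the linear span of `G` is rational if it takes rational values at the rational
points of that span. -/
def IsRationalForm [Module ℚ V] (VQ : Submodule ℚ V) (G : Set V)
    (ξ : Module.Dual ℝ (lowerSpace G)) : Prop :=
  ∀ v : lowerSpace G, (v : V) ∈ VQ → ∃ q : ℚ, ξ v = (q : ℝ)

end General

/-- A face of a convex set `X`: a nonempty convex subset `Y` of `X` such that every segment in `X`
with a point of `Y` in its relative interior is contained in `Y`. -/
def IsFace {E : Type*} [AddCommGroup E] [Module ℝ E] (X Y : Set E) : Prop :=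
  Y.Nonempty ∧ Convex ℝ Y ∧ IsExtreme ℝ X Y

end PolyCone

set_option linter.unusedSectionVars false

open Module

/-! Fix a `Γ`-stable lattice `L` in `V(ℚ)`. Then `X = C₊` is the cone generated by the lattice
points of the closure of `C`. The triple is replaced by the algebraic data `Sys`: a lattice, a cone
generated by lattice points, a group preserving both, and a finitely generated rational cone whose
translates cover the relative interior. The crucial fact is that every face of `X` is exposed by an
integral form (`exists_exposing_aux`). It is sharpened by `Sys.exposing_dominates`: a form exposing
`F` bounds, up to a factor, every integral form that is nonnegative on `X` and vanishes on `F`.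

Finiteness comes from the integral forms that are order units on `X`. At an interior point some of
them take the least value and are called active. By Dickson's lemma only finitely many are active
somewhere on a finitely generated rational cone (`finite_isActive`), and only finitely many group
elements carry a given form into a given finite set (`Sys.finite_group`). If one form stays active
along a sequence of points, these points therefore lie in finitely many translates of the polyhedral
cone. A ray with this property has its direction in one translate. This gives `Sys.star`: modulo the
span of a face `F`, the interior is covered by the translates of one rational polyhedral cone under
the pointwise stabilizer of `F`.

Exposedness is proved by induction on the dimension of `V` and the codimension of `F`. If two faces
strictly above `F` meet in `F`, the sum of their exposing forms exposes `F`. Otherwise there is a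
least face `F₁` strictly above `F`. If `F₁ = X`, the interior of `X` maps to an open cone `D` in `V
/ V_F` with a cocompact group of affine symmetries. An invariant subspace that meets `D` is
everything (`Cocompact.eq_top_of_invariant`). The radical of the representation is a rational
subspace, since it comes from the kernel of a trace form, and modulo it the representation is
semisimple. Together these facts make the forms that are nonnegative on `D` and vanish on the
radical span a rational space, so one of them is integral and nonzero. If `F₁ ≠ X`, induction
exposes `F` inside `F₁`, and `Sys.not_exposed_of_unique` derives a contradiction: the points of a
coset of the span of `F₁` that lie in the interior modulo `V_F` reach arbitrarily negative values of
the exposing form while one form stays active.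

The four statements follow. The quotient by `V^F` is again a system, and a line on which units and
exposing forms are constant cannot leave its cone; this gives (i). An integral core point of a face
of the dual cone exposes its zero face and dominates the forms vanishing there, which gives (ii).
Exposing forms separate faces after projection, which gives (iii). For (iv), lattice points in the
closure of a system's cone belong to the cone, and Hahn–Banach identifies the closure. -/

namespace RatCone

/-! ### Convex cones, algebraic relative interiors and faces. -/

section Cone

variable {V : Type*} [AddCommGroup V] [Module ℝ V]

theorem mem_hull_finset (P : Finset V) {x : V} :
    x ∈ PointedCone.hull ℝ (P : Set V) ↔
      ∃ a : V → ℝ, (∀ v, 0 ≤ a v) ∧ ∑ v ∈ P, a v • v = x := by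
  constructor
  · intro h
    obtain ⟨f, -, hf⟩ := Submodule.mem_span_finset.1 h
    exact ⟨fun v => f v, fun v => (f v).2, hf⟩
  · rintro ⟨a, ha, rfl⟩
    exact Submodule.sum_mem _ fun v hv =>
      PointedCone.smul_mem _ (ha v) (PointedCone.subset_hull hv)

theorem hull_nonneg {S : Set V} {ξ : Dual ℝ V} (h : ∀ p ∈ S, 0 ≤ ξ p) {x : V}
    (hx : x ∈ PointedCone.hull ℝ S) : 0 ≤ ξ x := by
  induction hx using Submodule.span_induction with
  | mem x hx => exact h x hx
  | zero => simp
  | add x y _ _ hx hy => rw [map_add]; positivity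
  | smul a x _ hx =>
    change 0 ≤ ξ ((a : ℝ) • x)
    rw [map_smul]
    exact mul_nonneg a.2 hx

/-- Induction on the number of generators. If the form separating `x` from the cone on `Q` is
negative at the new generator `p`, projecting along `p` onto its kernel reduces to the images of `Q`
and `x`. The form found there is pulled back along the projection, so it vanishes at `p`. -/
theorem farkas_aux (n : ℕ) : ∀ (P : Finset V), P.card ≤ n → ∀ {x : V},
    x ∉ PointedCone.hull ℝ (P : Set V) → ∃ ξ : Dual ℝ V, (∀ p ∈ P, 0 ≤ ξ p) ∧ ξ x < 0 := by
  classical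
  induction n with
  | zero =>
    intro P hP x hx
    obtain rfl : P = ∅ := by simpa using hP
    have hx0 : x ≠ 0 := by
      rintro rfl
      exact hx (Submodule.zero_mem _)
    obtain ⟨ξ, hξ⟩ : ∃ ξ : Dual ℝ V, ξ x ≠ 0 := by
      by_contra! h
      exact hx0 ((Module.forall_dual_apply_eq_zero_iff ℝ x).1 h)
    rcases lt_or_gt_of_ne hξ with h | h
    · exact ⟨ξ, by simp, h⟩
    · exact ⟨-ξ, by simp, by simpa using h⟩
  | succ n ih =>
    intro P hP x hx
    by_cases hPn : P.card ≤ n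
    · exact ih P hPn hx
    obtain ⟨p, Q, hpQ, rfl, hQ⟩ := Finset.card_eq_succ.1 (show P.card = n + 1 by omega)
    have hxQ : x ∉ PointedCone.hull ℝ (Q : Set V) := fun h =>
      hx (Submodule.span_mono (by simp) h)
    obtain ⟨ξ, hξ, hξx⟩ := ih Q hQ.le hxQ
    by_cases hp : 0 ≤ ξ p
    · exact ⟨ξ, by simpa [hp] using hξ, hξx⟩
    push Not at hp
    let pr : V →ₗ[ℝ] V := LinearMap.id - ((ξ p)⁻¹ • ξ).smulRight p
    have hpr : ∀ y, pr y = y - ((ξ p)⁻¹ * ξ y) • p := fun y => by simp [pr]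
    by_cases hx' : pr x ∈ PointedCone.hull ℝ ((Q.image pr : Finset V) : Set V)
    · exfalso
      apply hx
      have key : ∀ y ∈ PointedCone.hull ℝ ((Q.image pr : Finset V) : Set V),
          y ∈ PointedCone.hull ℝ ((insert p Q : Finset V) : Set V) := by
        intro y hy
        refine Submodule.span_le.2 ?_ hy
        intro z hz
        obtain ⟨q, hq, rfl⟩ := by simpa using hz
        rw [hpr, sub_eq_add_neg, ← neg_smul]
        refine Submodule.add_mem _ (PointedCone.subset_hull (by simp [hq]))
          (PointedCone.smul_mem _ ?_ (PointedCone.subset_hull (by simp)))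
        have := hξ q hq
        have h2 : (ξ p)⁻¹ < 0 := inv_lt_zero.2 hp
        nlinarith
      have h1 := key _ hx'
      have h2 : x = pr x + ((ξ p)⁻¹ * ξ x) • p := by rw [hpr]; abel
      rw [h2]
      refine Submodule.add_mem _ h1 (PointedCone.smul_mem _ ?_ (PointedCone.subset_hull (by simp)))
      have h2 : (ξ p)⁻¹ < 0 := inv_lt_zero.2 hp
      nlinarith
    · obtain ⟨ζ, hζ, hζx⟩ := ih (Q.image pr) (Finset.card_image_le.trans hQ.le) hx'
      refine ⟨ζ ∘ₗ pr, ?_, hζx⟩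
      intro q hq
      rcases Finset.mem_insert.1 hq with rfl | hq
      · have : pr q = 0 := by
          rw [hpr, inv_mul_cancel₀ hp.ne, one_smul, sub_self]
        simp [this]
      · exact hζ _ (Finset.mem_image_of_mem _ hq)

/-- **Farkas' lemma**. -/
theorem farkas (P : Finset V) {x : V} (hx : x ∉ PointedCone.hull ℝ (P : Set V)) :
    ∃ ξ : Dual ℝ V, (∀ p ∈ P, 0 ≤ ξ p) ∧ ξ x < 0 :=
  farkas_aux _ P le_rfl hx

/-- A finitely generated cone is cut out by linear inequalities, and each of these survives in the
recession direction. This is the tool by which a ray meeting one translate of a polyhedral cone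
infinitely often has its direction in that translate. -/
theorem mem_hull_of_frequently (P : Finset V) {c q : V}
    (h : ∀ N : ℝ, ∃ t : ℝ, N ≤ t ∧ c + t • q ∈ PointedCone.hull ℝ (P : Set V)) :
    q ∈ PointedCone.hull ℝ (P : Set V) := by
  by_contra hq
  obtain ⟨ξ, hξ, hξq⟩ := farkas P hq
  obtain ⟨t, ht, hm⟩ := h ((ξ c + 1) / (- ξ q))
  have h1 := hull_nonneg hξ hm
  rw [map_add, map_smul, smul_eq_mul] at h1
  rw [div_le_iff₀ (by linarith)] at ht
  linarith

/-- The relative interior of a cone, described algebraically. -/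
def core (X : PointedCone ℝ V) : Set V :=
  {x | x ∈ X ∧ ∀ y ∈ X, ∃ ε : ℝ, 0 < ε ∧ x - ε • y ∈ X}

variable {X F G : PointedCone ℝ V}

theorem sub_smul_mem {x y : V} (hx : x ∈ X) {ε δ : ℝ} (h : x - ε • y ∈ X) (hδ : 0 ≤ δ)
    (hδε : δ ≤ ε) : x - δ • y ∈ X := by
  rcases eq_or_lt_of_le (hδ.trans hδε) with h0 | h0
  · have : δ = 0 := le_antisymm (h0 ▸ hδε) hδ
    simpa [this] using hx
  have : x - δ • y = (1 - δ / ε) • x + (δ / ε) • (x - ε • y) := by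
    rw [smul_sub, smul_smul, div_mul_cancel₀ _ h0.ne', sub_smul, one_smul]
    abel
  rw [this]
  refine Submodule.add_mem _ (PointedCone.smul_mem _ ?_ hx) (PointedCone.smul_mem _ ?_ h)
  · rw [sub_nonneg, div_le_one h0]
    exact hδε
  · positivity

theorem core_add {x y : V} (hx : x ∈ core X) (hy : y ∈ X) : x + y ∈ core X := by
  refine ⟨Submodule.add_mem _ hx.1 hy, fun z hz => ?_⟩
  obtain ⟨ε, hε, h⟩ := hx.2 z hz
  refine ⟨ε, hε, ?_⟩
  rw [add_sub_right_comm]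
  exact Submodule.add_mem _ h hy

theorem core_smul {x : V} (hx : x ∈ core X) {t : ℝ} (ht : 0 < t) : t • x ∈ core X := by
  refine ⟨PointedCone.smul_mem _ ht.le hx.1, fun z hz => ?_⟩
  obtain ⟨ε, hε, h⟩ := hx.2 z hz
  refine ⟨t * ε, by positivity, ?_⟩
  rw [mul_smul, ← smul_sub]
  exact PointedCone.smul_mem _ ht.le h

theorem core_dom {x y : V} (hx : x ∈ core X) (hy : y ∈ X) :
    ∃ N : ℝ, 0 < N ∧ N • x - y ∈ X := by
  obtain ⟨ε, hε, h⟩ := hx.2 y hy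
  refine ⟨ε⁻¹, by positivity, ?_⟩
  have := PointedCone.smul_mem X (inv_nonneg.2 hε.le) h
  rwa [smul_sub, smul_smul, inv_mul_cancel₀ hε.ne', one_smul] at this

theorem mem_core_of_dom {x : V} (hx : x ∈ X)
    (h : ∀ y ∈ X, ∃ N : ℝ, 0 < N ∧ N • x - y ∈ X) : x ∈ core X := by
  refine ⟨hx, fun y hy => ?_⟩
  obtain ⟨N, hN, h⟩ := h y hy
  refine ⟨N⁻¹, by positivity, ?_⟩
  have := PointedCone.smul_mem X (inv_nonneg.2 hN.le) h
  rwa [smul_sub, smul_smul, inv_mul_cancel₀ hN.ne', one_smul] at this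

theorem mem_core_of_sub_mem {x y : V} {N : ℝ} (hN : 0 < N) (hy : y ∈ core X)
    (h : N • x - y ∈ X) : x ∈ core X := by
  have h1 := core_smul (core_add hy h) (inv_pos.2 hN)
  rwa [add_sub_cancel, smul_smul, inv_mul_cancel₀ hN.ne', one_smul] at h1

theorem mem_span_iff_sub {x : V} :
    x ∈ Submodule.span ℝ (X : Set V) ↔ ∃ a ∈ X, ∃ b ∈ X, x = a - b := by
  constructor
  · intro h
    induction h using Submodule.span_induction with
    | mem x hx => exact ⟨x, hx, 0, X.zero_mem, by simp⟩
    | zero => exact ⟨0, X.zero_mem, 0, X.zero_mem, by simp⟩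
    | add x y _ _ hx hy =>
      obtain ⟨a, ha, b, hb, rfl⟩ := hx
      obtain ⟨a', ha', b', hb', rfl⟩ := hy
      exact ⟨a + a', X.add_mem ha ha', b + b', X.add_mem hb hb', by abel⟩
    | smul t x _ hx =>
      obtain ⟨a, ha, b, hb, rfl⟩ := hx
      rcases le_total 0 t with ht | ht
      · exact ⟨t • a, X.smul_mem ht ha, t • b, X.smul_mem ht hb, smul_sub _ _ _⟩
      · refine ⟨(-t) • b, X.smul_mem (by linarith) hb, (-t) • a, X.smul_mem (by linarith) ha, ?_⟩
        rw [smul_sub, neg_smul, neg_smul]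
        abel
  · rintro ⟨a, ha, b, hb, rfl⟩
    exact Submodule.sub_mem _ (Submodule.subset_span ha) (Submodule.subset_span hb)

theorem core_absorb {x v : V} (hx : x ∈ core X) (hv : v ∈ Submodule.span ℝ (X : Set V)) :
    ∃ ε : ℝ, 0 < ε ∧ ∀ t : ℝ, |t| ≤ ε → x + t • v ∈ core X := by
  obtain ⟨a, ha, b, hb, rfl⟩ := mem_span_iff_sub.1 hv
  obtain ⟨ε, hε, h⟩ := hx.2 a ha
  obtain ⟨δ, hδ, h'⟩ := hx.2 b hb
  refine ⟨min ε δ / 2, by positivity, fun t ht => ?_⟩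
  -- One half of `x` absorbs the negative part of the perturbation; the other half keeps the sum in
  -- the core.
  have h2 : x = (1 / 2 : ℝ) • x + (1 / 2 : ℝ) • x := by
    rw [← add_smul]; norm_num
  have key : ∀ (s : ℝ) (u : V), u ∈ X → 0 ≤ s → (∃ η, s * 2 ≤ η ∧ x - η • u ∈ X) → ∀ w ∈ X,
      x + s • (w - u) ∈ core X := by
    rintro s u hu hs ⟨η, hsη, hη⟩ w hw
    have e : x + s • (w - u) = (1 / 2 : ℝ) • x + ((1 / 2 : ℝ) • (x - (s * 2) • u) + s • w) := by
      rw [smul_sub, smul_sub, smul_smul]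
      nth_rewrite 1 [h2]
      rw [show (1 / 2 : ℝ) * (s * 2) = s by ring]
      abel
    rw [e]
    refine core_add (core_smul hx (by norm_num)) (X.add_mem (X.smul_mem (by norm_num) ?_)
      (X.smul_mem hs hw))
    exact sub_smul_mem hx.1 hη (by positivity) hsη
  rcases le_total 0 t with h0 | h0
  · refine key t b hb h0 ⟨δ, ?_, h'⟩ a ha
    have := min_le_right ε δ
    rw [abs_of_nonneg h0] at ht
    linarith
  · rw [show t • (a - b) = (-t) • (b - a) by rw [neg_smul, ← smul_neg, neg_sub]]
    refine key (-t) a ha (by linarith) ⟨ε, ?_, h⟩ b hb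
    have := min_le_left ε δ
    rw [abs_of_nonpos h0] at ht
    linarith

theorem mem_core_of_smul_sub {x : V} (hx : x ∈ core X) {y : V}
    (hy : y ∈ Submodule.span ℝ (X : Set V)) : ∃ N : ℝ, 0 < N ∧ N • x + y ∈ core X := by
  obtain ⟨ε, hε, h⟩ := core_absorb hx hy
  refine ⟨ε⁻¹, by positivity, ?_⟩
  have := core_smul (h ε (by rw [abs_of_pos hε])) (inv_pos.2 hε)
  rwa [smul_add, smul_smul ε⁻¹ ε, inv_mul_cancel₀ hε.ne', one_smul] at this

/-- If `r` dominates a generating set, it lies in the core. -/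
theorem mem_core_hull {S : Set V} {r : V} (hr : r ∈ PointedCone.hull ℝ S)
    (h : ∀ s ∈ S, ∃ ε : ℝ, 0 < ε ∧ r - ε • s ∈ PointedCone.hull ℝ S) :
    r ∈ core (PointedCone.hull ℝ S) := by
  refine ⟨hr, fun y hy => ?_⟩
  induction hy using Submodule.span_induction with
  | mem x hx => exact h x hx
  | zero => exact ⟨1, one_pos, by simpa using hr⟩
  | add x y _ _ hx hy =>
    obtain ⟨ε, hε, h1⟩ := hx
    obtain ⟨δ, hδ, h2⟩ := hy
    refine ⟨min ε δ / 2, by positivity, ?_⟩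
    have e1 := sub_smul_mem hr h1 (δ := min ε δ) (by positivity) (min_le_left _ _)
    have e2 := sub_smul_mem hr h2 (δ := min ε δ) (by positivity) (min_le_right _ _)
    have := PointedCone.smul_mem _ (show (0:ℝ) ≤ 1 / 2 by norm_num) (Submodule.add_mem _ e1 e2)
    convert this using 1
    module
  | smul a x _ hx =>
    obtain ⟨ε, hε, h1⟩ := hx
    change ∃ ε : ℝ, 0 < ε ∧ r - ε • (a : ℝ) • x ∈ _
    have ha : (0 : ℝ) ≤ a := a.2
    refine ⟨ε / (a + 1), by positivity, ?_⟩
    rw [smul_smul]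
    refine sub_smul_mem hr h1 (by positivity) ?_
    rw [div_mul_eq_mul_div, div_le_iff₀ (by positivity)]
    nlinarith

/-- The sum of a maximal independent subset of `S` works: subtracting a small multiple of any `s`
leaves all coefficients nonnegative. Being in the additive monoid generated by `S`, the point is a
lattice point whenever `S` consists of lattice points. -/
theorem exists_mem_core_hull [FiniteDimensional ℝ V] (S : Set V) :
    ∃ r ∈ AddSubmonoid.closure S, r ∈ core (PointedCone.hull ℝ S) := by
  classical
  obtain ⟨b, hbS, hspan, hli⟩ := exists_linearIndependent ℝ S
  have hfin : b.Finite := hli.setFinite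
  lift b to Finset V using hfin
  have hrX : ∀ a : V → ℝ, (∀ v, 0 ≤ a v) → ∑ v ∈ b, a v • v ∈ PointedCone.hull ℝ S :=
    fun a ha => Submodule.sum_mem _ fun v hv =>
      PointedCone.smul_mem _ (ha v) (PointedCone.subset_hull (hbS hv))
  have hr : ∑ v ∈ b, v ∈ PointedCone.hull ℝ S := by
    simpa using hrX (fun _ => 1) (by simp)
  refine ⟨∑ v ∈ b, v, AddSubmonoid.sum_mem _ fun v hv => AddSubmonoid.subset_closure (hbS hv),
    mem_core_hull hr fun s hs => ?_⟩
  have : s ∈ Submodule.span ℝ (b : Set V) := by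
    rw [hspan]; exact Submodule.subset_span hs
  obtain ⟨f, -, hf⟩ := Submodule.mem_span_finset.1 this
  have hA : 0 < 1 + ∑ v ∈ b, |f v| := by positivity
  refine ⟨(1 + ∑ v ∈ b, |f v|)⁻¹, by positivity, ?_⟩
  have : ∑ v ∈ b, v - (1 + ∑ v ∈ b, |f v|)⁻¹ • s =
      ∑ v ∈ b, (if v ∈ b then 1 - (1 + ∑ v ∈ b, |f v|)⁻¹ * f v else 0) • v := by
    rw [← hf, Finset.smul_sum, ← Finset.sum_sub_distrib]
    refine Finset.sum_congr rfl fun v hv => ?_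
    rw [if_pos hv, sub_smul, one_smul, smul_smul]
  rw [this]
  refine hrX _ fun v => ?_
  split_ifs with hv
  · rw [sub_nonneg, inv_mul_le_iff₀ hA, mul_one]
    have h1 : |f v| ≤ ∑ v ∈ b, |f v| :=
      Finset.single_le_sum (f := fun v => |f v|) (fun _ _ => abs_nonneg _) hv
    have := le_abs_self (f v)
    linarith
  · exact le_rfl

theorem exists_mem_core [FiniteDimensional ℝ V] {L : AddSubgroup V} {Y : PointedCone ℝ V}
    (hY : Y = PointedCone.hull ℝ (Y ∩ L : Set V)) : ∃ r ∈ L, r ∈ core Y := by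
  obtain ⟨r, hr, hc⟩ := exists_mem_core_hull (Y ∩ L : Set V)
  rw [← hY] at hc
  refine ⟨r, ?_, hc⟩
  have : AddSubmonoid.closure (Y ∩ L : Set V) ≤ L.toAddSubmonoid :=
    AddSubmonoid.closure_le.2 fun x hx => hx.2
  exact this hr

/-! ### Faces -/

theorem face_mem_iff (hF : F.IsFaceOf X) {r : V} (hr : r ∈ core F) {x : V} :
    x ∈ F ↔ x ∈ X ∧ ∃ ε : ℝ, 0 < ε ∧ r - ε • x ∈ X := by
  constructor
  · intro h
    obtain ⟨ε, hε, h'⟩ := hr.2 x h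
    exact ⟨hF.le h, ε, hε, hF.le h'⟩
  · rintro ⟨hx, ε, hε, h⟩
    exact hF.mem_of_smul_add_mem hx h hε (by simpa using hr.1)

/-- The smallest face containing a given point. -/
def minFace (X : PointedCone ℝ V) (y : V) (hy : y ∈ X) : PointedCone ℝ V :=
  PointedCone.ofConeComb {x | x ∈ X ∧ ∃ ε : ℝ, 0 < ε ∧ y - ε • x ∈ X}
    ⟨0, X.zero_mem, 1, one_pos, by simpa using hy⟩ (by
    rintro x ⟨hx, ε, hε, h1⟩ z ⟨hz, δ, hδ, h2⟩ a ha b hb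
    refine ⟨X.add_mem (X.smul_mem ha hx) (X.smul_mem hb hz), ?_⟩
    have hc : ∀ (ε a : ℝ) (x : V), 0 < ε → 0 ≤ a → y - ε • x ∈ X →
        ∃ η : ℝ, 0 < η ∧ y - η • a • x ∈ X := by
      intro ε a x hε ha h1
      refine ⟨ε / (a + 1), by positivity, ?_⟩
      rw [smul_smul]
      refine sub_smul_mem hy h1 (by positivity) ?_
      rw [div_mul_eq_mul_div, div_le_iff₀ (by positivity)]
      nlinarith
    obtain ⟨ε', hε', e1⟩ := hc ε a x hε ha h1
    obtain ⟨δ', hδ', e2⟩ := hc δ b z hδ hb h2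
    refine ⟨min ε' δ' / 2, by positivity, ?_⟩
    have e1 := sub_smul_mem hy e1 (δ := min ε' δ') (by positivity) (min_le_left _ _)
    have e2 := sub_smul_mem hy e2 (δ := min ε' δ') (by positivity) (min_le_right _ _)
    have := PointedCone.smul_mem _ (show (0:ℝ) ≤ 1 / 2 by norm_num) (Submodule.add_mem _ e1 e2)
    convert this using 1
    module)

theorem mem_minFace {y x : V} (hy : y ∈ X) :
    x ∈ minFace X y hy ↔ x ∈ X ∧ ∃ ε : ℝ, 0 < ε ∧ y - ε • x ∈ X := Iff.rfl

theorem self_mem_minFace {y : V} (hy : y ∈ X) : y ∈ minFace X y hy :=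
  (mem_minFace hy).2 ⟨hy, 1, one_pos, by simp [X.zero_mem]⟩

theorem minFace_isFaceOf {y : V} (hy : y ∈ X) : (minFace X y hy).IsFaceOf X where
  le x hx := ((mem_minFace hy).1 hx).1
  mem_of_smul_add_mem := by
    intro x z a hx hz ha h
    obtain ⟨-, ε, hε, h⟩ := (mem_minFace hy).1 h
    refine (mem_minFace hy).2 ⟨hx, ε * a, by positivity, ?_⟩
    have := X.add_mem h (X.smul_mem hε.le hz)
    convert this using 1
    module

theorem minFace_le (hF : F.IsFaceOf X) {y : V} (hy : y ∈ F) : minFace X y (hF.le hy) ≤ F := by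
  intro x hx
  obtain ⟨hx, ε, hε, h⟩ := (mem_minFace _).1 hx
  exact hF.mem_of_smul_add_mem hx h hε (by simpa using hy)

theorem mem_core_minFace {y : V} (hy : y ∈ X) : y ∈ core (minFace X y hy) := by
  refine ⟨self_mem_minFace hy, fun z hz => ?_⟩
  obtain ⟨hz', ε, hε, h⟩ := (mem_minFace hy).1 hz
  refine ⟨ε, hε, (mem_minFace hy).2 ⟨h, 1, one_pos, ?_⟩⟩
  rw [one_smul, sub_sub_cancel]
  exact X.smul_mem hε.le hz'

theorem minFace_eq_iff {y : V} (hy : y ∈ X) : minFace X y hy = X ↔ y ∈ core X := by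
  constructor
  · intro h
    have := mem_core_minFace hy
    rwa [h] at this
  · intro h
    exact le_antisymm (minFace_isFaceOf hy).le fun x hx => (mem_minFace hy).2 ⟨hx, h.2 x hx⟩

theorem face_eq_of_mem_core (hF : F.IsFaceOf X) {y : V} (hy : y ∈ F) (hc : y ∈ core X) : F = X :=
  le_antisymm hF.le ((minFace_eq_iff (hF.le hy)).2 hc ▸ minFace_le hF hy)

theorem face_eq_of_mem_core_le (hF : F.IsFaceOf X) (hG : G.IsFaceOf X) {y : V} (hy : y ∈ G)
    (hc : y ∈ core F) : F ≤ G := by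
  intro x hx
  obtain ⟨hx', ε, hε, h⟩ := (face_mem_iff hF hc).1 hx
  exact hG.mem_of_smul_add_mem hx' h hε (by simpa using hy)

/-- When a positive combination of generators lies in a face, so does each generator with nonzero
coefficient. Thus faces of a cone generated by lattice points are generated by lattice points. -/
theorem face_hull (hF : F.IsFaceOf X) {S : Set V} (hX : X = PointedCone.hull ℝ (X ∩ S : Set V)) :
    F = PointedCone.hull ℝ (F ∩ S : Set V) := by
  classical
  refine le_antisymm (fun x hx => ?_) (Submodule.span_le.2 fun x hx => hx.1)
  have hxX : x ∈ PointedCone.hull ℝ (X ∩ S : Set V) := hX ▸ hF.le hx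
  obtain ⟨P, hP, hxP⟩ := Submodule.mem_span_finite_of_mem_span hxX
  obtain ⟨a, ha, rfl⟩ := (mem_hull_finset P).1 hxP
  refine Submodule.sum_mem _ fun v hv => ?_
  rcases eq_or_lt_of_le (ha v) with h0 | h0
  · simp [← h0]
  refine PointedCone.smul_mem _ (ha v) (PointedCone.subset_hull ⟨?_, (hP hv).2⟩)
  rw [← Finset.add_sum_erase _ _ hv] at hx
  exact hF.mem_of_smul_add_mem (hP hv).1 (Submodule.sum_mem _ fun w hw =>
    X.smul_mem (ha w) (hP (Finset.mem_of_mem_erase hw)).1) h0 hx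

theorem face_mem_of_mem_span (hF : F.IsFaceOf X) {x : V} (hx : x ∈ X)
    (hxs : x ∈ Submodule.span ℝ (F : Set V)) : x ∈ F := by
  obtain ⟨a, ha, b, hb, rfl⟩ := mem_span_iff_sub.1 hxs
  exact hF.mem_of_add_mem_left hx (hF.le hb) (by simpa using ha)

theorem face_le_of_span_le (hF : F.IsFaceOf X) (hG : G ≤ X)
    (h : Submodule.span ℝ (G : Set V) ≤ Submodule.span ℝ (F : Set V)) : G ≤ F :=
  fun _ hx => face_mem_of_mem_span hF (hG hx) (h (Submodule.subset_span hx))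

theorem finrank_face_lt [FiniteDimensional ℝ V] (hF : F.IsFaceOf X) (hG : G ≤ X) (h : F < G) :
    finrank ℝ (Submodule.span ℝ (F : Set V)) < finrank ℝ (Submodule.span ℝ (G : Set V)) := by
  refine Submodule.finrank_lt_finrank_of_lt (lt_of_le_not_ge (Submodule.span_mono h.le) fun h' => ?_)
  exact h.not_ge (face_le_of_span_le hF hG h')

theorem not_mem_core_of_face_ne (hF : F.IsFaceOf X) (hne : F ≠ X) {x : V} (hx : x ∈ core X) :
    x ∉ Submodule.span ℝ (F : Set V) := fun h =>
  hne (face_eq_of_mem_core hF (face_mem_of_mem_span hF hx.1 h) hx)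

/-- The zero face of a form that is nonnegative on a cone. -/
def zeroFace (X : PointedCone ℝ V) (ξ : Dual ℝ V) : PointedCone ℝ V :=
  X ⊓ PointedCone.ofSubmodule (LinearMap.ker ξ)

theorem mem_zeroFace {ξ : Dual ℝ V} {x : V} : x ∈ zeroFace X ξ ↔ x ∈ X ∧ ξ x = 0 := Iff.rfl

theorem zeroFace_isFaceOf {ξ : Dual ℝ V} (hξ : ∀ x ∈ X, 0 ≤ ξ x) : (zeroFace X ξ).IsFaceOf X where
  le := inf_le_left
  mem_of_smul_add_mem := by
    intro x y a hx hy ha h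
    refine mem_zeroFace.2 ⟨hx, ?_⟩
    have h := (mem_zeroFace.1 h).2
    rw [map_add, map_smul, smul_eq_mul] at h
    have h1 := hξ x hx
    have h2 := hξ y hy
    nlinarith [mul_nonneg ha.le h1]

/-- Infinite pigeonhole, used to find one group element that serves infinitely many points of a
sequence. -/
theorem exists_forall_frequently {ι : Type*} {S : Set ι} (hS : S.Finite) {p : ι → ℕ → Prop}
    {n₀ : ℕ} (h : ∀ n ≥ n₀, ∃ i ∈ S, p i n) : ∃ i ∈ S, ∀ N, ∃ n ≥ N, p i n := by
  by_contra! hc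
  choose! N hN using hc
  obtain ⟨i, hi, hp⟩ := h (n₀ + ∑ i ∈ hS.toFinset, N i) (by omega)
  refine hN i hi _ ?_ hp
  have := Finset.single_le_sum (f := N) (fun _ _ => Nat.zero_le _) (hS.mem_toFinset.2 hi)
  omega

end Cone

end RatCone

namespace RatCone

/-! ### Lattices, rational subspaces and finiteness of integral forms. -/

section Lattice

variable {V : Type*} [AddCommGroup V] [Module ℝ V]

def IsIntForm (L : AddSubgroup V) (ξ : Dual ℝ V) : Prop :=
  ∀ v ∈ L, ∃ n : ℤ, ξ v = n

/-- The dual lattice. -/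
def dualLat (L : AddSubgroup V) : AddSubgroup (Dual ℝ V) where
  carrier := {ξ | IsIntForm L ξ}
  zero_mem' := fun _ _ => ⟨0, by simp⟩
  add_mem' := by
    intro ξ ζ hξ hζ v hv
    obtain ⟨n, hn⟩ := hξ v hv
    obtain ⟨m, hm⟩ := hζ v hv
    exact ⟨n + m, by simp [hn, hm]⟩
  neg_mem' := by
    intro ξ hξ v hv
    obtain ⟨n, hn⟩ := hξ v hv
    exact ⟨-n, by simp [hn]⟩

/-- A lattice: a spanning subgroup on which sufficiently many linear forms are integral. -/
structure IsLat (L : AddSubgroup V) : Prop where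
  span_eq : Submodule.span ℝ (L : Set V) = ⊤
  dual_span : Submodule.span ℝ (dualLat L : Set (Dual ℝ V)) = ⊤

variable [FiniteDimensional ℝ V]

theorem exists_basis_of_span {S : Set V} (hS : Submodule.span ℝ S = ⊤) :
    ∃ b : Basis (Fin (finrank ℝ V)) ℝ V, ∀ i, b i ∈ S := by
  let b := Basis.ofSpan hS.ge
  have : Fintype _ := FiniteDimensional.fintypeBasisIndex b
  let e := Fintype.equivFinOfCardEq (finrank_eq_card_basis b).symm
  refine ⟨b.reindex e, fun i => ?_⟩
  rw [Basis.reindex_apply]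
  exact Basis.ofSpan_subset hS.ge (Set.mem_range_self _)

/-- Cramer's rule: a basis of forms from the dual lattice has an integral matrix of values on `b`,
with nonzero determinant `d`, and the adjugate expresses `d` times each coordinate form as an
integral combination. -/
theorem IsLat.exists_coord {L : AddSubgroup V} (hL : IsLat L) {ι : Type*} [Fintype ι]
    (b : Basis ι ℝ V) (hb : ∀ i, b i ∈ L) :
    ∃ d : ℤ, d ≠ 0 ∧ ∀ i, d • b.coord i ∈ dualLat L := by
  classical
  obtain ⟨β', hβ'⟩ := exists_basis_of_span hL.dual_span
  let e : Fin (finrank ℝ (Dual ℝ V)) ≃ ι := (Fintype.equivFinOfCardEq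
    (by rw [Subspace.dual_finrank_eq, finrank_eq_card_basis b])).symm
  let β := β'.reindex e
  have hβ : ∀ i, β i ∈ dualLat L := fun i => by
    rw [Basis.reindex_apply]; exact hβ' _
  choose M hM using fun i j => hβ i (b j) (hb j)
  have hMβ : b.dualBasis.toMatrix β = (Matrix.map (Matrix.of M) ((↑) : ℤ → ℝ)).transpose := by
    ext i j
    simp [Basis.toMatrix_apply, hM]
  have hdet : (Matrix.of M).det ≠ 0 := by
    intro h
    have h1 := Basis.toMatrix_mul_toMatrix_flip b.dualBasis β
    have h2 := congrArg Matrix.det h1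
    rw [Matrix.det_mul, hMβ, Matrix.det_transpose, Matrix.det_one] at h2
    have h3 : (Matrix.map (Matrix.of M) ((↑) : ℤ → ℝ)).det = 0 := by
      have := (Int.castRingHom ℝ).map_det (Matrix.of M)
      rw [h] at this
      simpa using this.symm
    rw [h3, zero_mul] at h2
    exact zero_ne_one h2
  refine ⟨(Matrix.of M).det, hdet, fun i => ?_⟩
  have : (Matrix.of M).det • b.coord i = ∑ j, (Matrix.of M).adjugate i j • β j := by
    refine b.ext fun k => ?_
    have h1 := congrFun (congrFun (Matrix.adjugate_mul (Matrix.of M)) i) k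
    rw [Matrix.mul_apply] at h1
    have h2 := congrArg ((↑) : ℤ → ℝ) h1
    push_cast at h2
    simp only [LinearMap.smul_apply, LinearMap.sum_apply, hM, Basis.coord_apply, Basis.repr_self,
      zsmul_eq_mul]
    simp only [Matrix.of_apply] at h2
    rw [h2]
    by_cases hik : i = k
    · subst hik; simp
    · simp [hik]
  rw [this]
  exact AddSubgroup.sum_mem _ fun j _ => AddSubgroup.zsmul_mem _ (hβ j) _

theorem isLat_dualLat {L : AddSubgroup V} (hL : IsLat L) : IsLat (dualLat L) := by
  refine ⟨hL.dual_span, ?_⟩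
  have h1 : (evalEquiv ℝ V) '' (L : Set V) ⊆ (dualLat (dualLat L) : Set _) := by
    rintro _ ⟨v, hv, rfl⟩ ξ hξ
    exact hξ v hv
  refine top_le_iff.1 (le_trans ?_ (Submodule.span_mono h1))
  have := Submodule.span_image (evalEquiv ℝ V).toLinearMap (s := (L : Set V))
  rw [hL.span_eq, Submodule.map_top] at this
  rw [show (evalEquiv ℝ V : V → Dual ℝ (Dual ℝ V)) '' (L : Set V) =
    (evalEquiv ℝ V).toLinearMap '' (L : Set V) from rfl, this]
  rw [LinearMap.range_eq_top.2 (evalEquiv ℝ V).surjective]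

/-- The coordinates of such a vector in a basis from `L` have denominators dividing a fixed `d`.
Commensurability of `L` with its bidual is all that is used. -/
theorem IsLat.exists_smul_mem {L : AddSubgroup V} (hL : IsLat L) :
    ∃ d : ℤ, d ≠ 0 ∧ ∀ v : V, (∀ ξ ∈ dualLat L, ∃ n : ℤ, ξ v = n) → d • v ∈ L := by
  obtain ⟨b, hb⟩ := exists_basis_of_span hL.span_eq
  obtain ⟨d, hd, h⟩ := hL.exists_coord b hb
  refine ⟨d, hd, fun v hv => ?_⟩
  choose n hn using fun i => hv _ (h i)
  have : d • v = ∑ i, n i • b i := by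
    rw [← b.sum_repr v, Finset.smul_sum]
    refine Finset.sum_congr rfl fun i _ => ?_
    have := hn i
    rw [LinearMap.smul_apply, zsmul_eq_mul, Basis.coord_apply] at this
    rw [← Int.cast_smul_eq_zsmul ℝ (n i), ← this, ← Int.cast_smul_eq_zsmul ℝ d, smul_smul]
  rw [this]
  exact AddSubgroup.sum_mem _ fun j _ => AddSubgroup.zsmul_mem _ (hb j) _

/-- The annihilator of a rational subspace is rational. -/
theorem IsLat.dualAnnihilator {L : AddSubgroup V} (hL : IsLat L) {W : Submodule ℝ V}
    (hW : W ≤ Submodule.span ℝ (W ∩ L : Set V)) :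
    W.dualAnnihilator ≤ Submodule.span ℝ (W.dualAnnihilator ∩ dualLat L : Set (Dual ℝ V)) := by
  classical
  obtain ⟨s, hs, hspan, hli⟩ := exists_linearIndependent ℝ (W ∩ L : Set V)
  have hli' : LinearIndepOn ℝ id s := hli
  have hsL : s ⊆ (L : Set V) := fun x hx => (hs hx).2
  -- A basis of `W` made of lattice points is extended inside `L`. The coordinate forms along the
  -- added vectors span the annihilator of `W` and are integral up to the factor `d`.
  let b := Basis.extendLe hli' hsL hL.span_eq.ge
  have : Fintype _ := FiniteDimensional.fintypeBasisIndex b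
  have hb : ∀ i, b i = i := fun i => by simp [b]
  have hbL : ∀ i, b i ∈ L := fun i => by
    rw [hb]; exact hli'.extend_subset hsL i.2
  obtain ⟨d, hd, h⟩ := hL.exists_coord b hbL
  intro α hα
  have : α = ∑ i, α (b i) • b.coord i := by
    refine b.ext fun k => ?_
    simp
  rw [this]
  refine Submodule.sum_mem _ fun i _ => ?_
  by_cases hi : (i : V) ∈ s
  · have : α (b i) = 0 := by
      rw [hb]
      exact (Submodule.mem_dualAnnihilator α).1 hα _ (hs hi).1
    rw [this, zero_smul]
    exact Submodule.zero_mem _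
  · refine Submodule.smul_mem _ _ ?_
    have e : b.coord i = (d : ℝ)⁻¹ • (d • b.coord i) := by
      rw [← Int.cast_smul_eq_zsmul ℝ d, smul_smul, inv_mul_cancel₀ (by exact_mod_cast hd), one_smul]
    rw [e]
    refine Submodule.smul_mem _ _ (Submodule.subset_span ⟨?_, h i⟩)
    refine (Submodule.mem_dualAnnihilator _).2 fun w hw => ?_
    have hw' : w ∈ Submodule.span ℝ s := by rw [hspan]; exact hW hw
    have hle : Submodule.span ℝ s ≤ LinearMap.ker (d • b.coord i) := by
      refine Submodule.span_le.2 fun x hx => ?_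
      have hx' := hli'.subset_extend hsL hx
      have : b ⟨x, hx'⟩ = x := hb _
      have hne : (⟨x, hx'⟩ : hli'.extend hsL) ≠ i := by
        rintro rfl; exact hi hx
      rw [SetLike.mem_coe, LinearMap.mem_ker, ← this]
      simp [hne]
    exact hle hw'

/-- The common kernel of integral forms is rational. -/
theorem IsLat.kernel {L : AddSubgroup V} (hL : IsLat L) {S : Set (Dual ℝ V)}
    (hS : S ⊆ dualLat L) {v : V} (hv : ∀ ξ ∈ S, ξ v = 0) :
    v ∈ Submodule.span ℝ ({w | ∀ ξ ∈ S, ξ w = 0} ∩ L : Set V) := by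
  obtain ⟨d, hd, hdL⟩ := hL.exists_smul_mem
  -- The common kernel is an annihilator in the bidual, so the rationality of annihilators is
  -- applied to the dual lattice.
  have h1 := (isLat_dualLat hL).dualAnnihilator (W := Submodule.span ℝ S) (Submodule.span_mono
    fun x hx => ⟨Submodule.subset_span hx, hS hx⟩)
  have hv' : evalEquiv ℝ V v ∈ (Submodule.span ℝ S).dualAnnihilator := by
    refine (Submodule.mem_dualAnnihilator _).2 fun w hw => ?_
    induction hw using Submodule.span_induction with
    | mem x hx => exact hv x hx
    | zero => simp
    | add x y _ _ hx hy => rw [map_add, hx, hy, add_zero]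
    | smul a x _ hx => rw [map_smul, hx, smul_zero]
  have h2 := Submodule.mem_map_of_mem (f := (evalEquiv ℝ V).symm.toLinearMap) (h1 hv')
  rw [Submodule.map_span] at h2
  simp only [LinearEquiv.coe_coe, LinearEquiv.symm_apply_apply] at h2
  refine Submodule.span_le.2 ?_ h2
  rintro _ ⟨Φ, ⟨hΦ, hΦL⟩, rfl⟩
  obtain ⟨w, rfl⟩ := (evalEquiv ℝ V).surjective Φ
  have e : w = (d : ℝ)⁻¹ • (d • w) := by
    rw [← Int.cast_smul_eq_zsmul ℝ d, smul_smul, inv_mul_cancel₀ (by exact_mod_cast hd), one_smul]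
  simp only [LinearEquiv.symm_apply_apply, SetLike.mem_coe]
  rw [e]
  refine Submodule.smul_mem _ _ (Submodule.subset_span ⟨fun ξ hξ => ?_, hdL w fun ξ hξ => hΦL ξ hξ⟩)
  have := (Submodule.mem_dualAnnihilator _).1 hΦ ξ (Submodule.subset_span hξ)
  rw [show (evalEquiv ℝ V w) ξ = ξ w from rfl] at this
  rw [map_zsmul, this, smul_zero]

/-- A point of the core of a cone which is spanned by lattice vectors of the span of the cone is a
positive combination of lattice points of the cone. -/
theorem mem_hull_lattice {Y : PointedCone ℝ V} {L : AddSubgroup V} {x : V} (hx : x ∈ core Y)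
    (hxs : x ∈ Submodule.span ℝ (Submodule.span ℝ (Y : Set V) ∩ L : Set V)) :
    x ∈ PointedCone.hull ℝ (Y ∩ L : Set V) := by
  classical
  obtain ⟨P, hP, hxP⟩ := Submodule.mem_span_finite_of_mem_span hxs
  obtain ⟨f, -, hf⟩ := Submodule.mem_span_finset.1 hxP
  have habs := fun v : P => core_absorb hx (hP v.2).1
  choose δ hδ hδ' using habs
  rcases isEmpty_or_nonempty P with hPe | hPn
  · have : x = 0 := by
      rw [← hf]; exact Finset.sum_eq_zero fun v hv => (hPe.false ⟨v, hv⟩).elim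
    rw [this]; exact Submodule.zero_mem _
  have hcard : (0 : ℝ) < Fintype.card P := by exact_mod_cast Fintype.card_pos
  -- `N` is so large that moving `x` by at most `2 / N` along every `v` at once, or by `2 * card P /
  -- N` along a single `v`, stays in `Y`. The factor 2 allows two such perturbations to be averaged.
  obtain ⟨N, hN⟩ := exists_nat_gt (∑ v, (2 * Fintype.card P / δ v))
  have hNpos : (0 : ℝ) < N := lt_of_le_of_lt (Finset.sum_nonneg fun v _ => by
    have := hδ v; positivity) hN
  have hNv : ∀ v, 2 * Fintype.card P / N ≤ δ v := fun v => by
    have h1 : 2 * Fintype.card P / δ v ≤ ∑ v, (2 * Fintype.card P / δ v) :=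
      Finset.single_le_sum (f := fun v => (2 * Fintype.card P / δ v : ℝ)) (fun w _ => by
        have := hδ w; positivity) (Finset.mem_univ v)
    have h2 := h1.trans hN.le
    rw [div_le_iff₀ (hδ v)] at h2
    rw [div_le_iff₀ hNpos]
    linarith
  -- the points `x + ∑ e_v v` with small `e`
  have hbox : ∀ e : P → ℝ, (∀ v, |e v| ≤ 2 / N) → x + ∑ v, e v • (v : V) ∈ Y := by
    intro e he
    have : x + ∑ v, e v • (v : V) =
        ∑ v, (1 / Fintype.card P : ℝ) • (x + (Fintype.card P * e v) • (v : V)) := by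
      simp_rw [smul_add, Finset.sum_add_distrib, smul_smul]
      rw [Finset.sum_const, Finset.card_univ, ← Nat.cast_smul_eq_nsmul ℝ, smul_smul,
        mul_one_div_cancel hcard.ne', one_smul]
      simp_rw [← mul_assoc, one_div_mul_cancel hcard.ne', one_mul]
    rw [this]
    refine Submodule.sum_mem _ fun v _ => Y.smul_mem (by positivity) (hδ' v _ ?_).1
    rw [abs_mul, abs_of_pos hcard]
    refine le_trans ?_ (hNv v)
    have := mul_le_mul_of_nonneg_left (he v) hcard.le
    rwa [mul_div_assoc', mul_comm _ (2 : ℝ)] at this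
  have hx0 : x = ∑ v : P, f v • (v : V) := by
    rw [← hf, ← Finset.sum_coe_sort]
  -- `y` is `N x` rounded down to a lattice point. Both `y` and the shifts `y + card P • v` lie in
  -- `Y`, and `N * card P` times `x` is a sum of these points weighted by fractional parts.
  let y : V := ∑ v : P, ⌊N * f v⌋ • (v : V)
  have hyL : y ∈ L := AddSubgroup.sum_mem _ fun v _ => AddSubgroup.zsmul_mem _ (hP v.2).2 _
  have hscale : ∀ u ∈ L, (N : ℝ)⁻¹ • u ∈ Y → u ∈ PointedCone.hull ℝ (Y ∩ L : Set V) := by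
    intro u hu h
    refine PointedCone.subset_hull ⟨?_, hu⟩
    have := Y.smul_mem hNpos.le h
    rwa [smul_smul, mul_inv_cancel₀ hNpos.ne', one_smul] at this
  have hyexp : (N : ℝ)⁻¹ • y = x + ∑ v : P, (-(Int.fract (N * f v) / N)) • (v : V) := by
    rw [hx0, Finset.smul_sum, ← Finset.sum_add_distrib]
    refine Finset.sum_congr rfl fun v _ => ?_
    rw [← Int.cast_smul_eq_zsmul ℝ, smul_smul, ← add_smul, Int.fract]
    congr 1
    field_simp
    ring
  have hy : y ∈ PointedCone.hull ℝ (Y ∩ L : Set V) := by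
    refine hscale y hyL ?_
    rw [hyexp]
    refine hbox _ fun v => ?_
    rw [abs_neg, abs_of_nonneg (by have := Int.fract_nonneg (N * f v); positivity)]
    have := (Int.fract_lt_one (N * f v)).le
    gcongr
    linarith
  have hyv : ∀ w : P, y + (Fintype.card P : ℤ) • (w : V) ∈
      PointedCone.hull ℝ (Y ∩ L : Set V) := by
    intro w
    refine hscale _ (L.add_mem hyL (AddSubgroup.zsmul_mem _ (hP w.2).2 _)) ?_
    have e1 : (N : ℝ)⁻¹ • (y + (Fintype.card P : ℤ) • (w : V)) =
        (1 / 2 : ℝ) • (x + ∑ v : P, (-(2 * Int.fract (N * f v) / N)) • (v : V)) +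
        (1 / 2 : ℝ) • (x + (2 * Fintype.card P / N : ℝ) • (w : V)) := by
      rw [smul_add, hyexp, smul_add, smul_add, ← Int.cast_smul_eq_zsmul ℝ, smul_smul, smul_smul,
        Finset.smul_sum]
      have : ∀ v : P, (1 / 2 : ℝ) • (-(2 * Int.fract (N * f v) / N)) • (v : V) =
          (-(Int.fract (N * f v) / N)) • (v : V) := fun v => by
        rw [smul_smul]; congr 1; ring
      simp_rw [this]
      rw [show (N : ℝ)⁻¹ * ((Fintype.card P : ℤ) : ℝ) = 1 / 2 * (2 * Fintype.card P / N : ℝ) by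
        push_cast; field_simp]
      module
    rw [e1]
    refine Y.add_mem (Y.smul_mem (by norm_num) (hbox _ fun v => ?_))
      (Y.smul_mem (by norm_num) (hδ' w _ ?_).1)
    · rw [abs_neg, abs_of_nonneg (by have := Int.fract_nonneg (N * f v); positivity)]
      have := (Int.fract_lt_one (N * f v)).le
      gcongr
      linarith
    · rw [abs_of_nonneg (by positivity)]
      exact hNv w
  have hfin : x = (1 / (N * Fintype.card P) : ℝ) • ∑ v : P,
      ((1 - Int.fract (N * f v)) • y +
        Int.fract (N * f v) • (y + (Fintype.card P : ℤ) • (v : V))) := by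
    have e1 : ∀ v : P, (1 - Int.fract (N * f v)) • y +
        Int.fract (N * f v) • (y + (Fintype.card P : ℤ) • (v : V)) =
        y + (Fintype.card P * Int.fract (N * f v)) • (v : V) := fun v => by
      rw [← Int.cast_smul_eq_zsmul ℝ]
      push_cast
      module
    simp_rw [e1]
    rw [Finset.sum_add_distrib, Finset.sum_const, Finset.card_univ, ← Nat.cast_smul_eq_nsmul ℝ,
      smul_add, smul_smul]
    rw [show (1 / (N * Fintype.card P) * Fintype.card P : ℝ) = (N : ℝ)⁻¹ by field_simp, hyexp,
      Finset.smul_sum, add_assoc, ← Finset.sum_add_distrib]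
    conv_lhs => rw [← add_zero x]
    congr 1
    refine (Finset.sum_eq_zero fun v _ => ?_).symm
    rw [smul_smul, ← add_smul]
    have : -(Int.fract (N * f v) / N) +
        1 / (N * Fintype.card P) * (Fintype.card P * Int.fract (N * f v)) = 0 := by
      field_simp; ring
    rw [this, zero_smul]
  rw [hfin]
  refine PointedCone.smul_mem _ (by positivity) (Submodule.sum_mem _ fun v _ =>
    Submodule.add_mem _ (PointedCone.smul_mem _ ?_ hy) (PointedCone.smul_mem _ ?_ (hyv v)))
  · linarith [Int.fract_lt_one (N * f v)]
  · exact Int.fract_nonneg _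

/-! ### Finiteness -/

theorem finite_of_basis {ι W : Type*} [Finite ι] [AddCommGroup W] [Module ℝ W] (b : Basis ι ℝ V)
    {S : Set (V →ₗ[ℝ] W)} (hS : ∀ i, ((fun ξ : V →ₗ[ℝ] W => ξ (b i)) '' S).Finite) :
    S.Finite := by
  refine Set.Finite.of_injOn (f := fun ξ i => ξ (b i))
    (t := Set.pi Set.univ fun i => (fun ξ : V →ₗ[ℝ] W => ξ (b i)) '' S) ?_ ?_
    (Set.Finite.pi' hS |>.subset ?_)
  · intro ξ hξ i _
    exact ⟨ξ, hξ, rfl⟩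
  · intro ξ _ ζ _ h
    exact b.ext fun i => congrFun h i
  · intro f hf i
    exact hf i trivial

theorem finite_int_le {A : Set ℝ} (h : ∀ a ∈ A, ∃ n : ℤ, a = n) {l u : ℝ} (hl : ∀ a ∈ A, l ≤ a)
    (hu : ∀ a ∈ A, a ≤ u) : A.Finite := by
  refine ((Set.finite_Icc ⌈l⌉ ⌊u⌋).image ((↑) : ℤ → ℝ)).subset fun a ha => ?_
  obtain ⟨n, rfl⟩ := h a ha
  exact ⟨n, ⟨Int.ceil_le.2 (hl _ ha), Int.le_floor.2 (hu _ ha)⟩, rfl⟩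

/-- A multiple of the core point `x` dominates each member of a basis of lattice points of `X`, so a
bound at `x` bounds the nonnegative integer values on that basis. -/
theorem finite_forms {L : AddSubgroup V} {X : PointedCone ℝ V}
    (hX : X = PointedCone.hull ℝ (X ∩ L : Set V)) (hsp : Submodule.span ℝ (X : Set V) = ⊤) {x : V}
    (hx : x ∈ core X) (M : ℝ) :
    {ξ : Dual ℝ V | ξ ∈ dualLat L ∧ (∀ y ∈ X, 0 ≤ ξ y) ∧ ξ x ≤ M}.Finite := by
  have hsp' : Submodule.span ℝ (X ∩ L : Set V) = ⊤ := by
    refine top_le_iff.1 (hsp.ge.trans (Submodule.span_le.2 fun y hy => ?_))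
    rw [hX] at hy
    exact PointedCone.hull_le_span ℝ _ hy
  obtain ⟨b, hb⟩ := exists_basis_of_span hsp'
  refine finite_of_basis b fun i => ?_
  obtain ⟨N, hN, h⟩ := core_dom hx (hb i).1
  refine finite_int_le (l := 0) (u := N * M) ?_ ?_ ?_
  · rintro _ ⟨ξ, hξ, rfl⟩
    exact hξ.1 _ (hb i).2
  · rintro _ ⟨ξ, hξ, rfl⟩
    exact hξ.2.1 _ (hb i).1
  · rintro _ ⟨ξ, hξ, rfl⟩
    have h1 := hξ.2.1 _ h
    rw [map_sub, map_smul, smul_eq_mul] at h1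
    have := mul_le_mul_of_nonneg_left hξ.2.2 hN.le
    simp only
    linarith

/-- The integral forms that are order units for the order given by the cone. -/
def posForms (L : AddSubgroup V) (X : PointedCone ℝ V) : Set (Dual ℝ V) :=
  {ξ | ξ ∈ dualLat L ∧ (∀ x ∈ X, 0 ≤ ξ x) ∧ ∀ α : Dual ℝ V, ∃ N : ℝ, ∀ x ∈ X, α x ≤ N * ξ x}

variable {L : AddSubgroup V} {X : PointedCone ℝ V}

theorem posForms_pos {ξ : Dual ℝ V} (hξ : ξ ∈ posForms L X) {x : V} (hx : x ∈ X) (hx0 : x ≠ 0) :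
    0 < ξ x := by
  refine lt_of_le_of_ne (hξ.2.1 x hx) fun h => hx0 ?_
  refine (Module.forall_dual_apply_eq_zero_iff ℝ x).1 fun α => le_antisymm ?_ ?_
  · obtain ⟨N, hN⟩ := hξ.2.2 α
    simpa [← h] using hN x hx
  · obtain ⟨N, hN⟩ := hξ.2.2 (-α)
    simpa [← h] using hN x hx

theorem posForms_nonneg_bound {ξ : Dual ℝ V} (hξ : ξ ∈ posForms L X) (α : Dual ℝ V) :
    ∃ N : ℝ, 0 ≤ N ∧ ∀ x ∈ X, |α x| ≤ N * ξ x := by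
  obtain ⟨N, hN⟩ := hξ.2.2 α
  obtain ⟨N', hN'⟩ := hξ.2.2 (-α)
  refine ⟨max 0 (max N N'), le_max_left _ _, fun x hx => abs_le'.2 ⟨?_, ?_⟩⟩
  · exact (hN x hx).trans (mul_le_mul_of_nonneg_right (by simp) (hξ.2.1 x hx))
  · exact (hN' x hx).trans (mul_le_mul_of_nonneg_right (by simp) (hξ.2.1 x hx))

/-- A unit `ξ` bounds all members of a basis of integral forms, so a bound on `ξ y` leaves finitely
many integer values for each of them. -/
theorem finite_points (hL : IsLat L) {ξ : Dual ℝ V} (hξ : ξ ∈ posForms L X) (M : ℝ) :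
    {y : V | y ∈ X ∧ y ∈ L ∧ ξ y ≤ M}.Finite := by
  obtain ⟨β, hβ⟩ := exists_basis_of_span hL.dual_span
  have : ((evalEquiv ℝ V) '' {y : V | y ∈ X ∧ y ∈ L ∧ ξ y ≤ M}).Finite := by
    refine finite_of_basis β fun i => ?_
    obtain ⟨N, hN0, hN⟩ := posForms_nonneg_bound hξ (β i)
    refine finite_int_le (l := -(N * M)) (u := N * M) ?_ ?_ ?_
    · rintro _ ⟨_, ⟨y, hy, rfl⟩, rfl⟩
      exact hβ i y hy.2.1
    · rintro _ ⟨_, ⟨y, hy, rfl⟩, rfl⟩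
      exact (abs_le.1 ((hN y hy.1).trans (mul_le_mul_of_nonneg_left hy.2.2 hN0))).1
    · rintro _ ⟨_, ⟨y, hy, rfl⟩, rfl⟩
      exact (abs_le.1 ((hN y hy.1).trans (mul_le_mul_of_nonneg_left hy.2.2 hN0))).2
  exact Set.Finite.of_finite_image this (evalEquiv ℝ V).injective.injOn

/-- `ξ` minimizes the value at `y` among the elements of `T`. -/
def IsActive (T : Set (Dual ℝ V)) (y : V) (ξ : Dual ℝ V) : Prop :=
  ξ ∈ T ∧ ∀ ζ ∈ T, ξ y ≤ ζ y

theorem exists_isActive {T : Set (Dual ℝ V)} (hT : T.Nonempty) {y : V}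
    (hfin : ∀ M : ℝ, {ξ ∈ T | ξ y ≤ M}.Finite) : ∃ ξ, IsActive T y ξ := by
  obtain ⟨ξ₀, h₀⟩ := hT
  obtain ⟨ξ, hξ, hmin⟩ := Set.exists_min_image _ (fun ξ : Dual ℝ V => ξ y) (hfin (ξ₀ y))
    ⟨ξ₀, h₀, le_rfl⟩
  refine ⟨ξ, hξ.1, fun ζ hζ => ?_⟩
  rcases le_total (ζ y) (ξ₀ y) with h | h
  · exact hmin ζ ⟨hζ, h⟩
  · exact hξ.2.trans h

/-- By Dickson's lemma, only finitely many forms are minimal somewhere on a given finitely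
generated cone. -/
theorem finite_isActive {T : Set (Dual ℝ V)} {P : Finset V} {O : Set V}
    (hT : ∀ ξ ∈ T, ∀ p ∈ P, ∃ n : ℕ, ξ p = n)
    (hfin : ∀ y ∈ O, ∀ M : ℝ, {ξ ∈ T | ξ y ≤ M}.Finite) :
    {ξ | ∃ y ∈ O, y ∈ PointedCone.hull ℝ (P : Set V) ∧ IsActive T y ξ}.Finite := by
  classical
  -- The points are sorted by their support `I`. On a fixed support all coefficients are positive,
  -- which makes the comparison below strict.
  let A : Finset V → Set (Dual ℝ V) := fun I =>
    {ξ | ∃ a : V → ℝ, (∀ p ∈ I, 0 < a p) ∧ ∑ p ∈ I, a p • p ∈ O ∧ IsActive T (∑ p ∈ I, a p • p) ξ}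
  have hA : ∀ I ⊆ P, (A I).Finite := by
    intro I hI
    rcases (A I).eq_empty_or_nonempty with he | ⟨ξ₀, a₀, ha₀, hO, -⟩
    · rw [he]; exact Set.finite_empty
    let v : Dual ℝ V → (I → ℕ) := fun ξ p => ⌊ξ p⌋₊
    have hv : ∀ ξ ∈ T, ∀ p : I, ξ p = v ξ p := fun ξ hξ p => by
      obtain ⟨n, hn⟩ := hT ξ hξ p (hI p.2)
      simp [v, hn]
    -- A form with smaller values on `I`, somewhere strictly, would beat the other at every point
    -- with support `I`. So the value vectors of active forms are an antichain in `ℕ^I`.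
    have hanti : IsAntichain (· ≤ ·) (v '' A I) := by
      rintro _ ⟨ξ, ⟨a, ha, hy, hξT, hξ⟩, rfl⟩ _ ⟨ζ, ⟨a', ha', hy', hζT, hζ⟩, rfl⟩ hne hle
      apply hne
      funext p
      by_contra hp
      have h1 := hζ ξ hξT
      have hlt : ∑ p ∈ I, a' p * ξ p < ∑ p ∈ I, a' p * ζ p := by
        refine Finset.sum_lt_sum (fun q hq => ?_) ⟨p, p.2, ?_⟩
        · refine mul_le_mul_of_nonneg_left ?_ (ha' q hq).le
          rw [hv ξ hξT ⟨q, hq⟩, hv ζ hζT ⟨q, hq⟩]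
          exact_mod_cast hle ⟨q, hq⟩
        · refine mul_lt_mul_of_pos_left ?_ (ha' p p.2)
          rw [hv ξ hξT p, hv ζ hζT p]
          exact_mod_cast lt_of_le_of_ne (hle p) hp
      simp only [map_sum, map_smul, smul_eq_mul] at h1
      exact absurd h1 (not_le.2 hlt)
    have hfinv : (v '' A I).Finite := WellQuasiOrderedLE.finite_of_isAntichain hanti
    -- Finitely many value vectors bound all these forms at one fixed point of `O`, where only
    -- finitely many forms lie below a bound.
    obtain ⟨B, hB⟩ := ((hfinv.image fun f => ∑ p, f p)).bddAbove
    refine (hfin _ hO (∑ p ∈ I, a₀ p * B)).subset ?_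
    rintro ξ ⟨a, ha, hy, hξT, hξ⟩
    refine ⟨hξT, ?_⟩
    rw [map_sum]
    refine Finset.sum_le_sum fun p hp => ?_
    rw [map_smul, smul_eq_mul, hv ξ hξT ⟨p, hp⟩]
    refine mul_le_mul_of_nonneg_left ?_ (ha₀ p hp).le
    have h1 : ∑ p, v ξ p ≤ B := hB ⟨v ξ, ⟨ξ, ⟨a, ha, hy, hξT, hξ⟩, rfl⟩, rfl⟩
    have h2 := Finset.single_le_sum (f := v ξ) (fun _ _ => Nat.zero_le _)
      (Finset.mem_univ ⟨p, hp⟩)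
    exact_mod_cast h2.trans h1
  refine (Set.Finite.biUnion (P.powerset.finite_toSet) fun I hI =>
    hA I (Finset.mem_powerset.1 hI)).subset ?_
  rintro ξ ⟨y, hyO, hyP, hξ⟩
  obtain ⟨a, ha, rfl⟩ := (mem_hull_finset P).1 hyP
  have hsum : ∑ p ∈ P.filter (fun p => 0 < a p), a p • p = ∑ p ∈ P, a p • p := by
    refine Finset.sum_subset (Finset.filter_subset _ _) fun p hp hnp => ?_
    have : a p = 0 := le_antisymm (not_lt.1 fun h => hnp (Finset.mem_filter.2 ⟨hp, h⟩)) (ha p)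
    rw [this, zero_smul]
  refine Set.mem_biUnion (x := P.filter (fun p => 0 < a p)) ?_ ⟨a, ?_, ?_⟩
  · exact Finset.mem_coe.2 (Finset.mem_powerset.2 (Finset.filter_subset _ _))
  · intro p hp; exact (Finset.mem_filter.1 hp).2
  · rw [hsum]; exact ⟨hyO, hξ⟩

end Lattice

end RatCone

namespace RatCone

/-! ### Cones with a polyhedral covering: rays, closure points and stars of faces. -/

section System

variable {V : Type*} [AddCommGroup V] [Module ℝ V] [FiniteDimensional ℝ V]

/-- A rational cone `X` with a lattice `L` and a group `Γ` that acts on `L` and on `X`, such that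
the interior of `X` is covered by the translates of a rational polyhedral cone. -/
structure Sys (L : AddSubgroup V) (X : PointedCone ℝ V) (Γ : Subgroup (V ≃ₗ[ℝ] V)) : Prop where
  lat : IsLat L
  gen : X = PointedCone.hull ℝ (X ∩ L : Set V)
  span_top : Submodule.span ℝ (X : Set V) = ⊤
  unit : (posForms L X).Nonempty
  mapL : ∀ γ ∈ Γ, ∀ v ∈ L, γ v ∈ L
  mapX : ∀ γ ∈ Γ, ∀ x ∈ X, γ x ∈ X
  cover : ∃ P : Finset V, (P : Set V) ⊆ X ∩ L ∧
    ∀ x ∈ core X, ∃ γ ∈ Γ, ∃ p ∈ PointedCone.hull ℝ (P : Set V), γ p = x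

variable {L : AddSubgroup V} {X F : PointedCone ℝ V} {Γ : Subgroup (V ≃ₗ[ℝ] V)}

theorem dualLat_nat {ξ : Dual ℝ V} (hξ : ξ ∈ dualLat L) (hX : ∀ x ∈ X, 0 ≤ ξ x) {x : V}
    (hx : x ∈ X) (hxL : x ∈ L) : ∃ n : ℕ, ξ x = n := by
  obtain ⟨n, hn⟩ := hξ x hxL
  have : 0 ≤ n := by
    have := hX x hx
    rw [hn] at this
    exact_mod_cast this
  lift n to ℕ using this
  exact ⟨n, by simpa using hn⟩

/-- The elements of `posForms L X` with the same restriction to `F` as `ξ₀`. -/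
def fam (L : AddSubgroup V) (X F : PointedCone ℝ V) (ξ₀ : Dual ℝ V) : Set (Dual ℝ V) :=
  {ξ | ξ ∈ posForms L X ∧ ∀ v ∈ F, ξ v = ξ₀ v}

theorem eq_on_span {ξ ξ₀ : Dual ℝ V} (h : ∀ v ∈ F, ξ v = ξ₀ v) {v : V}
    (hv : v ∈ Submodule.span ℝ (F : Set V)) : ξ v = ξ₀ v :=
  LinearMap.eqOn_span (f := ξ) (g := ξ₀) (fun _ hx => h _ hx) hv

/-- The elements of `Γ` that fix `F` pointwise. -/
def fixer (Γ : Subgroup (V ≃ₗ[ℝ] V)) (F : PointedCone ℝ V) : Subgroup (V ≃ₗ[ℝ] V) where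
  carrier := {γ | γ ∈ Γ ∧ ∀ v ∈ F, γ v = v}
  one_mem' := ⟨Γ.one_mem, fun _ _ => rfl⟩
  mul_mem' := by
    rintro γ δ ⟨hγ, h1⟩ ⟨hδ, h2⟩
    refine ⟨Γ.mul_mem hγ hδ, fun v hv => ?_⟩
    change γ (δ v) = v
    rw [h2 v hv, h1 v hv]
  inv_mem' := by
    rintro γ ⟨hγ, h1⟩
    refine ⟨Γ.inv_mem hγ, fun v hv => ?_⟩
    change γ.symm v = v
    rw [LinearEquiv.symm_apply_eq, h1 v hv]

theorem symm_mem {γ : V ≃ₗ[ℝ] V} (hγ : γ ∈ Γ) : γ.symm ∈ Γ := Γ.inv_mem hγ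

theorem fixer_le : fixer Γ F ≤ Γ := fun _ h => h.1

theorem fixer_span {γ : V ≃ₗ[ℝ] V} (hγ : γ ∈ fixer Γ F) {v : V}
    (hv : v ∈ Submodule.span ℝ (F : Set V)) : γ v = v :=
  LinearMap.eqOn_span (f := γ.toLinearMap) (g := LinearMap.id) (fun _ hx => hγ.2 _ hx) hv

/-- For a real combination of lattice points the values need not be integers, but they are sums of
nonnegative numbers taken from multiples of discrete sets. -/
theorem finite_values {q : V} (hq : q ∈ PointedCone.hull ℝ (X ∩ L : Set V)) (M : ℝ) :
    {r : ℝ | ∃ ξ ∈ posForms L X, ξ q = r ∧ r ≤ M}.Finite := by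
  have hle : PointedCone.hull ℝ (X ∩ L : Set V) ≤ X := Submodule.span_le.2 fun x hx => hx.1
  induction hq using Submodule.span_induction generalizing M with
  | mem x hx =>
    refine finite_int_le (l := 0) (u := M) ?_ ?_ ?_
    · rintro _ ⟨ξ, hξ, rfl, -⟩
      exact hξ.1 x hx.2
    · rintro _ ⟨ξ, hξ, rfl, -⟩
      exact hξ.2.1 x hx.1
    · rintro _ ⟨ξ, hξ, -, h⟩
      exact h
  | zero =>
    refine (Set.finite_singleton (0 : ℝ)).subset ?_
    rintro _ ⟨ξ, hξ, rfl, -⟩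
    simp
  | add x y hx' hy' hx hy =>
    refine (Set.Finite.image2 (· + ·) (hx M) (hy M)).subset ?_
    rintro _ ⟨ξ, hξ, rfl, h⟩
    have h1 := hξ.2.1 x (hle hx')
    have h2 := hξ.2.1 y (hle hy')
    rw [map_add] at h ⊢
    exact ⟨ξ x, ⟨ξ, hξ, rfl, by linarith⟩, ξ y, ⟨ξ, hξ, rfl, by linarith⟩, rfl⟩
  | smul a x hx' hx =>
    rcases eq_or_lt_of_le (show (0 : ℝ) ≤ a from a.2) with h0 | h0
    · refine (Set.finite_singleton (0 : ℝ)).subset ?_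
      rintro _ ⟨ξ, hξ, rfl, -⟩
      change ξ ((a : ℝ) • x) = 0
      rw [← h0, zero_smul, map_zero]
    · refine ((hx (M / a)).image fun r : ℝ => (a : ℝ) * r).subset ?_
      rintro _ ⟨ξ, hξ, rfl, h⟩
      change ξ ((a : ℝ) • x) ≤ M at h
      rw [map_smul, smul_eq_mul] at h
      refine ⟨ξ x, ⟨ξ, hξ, rfl, ?_⟩, ?_⟩
      · rw [le_div_iff₀ h0]; linarith
      · change _ = ξ ((a : ℝ) • x)
        rw [map_smul, smul_eq_mul]

namespace Sys

variable (h : Sys L X Γ)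
include h

theorem exists_core : ∃ c ∈ L, c ∈ core X := exists_mem_core h.gen

theorem exists_face_core (hF : F.IsFaceOf X) : ∃ r ∈ L, r ∈ core F :=
  exists_mem_core (face_hull hF h.gen)

theorem span_lattice : Submodule.span ℝ (X ∩ L : Set V) = ⊤ := by
  refine top_le_iff.1 (h.span_top.ge.trans (Submodule.span_le.2 fun y hy => ?_))
  have hy' : y ∈ PointedCone.hull ℝ (X ∩ L : Set V) := h.gen ▸ hy
  exact PointedCone.hull_le_span ℝ _ hy'

theorem map_core {γ : V ≃ₗ[ℝ] V} (hγ : γ ∈ Γ) {x : V} (hx : x ∈ core X) : γ x ∈ core X := by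
  refine ⟨h.mapX γ hγ x hx.1, fun y hy => ?_⟩
  obtain ⟨ε, hε, he⟩ := hx.2 _ (h.mapX _ (symm_mem hγ) y hy)
  refine ⟨ε, hε, ?_⟩
  have := h.mapX γ hγ _ he
  rwa [map_sub, map_smul, LinearEquiv.apply_symm_apply] at this

theorem comp_mem {γ : V ≃ₗ[ℝ] V} (hγ : γ ∈ Γ) {ξ : Dual ℝ V} (hξ : ξ ∈ posForms L X) :
    ξ ∘ₗ γ.toLinearMap ∈ posForms L X := by
  refine ⟨fun v hv => hξ.1 _ (h.mapL γ hγ v hv), fun x hx => hξ.2.1 _ (h.mapX γ hγ x hx),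
    fun α => ?_⟩
  obtain ⟨N, hN⟩ := hξ.2.2 (α ∘ₗ γ.symm.toLinearMap)
  refine ⟨N, fun x hx => ?_⟩
  simpa using hN _ (h.mapX γ hγ x hx)

theorem comp_fam {γ : V ≃ₗ[ℝ] V} (hγ : γ ∈ fixer Γ F) {ξ ξ₀ : Dual ℝ V} (hξ : ξ ∈ fam L X F ξ₀) :
    ξ ∘ₗ γ.toLinearMap ∈ fam L X F ξ₀ :=
  ⟨h.comp_mem hγ.1 hξ.1, fun v hv => by simpa [hγ.2 v hv] using hξ.2 v hv⟩

theorem active_comp {γ : V ≃ₗ[ℝ] V} (hγ : γ ∈ Γ) {ξ : Dual ℝ V} {p : V}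
    (hξ : IsActive (posForms L X) (γ p) ξ) :
    IsActive (posForms L X) p (ξ ∘ₗ γ.toLinearMap) := by
  refine ⟨h.comp_mem hγ hξ.1, fun ζ hζ => ?_⟩
  have := hξ.2 _ (h.comp_mem (symm_mem hγ) hζ)
  simpa using this

theorem active_fam_comp {γ : V ≃ₗ[ℝ] V} (hγ : γ ∈ fixer Γ F) {ξ ξ₀ : Dual ℝ V} {p : V}
    (hξ : IsActive (fam L X F ξ₀) (γ p) ξ) :
    IsActive (fam L X F ξ₀) p (ξ ∘ₗ γ.toLinearMap) := by
  refine ⟨h.comp_fam hγ hξ.1, fun ζ hζ => ?_⟩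
  have := hξ.2 _ (h.comp_fam (symm_mem hγ) hζ)
  simpa using this

theorem finite_posForms {x : V} (hx : x ∈ core X) (M : ℝ) :
    {ξ ∈ posForms L X | ξ x ≤ M}.Finite :=
  (finite_forms h.gen h.span_top hx M).subset fun _ hξ => ⟨hξ.1.1, hξ.1.2.1, hξ.2⟩

theorem finite_fam {ξ₀ : Dual ℝ V} {x v : V} (hx : x ∈ core X)
    (hv : v ∈ Submodule.span ℝ (F : Set V)) (M : ℝ) :
    {ξ ∈ fam L X F ξ₀ | ξ (x + v) ≤ M}.Finite := by
  refine (h.finite_posForms hx (M - ξ₀ v)).subset ?_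
  rintro ξ ⟨hξ, hM⟩
  refine ⟨hξ.1, ?_⟩
  rw [map_add, eq_on_span hξ.2 hv] at hM
  linarith

/-- If `ξ ∘ γ` ranges over a finite set, the unit `ξ` is bounded at the images under `γ` of a basis
of lattice points of `X`. These images are lattice points of `X`, so there are finitely many of
them, and they determine `γ`. -/
theorem finite_group {ξ : Dual ℝ V} (hξ : ξ ∈ posForms L X) {S : Set (Dual ℝ V)} (hS : S.Finite) :
    {γ : V ≃ₗ[ℝ] V | γ ∈ Γ ∧ ξ ∘ₗ γ.toLinearMap ∈ S}.Finite := by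
  obtain ⟨b, hb⟩ := exists_basis_of_span h.span_lattice
  refine Set.Finite.of_finite_image (f := fun γ : V ≃ₗ[ℝ] V => γ.toLinearMap) ?_
    (LinearEquiv.toLinearMap_injective.injOn)
  refine finite_of_basis b fun i => ?_
  obtain ⟨M, hM⟩ := (hS.image fun ζ => ζ (b i)).bddAbove
  refine (finite_points h.lat hξ M).subset ?_
  rintro _ ⟨_, ⟨γ, ⟨hγ, hγS⟩, rfl⟩, rfl⟩
  exact ⟨h.mapX γ hγ _ (hb i).1, h.mapL γ hγ _ (hb i).2, hM ⟨_, hγS, rfl⟩⟩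

/-- Among the units, one that minimizes first the value at `q` and then the value at `c` is active
at all far points of the ray. Hence these points lie in finitely many translates of the polyhedral
cone, one translate contains infinitely many of them, and so it contains `q`. -/
theorem exists_of_ray {P : Finset V} (hP : (P : Set V) ⊆ X ∩ L)
    (hcov : ∀ x ∈ core X, ∃ γ ∈ Γ, ∃ p ∈ PointedCone.hull ℝ (P : Set V), γ p = x) {c q : V}
    (hc : ∀ n : ℕ, c + (n : ℝ) • q ∈ core X)
    (hfin : ∀ M : ℝ, {r : ℝ | ∃ ξ ∈ posForms L X, ξ q = r ∧ r ≤ M}.Finite) :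
    ∃ γ ∈ Γ, γ.symm q ∈ PointedCone.hull ℝ (P : Set V) ∧
      ∃ n : ℕ, γ.symm (c + (n : ℝ) • q) ∈ PointedCone.hull ℝ (P : Set V) := by
  obtain ⟨ξ₀, h₀⟩ := h.unit
  have hc0 : c ∈ core X := by simpa using hc 0
  -- a form with minimal value at `q`
  obtain ⟨ξ₁, h₁, hmin⟩ : ∃ ξ₁ ∈ posForms L X, ∀ ζ ∈ posForms L X, ξ₁ q ≤ ζ q := by
    obtain ⟨m, ⟨ξ₁, h₁, rfl, hle⟩, hmin⟩ := Set.exists_min_image _ id (hfin (ξ₀ q))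
      ⟨ξ₀ q, ξ₀, h₀, rfl, le_rfl⟩
    refine ⟨ξ₁, h₁, fun ζ hζ => ?_⟩
    rcases le_total (ζ q) (ξ₀ q) with h' | h'
    · exact hmin _ ⟨ζ, hζ, rfl, h'⟩
    · exact hle.trans h'
  -- The least value at `q` is isolated. Once `n * δ` reaches the value of the chosen form at `c`,
  -- forms with a larger value at `q` cannot compete at `c + n q`.
  obtain ⟨δ, hδ, hgap⟩ : ∃ δ : ℝ, 0 < δ ∧ ∀ ζ ∈ posForms L X, ζ q = ξ₁ q ∨ ξ₁ q + δ ≤ ζ q := by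
    rcases ({r : ℝ | ∃ ξ ∈ posForms L X, ξ q = r ∧ r ≤ ξ₁ q + 1} \ {ξ₁ q}).eq_empty_or_nonempty
      with he | hne
    · refine ⟨1, one_pos, fun ζ hζ => ?_⟩
      by_contra! hcon
      have : ζ q ∈ ({r : ℝ | ∃ ξ ∈ posForms L X, ξ q = r ∧ r ≤ ξ₁ q + 1} \ {ξ₁ q}) :=
        ⟨⟨ζ, hζ, rfl, hcon.2.le⟩, hcon.1⟩
      rw [he] at this
      exact this
    · obtain ⟨m, ⟨⟨ξ₂, h₂, rfl, hle⟩, hne'⟩, hm⟩ := Set.exists_min_image _ id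
        ((hfin (ξ₁ q + 1)).sdiff (t := {ξ₁ q})) hne
      refine ⟨ξ₂ q - ξ₁ q, sub_pos.2 (lt_of_le_of_ne (hmin _ h₂) (Ne.symm hne')), fun ζ hζ => ?_⟩
      by_contra! hcon
      have := hm (ζ q) ⟨⟨ζ, hζ, rfl, by linarith [hcon.2]⟩, hcon.1⟩
      simp only [id] at this
      linarith [hcon.2]
  obtain ⟨ξ₂, ⟨h₂, hq₂⟩, hact⟩ := exists_isActive (T := {ξ ∈ posForms L X | ξ q = ξ₁ q}) (y := c)
    ⟨ξ₁, h₁, rfl⟩ fun M => (h.finite_posForms hc0 M).subset fun ξ hξ => ⟨hξ.1.1, hξ.2⟩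
  obtain ⟨n₀, hn₀⟩ := exists_nat_ge (ξ₂ c / δ)
  have hactn : ∀ n ≥ n₀, IsActive (posForms L X) (c + (n : ℝ) • q) ξ₂ := by
    refine fun n hn => ⟨h₂, fun ζ hζ => ?_⟩
    simp only [map_add, map_smul, smul_eq_mul, hq₂]
    rcases hgap ζ hζ with h' | h'
    · rw [h']
      linarith [hact ζ ⟨hζ, h'⟩]
    · have h3 : ξ₂ c ≤ n * δ := by
        rw [div_le_iff₀ hδ] at hn₀
        refine hn₀.trans (mul_le_mul_of_nonneg_right (by exact_mod_cast hn) hδ.le)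
      have h4 := hζ.2.1 c hc0.1
      have h5 := mul_le_mul_of_nonneg_left h' (Nat.cast_nonneg n)
      linarith
  have hSfin := finite_isActive (T := posForms L X) (P := P) (O := core X)
    (fun ξ hξ p hp => dualLat_nat hξ.1 hξ.2.1 (hP hp).1 (hP hp).2)
    (fun y hy M => h.finite_posForms hy M)
  obtain ⟨γ, ⟨hγ, -⟩, hfreq⟩ := exists_forall_frequently (h.finite_group h₂ hSfin)
    (p := fun γ n => γ.symm (c + (n : ℝ) • q) ∈ PointedCone.hull ℝ (P : Set V)) (n₀ := n₀) (by
      intro n hn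
      obtain ⟨γ, hγ, p, hp, hγp⟩ := hcov _ (hc n)
      have hpc : p ∈ core X := by
        have := h.map_core (symm_mem hγ) (hc n)
        rwa [← hγp, LinearEquiv.symm_apply_apply] at this
      refine ⟨γ, ⟨hγ, p, hpc, hp, h.active_comp hγ ?_⟩, ?_⟩
      · rw [hγp]; exact hactn n hn
      · rw [← hγp, LinearEquiv.symm_apply_apply]; exact hp)
  refine ⟨γ, hγ, ?_, ?_⟩
  · refine mem_hull_of_frequently P (c := γ.symm c) fun N => ?_
    obtain ⟨n, hn, hm⟩ := hfreq ⌈N⌉₊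
    refine ⟨n, (Nat.le_ceil N).trans (by exact_mod_cast hn), ?_⟩
    rwa [map_add, map_smul] at hm
  · obtain ⟨n, -, hm⟩ := hfreq 0
    exact ⟨n, hm⟩

/-- The whole cone is covered. -/
theorem full_cover {P : Finset V} (hP : (P : Set V) ⊆ X ∩ L)
    (hcov : ∀ x ∈ core X, ∃ γ ∈ Γ, ∃ p ∈ PointedCone.hull ℝ (P : Set V), γ p = x) {q : V}
    (hq : q ∈ X) : ∃ γ ∈ Γ, ∃ p ∈ PointedCone.hull ℝ (P : Set V), γ p = q := by
  obtain ⟨c, -, hc⟩ := h.exists_core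
  obtain ⟨γ, hγ, hm, -⟩ := h.exists_of_ray hP hcov (c := c) (q := q)
    (fun n => core_add hc (X.smul_mem (Nat.cast_nonneg n) hq))
    (fun M => finite_values (h.gen ▸ hq) M)
  exact ⟨γ, hγ, _, hm, by simp⟩

/-- A lattice point in the closure of the cone belongs to the cone. -/
theorem mem_of_lattice_ray {c q : V} (hqL : q ∈ L) (hc : ∀ n : ℕ, c + (n : ℝ) • q ∈ core X) :
    q ∈ X := by
  obtain ⟨P, hP, hcov⟩ := h.cover
  -- `q` is not yet known to lie in `X`. Its values are still integers because `q ∈ L`, and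
  -- nonnegative because the whole ray lies in `X`.
  obtain ⟨γ, hγ, hm, -⟩ := h.exists_of_ray hP hcov hc fun M => by
    refine finite_int_le (l := 0) (u := M) ?_ ?_ ?_
    · rintro _ ⟨ξ, hξ, rfl, -⟩
      exact hξ.1 q hqL
    · rintro _ ⟨ξ, hξ, rfl, -⟩
      by_contra! hneg
      obtain ⟨n, hn⟩ := exists_nat_gt (ξ c / (-ξ q))
      have := hξ.2.1 _ (hc n).1
      rw [map_add, map_smul, smul_eq_mul] at this
      rw [div_lt_iff₀ (by linarith)] at hn
      linarith
    · rintro _ ⟨ξ, hξ, -, h⟩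
      exact h
  have hle : PointedCone.hull ℝ (P : Set V) ≤ X := Submodule.span_le.2 fun x hx => (hP hx).1
  simpa using h.mapX γ hγ _ (hle hm)

/-- Modulo the span of a face `F`, the interior of the cone is covered by the translates of a
rational polyhedral cone under the pointwise stabilizer of `F`. -/
theorem star (hF : F.IsFaceOf X) : ∃ Q : Finset V, (Q : Set V) ⊆ X ∩ L ∧
    ∀ x ∈ core X, ∃ γ ∈ fixer Γ F, ∃ p ∈ PointedCone.hull ℝ (Q : Set V),
      x - γ p ∈ Submodule.span ℝ (F : Set V) := by
  classical
  obtain ⟨P, hP, hcov⟩ := h.cover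
  obtain ⟨r, hrL, hr⟩ := h.exists_face_core hF
  have hrX := hF.le hr.1
  obtain ⟨ξ₁, h₁⟩ := h.unit
  let A : Set (V ≃ₗ[ℝ] V) := {γ | γ ∈ Γ ∧ γ.symm r ∈ PointedCone.hull ℝ (P : Set V)}
  -- the preimages of `r` are bounded
  obtain ⟨M, hM⟩ : ∃ M : ℝ, ∀ γ ∈ A, ξ₁ (γ.symm r) ≤ M := by
    obtain ⟨m, ⟨ξ₂, h₂, rfl, -⟩, -⟩ := Set.exists_min_image _ id
      (finite_values (L := L) (X := X) (h.gen ▸ hrX) (ξ₁ r)) ⟨ξ₁ r, ξ₁, h₁, rfl, le_rfl⟩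
    obtain ⟨K, hK⟩ := (P.finite_toSet.image ξ₁).bddAbove
    have hK0 : ∀ p ∈ P, ξ₁ p ≤ max K 0 := fun p hp => (hK ⟨p, hp, rfl⟩).trans (le_max_left _ _)
    refine ⟨max K 0 * ξ₂ r, ?_⟩
    rintro γ ⟨hγ, hγP⟩
    obtain ⟨a, ha, hsum⟩ := (mem_hull_finset P).1 hγP
    have h3 := h.comp_mem hγ h₂
    have h4 : ξ₂ r = ∑ p ∈ P, a p * ξ₂ (γ p) := by
      have : r = γ (∑ p ∈ P, a p • p) := by rw [hsum, LinearEquiv.apply_symm_apply]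
      conv_lhs => rw [this]
      simp
    rw [← hsum, h4, map_sum, Finset.mul_sum]
    refine Finset.sum_le_sum fun p hp => ?_
    rw [map_smul, smul_eq_mul]
    by_cases hp0 : p = 0
    · simp [hp0]
    -- `ξ₂ ∘ γ` takes positive integer values at the nonzero generators, so `ξ₂ r` bounds the sum of
    -- their coefficients in `γ⁻¹ r`, independently of `γ`.
    · have h5 : 0 < ξ₂ (γ p) := posForms_pos h3 (hP hp).1 hp0
      obtain ⟨n, hn⟩ := dualLat_nat h3.1 h3.2.1 (hP hp).1 (hP hp).2
      have h6 : 1 ≤ ξ₂ (γ p) := by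
        change ξ₂ (γ p) = n at hn
        rw [hn] at h5 ⊢
        exact_mod_cast h5
      have h7 := hK0 p hp
      have h8 : ξ₁ p ≤ max K 0 * ξ₂ (γ p) := h7.trans (le_mul_of_one_le_right (le_max_right _ _) h6)
      calc a p * ξ₁ p ≤ a p * (max K 0 * ξ₂ (γ p)) := mul_le_mul_of_nonneg_left h8 (ha p)
        _ = _ := by ring
  -- Only the restriction of `γ⁻¹` to the span of `F` matters. It sends lattice points of `F`, each
  -- dominated by a multiple of `r`, to lattice points of bounded size, so finitely many
  -- restrictions occur.
  let f : (V ≃ₗ[ℝ] V) → (Submodule.span ℝ (F : Set V) →ₗ[ℝ] V) := fun γ =>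
    γ.symm.toLinearMap ∘ₗ (Submodule.span ℝ (F : Set V)).subtype
  have hfA : (f '' A).Finite := by
    have hsp : Submodule.span ℝ {v : Submodule.span ℝ (F : Set V) | (v : V) ∈ F ∧ (v : V) ∈ L} =
        ⊤ := by
      have h1 : (Subtype.val '' {v : Submodule.span ℝ (F : Set V) | (v : V) ∈ F ∧ (v : V) ∈ L}) =
          (F ∩ L : Set V) := by
        ext v
        constructor
        · rintro ⟨w, hw, rfl⟩; exact hw
        · rintro hv; exact ⟨⟨v, Submodule.subset_span hv.1⟩, hv, rfl⟩
      apply Submodule.map_injective_of_injective (Submodule.subtype_injective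
        (Submodule.span ℝ (F : Set V)))
      rw [Submodule.map_span, Submodule.map_subtype_top]
      change Submodule.span ℝ (Subtype.val '' _) = _
      rw [h1]
      refine le_antisymm (Submodule.span_mono fun x hx => hx.1) (Submodule.span_le.2 fun x hx => ?_)
      have : x ∈ PointedCone.hull ℝ (F ∩ L : Set V) := face_hull hF h.gen ▸ hx
      exact PointedCone.hull_le_span ℝ _ this
    obtain ⟨b, hb⟩ := exists_basis_of_span hsp
    refine finite_of_basis b fun i => ?_
    obtain ⟨N, hN, hNX⟩ := core_dom hr (hb i).1
    refine (finite_points h.lat h₁ (N * M)).subset ?_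
    rintro _ ⟨_, ⟨γ, hγ, rfl⟩, rfl⟩
    refine ⟨h.mapX _ (symm_mem hγ.1) _ (hF.le (hb i).1), h.mapL _ (symm_mem hγ.1) _ (hb i).2, ?_⟩
    have := h₁.2.1 _ (h.mapX _ (symm_mem hγ.1) _ (hF.le hNX))
    rw [map_sub, map_smul, map_sub, map_smul, smul_eq_mul] at this
    have h2 := mul_le_mul_of_nonneg_left (hM γ hγ) hN.le
    change ξ₁ (γ.symm (b i)) ≤ _
    linarith
  -- One representative is kept for each restriction; if `γ` and `φ` have the same one, then `γ φ⁻¹`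
  -- fixes `F` pointwise.
  obtain ⟨Φ, hΦA, hΦ⟩ := Set.exists_subset_bijOn A f
  have hΦfin : Φ.Finite := (hΦ.finite_iff_finite).2 hfA
  refine ⟨(hΦfin.toFinset.product P).image fun y => y.1 y.2, ?_, fun x hx => ?_⟩
  · intro y hy
    obtain ⟨⟨φ, p⟩, hφp, rfl⟩ := Finset.mem_image.1 (Finset.mem_coe.1 hy)
    obtain ⟨hφ, hp⟩ := Finset.mem_product.1 hφp
    have hφΓ := (hΦA (hΦfin.mem_toFinset.1 hφ)).1
    exact ⟨h.mapX _ hφΓ _ (hP hp).1, h.mapL _ hφΓ _ (hP hp).2⟩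
  -- Moving from `x` in the direction `r` does not change the class modulo the span of `F`, and it
  -- forces the covering element `γ` into `A`.
  · obtain ⟨γ, hγ, hγr, n, hγn⟩ := h.exists_of_ray hP hcov (c := x) (q := r)
      (fun n => core_add hx (X.smul_mem (Nat.cast_nonneg n) hrX))
      (fun M => finite_values (h.gen ▸ hrX) M)
    obtain ⟨φ, hφ, hφγ⟩ := hΦ.surjOn ⟨γ, ⟨hγ, hγr⟩, rfl⟩
    have hfix : γ * φ⁻¹ ∈ fixer Γ F := by
      refine ⟨Γ.mul_mem hγ (Γ.inv_mem (hΦA hφ).1), fun v hv => ?_⟩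
      have := LinearMap.congr_fun hφγ ⟨v, Submodule.subset_span hv⟩
      change φ.symm v = γ.symm v at this
      change γ (φ.symm v) = v
      rw [this, LinearEquiv.apply_symm_apply]
    refine ⟨γ * φ⁻¹, hfix, φ (γ.symm (x + (n : ℝ) • r)), ?_, ?_⟩
    · obtain ⟨a, ha, hsum⟩ := (mem_hull_finset P).1 hγn
      rw [← hsum, map_sum]
      refine Submodule.sum_mem _ fun p hp => ?_
      rw [map_smul]
      refine PointedCone.smul_mem _ (ha p) (PointedCone.subset_hull ?_)
      exact Finset.mem_coe.2 (Finset.mem_image.2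
        ⟨(φ, p), Finset.mem_product.2 ⟨hΦfin.mem_toFinset.2 hφ, hp⟩, rfl⟩)
    · have : (γ * φ⁻¹) (φ (γ.symm (x + (n : ℝ) • r))) = x + (n : ℝ) • r := by
        change γ (φ.symm (φ _)) = _
        rw [LinearEquiv.symm_apply_apply, LinearEquiv.apply_symm_apply]
      rw [this, sub_add_cancel_left]
      exact Submodule.neg_mem _ (Submodule.smul_mem _ _ (Submodule.subset_span hr.1))

end Sys

end System

end RatCone

namespace RatCone

/-! ### Open cones with cocompact affine symmetries. -/

section OpenCone

variable {U : Type*} [NormedAddCommGroup U] [NormedSpace ℝ U] [FiniteDimensional ℝ U]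

/-- The linear forms that are nonnegative on `D`. -/
def dualSet (D : Set U) : Set (Dual ℝ U) :=
  {β | ∀ d ∈ D, 0 ≤ β d}

/-- A nonempty open convex cone that does not contain the origin. -/
structure IsOpenCone (D : Set U) : Prop where
  isOpen : IsOpen D
  nonempty : D.Nonempty
  add_mem : ∀ x ∈ D, ∀ y ∈ D, x + y ∈ D
  smul_mem : ∀ x ∈ D, ∀ t : ℝ, 0 < t → t • x ∈ D
  zero_notMem : (0 : U) ∉ D

variable {D : Set U}

/-- A nearby point is an average of perturbations of `d` along the vectors of a basis, so convexity
reduces openness to finitely many directions. -/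
theorem isOpen_of_absorb {D : Set U} (hconv : Convex ℝ D)
    (h : ∀ d ∈ D, ∀ u : U, ∃ ε : ℝ, 0 < ε ∧ ∀ t : ℝ, |t| ≤ ε → d + t • u ∈ D) : IsOpen D := by
  classical
  rw [isOpen_iff_mem_nhds]
  intro d hd
  let b := finBasis ℝ U
  rcases Nat.eq_zero_or_pos (finrank ℝ U) with h0 | h0
  · have : Subsingleton U := finrank_zero_iff.1 h0
    have : D = Set.univ := Set.eq_univ_of_forall fun u => Subsingleton.elim d u ▸ hd
    rw [this]; exact Filter.univ_mem
  have hn : (0 : ℝ) < finrank ℝ U := by exact_mod_cast h0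
  choose ε hε hεD using fun i => h d hd (b i)
  have hmem : ∀ᶠ u in nhds d, ∀ i, |b.coord i (u - d)| < ε i / finrank ℝ U := by
    refine Filter.eventually_all.2 fun i => ?_
    have hc : Continuous fun u : U => |b.coord i (u - d)| :=
      ((b.coord i).continuous_of_finiteDimensional.comp (continuous_id.sub continuous_const)).abs
    have : |b.coord i (d - d)| < ε i / finrank ℝ U := by
      rw [sub_self, map_zero, abs_zero]
      have := hε i
      positivity
    exact hc.continuousAt.eventually (gt_mem_nhds this)
  filter_upwards [hmem] with u hu
  have e : u = ∑ i, (1 / finrank ℝ U : ℝ) • (d + (finrank ℝ U * b.coord i (u - d)) • b i) := by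
    simp_rw [smul_add, Finset.sum_add_distrib, smul_smul]
    rw [Finset.sum_const, Finset.card_univ, Fintype.card_fin, ← Nat.cast_smul_eq_nsmul ℝ, smul_smul,
      mul_one_div_cancel hn.ne', one_smul]
    simp_rw [← mul_assoc, one_div_mul_cancel hn.ne', one_mul]
    simp only [Basis.coord_apply]
    rw [b.sum_repr (u - d)]
    abel
  rw [e]
  refine hconv.sum_mem (fun _ _ => by positivity) ?_ fun i _ => hεD i _ ?_
  · rw [Finset.sum_const, Finset.card_univ, Fintype.card_fin, nsmul_eq_mul,
      mul_one_div_cancel hn.ne']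
  · have := hu i
    rw [lt_div_iff₀ hn] at this
    rw [abs_mul, abs_of_pos hn]
    linarith

namespace IsOpenCone

variable (h : IsOpenCone D)
include h

theorem absorb {d : U} (hd : d ∈ D) (u : U) : ∃ ε : ℝ, 0 < ε ∧ d - ε • u ∈ D := by
  have hc : ContinuousAt (fun t : ℝ => d - t • u) 0 := by fun_prop
  have h1 : ∀ᶠ t in nhds (0 : ℝ), d - t • u ∈ D :=
    hc.eventually (h.isOpen.mem_nhds (by simpa using hd))
  obtain ⟨ε, hε, hm⟩ := Metric.eventually_nhds_iff.1 h1
  refine ⟨ε / 2, by positivity, hm ?_⟩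
  rw [dist_zero_right, Real.norm_of_nonneg (by positivity)]
  linarith

theorem absorb_le {d : U} (hd : d ∈ D) (u : U) :
    ∃ ε : ℝ, 0 < ε ∧ ∀ δ : ℝ, 0 < δ → δ ≤ ε → d - δ • u ∈ D := by
  obtain ⟨ε, hε, hm⟩ := h.absorb hd u
  refine ⟨ε, hε, fun δ hδ hle => ?_⟩
  rcases eq_or_lt_of_le hle with rfl | hlt
  · exact hm
  have : d - δ • u = (1 - δ / ε) • d + (δ / ε) • (d - ε • u) := by
    rw [smul_sub, smul_smul, div_mul_cancel₀ _ hε.ne', sub_smul, one_smul]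
    abel
  rw [this]
  refine h.add_mem _ (h.smul_mem _ hd _ ?_) _ (h.smul_mem _ hm _ (by positivity))
  rw [sub_pos, div_lt_one hε]
  exact hlt

theorem absorb_finset {ι : Type*} {P : Finset ι} {f g : ι → U} (hf : ∀ p ∈ P, f p ∈ D) :
    ∃ ε : ℝ, 0 < ε ∧ ∀ p ∈ P, ∀ δ : ℝ, 0 < δ → δ ≤ ε → f p - δ • g p ∈ D := by
  choose! ε hε hm using fun p (hp : p ∈ P) => h.absorb_le (hf p hp) (g p)
  rcases P.eq_empty_or_nonempty with rfl | hne
  · exact ⟨1, one_pos, by simp⟩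
  obtain ⟨q, hq, hmin⟩ := Finset.exists_min_image P ε hne
  exact ⟨ε q, hε q hq, fun p hp δ hδ hle => hm p hp δ hδ (hle.trans (hmin p hp))⟩

theorem hull_subset {P : Set U} (hP : P ⊆ D) {p : U} (hp : p ∈ PointedCone.hull ℝ P)
    (hp0 : p ≠ 0) : p ∈ D := by
  have : p = 0 ∨ p ∈ D := by
    clear hp0
    induction hp using Submodule.span_induction with
    | mem x hx => exact Or.inr (hP hx)
    | zero => exact Or.inl rfl
    | add x y _ _ hx hy =>
      rcases hx with rfl | hx
      · simpa using hy
      · rcases hy with rfl | hy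
        · simpa using Or.inr hx
        · exact Or.inr (h.add_mem _ hx _ hy)
    | smul a x _ hx =>
      change (a : ℝ) • x = 0 ∨ (a : ℝ) • x ∈ D
      rcases eq_or_lt_of_le (show (0 : ℝ) ≤ a from a.2) with h0 | h0
      · left; rw [← h0, zero_smul]
      · rcases hx with rfl | hx
        · left; simp
        · exact Or.inr (h.smul_mem _ hx _ h0)
  exact this.resolve_left hp0

theorem sum_mem {ι : Type*} {P : Finset ι} {f : ι → U} {a : ι → ℝ} (hf : ∀ p ∈ P, f p ∈ D)
    (ha : ∀ p ∈ P, 0 ≤ a p) (hpos : ∃ p ∈ P, 0 < a p) : ∑ p ∈ P, a p • f p ∈ D := by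
  classical
  obtain ⟨q, hq, hq0⟩ := hpos
  rw [← Finset.add_sum_erase _ _ hq]
  by_cases h0 : ∑ p ∈ P.erase q, a p • f p = 0
  · rw [h0, add_zero]; exact h.smul_mem _ (hf q hq) _ hq0
  · refine h.add_mem _ (h.smul_mem _ (hf q hq) _ hq0) _ (h.hull_subset (P := D) subset_rfl ?_ h0)
    exact Submodule.sum_mem _ fun p hp => PointedCone.smul_mem _ (ha p (Finset.mem_of_mem_erase hp))
      (PointedCone.subset_hull (hf p (Finset.mem_of_mem_erase hp)))

theorem dual_pos {β : Dual ℝ U} (hβ : β ∈ dualSet D) (hβ0 : β ≠ 0) {d : U} (hd : d ∈ D) :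
    0 < β d := by
  obtain ⟨u, hu⟩ : ∃ u, 0 < β u := by
    by_contra! hc
    refine hβ0 (LinearMap.ext fun u => le_antisymm (hc u) ?_)
    have := hc (-u)
    rw [map_neg] at this
    simpa using this
  obtain ⟨ε, hε, hm⟩ := h.absorb hd u
  have := hβ _ hm
  rw [map_sub, map_smul, smul_eq_mul] at this
  nlinarith [mul_pos hε hu]

theorem convex : Convex ℝ D := by
  intro x hx y hy a b ha hb hab
  rcases eq_or_lt_of_le ha with rfl | ha
  · have : b = 1 := by linarith
    simpa [this] using hy
  rcases eq_or_lt_of_le hb with rfl | hb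
  · have : a = 1 := by linarith
    simpa [this] using hx
  exact h.add_mem _ (h.smul_mem _ hx _ ha) _ (h.smul_mem _ hy _ hb)

theorem separate {x : U} (hx : x ∉ D) : ∃ β ∈ dualSet D, β x ≤ 0 ∧ β ≠ 0 := by
  obtain ⟨f, hf⟩ := geometric_hahn_banach_open_point h.convex h.isOpen hx
  have key : ∀ a ∈ D, ∀ t : ℝ, 0 < t → t * f a < f x := fun a ha t ht => by
    have := hf _ (h.smul_mem a ha t ht)
    rwa [map_smul, smul_eq_mul] at this
  obtain ⟨d, hd⟩ := h.nonempty
  refine ⟨-(f : U →ₗ[ℝ] ℝ), fun a ha => ?_, ?_, ?_⟩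
  · change 0 ≤ -f a
    by_contra! hc
    have hpos : 0 < f a := by linarith
    have := key a ha ((|f x| + 1) / f a) (by positivity)
    rw [div_mul_cancel₀ _ hpos.ne'] at this
    linarith [le_abs_self (f x)]
  · change -f x ≤ 0
    by_contra! hc
    have hd0 : f d < 0 := by linarith [hf d hd]
    have := key d hd (f x / (2 * f d)) (div_pos_of_neg_of_neg (by linarith) (by linarith))
    rw [show f x / (2 * f d) * f d = f x / 2 by field_simp [hd0.ne]] at this
    linarith
  · intro h0
    have h1 := hf d hd
    have e : ∀ v, f v = 0 := fun v => by
      have := LinearMap.congr_fun h0 v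
      change -f v = 0 at this
      linarith
    rw [e, e] at h1
    exact lt_irrefl _ h1

/-- A convex cone disjoint from `D` is separated from it. -/
theorem separate_submodule {K : Submodule ℝ U} (hK : ∀ x ∈ K, x ∉ D) :
    ∃ β ∈ dualSet D, β ≠ 0 ∧ ∀ x ∈ K, β x = 0 := by
  obtain ⟨f, c, hf, hfK⟩ := geometric_hahn_banach_open h.convex h.isOpen K.convex
    (Set.disjoint_left.2 fun x hx hxK => hK x hxK hx)
  have hK0 : ∀ x ∈ K, f x = 0 := by
    intro x hx
    by_contra hne
    have := hfK _ (K.smul_mem ((c - 1) / f x) hx)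
    rw [map_smul, smul_eq_mul, div_mul_cancel₀ _ hne] at this
    linarith
  have hc : c ≤ 0 := by simpa using hfK 0 K.zero_mem
  obtain ⟨d, hd⟩ := h.nonempty
  refine ⟨-(f : U →ₗ[ℝ] ℝ), fun a ha => ?_, ?_, ?_⟩
  · change 0 ≤ -f a
    linarith [hf a ha]
  · intro h0
    have e : -f d = 0 := LinearMap.congr_fun h0 d
    linarith [hf d hd]
  · intro x hx
    change -f x = 0
    rw [hK0 x hx, neg_zero]

end IsOpenCone

/-- The common kernel of the forms that are nonnegative on `D`. -/
def lin (D : Set U) : Submodule ℝ U :=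
  (Submodule.span ℝ (dualSet D)).dualCoannihilator

theorem mem_lin {w : U} : w ∈ lin D ↔ ∀ β ∈ dualSet D, β w = 0 := by
  rw [lin, Submodule.mem_dualCoannihilator]
  refine ⟨fun hw β hβ => hw β (Submodule.subset_span hβ), fun hw β hβ => ?_⟩
  induction hβ using Submodule.span_induction with
  | mem x hx => exact hw x hx
  | zero => simp
  | add x y _ _ hx hy => rw [LinearMap.add_apply, hx, hy, add_zero]
  | smul a x _ hx => rw [LinearMap.smul_apply, hx, smul_zero]

/-- An open cone is determined by the forms that are nonnegative on it, and none of these sees `lin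
D`. -/
theorem IsOpenCone.add_lin (h : IsOpenCone D) {d w : U} (hd : d ∈ D) (hw : w ∈ lin D) :
    d + w ∈ D := by
  by_contra hn
  obtain ⟨β, hβ, hβx, hβ0⟩ := h.separate hn
  rw [map_add, mem_lin.1 hw β hβ, add_zero] at hβx
  exact (h.dual_pos hβ hβ0 hd).not_ge hβx

/-- An open convex cone with a set `S` of affine symmetries of a set `T` of forms, such that the
cone is covered by the translates of a finitely generated cone. -/
structure Cocompact (D : Set U) (S : Set ((U ≃ₗ[ℝ] U) × Dual ℝ U)) (T : Set (Dual ℝ U)) :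
    Prop extends IsOpenCone D where
  map_mem : ∀ s ∈ S, ∀ x ∈ D, s.1 x ∈ D
  symm_mem : ∀ s ∈ S, ∀ x ∈ D, s.1.symm x ∈ D
  cover : ∃ P : Finset U, (P : Set U) ⊆ D ∧
    ∀ x ∈ D, ∃ s ∈ S, ∃ p ∈ PointedCone.hull ℝ (P : Set U), s.1 p = x
  T_nonempty : T.Nonempty
  T_fin : ∀ x ∈ D, ∀ M : ℝ, {τ ∈ T | τ x ≤ M}.Finite
  S_fin : ∀ τ ∈ T, ∀ τ' ∈ T, {s ∈ S | τ ∘ₗ s.1.toLinearMap + s.2 = τ'}.Finite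
  act : ∀ s ∈ S, ∀ τ ∈ T, τ ∘ₗ s.1.toLinearMap + s.2 ∈ T
  act_surj : ∀ s ∈ S, ∀ τ ∈ T, ∃ τ' ∈ T, τ' ∘ₗ s.1.toLinearMap + s.2 = τ

theorem symm_mem_of_invariant {Z : Submodule ℝ U} {g : U ≃ₗ[ℝ] U} (hg : ∀ z ∈ Z, g z ∈ Z) {z : U}
    (hz : z ∈ Z) : g.symm z ∈ Z := by
  have h1 : Z.map g.toLinearMap ≤ Z := by
    rintro _ ⟨z, hz, rfl⟩; exact hg z hz
  have h2 : Z.map g.toLinearMap = Z := Submodule.eq_of_le_of_finrank_eq h1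
    (LinearEquiv.finrank_map_eq g Z)
  rw [← h2] at hz
  obtain ⟨y, hy, rfl⟩ := hz
  simpa using hy

/-- The forms that are active somewhere on a finitely generated subcone of `D`. -/
theorem IsOpenCone.finite_active (h : IsOpenCone D) {T : Set (Dual ℝ U)} (hT : T.Nonempty)
    (hfin : ∀ x ∈ D, ∀ M : ℝ, {τ ∈ T | τ x ≤ M}.Finite) {Q : Finset U} (hQ : (Q : Set U) ⊆ D) :
    {τ | ∃ y ∈ D, y ∈ PointedCone.hull ℝ (Q : Set U) ∧ IsActive T y τ}.Finite := by
  classical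
  obtain ⟨τ₀, h₀⟩ := hT
  choose! m hmT hm using fun q (hq : q ∈ Q) => exists_isActive ⟨τ₀, h₀⟩ (hfin q (hQ hq))
  -- The forms of `T` need not be integral on `Q`, so a weight argument replaces Dickson's lemma.
  -- `C` bounds how far `τ₀` can exceed any member of `T` at a generator.
  let C : ℝ := ∑ q ∈ Q, |τ₀ q - m q q|
  have hC0 : 0 ≤ C := Finset.sum_nonneg fun _ _ => abs_nonneg _
  have hC : ∀ q ∈ Q, ∀ τ ∈ T, τ₀ q - τ q ≤ C := fun q hq τ hτ =>
    calc τ₀ q - τ q ≤ τ₀ q - m q q := by linarith [hm q hq τ hτ]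
      _ ≤ |τ₀ q - m q q| := le_abs_self _
      _ ≤ C := Finset.single_le_sum (f := fun q => |τ₀ q - m q q|) (fun _ _ => abs_nonneg _) hq
  refine (Set.Finite.biUnion Q.finite_toSet fun q hq =>
    hfin q (hQ hq) (τ₀ q + Q.card * C)).subset ?_
  rintro τ ⟨y, hyD, hyQ, hτ, hact⟩
  obtain ⟨a, ha, rfl⟩ := (mem_hull_finset Q).1 hyQ
  have hne : Q.Nonempty := by
    rw [Finset.nonempty_iff_ne_empty]
    rintro rfl
    simp only [Finset.sum_empty] at hyD
    exact h.zero_notMem hyD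
  -- At a generator with the largest coefficient an active form exceeds `τ₀` by at most `Q.card *
  -- C`; a larger excess could not be compensated at the other generators.
  obtain ⟨q, hq, hmax⟩ := Finset.exists_max_image Q a hne
  have haq : 0 < a q := by
    rcases eq_or_lt_of_le (ha q) with h0 | h0
    · exfalso
      have : ∑ v ∈ Q, a v • v = 0 := Finset.sum_eq_zero fun v hv => by
        rw [le_antisymm (h0 ▸ hmax v hv) (ha v), zero_smul]
      exact h.zero_notMem (this ▸ hyD)
    · exact h0
  refine Set.mem_biUnion hq ⟨hτ, ?_⟩
  have h1 := hact τ₀ h₀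
  simp only [map_sum, map_smul, smul_eq_mul] at h1
  have h2 : ∑ v ∈ Q, a v * (τ v - τ₀ v) ≤ 0 := by
    simp only [mul_sub, Finset.sum_sub_distrib]
    linarith
  rw [← Finset.add_sum_erase _ _ hq] at h2
  have h3 : -(Q.card * (a q * C)) ≤ ∑ v ∈ Q.erase q, a v * (τ v - τ₀ v) := by
    have : ∑ v ∈ Q.erase q, -(a q * C) ≤ ∑ v ∈ Q.erase q, a v * (τ v - τ₀ v) := by
      refine Finset.sum_le_sum fun v hv => ?_
      have h4 := hC v (Finset.mem_of_mem_erase hv) τ hτ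
      have h5 := hmax v (Finset.mem_of_mem_erase hv)
      have h6 : a v * (τ₀ v - τ v) ≤ a v * C := mul_le_mul_of_nonneg_left h4 (ha v)
      have h7 : a v * C ≤ a q * C := mul_le_mul_of_nonneg_right h5 hC0
      linarith
    refine le_trans ?_ this
    rw [Finset.sum_const, nsmul_eq_mul, mul_neg]
    have h8 : ((Q.erase q).card : ℝ) ≤ Q.card := by exact_mod_cast Finset.card_erase_le
    have h9 : 0 ≤ a q * C := by positivity
    have := mul_le_mul_of_nonneg_right h8 h9
    linarith
  by_contra! hlt
  have : a q * (Q.card * C) < a q * (τ q - τ₀ q) := mul_lt_mul_of_pos_left (by linarith) haq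
  linarith

namespace Cocompact

variable {S : Set ((U ≃ₗ[ℝ] U) × Dual ℝ U)} {T : Set (Dual ℝ U)} (h : Cocompact D S T)
include h

theorem lin_map {s : (U ≃ₗ[ℝ] U) × Dual ℝ U} (hs : s ∈ S) : ∀ w ∈ lin D, s.1 w ∈ lin D := by
  intro w hw
  refine mem_lin.2 fun β hβ => ?_
  exact mem_lin.1 hw (β ∘ₗ s.1.toLinearMap) fun d hd => hβ _ (h.map_mem s hs d hd)

theorem active_comp {s : (U ≃ₗ[ℝ] U) × Dual ℝ U} (hs : s ∈ S) {τ : Dual ℝ U} {p : U}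
    (hτ : IsActive T (s.1 p) τ) : IsActive T p (τ ∘ₗ s.1.toLinearMap + s.2) := by
  refine ⟨h.act s hs τ hτ.1, fun ζ hζ => ?_⟩
  obtain ⟨τ', hτ', rfl⟩ := h.act_surj s hs ζ hζ
  have := hτ.2 τ' hτ'
  simpa using this

theorem exists_active {x : U} (hx : x ∈ D) : ∃ τ, IsActive T x τ :=
  exists_isActive h.T_nonempty (h.T_fin x hx)

/-- Forms in the span of the dual cone that vanish on an invariant subspace meeting `D` are `0`. -/
theorem eq_zero_of_invariant {Z : Submodule ℝ U} (hZ : ∀ s ∈ S, ∀ z ∈ Z, s.1 z ∈ Z)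
    (hZD : ∃ z ∈ Z, z ∈ D) {α : Dual ℝ U} (hα : α ∈ Submodule.span ℝ (dualSet D))
    (hαZ : ∀ z ∈ Z, α z = 0) : α = 0 := by
  obtain ⟨z₀, hz₀, hz₀D⟩ := hZD
  obtain ⟨P, hP, hcov⟩ := h.cover
  obtain ⟨β, hβ, hβα⟩ : ∃ β ∈ dualSet D, ∀ d ∈ D, |α d| ≤ β d := by
    clear hαZ
    induction hα using Submodule.span_induction with
    | mem x hx => exact ⟨x, hx, fun d hd => by rw [abs_of_nonneg (hx d hd)]⟩
    | zero => exact ⟨0, fun _ _ => le_rfl, by simp⟩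
    | add x y _ _ hx hy =>
      obtain ⟨β, hβ, h1⟩ := hx
      obtain ⟨β', hβ', h2⟩ := hy
      exact ⟨β + β', fun d hd => add_nonneg (hβ d hd) (hβ' d hd), fun d hd =>
        (abs_add_le _ _).trans (add_le_add (h1 d hd) (h2 d hd))⟩
    | smul a x _ hx =>
      obtain ⟨β, hβ, h1⟩ := hx
      refine ⟨|a| • β, fun d hd => mul_nonneg (abs_nonneg _) (hβ d hd), fun d hd => ?_⟩
      rw [LinearMap.smul_apply, smul_eq_mul, abs_mul]
      exact mul_le_mul_of_nonneg_left (h1 d hd) (abs_nonneg _)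
  -- Comparing the generators with `z₀` in both directions produces, for each `x` in `D`, a point
  -- `z` of `Z` that lies between `c₁ * c₂` times `x` and `x` in the order given by `D`.
  obtain ⟨c₁, hc₁, h₁⟩ := h.absorb_finset (P := P) (f := id) (g := fun _ => z₀) hP
  obtain ⟨c₂', hc₂', h₂'⟩ := h.absorb_finset (P := P) (f := fun _ => z₀) (g := id)
    (fun _ _ => hz₀D)
  -- The second term gives `c₁ * c₂ ≤ 1 / 2`, so the contraction factor `1 - c₁ * c₂` is positive.
  let c₂ := min c₂' (1 / c₁ / 2)
  have hc₂ : 0 < c₂ := lt_min hc₂' (by positivity)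
  have hcc : c₁ * c₂ ≤ 1 / 2 := by
    have := mul_le_mul_of_nonneg_left (min_le_right c₂' (1 / c₁ / 2)) hc₁.le
    rwa [show c₁ * (1 / c₁ / 2) = 1 / 2 by field_simp] at this
  -- Replacing `x` by `x - z` does not change the value of `α` and shrinks that of `β` by the factor
  -- `1 - c₁ * c₂`; this is iterated.
  have key : ∀ n : ℕ, ∀ x ∈ D, |α x| ≤ (1 - c₁ * c₂) ^ n * β x := by
    intro n
    induction n with
    | zero => intro x hx; simpa using hβα x hx
    | succ n ih =>
      intro x hx
      obtain ⟨s, hs, p, hp, rfl⟩ := hcov x hx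
      obtain ⟨a, ha, rfl⟩ := (mem_hull_finset P).1 hp
      have hpos : ∃ v ∈ P, 0 < a v := by
        by_contra! hc
        have : ∑ v ∈ P, a v • v = 0 := Finset.sum_eq_zero fun v hv => by
          rw [le_antisymm (hc v hv) (ha v), zero_smul]
        rw [this, map_zero] at hx
        exact h.zero_notMem hx
      let z := s.1 (∑ v ∈ P, a v • c₁ • z₀)
      have hz : z ∈ Z := hZ s hs _ (Z.sum_mem fun v _ => Z.smul_mem _ (Z.smul_mem _ hz₀))
      have hxz : s.1 (∑ v ∈ P, a v • v) - z ∈ D := by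
        rw [← map_sub, ← Finset.sum_sub_distrib]
        simp_rw [← smul_sub]
        exact h.map_mem s hs _ (h.sum_mem (fun v hv => h₁ v hv _ hc₁ le_rfl) (fun v _ => ha v) hpos)
      have hzx : z - (c₁ * c₂) • s.1 (∑ v ∈ P, a v • v) ∈ D := by
        have e : z - (c₁ * c₂) • s.1 (∑ v ∈ P, a v • v) =
            s.1 (c₁ • ∑ v ∈ P, a v • (z₀ - c₂ • v)) := by
          simp only [z]
          rw [← map_smul, ← map_sub, Finset.smul_sum, Finset.smul_sum, ← Finset.sum_sub_distrib]
          congr 1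
          refine Finset.sum_congr rfl fun v _ => ?_
          module
        rw [e]
        exact h.map_mem s hs _ (h.smul_mem _ (h.sum_mem
          (fun v hv => h₂' v hv _ hc₂ (min_le_left _ _)) (fun v _ => ha v) hpos) _ hc₁)
      have h3 := ih _ hxz
      rw [map_sub, hαZ z hz, sub_zero] at h3
      refine h3.trans ?_
      rw [pow_succ, mul_assoc]
      refine mul_le_mul_of_nonneg_left ?_ (pow_nonneg (by linarith) n)
      have h4 := hβ _ hzx
      rw [map_sub, map_smul, smul_eq_mul] at h4
      rw [map_sub]
      linarith
  have hD0 : ∀ x ∈ D, α x = 0 := by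
    intro x hx
    have hlim : Filter.Tendsto (fun n : ℕ => (1 - c₁ * c₂) ^ n * β x) Filter.atTop (nhds (0 * β x)) :=
      (tendsto_pow_atTop_nhds_zero_of_lt_one (by linarith) (by
        have : 0 < c₁ * c₂ := by positivity
        linarith)).mul_const _
    rw [zero_mul] at hlim
    have := ge_of_tendsto' hlim fun n => key n x hx
    exact abs_nonpos_iff.1 this
  obtain ⟨d, hd⟩ := h.nonempty
  refine LinearMap.ext fun u => ?_
  obtain ⟨ε, hε, hm⟩ := h.absorb hd u
  have := hD0 _ hm
  rw [map_sub, hD0 d hd, map_smul, smul_eq_mul, zero_sub, neg_eq_zero] at this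
  simpa [hε.ne'] using this

/-- A form that kills `lin D` lies in the span of the dual cone, so if it also kills `Z` it is zero
by the contraction argument. -/
theorem sup_lin_eq_top {Z : Submodule ℝ U} (hZ : ∀ s ∈ S, ∀ z ∈ Z, s.1 z ∈ Z)
    (hZD : ∃ z ∈ Z, z ∈ D) : Z ⊔ lin D = ⊤ := by
  by_contra hne
  obtain ⟨f, hf, hle⟩ := Submodule.exists_le_ker_of_lt_top _ (lt_top_iff_ne_top.2 hne)
  refine hf (h.eq_zero_of_invariant hZ hZD ?_ fun z hz => hle (Submodule.mem_sup_left hz))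
  have : f ∈ (lin D).dualAnnihilator := (Submodule.mem_dualAnnihilator _).2 fun w hw =>
    hle (Submodule.mem_sup_right hw)
  rwa [lin, Subspace.dualCoannihilator_dualAnnihilator_eq] at this

end Cocompact

end OpenCone

end RatCone

namespace RatCone

/-! ### Invariant subspaces that meet a cocompact open cone. -/

section Peak

variable {U : Type*} [NormedAddCommGroup U] [NormedSpace ℝ U] [FiniteDimensional ℝ U]
  {D : Set U}

/-- Small perturbations along the lineality space of points in a finitely generated subcone stay in
a finitely generated subcone. -/
theorem IsOpenCone.exists_thickening (h : IsOpenCone D) :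
    ∃ K : ℝ, 0 < K ∧ ∀ (P : Finset U) (f : U → U), (∀ p ∈ P, f p ∈ D) → ∀ R : ℝ, 0 < R →
      ∃ Q : Finset U, (Q : Set U) ⊆ D ∧ ∀ a : U → ℝ, (∀ v, 0 ≤ a v) → ∀ u ∈ lin D,
        K * ‖u‖ ≤ R * ∑ p ∈ P, a p → ∑ p ∈ P, a p • f p + u ∈ PointedCone.hull ℝ (Q : Set U) := by
  classical
  let b := finBasis ℝ (lin D)
  let c := fun i => LinearMap.toContinuousLinearMap (b.coord i)
  refine ⟨∑ i, ‖c i‖ + 1, by positivity, fun P f hf R hR => ?_⟩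
  let Q₀ := P.image f
  let Q₁ := (P ×ˢ Finset.univ).image fun x : U × Fin _ => f x.1 + R • (b x.2 : U)
  let Q₂ := (P ×ˢ Finset.univ).image fun x : U × Fin _ => f x.1 - R • (b x.2 : U)
  refine ⟨Q₀ ∪ (Q₁ ∪ Q₂), ?_, fun a ha u hu hle => ?_⟩
  · intro x hx
    simp only [Finset.coe_union, Set.mem_union, Finset.mem_coe, Q₀, Q₁, Q₂, Finset.mem_image,
      Finset.mem_product] at hx
    rcases hx with ⟨p, hp, rfl⟩ | ⟨⟨p, i⟩, hp, rfl⟩ | ⟨⟨p, i⟩, hp, rfl⟩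
    · exact hf p hp
    · exact h.add_lin (hf p hp.1) (Submodule.smul_mem _ _ (b i).2)
    · rw [sub_eq_add_neg]
      exact h.add_lin (hf p hp.1) (Submodule.neg_mem _ (Submodule.smul_mem _ _ (b i).2))
  -- A separating form is nonnegative at all `f p ± R b_i`, so its values on the lineality space are
  -- controlled by its values at the `f p`; the constant `K` absorbs the coordinate norms.
  · by_contra hnot
    obtain ⟨ξ, hξ, hξu⟩ := farkas _ hnot
    have h0 : ∀ p ∈ P, 0 ≤ ξ (f p) := fun p hp => hξ _ (Finset.mem_union_left _
      (Finset.mem_image_of_mem _ hp))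
    have h1 : ∀ p ∈ P, ∀ i, R * |ξ (b i)| ≤ ξ (f p) := fun p hp i => by
      have e1 := hξ (f p + R • (b i : U)) (Finset.mem_union_right _ (Finset.mem_union_left _
        (Finset.mem_image.2 ⟨(p, i), Finset.mem_product.2 ⟨hp, Finset.mem_univ _⟩, rfl⟩)))
      have e2 := hξ (f p - R • (b i : U)) (Finset.mem_union_right _ (Finset.mem_union_right _
        (Finset.mem_image.2 ⟨(p, i), Finset.mem_product.2 ⟨hp, Finset.mem_univ _⟩, rfl⟩)))
      rw [map_add, map_smul, smul_eq_mul] at e1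
      rw [map_sub, map_smul, smul_eq_mul] at e2
      rcases abs_cases (ξ (b i)) with ⟨e, -⟩ | ⟨e, -⟩ <;> rw [e] <;> linarith
    have hξf : ∀ i, R * |ξ (b i)| * ∑ p ∈ P, a p ≤ ξ (∑ p ∈ P, a p • f p) := fun i => by
      rw [map_sum, Finset.mul_sum]
      refine Finset.sum_le_sum fun p hp => ?_
      rw [map_smul, smul_eq_mul, mul_comm]
      exact mul_le_mul_of_nonneg_left (h1 p hp i) (ha p)
    have hξf0 : 0 ≤ ξ (∑ p ∈ P, a p • f p) := by
      rw [map_sum]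
      refine Finset.sum_nonneg fun p hp => ?_
      rw [map_smul, smul_eq_mul]
      exact mul_nonneg (ha p) (h0 p hp)
    have hu' : ξ u = ∑ i, c i ⟨u, hu⟩ * ξ (b i) := by
      have := congrArg (fun w : lin D => ξ w) (b.sum_repr ⟨u, hu⟩)
      simp only [Submodule.coe_sum, map_sum, Submodule.coe_smul, map_smul, smul_eq_mul] at this
      rw [← this]
      rfl
    have hb : -(ξ (∑ p ∈ P, a p • f p)) ≤ ξ u := by
      rcases eq_or_lt_of_le (norm_nonneg u) with hz | hz
      · have : u = 0 := norm_eq_zero.1 hz.symm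
        rw [this, map_zero]; linarith
      have hsum : (∑ i, ‖c i‖ + 1) * ‖u‖ / R ≤ ∑ p ∈ P, a p := by
        rw [div_le_iff₀ hR]; linarith
      have h2 : ∀ i, (∑ i, ‖c i‖ + 1) * ‖u‖ * |ξ (b i)| ≤ ξ (∑ p ∈ P, a p • f p) := fun i => by
        refine le_trans ?_ (hξf i)
        have := mul_le_mul_of_nonneg_left hsum (by positivity : 0 ≤ R * |ξ (b i)|)
        refine le_trans (le_of_eq ?_) this
        field_simp
      have h3 : |ξ u| * (∑ i, ‖c i‖ + 1) ≤ ξ (∑ p ∈ P, a p • f p) * (∑ i, ‖c i‖ + 1) := by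
        calc |ξ u| * (∑ i, ‖c i‖ + 1) ≤ (∑ i, ‖c i‖ * ‖u‖ * |ξ (b i)|) * (∑ i, ‖c i‖ + 1) := by
              refine mul_le_mul_of_nonneg_right ?_ (by positivity)
              rw [hu']
              refine (Finset.abs_sum_le_sum_abs _ _).trans (Finset.sum_le_sum fun i _ => ?_)
              rw [abs_mul]
              exact mul_le_mul_of_nonneg_right ((c i).le_opNorm ⟨u, hu⟩) (abs_nonneg _)
          _ = ∑ i, ‖c i‖ * ((∑ i, ‖c i‖ + 1) * ‖u‖ * |ξ (b i)|) := by
              rw [Finset.sum_mul]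
              exact Finset.sum_congr rfl fun i _ => by ring
          _ ≤ ∑ i, ‖c i‖ * ξ (∑ p ∈ P, a p • f p) :=
              Finset.sum_le_sum fun i _ => mul_le_mul_of_nonneg_left (h2 i) (by positivity)
          _ = ξ (∑ p ∈ P, a p • f p) * ∑ i, ‖c i‖ := by rw [← Finset.sum_mul, mul_comm]
          _ ≤ _ := by linarith
      have h4 := le_of_mul_le_mul_right h3 (by positivity)
      linarith [neg_abs_le (ξ u)]
    rw [map_add] at hξu
    linarith

/-- `x` is a maximum, on its coset of `W`, of the difference of the lower envelope of `T` and
of `θ`. -/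
def IsPeak (T : Set (Dual ℝ U)) (W : Submodule ℝ U) (θ : Dual ℝ U) (x : U) : Prop :=
  ∀ u ∈ W, ∃ τ ∈ T, ∀ τ₁ ∈ T, τ (x + u) - θ (x + u) ≤ τ₁ x - θ x

/-- Coercivity makes the envelope minus `θ` tend to minus infinity along the coset. It is upper
semicontinuous, being an attained minimum of affine functions, so it has a maximum on a large ball.
-/
theorem exists_isPeak {T : Set (Dual ℝ U)} {W : Submodule ℝ U} {θ : Dual ℝ U} {x : U}
    (hact : ∀ u ∈ W, ∃ τ, IsActive T (x + u) τ) {T₀ : Set (Dual ℝ U)} (hT₀ : T₀.Finite)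
    (hT₀T : T₀ ⊆ T) {δ : ℝ} (hδ : 0 < δ) (hcoer : ∀ u ∈ W, ∃ τ ∈ T₀, τ u + δ * ‖u‖ ≤ θ u) :
    ∃ u ∈ W, IsPeak T W θ (x + u) := by
  choose! A hA using hact
  let g : W → ℝ := fun u => A u (x + u) - θ (x + u)
  have hg : ∀ (u : W), ∀ τ ∈ T, g u ≤ τ (x + u) - θ (x + u) := fun u τ hτ =>
    sub_le_sub_right ((hA u u.2).2 τ hτ) _
  obtain ⟨C, hC⟩ := (hT₀.image fun τ => τ x - θ x).bddAbove
  have hgC : ∀ u : W, g u ≤ C - δ * ‖u‖ := fun u => by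
    obtain ⟨τ, hτ, hle⟩ := hcoer u u.2
    have h1 := hg u τ (hT₀T hτ)
    have h2 : τ x - θ x ≤ C := hC ⟨τ, hτ, rfl⟩
    rw [map_add, map_add] at h1
    change g u ≤ C - δ * ‖(u : U)‖
    linarith
  have husc : UpperSemicontinuous g := by
    intro u y hy
    have hc : Continuous fun u' : W => A u (x + u') - θ (x + u') := by
      have h1 := (A u).continuous_of_finiteDimensional
      have h2 := θ.continuous_of_finiteDimensional
      fun_prop
    have h3 : ∀ᶠ u' : W in nhds u, A u (x + (u' : U)) - θ (x + u') < y :=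
      hc.continuousAt.eventually (gt_mem_nhds hy)
    filter_upwards [h3] with u' hu'
    exact (hg u' _ (hA u u.2).1).trans_lt hu'
  let R : ℝ := max 0 ((C - g 0) / δ)
  obtain ⟨u, -, hu⟩ := UpperSemicontinuousOn.exists_isMaxOn (s := Metric.closedBall (0 : W) R)
    ⟨0, Metric.mem_closedBall_self (le_max_left _ _)⟩ (isCompact_closedBall _ _)
    (husc.upperSemicontinuousOn _)
  have hmax : ∀ u', g u' ≤ g u := fun u' => by
    by_cases hR : ‖u'‖ ≤ R
    · exact hu (mem_closedBall_zero_iff.2 hR)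
    · have h0 : g 0 ≤ g u := hu (Metric.mem_closedBall_self (le_max_left _ _))
      push Not at hR
      have h1 := (le_max_right _ _).trans hR.le
      rw [div_le_iff₀ hδ] at h1
      linarith [hgC u']
  refine ⟨u, u.2, fun v hv => ⟨A (u + v), ?_, fun τ₁ hτ₁ => ?_⟩⟩
  · exact (hA _ (W.add_mem u.2 hv)).1
  · have h1 := hmax ⟨u + v, W.add_mem u.2 hv⟩
    have h2 := hg u τ₁ hτ₁
    simp only [g] at h1 h2
    rw [add_assoc]
    linarith

namespace Cocompact

variable {S : Set ((U ≃ₗ[ℝ] U) × Dual ℝ U)} {T : Set (Dual ℝ U)} (h : Cocompact D S T)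
include h

theorem isPeak_comp {s : (U ≃ₗ[ℝ] U) × Dual ℝ U} (hs : s ∈ S) {W : Submodule ℝ U}
    (hW : ∀ w ∈ W, s.1 w ∈ W) {θ : Dual ℝ U} {p : U} (hp : IsPeak T W θ (s.1 p)) :
    IsPeak T W (θ ∘ₗ s.1.toLinearMap + s.2) p := by
  intro u hu
  obtain ⟨τ, hτ, hle⟩ := hp _ (hW u hu)
  refine ⟨_, h.act s hs τ hτ, fun τ₁ hτ₁ => ?_⟩
  obtain ⟨τ₂, hτ₂, rfl⟩ := h.act_surj s hs τ₁ hτ₁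
  have := hle τ₂ hτ₂
  simp only [LinearMap.add_apply, LinearMap.comp_apply, LinearEquiv.coe_coe, map_add] at this ⊢
  linarith

/-- A form that is active on a finitely generated subcone is not minimal in any direction of the
lineality space. -/
theorem exists_lt {P Q : Finset U} (hP : (P : Set U) ⊆ D)
    (hcov : ∀ x ∈ D, ∃ s ∈ S, ∃ p ∈ PointedCone.hull ℝ (P : Set U), s.1 p = x) {τ : Dual ℝ U}
    (hτ : ∃ y ∈ D, y ∈ PointedCone.hull ℝ (Q : Set U) ∧ IsActive T y τ) {w : U} (hw : w ∈ lin D)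
    (hw0 : w ≠ 0) : ∃ τ' ∈ T, τ' w < τ w := by
  obtain ⟨x, hx, -, hτT, hact⟩ := hτ
  by_contra! hc
  -- Otherwise `τ` stays active along `x + n w`, which remains in `D`. Finitely many translates then
  -- contain the ray, so `w` itself lies in `D`, which is impossible for a vector of `lin D`.
  have hactn : ∀ n : ℕ, IsActive T (x + (n : ℝ) • w) τ := fun n => ⟨hτT, fun ζ hζ => by
    rw [map_add, map_add, map_smul, map_smul]
    exact add_le_add (hact ζ hζ) (mul_le_mul_of_nonneg_left (hc ζ hζ) (Nat.cast_nonneg n))⟩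
  have hA := h.finite_active h.T_nonempty h.T_fin hP
  have hS : {s | s ∈ S ∧ τ ∘ₗ s.1.toLinearMap + s.2 ∈
      {τ | ∃ y ∈ D, y ∈ PointedCone.hull ℝ (P : Set U) ∧ IsActive T y τ}}.Finite := by
    refine (Set.Finite.biUnion hA fun τ' hτ' => h.S_fin τ hτT τ' ?_).subset ?_
    · obtain ⟨y, -, -, hy⟩ := hτ'; exact hy.1
    · rintro s ⟨hs, hs'⟩
      exact Set.mem_biUnion hs' ⟨hs, rfl⟩
  obtain ⟨s, ⟨hs, -⟩, hfreq⟩ := exists_forall_frequently hS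
    (p := fun s n => s.1.symm (x + (n : ℝ) • w) ∈ PointedCone.hull ℝ (P : Set U)) (n₀ := 0) (by
      intro n _
      have hD : x + (n : ℝ) • w ∈ D := h.add_lin hx (Submodule.smul_mem _ _ hw)
      obtain ⟨s, hs, p, hp, hsp⟩ := hcov _ hD
      refine ⟨s, ⟨hs, p, ?_, hp, h.active_comp hs ?_⟩, ?_⟩
      · have := h.symm_mem s hs _ hD
        rwa [← hsp, LinearEquiv.symm_apply_apply] at this
      · rw [hsp]; exact hactn n
      · rw [← hsp, LinearEquiv.symm_apply_apply]; exact hp)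
  have hm : s.1.symm w ∈ PointedCone.hull ℝ (P : Set U) := by
    refine mem_hull_of_frequently P (c := s.1.symm x) fun N => ?_
    obtain ⟨n, hn, hm⟩ := hfreq ⌈N⌉₊
    refine ⟨n, (Nat.le_ceil N).trans (by exact_mod_cast hn), ?_⟩
    rwa [map_add, map_smul] at hm
  have hmD := h.hull_subset hP hm (by simpa using hw0)
  have hwD := h.map_mem s hs _ hmD
  rw [LinearEquiv.apply_symm_apply] at hwD
  obtain ⟨β, hβ, -, hβ0⟩ := h.separate h.zero_notMem
  exact (h.dual_pos hβ hβ0 hwD).ne' (mem_lin.1 hw β hβ)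

/-- Compactness of the unit sphere of `lin D` turns the strict inequalities into a linear gap with
finitely many competitors. -/
theorem exists_uniform {Ξ : Set (Dual ℝ U)} (hΞ : Ξ.Finite) (hne : Ξ.Nonempty)
    (hlt : ∀ τ ∈ Ξ, ∀ w ∈ lin D, w ≠ 0 → ∃ τ' ∈ T, τ' w < τ w) :
    ∃ T₀ : Set (Dual ℝ U), T₀.Finite ∧ T₀ ⊆ T ∧ ∃ δ : ℝ, 0 < δ ∧
      ∀ w ∈ lin D, ∃ τ' ∈ T₀, ∀ τ ∈ Ξ, τ' w + δ * ‖w‖ ≤ τ w := by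
  have hcpt : IsCompact (Metric.sphere (0 : U) 1 ∩ lin D) :=
    (isCompact_sphere 0 1).inter_right (Submodule.closed_of_finiteDimensional _)
  obtain ⟨T₀, hfin, hT, δ, hδ, hT₀⟩ : ∃ T₀ : Set (Dual ℝ U), T₀.Finite ∧ T₀ ⊆ T ∧
      ∃ δ : ℝ, 0 < δ ∧ ∀ w ∈ Metric.sphere (0 : U) 1 ∩ lin D, ∃ τ' ∈ T₀, ∀ τ ∈ Ξ,
        τ' w + δ ≤ τ w := by
    refine hcpt.induction_on (p := fun s => ∃ T₀ : Set (Dual ℝ U), T₀.Finite ∧ T₀ ⊆ T ∧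
      ∃ δ : ℝ, 0 < δ ∧ ∀ w ∈ s, ∃ τ' ∈ T₀, ∀ τ ∈ Ξ, τ' w + δ ≤ τ w)
      ⟨∅, Set.finite_empty, Set.empty_subset _, 1, one_pos, by simp⟩ ?_ ?_ ?_
    · rintro s t hst ⟨T₀, h1, h2, δ, h3, h4⟩
      exact ⟨T₀, h1, h2, δ, h3, fun w hw => h4 w (hst hw)⟩
    · rintro s t ⟨T₀, h1, h2, δ, h3, h4⟩ ⟨T₁, h1', h2', δ', h3', h4'⟩
      refine ⟨T₀ ∪ T₁, h1.union h1', Set.union_subset h2 h2', min δ δ', lt_min h3 h3', ?_⟩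
      rintro w (hw | hw)
      · obtain ⟨τ', hτ', hle⟩ := h4 w hw
        exact ⟨τ', Or.inl hτ', fun τ hτ => by
          have := hle τ hτ
          have := min_le_left δ δ'
          linarith⟩
      · obtain ⟨τ', hτ', hle⟩ := h4' w hw
        exact ⟨τ', Or.inr hτ', fun τ hτ => by
          have := hle τ hτ
          have := min_le_right δ δ'
          linarith⟩
    · rintro w ⟨hw1, hwL⟩
      have hw0 : w ≠ 0 := by
        rintro rfl
        simp at hw1
      obtain ⟨τm, hτm, hmin⟩ := Set.exists_min_image Ξ (fun τ => τ w) hΞ hne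
      obtain ⟨τ', hτ', hlt'⟩ := hlt τm hτm w hwL hw0
      let δ := (τm w - τ' w) / 2
      have hδ : 0 < δ := by simp only [δ]; linarith
      refine ⟨{w' | ∀ τ ∈ Ξ, τ' w' + δ < τ w'}, mem_nhdsWithin_of_mem_nhds ?_,
        {τ'}, Set.finite_singleton _, by simpa using hτ', δ, hδ, ?_⟩
      · refine (Filter.eventually_all_finite hΞ).2 fun τ hτ => ?_
        have hc : Continuous fun w' => τ w' - τ' w' :=
          τ.continuous_of_finiteDimensional.sub τ'.continuous_of_finiteDimensional
        have h1 : δ < τ w - τ' w := by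
          have := hmin τ hτ
          simp only [δ] at hδ ⊢
          linarith
        filter_upwards [hc.continuousAt.eventually (lt_mem_nhds h1)] with w' hw'
        linarith
      · intro w' hw'
        exact ⟨τ', rfl, fun τ hτ => (hw' τ hτ).le⟩
  obtain ⟨τ₀, hτ₀⟩ := h.T_nonempty
  refine ⟨insert τ₀ T₀, hfin.insert _, Set.insert_subset hτ₀ hT, δ, hδ, fun w hw => ?_⟩
  by_cases hw0 : w = 0
  · exact ⟨τ₀, Set.mem_insert _ _, fun τ _ => by simp [hw0]⟩
  have hn : 0 < ‖w‖ := norm_pos_iff.2 hw0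
  obtain ⟨τ', hτ', hle⟩ := hT₀ (‖w‖⁻¹ • w) ⟨by
    rw [mem_sphere_zero_iff_norm, norm_smul, norm_inv, norm_norm, inv_mul_cancel₀ hn.ne'],
    Submodule.smul_mem _ _ hw⟩
  refine ⟨τ', Set.mem_insert_of_mem _ hτ', fun τ hτ => ?_⟩
  have := mul_le_mul_of_nonneg_left (hle τ hτ) hn.le
  rw [map_smul, map_smul, smul_eq_mul, smul_eq_mul, mul_add, ← mul_assoc, ← mul_assoc,
    mul_inv_cancel₀ hn.ne', one_mul, one_mul] at this
  linarith

/-- An invariant subspace that meets `D` is the whole space. -/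
theorem eq_top_of_invariant {Z : Submodule ℝ U} (hZ : ∀ s ∈ S, ∀ z ∈ Z, s.1 z ∈ Z)
    (hZD : ∃ z ∈ Z, z ∈ D) : Z = ⊤ := by
  classical
  have hsup := h.sup_lin_eq_top hZ hZD
  obtain ⟨z, hz, hzD⟩ := hZD
  obtain ⟨P, hP, hcov⟩ := h.cover
  obtain ⟨K, hK, hthick⟩ := h.exists_thickening
  obtain ⟨Q₁, hQ₁, hperturb⟩ := hthick P id hP K hK
  let Ξ : Set (Dual ℝ U) := {τ | ∃ y ∈ D, y ∈ PointedCone.hull ℝ (Q₁ : Set U) ∧ IsActive T y τ}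
  have hΞ : Ξ.Finite := h.finite_active h.T_nonempty h.T_fin hQ₁
  have hdom : ∀ a : U → ℝ, (∀ v, 0 ≤ a v) → ∑ v ∈ P, a v • v ∈ D → 0 < ∑ v ∈ P, a v := by
    intro a ha hD
    refine lt_of_le_of_ne (Finset.sum_nonneg fun v _ => ha v) fun h0 => h.zero_notMem ?_
    have := (Finset.sum_eq_zero_iff_of_nonneg fun v _ => ha v).1 h0.symm
    rwa [Finset.sum_eq_zero fun v hv => by rw [this v hv, zero_smul]] at hD
  have hsymm : ∀ s ∈ S, ∀ p, s.1 p ∈ D → p ∈ D := fun s hs p hp => by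
    simpa using h.symm_mem s hs _ hp
  have hΞne : Ξ.Nonempty := by
    obtain ⟨s, hs, p, hp, hsp⟩ := hcov z hzD
    have hpD : p ∈ D := hsymm s hs p (hsp ▸ hzD)
    obtain ⟨τ, hτ⟩ := h.exists_active hpD
    refine ⟨τ, p, hpD, ?_, hτ⟩
    obtain ⟨a, ha, rfl⟩ := (mem_hull_finset P).1 hp
    simpa using hperturb a ha 0 (Submodule.zero_mem _) (by
      rw [norm_zero, mul_zero]
      exact mul_nonneg hK.le (Finset.sum_nonneg fun v _ => ha v))
  obtain ⟨T₀, hT₀fin, hT₀, δ, hδ, hcoer⟩ := h.exists_uniform hΞ hΞne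
    fun τ hτ w hw hw0 => h.exists_lt hP hcov hτ hw hw0
  obtain ⟨θ, hθ⟩ := hΞne
  -- It remains to show `lin D ≤ Z`. The cosets of `W₀` inside `z + lin D` are compared through the
  -- points where the envelope minus `θ` is maximal on them.
  let W₀ : Submodule ℝ U := Z ⊓ lin D
  have hW₀ : ∀ s ∈ S, ∀ w ∈ W₀, s.1 w ∈ W₀ := fun s hs w hw =>
    ⟨hZ s hs w hw.1, h.lin_map hs w hw.2⟩
  have hpeak : ∀ x ∈ D, ∃ u ∈ W₀, IsPeak T W₀ θ (x + u) := fun x hx =>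
    exists_isPeak (fun u hu => h.exists_active (h.add_lin hx hu.2)) hT₀fin hT₀ hδ fun u hu => by
      obtain ⟨τ, hτ, hle⟩ := hcoer u hu.2
      exact ⟨τ, hτ, hle θ hθ⟩
  obtain ⟨u₁, hu₁, hpeak₁⟩ := hpeak z hzD
  have hz₁D : z + u₁ ∈ D := h.add_lin hzD hu₁.2
  obtain ⟨τ₁, hτ₁⟩ := h.exists_active hz₁D
  -- a section of the projection along the lineality space
  have hsec : ∀ v : U, ∃ y ∈ Z, y - v ∈ lin D := fun v => by
    obtain ⟨y, hy, w, hw, e⟩ := Submodule.mem_sup.1 (hsup ▸ Submodule.mem_top : v ∈ Z ⊔ lin D)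
    refine ⟨y, hy, ?_⟩
    rw [← e, sub_add_cancel_left]
    exact Submodule.neg_mem _ hw
  choose σ hσZ hσ using hsec
  have hσD : ∀ p ∈ P, σ p ∈ D := fun p hp => by
    have := h.add_lin (hP hp) (hσ p)
    rwa [add_sub_cancel] at this
  choose! m hmT hm using fun p (hp : p ∈ P) => h.exists_active (hσD p hp)
  obtain ⟨C, hC, hCle⟩ : ∃ C : ℝ, 0 < C ∧ ∀ τ ∈ T₀, ∀ p ∈ P, τ (σ p) - m p (σ p) ≤ C := by
    obtain ⟨C, hC⟩ := ((hT₀fin.prod P.finite_toSet).image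
      fun x => x.1 (σ x.2) - m x.2 (σ x.2)).bddAbove
    exact ⟨max C 1, lt_max_of_lt_right one_pos, fun τ hτ p hp =>
      (hC ⟨(τ, p), ⟨hτ, hp⟩, rfl⟩).trans (le_max_left _ _)⟩
  obtain ⟨Q₂, hQ₂, hperturb₂⟩ := hthick P σ hσD (K * C / δ) (by positivity)
  have hA₂ := h.finite_active h.T_nonempty h.T_fin hQ₂
  have hS₀ : {s | s ∈ S ∧ τ₁ ∘ₗ s.1.toLinearMap + s.2 ∈
      {τ | ∃ y ∈ D, y ∈ PointedCone.hull ℝ (Q₂ : Set U) ∧ IsActive T y τ}}.Finite := by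
    refine (Set.Finite.biUnion hA₂ fun τ' hτ' => h.S_fin τ₁ hτ₁.1 τ' ?_).subset ?_
    · obtain ⟨y, -, -, hy⟩ := hτ'; exact hy.1
    · rintro s ⟨hs, hs'⟩
      exact Set.mem_biUnion hs' ⟨hs, rfl⟩
  -- all the maxima lie in finitely many translates
  have hmain : ∀ w ∈ lin D, ∃ s ∈ {s | s ∈ S ∧ τ₁ ∘ₗ s.1.toLinearMap + s.2 ∈
      {τ | ∃ y ∈ D, y ∈ PointedCone.hull ℝ (Q₂ : Set U) ∧ IsActive T y τ}},
      ∃ p ∈ PointedCone.hull ℝ (P : Set U), s.1 p - (z + w) ∈ W₀ := by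
    intro w hw
    obtain ⟨u₂, hu₂, hpeak₂⟩ := hpeak (z + w) (h.add_lin hzD hw)
    have hx₂D : z + w + u₂ ∈ D := h.add_lin (h.add_lin hzD hw) hu₂.2
    obtain ⟨s, hs, p, hp, hsp⟩ := hcov _ hx₂D
    refine ⟨s, ⟨hs, s.1.symm (z + u₁), h.symm_mem s hs _ hz₁D, ?_, h.active_comp hs (by simpa)⟩,
      p, hp, by rw [hsp, add_sub_cancel_left]; exact hu₂⟩
    have hpD : p ∈ D := hsymm s hs p (hsp ▸ hx₂D)
    obtain ⟨a, ha, rfl⟩ := (mem_hull_finset P).1 hp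
    have hapos := hdom a ha hpD
    rw [← hsp] at hpeak₂
    have hpk := h.isPeak_comp hs (hW₀ s hs) hpeak₂
    set θ' := θ ∘ₗ s.1.toLinearMap + s.2 with hθ'
    -- First-order optimality at `p`: small moves along `W₀` stay in the thickened cone, so the
    -- forms active there belong to the finite set `Ξ`.
    have hdir : ∀ u ∈ W₀, ∃ τ ∈ Ξ, τ u ≤ θ' u := by
      intro u hu
      obtain ⟨ε, hε, hεu⟩ : ∃ ε : ℝ, 0 < ε ∧ ε * ‖u‖ ≤ ∑ v ∈ P, a v := by
        refine ⟨(∑ v ∈ P, a v) / (‖u‖ + 1), by positivity, ?_⟩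
        rw [div_mul_eq_mul_div, div_le_iff₀ (by positivity)]
        exact mul_le_mul_of_nonneg_left (by linarith) hapos.le
      have hmem : ∑ v ∈ P, a v • v + ε • u ∈ PointedCone.hull ℝ (Q₁ : Set U) := by
        refine hperturb a ha _ (Submodule.smul_mem _ _ hu.2) ?_
        rw [norm_smul, Real.norm_of_nonneg hε.le]
        exact mul_le_mul_of_nonneg_left hεu hK.le
      have hmemD : ∑ v ∈ P, a v • v + ε • u ∈ D := h.add_lin hpD (Submodule.smul_mem _ _ hu.2)
      obtain ⟨τ, hτ⟩ := h.exists_active hmemD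
      refine ⟨τ, ⟨_, hmemD, hmem, hτ⟩, ?_⟩
      obtain ⟨τ₂, hτ₂, hle⟩ := hpk _ (W₀.smul_mem ε hu)
      have h1 := hle τ hτ.1
      have h2 := hτ.2 τ₂ hτ₂
      have h3 : τ (∑ v ∈ P, a v • v + ε • u) - θ' (∑ v ∈ P, a v • v + ε • u) ≤
          τ (∑ v ∈ P, a v • v) - θ' (∑ v ∈ P, a v • v) := by linarith
      rw [map_add, map_add, map_smul, map_smul, smul_eq_mul, smul_eq_mul] at h3
      exact le_of_mul_le_mul_left (by linarith) hε
    have hq : s.1 (s.1.symm (z + u₁)) = z + u₁ := by simp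
    have hpkq := h.isPeak_comp hs (hW₀ s hs) (hq.symm ▸ hpeak₁)
    rw [← hθ'] at hpkq
    set q := s.1.symm (z + u₁) with hqdef
    -- `y` lifts `p` into `Z` modulo `lin D`, so it lies on the `W₀`-coset of the maximum `q`. The
    -- aim is to bound the distance from `q` to `y` by the coefficient sum of `p`.
    let y := ∑ v ∈ P, a v • σ v
    have hqZ : q ∈ Z := symm_mem_of_invariant (hZ s hs) (Z.add_mem hz hu₁.1)
    have hyZ : y ∈ Z := Z.sum_mem fun v _ => Z.smul_mem _ (hσZ v)
    have hu' : q - y ∈ W₀ := by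
      refine ⟨Z.sub_mem hqZ hyZ, ?_⟩
      have e : q - y = (q - ∑ v ∈ P, a v • v) - (y - ∑ v ∈ P, a v • v) := by abel
      rw [e]
      refine Submodule.sub_mem _ ?_ ?_
      · have h1 : s.1.symm (u₁ - w - u₂) ∈ lin D := symm_mem_of_invariant (h.lin_map hs)
          (Submodule.sub_mem _ (Submodule.sub_mem _ hu₁.2 hw) hu₂.2)
        have h2 : s.1.symm (u₁ - w - u₂) = q - ∑ v ∈ P, a v • v := by
          rw [LinearEquiv.symm_apply_eq, map_sub, hsp, hqdef, LinearEquiv.apply_symm_apply]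
          abel
        rwa [h2] at h1
      · rw [← Finset.sum_sub_distrib]
        refine Submodule.sum_mem _ fun v _ => ?_
        rw [← smul_sub]
        exact Submodule.smul_mem _ _ (hσ v)
    obtain ⟨τy, hτy, hley⟩ := hpkq _ (W₀.neg_mem hu')
    rw [neg_sub, add_sub_cancel] at hley
    obtain ⟨τ, hτΞ, hτθ⟩ := hdir _ hu'
    obtain ⟨τ', hτ', hlt⟩ := hcoer _ hu'.2
    have h1 := hley τ' (hT₀ hτ')
    have h2 := hlt τ hτΞ
    simp only [map_sub] at h2 hτθ
    -- The linear gap in the direction `q - y` is played against the maximality of `q` over `y`.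
    have h3 : δ * ‖q - y‖ ≤ τ' y - τy y := by linarith
    have h4 : τ' y - τy y ≤ C * ∑ v ∈ P, a v := by
      simp only [y, map_sum, map_smul, smul_eq_mul]
      rw [← Finset.sum_sub_distrib, Finset.mul_sum]
      refine Finset.sum_le_sum fun v hv => ?_
      have h5 := hCle τ' hτ' v hv
      have h6 := hm v hv τy hτy
      rw [← mul_sub, mul_comm C]
      exact mul_le_mul_of_nonneg_left (by linarith) (ha v)
    -- So `q` stays in a fixed finitely generated cone, and the form active at it is one of finitely
    -- many.
    have := hperturb₂ a ha (q - y) hu'.2 (by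
      have h7 := mul_le_mul_of_nonneg_left (h3.trans h4) (by positivity : 0 ≤ K / δ)
      refine le_trans (le_of_eq ?_) (h7.trans (le_of_eq ?_))
      · field_simp
      · field_simp)
    rwa [show ∑ v ∈ P, a v • σ v + (q - y) = q from add_sub_cancel _ _] at this
  -- One `s` serves infinitely many multiples of `w`, so `w` agrees with some `s p` modulo `W₀`,
  -- where `p` is in the cone on `P`. Then `s p` lies in `lin D`, while a nonzero `p` would put it
  -- in `D`; hence `p = 0` and `w ∈ W₀`.
  have hlin : lin D ≤ Z := by
    intro w hw
    obtain ⟨s, ⟨hs, -⟩, hfreq⟩ := exists_forall_frequently hS₀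
      (p := fun s n => ∃ p ∈ PointedCone.hull ℝ (P : Set U), s.1 p - (z + (n : ℝ) • w) ∈ W₀)
      (n₀ := 0) fun n _ => hmain _ (Submodule.smul_mem _ (n : ℝ) hw)
    have hmap : ∀ p ∈ PointedCone.hull ℝ (P : Set U), W₀.mkQ (s.1 p) ∈
        PointedCone.hull ℝ ((P.image fun v => W₀.mkQ (s.1 v) : Finset _) : Set (U ⧸ W₀)) := by
      intro p hp
      obtain ⟨a, ha, rfl⟩ := (mem_hull_finset P).1 hp
      simp only [map_sum, map_smul]
      exact Submodule.sum_mem _ fun v hv => PointedCone.smul_mem _ (ha v)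
        (PointedCone.subset_hull (Finset.mem_coe.2 (Finset.mem_image_of_mem _ hv)))
    have hm : W₀.mkQ w ∈
        PointedCone.hull ℝ ((P.image fun v => W₀.mkQ (s.1 v) : Finset _) : Set (U ⧸ W₀)) := by
      refine mem_hull_of_frequently _ (c := W₀.mkQ z) fun N => ?_
      obtain ⟨n, hn, p, hp, hmem⟩ := hfreq ⌈N⌉₊
      refine ⟨n, (Nat.le_ceil N).trans (by exact_mod_cast hn), ?_⟩
      have e : W₀.mkQ z + (n : ℝ) • W₀.mkQ w = W₀.mkQ (s.1 p) := by
        rw [← map_smul, ← map_add]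
        exact ((Submodule.Quotient.eq _).2 hmem).symm
      rw [e]
      exact hmap p hp
    obtain ⟨p, hp, hpw⟩ : ∃ p ∈ PointedCone.hull ℝ (P : Set U), W₀.mkQ (s.1 p) = W₀.mkQ w := by
      generalize W₀.mkQ w = x at hm
      induction hm using Submodule.span_induction with
      | mem x hx =>
        obtain ⟨v, hv, rfl⟩ := Finset.mem_image.1 (Finset.mem_coe.1 hx)
        exact ⟨v, PointedCone.subset_hull hv, rfl⟩
      | zero => exact ⟨0, Submodule.zero_mem _, by simp⟩
      | add x y _ _ hx hy =>
        obtain ⟨p, hp, rfl⟩ := hx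
        obtain ⟨p', hp', rfl⟩ := hy
        exact ⟨p + p', Submodule.add_mem _ hp hp', by simp⟩
      | smul a x _ hx =>
        obtain ⟨p, hp, rfl⟩ := hx
        refine ⟨(a : ℝ) • p, PointedCone.smul_mem _ a.2 hp, ?_⟩
        rw [map_smul, map_smul]
        rfl
    have hmem : s.1 p - w ∈ W₀ := (Submodule.Quotient.eq _).1 hpw
    have hsp : s.1 p ∈ lin D := by
      have := Submodule.add_mem _ hmem.2 hw
      rwa [sub_add_cancel] at this
    have hp0 : p = 0 := by
      by_contra hne
      have hD := h.map_mem s hs _ (h.hull_subset hP hp hne)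
      obtain ⟨β, hβ, -, hβ0⟩ := h.separate h.zero_notMem
      exact (h.dual_pos hβ hβ0 hD).ne' (mem_lin.1 hsp β hβ)
    rw [hp0, map_zero, zero_sub] at hmem
    simpa using Z.neg_mem hmem.1
  rwa [sup_eq_left.2 hlin] at hsup

end Cocompact

end Peak

end RatCone

namespace RatCone

/-! ### The Jacobson radical of an algebra generated by lattice endomorphisms. -/

section Radical

/-- A module over an Artinian ring is semisimple modulo its radical. -/
theorem exists_compl_radical {R M : Type*} [Ring R] [IsArtinianRing R] [AddCommGroup M]
    [Module R M] (W : Submodule R M) (hW : Ring.jacobson R • ⊤ ≤ W) :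
    ∃ Z : Submodule R M, Z ⊔ W = ⊤ ∧ Z ⊓ W = Ring.jacobson R • ⊤ := by
  have htors : Module.IsTorsionBySet R (M ⧸ (Ring.jacobson R • ⊤ : Submodule R M))
      (Ring.jacobson R) :=
    (Module.isTorsionBySet_quotient_iff _ _).2 fun x r hr =>
      Submodule.smul_mem_smul hr trivial
  have hss : IsSemisimpleModule R (M ⧸ (Ring.jacobson R • ⊤ : Submodule R M)) := by
    let := htors.module
    exact (Module.IsTorsionBySet.isSemisimpleModule_iff htors).1 inferInstance
  generalize (Ring.jacobson R • ⊤ : Submodule R M) = K at hss hW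
  obtain ⟨Z, hZ⟩ := exists_isCompl (W.map K.mkQ)
  refine ⟨Z.comap K.mkQ, ?_, ?_⟩
  · rw [eq_top_iff]
    intro u _
    have hu : K.mkQ u ∈ W.map K.mkQ ⊔ Z := by rw [hZ.sup_eq_top]; exact Submodule.mem_top
    obtain ⟨y, ⟨w, hw, rfl⟩, z, hz, e⟩ := Submodule.mem_sup.1 hu
    refine Submodule.mem_sup.2 ⟨u - w, ?_, w, hw, sub_add_cancel _ _⟩
    rw [Submodule.mem_comap, map_sub, ← e, add_sub_cancel_left]
    exact hz
  · refine le_antisymm ?_ ?_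
    · rintro u ⟨huZ, huW⟩
      have : K.mkQ u ∈ W.map K.mkQ ⊓ Z := ⟨⟨u, huW, rfl⟩, huZ⟩
      rw [hZ.inf_eq_bot] at this
      exact (Submodule.Quotient.mk_eq_zero K).1 this
    · intro u hu
      refine ⟨?_, hW hu⟩
      have : K.mkQ u = 0 := (Submodule.Quotient.mk_eq_zero K).2 hu
      rw [SetLike.mem_coe, Submodule.mem_comap, this]
      exact Z.zero_mem

variable {U : Type*} [AddCommGroup U] [Module ℝ U] [FiniteDimensional ℝ U]

theorem eq_zero_of_isIdempotentElem (e : U →ₗ[ℝ] U) (he : IsIdempotentElem e)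
    (h : LinearMap.trace ℝ U e = 0) : e = 0 :=
  (LinearMap.IsIdempotentElem.trace_eq_zero_iff he).1 h

open Polynomial in
/-- An endomorphism is nilpotent if its products with all its polynomials have trace zero. -/
theorem isNilpotent_of_trace (t : Module.End ℝ U)
    (h : ∀ p : ℝ[X], LinearMap.trace ℝ U (t * aeval t p) = 0) : IsNilpotent t := by
  have hm0 : minpoly ℝ t ≠ 0 := minpoly.ne_zero (Algebra.IsIntegral.isIntegral t)
  obtain ⟨q, hq, hnd⟩ := exists_eq_pow_rootMultiplicity_mul_and_not_dvd (minpoly ℝ t) hm0 0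
  set n := (minpoly ℝ t).rootMultiplicity 0
  rw [map_zero, sub_zero] at hq hnd
  have hcop : IsCoprime (X ^ (n + 1)) q :=
    (((irreducible_X).coprime_iff_not_dvd).2 hnd).pow_left
  -- Fitting decomposition: `u * X ^ (n + 1)` evaluates to the idempotent onto the part where `t` is
  -- invertible. Its trace vanishes by hypothesis, so in characteristic zero the idempotent is zero.
  obtain ⟨u, v, huv⟩ := hcop
  have hmin : aeval t (X ^ n * q) = 0 := by rw [← hq]; exact minpoly.aeval ℝ t
  have hidem : IsIdempotentElem (aeval t (u * X ^ (n + 1))) := by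
    have e : u * X ^ (n + 1) * (u * X ^ (n + 1)) =
        u * X ^ (n + 1) - u * v * X * (X ^ n * q) := by
      linear_combination (u * X ^ (n + 1)) * huv
    rw [IsIdempotentElem, ← map_mul, e, map_sub, map_mul _ _ (X ^ n * q), hmin, mul_zero, sub_zero]
  have htr : LinearMap.trace ℝ U (aeval t (u * X ^ (n + 1))) = 0 := by
    rw [show u * X ^ (n + 1) = X * (X ^ n * u) by ring, map_mul, aeval_X]
    exact h _
  have h0 : aeval t (u * X ^ (n + 1)) = 0 := eq_zero_of_isIdempotentElem _ hidem htr
  refine ⟨n, ?_⟩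
  have h1 := congrArg (aeval t) huv
  rw [map_add, h0, zero_add, map_one] at h1
  have h2 : X ^ n * (v * q) = v * (X ^ n * q) := by ring
  have h3 := congrArg (aeval t) h2
  rw [map_mul, h1, map_mul _ v, hmin, mul_zero, mul_one, map_pow, aeval_X] at h3
  exact h3

/-- The coordinate forms of a basis from `L` have a common denominator `d`, which then clears the
diagonal entries of every lattice endomorphism. -/
theorem trace_isInt {L : AddSubgroup U} (hL : IsLat L) :
    ∃ d : ℤ, d ≠ 0 ∧ ∀ g : Module.End ℝ U, (∀ v ∈ L, g v ∈ L) →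
      ∃ n : ℤ, d * LinearMap.trace ℝ U g = n := by
  obtain ⟨b, hb⟩ := exists_basis_of_span hL.span_eq
  obtain ⟨d, hd, h⟩ := hL.exists_coord b hb
  refine ⟨d, hd, fun g hg => ?_⟩
  choose n hn using fun i => h i (g (b i)) (hg _ (hb i))
  refine ⟨∑ i, n i, ?_⟩
  rw [LinearMap.trace_eq_matrix_trace ℝ b, Matrix.trace, Finset.mul_sum]
  push_cast
  refine Finset.sum_congr rfl fun i _ => ?_
  rw [← hn i, Matrix.diag_apply, LinearMap.toMatrix_apply, LinearMap.smul_apply, zsmul_eq_mul]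
  rfl

variable (A : Subalgebra ℝ (Module.End ℝ U))

/-- The radical is nilpotent, so its elements have traceless products. Conversely, traceless
products make every `y * a` nilpotent, hence `1 + y * a` a unit. This describes the radical by
linear equations that are rational with respect to a lattice. -/
theorem mem_jacobson_iff_trace {a : A} : a ∈ Ring.jacobson A ↔
    ∀ b : A, LinearMap.trace ℝ U ((a : Module.End ℝ U) * b) = 0 := by
  have : IsArtinianRing A := IsArtinianRing.of_finite ℝ A
  constructor
  · intro ha b
    have h1 : a * b ∈ Ring.jacobson A := Ideal.mul_mem_right _ _ ha
    obtain ⟨n, hn⟩ := IsSemiprimaryRing.isNilpotent (R := A)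
    have h2 : IsNilpotent (a * b) := ⟨n, by
      have := Ideal.pow_mem_pow h1 n
      rwa [hn] at this⟩
    have h3 : IsNilpotent ((a : Module.End ℝ U) * b) := h2.map A.val
    exact (LinearMap.isNilpotent_trace_of_isNilpotent h3).eq_zero
  · intro h
    rw [Ring.jacobson_eq_sInf_isMaximal]
    have hmem : a ∈ Ideal.jacobson (⊥ : Ideal A) := by
      refine Ideal.mem_jacobson_iff.2 fun y => ?_
      have hnil : IsNilpotent (y * a) := by
        have h1 : IsNilpotent ((y : Module.End ℝ U) * a) := by
          refine isNilpotent_of_trace _ fun p => ?_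
          have hp : Polynomial.aeval ((y : Module.End ℝ U) * a) p ∈ A := by
            have := Polynomial.aeval_algHom_apply A.val (y * a) p
            rw [map_mul] at this
            change Polynomial.aeval (A.val y * A.val a) p ∈ A
            rw [this]
            exact (Polynomial.aeval (y * a) p).2
          rw [mul_assoc, LinearMap.trace_mul_comm, mul_assoc]
          exact h (⟨_, hp⟩ * y)
        obtain ⟨n, hn⟩ := h1
        exact ⟨n, Subtype.ext (by simpa using hn)⟩
      obtain ⟨z, hz⟩ := hnil.isUnit_one_add
      refine ⟨((z⁻¹ : Aˣ) : A), ?_⟩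
      have := z.inv_mul
      rw [hz, mul_add, mul_one] at this
      rw [Ideal.mem_bot, mul_assoc, sub_eq_zero, add_comm, this]
    have hle : Ideal.jacobson (⊥ : Ideal A) ≤ sInf {I : Ideal A | I.IsMaximal} :=
      sInf_le_sInf fun I hI => ⟨bot_le, hI⟩
    exact hle hmem

/-- The endomorphisms in `A` that preserve a lattice. -/
def stabLat (L : AddSubgroup U) : AddSubgroup A where
  carrier := {a | ∀ v ∈ L, (a : Module.End ℝ U) v ∈ L}
  zero_mem' := fun _ _ => by simp
  add_mem' := fun ha hb v hv => L.add_mem (ha v hv) (hb v hv)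
  neg_mem' := fun ha v hv => L.neg_mem (ha v hv)

/-- The monoid generated by `G` preserves `L` and spans the algebra. Matrix coefficients formed from
lattice vectors and integral forms are integral and separate its elements. -/
theorem isLat_stabLat {L : AddSubgroup U} (hL : IsLat L) {G : Set (Module.End ℝ U)}
    (hG : ∀ g ∈ G, ∀ v ∈ L, g v ∈ L) (hA : A = Algebra.adjoin ℝ G) : IsLat (stabLat A L) := by
  constructor
  · have hmon : ∀ g ∈ Submonoid.closure G, ∀ v ∈ L, g v ∈ L := fun g hg => by
      induction hg using Submonoid.closure_induction with
      | mem x hx => exact hG x hx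
      | one => exact fun v hv => hv
      | mul x y _ _ hx hy => exact fun v hv => hx _ (hy v hv)
    rw [eq_top_iff]
    rintro ⟨a, ha⟩ -
    have h1 : a ∈ Submodule.span ℝ (Submonoid.closure G : Set (Module.End ℝ U)) := by
      rw [← Algebra.adjoin_eq_span, ← hA]
      exact ha
    have h2 : ∀ g ∈ Submonoid.closure G, g ∈ A := fun g hg => by
      rw [hA]
      exact Submonoid.closure_le.2 (Algebra.subset_adjoin (R := ℝ)) hg
    induction h1 using Submodule.span_induction with
    | mem x hx => exact Submodule.subset_span (hmon x hx)
    | zero => exact Submodule.zero_mem _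
    | add x y hx hy hx' hy' =>
      have hxA : x ∈ A := Submodule.span_le (p := A.toSubmodule).2 (fun g hg => h2 g hg) hx
      have hyA : y ∈ A := Submodule.span_le (p := A.toSubmodule).2 (fun g hg => h2 g hg) hy
      exact Submodule.add_mem _ (hx' hxA) (hy' hyA)
    | smul c x hx hx' =>
      have hxA : x ∈ A := Submodule.span_le (p := A.toSubmodule).2 (fun g hg => h2 g hg) hx
      exact Submodule.smul_mem _ c (hx' hxA)
  · by_contra hne
    obtain ⟨f, hf, hle⟩ := Submodule.exists_le_ker_of_lt_top _ (lt_top_iff_ne_top.2 hne)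
    obtain ⟨a, rfl⟩ := (evalEquiv ℝ A).surjective f
    apply hf
    have ha : a = 0 := by
      have h1 : ∀ v ∈ L, (a : Module.End ℝ U) v = 0 := fun v hv => by
        refine (Module.forall_dual_apply_eq_zero_iff ℝ _).1 fun α => ?_
        have hα : α ∈ Submodule.span ℝ (dualLat L : Set (Dual ℝ U)) := by
          rw [hL.dual_span]; exact Submodule.mem_top
        induction hα using Submodule.span_induction with
        | mem β hβ =>
          have hm : β ∘ₗ (LinearMap.applyₗ v) ∘ₗ A.val.toLinearMap ∈ dualLat (stabLat A L) :=
            fun c hc => hβ _ (hc v hv)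
          exact hle (Submodule.subset_span (SetLike.mem_coe.2 hm))
        | zero => simp
        | add x y _ _ hx hy => rw [LinearMap.add_apply, hx, hy, add_zero]
        | smul c x _ hx => rw [LinearMap.smul_apply, hx, smul_zero]
      have h2 : (a : Module.End ℝ U) = 0 := by
        refine LinearMap.ext_on hL.span_eq fun v hv => ?_
        simpa using h1 v hv
      exact Subtype.ext h2
    rw [ha, map_zero]

theorem exists_compl_subalgebra {G : Set (Module.End ℝ U)} (hGA : ∀ g ∈ G, g ∈ A)
    (W : Submodule ℝ U) (hKW : ∀ u ∈ (Ring.jacobson A • ⊤ : Submodule A U), u ∈ W)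
    (hWA : ∀ a ∈ A, ∀ w ∈ W, a w ∈ W) :
    ∃ Z : Submodule ℝ U, (∀ g ∈ G, ∀ z ∈ Z, g z ∈ Z) ∧ Z ⊔ W = ⊤ ∧
      Z ⊓ W = (Ring.jacobson A • ⊤ : Submodule A U).restrictScalars ℝ := by
  have : IsArtinianRing A := IsArtinianRing.of_finite ℝ A
  obtain ⟨W', hW'⟩ : ∃ W' : Submodule A U, ∀ u, u ∈ W' ↔ u ∈ W :=
    ⟨{ carrier := W
       add_mem' := W.add_mem
       zero_mem' := W.zero_mem
       smul_mem' := fun a w hw => hWA a a.2 w hw }, fun _ => Iff.rfl⟩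
  obtain ⟨Z, hsup, hinf⟩ := exists_compl_radical W' (fun u hu => (hW' u).2 (hKW u hu))
  generalize (Ring.jacobson A • ⊤ : Submodule A U) = K at hinf
  refine ⟨Z.restrictScalars ℝ, fun g hg z hz => Z.smul_mem ⟨g, hGA g hg⟩ hz, ?_, ?_⟩
  · rw [eq_top_iff]
    intro u _
    have hu : u ∈ Z ⊔ W' := by rw [hsup]; exact Submodule.mem_top
    obtain ⟨z, hz, w, hw, rfl⟩ := Submodule.mem_sup.1 hu
    exact Submodule.mem_sup.2 ⟨z, hz, w, (hW' w).1 hw, rfl⟩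
  · ext u
    rw [Submodule.restrictScalars_mem, ← hinf, Submodule.mem_inf, Submodule.mem_inf, hW',
      Submodule.restrictScalars_mem]

theorem apply_mem_of_mem_span {E F M : Type*} [AddCommGroup E] [Module ℝ E] [AddCommGroup F]
    [Module ℝ F] [AddCommGroup M] [Module ℝ M] (f : E →ₗ[ℝ] F →ₗ[ℝ] M) {S : Set E} {T : Set F}
    {N : Submodule ℝ M} {x : E} {y : F} (hx : x ∈ Submodule.span ℝ S)
    (hy : y ∈ Submodule.span ℝ T) (h : ∀ x ∈ S, ∀ y ∈ T, f x y ∈ N) : f x y ∈ N := by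
  have h1 := Submodule.apply_mem_map₂ f hx hy
  rw [Submodule.map₂_span_span] at h1
  refine Submodule.span_le.2 ?_ h1
  rintro _ ⟨x, hx, y, hy, rfl⟩
  exact h x hx y hy

/-- The radical is the common kernel of the forms `a ↦ d * trace (a * b)` with `b` in the lattice of
`A`, and these forms are integral. -/
theorem jacobson_rational {L : AddSubgroup U} (hL : IsLat L) {G : Set (Module.End ℝ U)}
    (hG : ∀ g ∈ G, ∀ v ∈ L, g v ∈ L) (hA : A = Algebra.adjoin ℝ G) {a : A}
    (ha : a ∈ Ring.jacobson A) :
    a ∈ Submodule.span ℝ ({a | a ∈ Ring.jacobson A} ∩ stabLat A L : Set A) := by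
  have hlatA := isLat_stabLat A hL hG hA
  obtain ⟨d, hd, hint⟩ := trace_isInt hL
  have hd' : (d : ℝ) ≠ 0 := by exact_mod_cast hd
  let τ : A → Dual ℝ A := fun b => (d : ℝ) • (LinearMap.trace ℝ U ∘ₗ
    LinearMap.mulRight ℝ (b : Module.End ℝ U) ∘ₗ A.val.toLinearMap)
  have hτ : ∀ a b : A, τ b a = d * LinearMap.trace ℝ U ((a : Module.End ℝ U) * b) :=
    fun _ _ => rfl
  have hS : τ '' (stabLat A L : Set A) ⊆ dualLat (stabLat A L) := by
    rintro _ ⟨b, hb, rfl⟩ a ha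
    exact hint _ fun v hv => ha _ (hb v hv)
  have hker : ∀ a : A, a ∈ Ring.jacobson A ↔ ∀ ξ ∈ τ '' (stabLat A L : Set A), ξ a = 0 := by
    intro a
    rw [mem_jacobson_iff_trace]
    constructor
    · rintro h _ ⟨b, hb, rfl⟩
      rw [hτ, h b, mul_zero]
    · intro h b
      have hb : b ∈ Submodule.span ℝ (stabLat A L : Set A) := by
        rw [hlatA.span_eq]; exact Submodule.mem_top
      induction hb using Submodule.span_induction with
      | mem x hx =>
        have := h _ ⟨x, hx, rfl⟩
        rw [hτ] at this
        exact (mul_eq_zero.1 this).resolve_left hd'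
      | zero => simp
      | add x y _ _ hx hy => simp only [Subalgebra.coe_add, mul_add, map_add, hx, hy, add_zero]
      | smul c x _ hx =>
        simp only [Subalgebra.coe_smul, mul_smul_comm, map_smul, hx, smul_zero]
  have h1 := hlatA.kernel hS ((hker a).1 ha)
  refine Submodule.span_mono ?_ h1
  rintro x ⟨hx, hxL⟩
  exact ⟨(hker x).2 hx, hxL⟩

theorem ideal_smul_rational {L : AddSubgroup U} (hL : IsLat L) {J : Ideal A}
    (hJ : ∀ a ∈ J, a ∈ Submodule.span ℝ ({a | a ∈ J} ∩ stabLat A L : Set A)) {k : U}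
    (hk : k ∈ (J • ⊤ : Submodule A U)) :
    k ∈ Submodule.span ℝ ({u | u ∈ (J • ⊤ : Submodule A U)} ∩ L : Set U) := by
  have key : ∀ a ∈ J, ∀ u : U,
      a • u ∈ Submodule.span ℝ ({u | u ∈ (J • ⊤ : Submodule A U)} ∩ L : Set U) := by
    intro a ha u
    have hu : u ∈ Submodule.span ℝ (L : Set U) := by rw [hL.span_eq]; exact Submodule.mem_top
    refine apply_mem_of_mem_span (x := a) (y := u) A.val.toLinearMap (hJ a ha) hu ?_
    intro x hx v hv
    have h1 : x • v ∈ (J • ⊤ : Submodule A U) := Submodule.smul_mem_smul hx.1 Submodule.mem_top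
    exact Submodule.subset_span ⟨h1, hx.2 v hv⟩
  exact Submodule.smul_induction_on hk (fun a ha u _ => key a ha u)
    (fun _ _ hx hy => Submodule.add_mem _ hx hy)

/-- A real representation that preserves a lattice has a proper rational subrepresentation
modulo which it is semisimple. -/
theorem exists_rational_radical [Nontrivial U] {L : AddSubgroup U} (hL : IsLat L)
    {G : Set (Module.End ℝ U)} (hG : ∀ g ∈ G, ∀ v ∈ L, g v ∈ L) :
    ∃ K : Submodule ℝ U, K ≠ ⊤ ∧ K ≤ Submodule.span ℝ (K ∩ L : Set U) ∧
      (∀ g ∈ G, ∀ k ∈ K, g k ∈ K) ∧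
      ∀ W : Submodule ℝ U, K ≤ W → (∀ g ∈ G, ∀ w ∈ W, g w ∈ W) →
        ∃ Z : Submodule ℝ U, (∀ g ∈ G, ∀ z ∈ Z, g z ∈ Z) ∧ Z ⊔ W = ⊤ ∧ Z ⊓ W = K := by
  let A := Algebra.adjoin ℝ G
  have : IsArtinianRing A := IsArtinianRing.of_finite ℝ A
  have hGA : ∀ g ∈ G, g ∈ A := fun g hg => Algebra.subset_adjoin hg
  -- By Nakayama this is a proper submodule, and it is rational because both factors are spanned by
  -- lattice elements.
  let K : Submodule A U := Ring.jacobson A • ⊤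
  have hinv : ∀ N : Submodule A U, ∀ g ∈ G, ∀ v ∈ N.restrictScalars ℝ, g v ∈ N.restrictScalars ℝ :=
    fun N g hg v hv => N.smul_mem ⟨g, hGA g hg⟩ hv
  refine ⟨K.restrictScalars ℝ, ?_, ?_, hinv K, ?_⟩
  · intro htop
    have hK : K = ⊤ := by
      rwa [Submodule.restrictScalars_eq_top_iff] at htop
    have : IsNoetherian A U := isNoetherian_of_tower ℝ inferInstance
    exact (Submodule.jacobson_smul_lt_top (R := A) (⊤ : Submodule A U)).ne hK
  · exact fun k hk => ideal_smul_rational A hL (fun a ha => jacobson_rational A hL hG rfl ha) hk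
  · intro W hKW hW
    have hWA : ∀ a ∈ A, ∀ w ∈ W, a w ∈ W := fun a ha => by
      induction ha using Algebra.adjoin_induction with
      | mem x hx => exact hW x hx
      | algebraMap r => exact fun w hw => W.smul_mem r hw
      | add x y _ _ hx hy => exact fun w hw => W.add_mem (hx w hw) (hy w hw)
      | mul x y _ _ hx hy => exact fun w hw => hx _ (hy w hw)
    exact exists_compl_subalgebra A hGA W (fun u hu => hKW hu) hWA

end Radical

/-! ### Integral supporting forms of a cocompact cone. -/

section

variable {U : Type*} [NormedAddCommGroup U] [NormedSpace ℝ U] [FiniteDimensional ℝ U]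
  {D : Set U} {S : Set ((U ≃ₗ[ℝ] U) × Dual ℝ U)} {T : Set (Dual ℝ U)}

/-- There is a nonzero integral form which is nonnegative on `D`. -/
theorem Cocompact.exists_integral (h : Cocompact D S T) {L : AddSubgroup U} (hL : IsLat L)
    (hSL : ∀ s ∈ S, ∀ v ∈ L, s.1 v ∈ L) : ∃ β ∈ dualLat L, β ∈ dualSet D ∧ β ≠ 0 := by
  obtain ⟨d, hd⟩ := h.nonempty
  have : Nontrivial U := ⟨⟨d, 0, fun h0 => h.zero_notMem (h0 ▸ hd)⟩⟩
  let G : Set (Module.End ℝ U) := {g | ∃ s ∈ S, g = s.1.toLinearMap}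
  obtain ⟨K, hK, hrat, hinv, hcompl⟩ := exists_rational_radical hL (G := G) (by
    rintro _ ⟨s, hs, rfl⟩; exact hSL s hs)
  let Y : PointedCone ℝ (Dual ℝ U) :=
    PointedCone.hull ℝ {β | β ∈ dualSet D ∧ ∀ k ∈ K, β k = 0}
  have hY : ∀ β, β ∈ Y ↔ β ∈ dualSet D ∧ ∀ k ∈ K, β k = 0 := by
    intro β
    refine ⟨fun hβ => ?_, fun hβ => PointedCone.subset_hull hβ⟩
    induction hβ using Submodule.span_induction with
    | mem x hx => exact hx
    | zero => exact ⟨fun _ _ => le_rfl, fun _ _ => rfl⟩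
    | add x y _ _ hx hy =>
      exact ⟨fun d hd => add_nonneg (hx.1 d hd) (hy.1 d hd), fun k hk => by
        rw [LinearMap.add_apply, hx.2 k hk, hy.2 k hk, add_zero]⟩
    | smul a x _ hx =>
      exact ⟨fun d hd => mul_nonneg a.2 (hx.1 d hd), fun k hk => by
        change (a : ℝ) * x k = 0
        rw [hx.2 k hk, mul_zero]⟩
  let W : Submodule ℝ U := (Submodule.span ℝ (Y : Set (Dual ℝ U))).dualCoannihilator
  have hW : ∀ u, u ∈ W ↔ ∀ β ∈ Y, β u = 0 := by
    intro u
    rw [Submodule.mem_dualCoannihilator]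
    refine ⟨fun hw β hβ => hw β (Submodule.subset_span hβ), fun hw β hβ => ?_⟩
    induction hβ using Submodule.span_induction with
    | mem x hx => exact hw x hx
    | zero => simp
    | add x y _ _ hx hy => rw [LinearMap.add_apply, hx, hy, add_zero]
    | smul a x _ hx => rw [LinearMap.smul_apply, hx, smul_zero]
  have hKW : K ≤ W := fun k hk => (hW k).2 fun β hβ => ((hY β).1 hβ).2 k hk
  obtain ⟨Z, hZinv, hsup, hinf⟩ := hcompl W hKW (by
    rintro _ ⟨s, hs, rfl⟩ w hw
    refine (hW _).2 fun β hβ => ?_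
    refine (hW w).1 hw (β ∘ₗ s.1.toLinearMap) ((hY _).2 ⟨fun d hd => ?_, fun k hk => ?_⟩)
    · exact ((hY β).1 hβ).1 _ (h.map_mem s hs d hd)
    · exact ((hY β).1 hβ).2 _ (hinv _ ⟨s, hs, rfl⟩ k hk))
  -- If `Z` missed `D`, a separating form would vanish on `Z`, which contains `K`; it would belong
  -- to `Y`, vanish on `W` too, and so be zero. Thus `Z` meets `D` and is everything, `W = K`, and
  -- `Y` spans the rational annihilator of `K`.
  have hZ : Z = ⊤ := by
    refine h.eq_top_of_invariant (fun s hs => hZinv _ ⟨s, hs, rfl⟩) ?_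
    by_contra! hmiss
    obtain ⟨β, hβ, hβ0, hβZ⟩ := h.separate_submodule hmiss
    refine hβ0 (LinearMap.ext fun u => ?_)
    obtain ⟨z, hz, w, hw, rfl⟩ := Submodule.mem_sup.1 (hsup ▸ Submodule.mem_top : u ∈ Z ⊔ W)
    have hKZ : K ≤ Z := hinf ▸ inf_le_left
    rw [map_add, hβZ z hz, (hW w).1 hw β ((hY β).2 ⟨hβ, fun k hk => hβZ k (hKZ hk)⟩), add_zero]
    rfl
  have hWK : W = K := by rw [← hinf, hZ, top_inf_eq]
  have hspan : Submodule.span ℝ (Y : Set (Dual ℝ U)) = K.dualAnnihilator := by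
    rw [← hWK]
    exact (Subspace.dualCoannihilator_dualAnnihilator_eq).symm
  -- a nonzero element
  obtain ⟨β, hβ, hβ0, hβK⟩ := h.separate_submodule (K := K) (by
    by_contra! hmeet
    exact hK (h.eq_top_of_invariant (fun s hs => hinv _ ⟨s, hs, rfl⟩) hmeet))
  have hβY : β ∈ Y := (hY β).2 ⟨hβ, hβK⟩
  obtain ⟨y, -, hy⟩ := exists_mem_core_hull {β | β ∈ dualSet D ∧ ∀ k ∈ K, β k = 0}
  -- A core point of `Y` is a positive combination of integral forms in `Y`. If all of these were
  -- zero, `Y` could not contain the nonzero form `β`.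
  have hmem := mem_hull_lattice (Y := Y) (L := dualLat L) hy (by
    rw [hspan]
    refine hL.dualAnnihilator hrat ?_
    rw [← hspan]
    exact Submodule.subset_span hy.1)
  by_contra! hno
  have hy0 : y = 0 := by
    have : PointedCone.hull ℝ (Y ∩ dualLat L : Set (Dual ℝ U)) ≤ ⊥ := by
      refine Submodule.span_le.2 fun β hβ => ?_
      exact hno β hβ.2 ((hY β).1 hβ.1).1
    exact (Submodule.mem_bot _).1 (this hmem)
  obtain ⟨ε, hε, hm⟩ := hy.2 β hβY
  have h1 := ((hY _).1 hm).1 d hd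
  have h2 := h.dual_pos hβ hβ0 hd
  rw [hy0, zero_sub, LinearMap.neg_apply, LinearMap.smul_apply, smul_eq_mul] at h1
  nlinarith [mul_pos hε h2]

end

end RatCone

namespace RatCone

/-! ### Lattices and automorphisms induced on quotients. -/

section Quotient

variable {V U : Type*} [AddCommGroup V] [Module ℝ V] [FiniteDimensional ℝ V] [AddCommGroup U]
  [Module ℝ U]

theorem exists_coords (W : Submodule ℝ V) : ∃ (n : ℕ) (A : V →ₗ[ℝ] (Fin n → ℝ)),
    Function.Surjective A ∧ LinearMap.ker A = W := by
  let b := finBasis ℝ (V ⧸ W)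
  refine ⟨_, b.equivFun.toLinearMap ∘ₗ W.mkQ, b.equivFun.surjective.comp W.mkQ_surjective, ?_⟩
  rw [LinearMap.ker_comp, LinearEquiv.ker, Submodule.comap_bot, Submodule.ker_mkQ]

variable {A : V →ₗ[ℝ] U} (hA : Function.Surjective A)

theorem exists_factor {ζ : Dual ℝ V} (hζ : ∀ v, A v = 0 → ζ v = 0) :
    ∃ τ : Dual ℝ U, τ ∘ₗ A = ζ := by
  have : ζ ∈ LinearMap.range A.dualMap := by
    rw [LinearMap.range_dualMap_eq_dualAnnihilator_ker, Submodule.mem_dualAnnihilator]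
    exact fun v hv => hζ v hv
  exact this

include hA

theorem exists_induced (γ : V ≃ₗ[ℝ] V) (hγ : ∀ v, A v = 0 ↔ A (γ v) = 0) :
    ∃ g : U ≃ₗ[ℝ] U, ∀ v, g (A v) = A (γ v) := by
  have h : (LinearMap.ker A).map γ.toLinearMap = LinearMap.ker A := by
    ext v
    constructor
    · rintro ⟨w, hw, rfl⟩
      exact (hγ w).1 hw
    · intro hv
      exact ⟨γ.symm v, (hγ _).2 (by simpa using hv), by simp⟩
  let e := A.quotKerEquivOfSurjective hA
  refine ⟨e.symm ≪≫ₗ Submodule.Quotient.equiv _ _ γ h ≪≫ₗ e, fun v => ?_⟩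
  have h1 : e.symm (A v) = Submodule.Quotient.mk v := by
    rw [LinearEquiv.symm_apply_eq]; rfl
  rw [LinearEquiv.trans_apply, LinearEquiv.trans_apply, h1]
  rfl

theorem IsLat.map {L : AddSubgroup V} (hL : IsLat L)
    (hker : LinearMap.ker A ≤ Submodule.span ℝ (LinearMap.ker A ∩ L : Set V)) :
    IsLat (L.map A.toAddMonoidHom) := by
  constructor
  · rw [AddSubgroup.coe_map]
    change Submodule.span ℝ (A '' L) = ⊤
    rw [Submodule.span_image, hL.span_eq, Submodule.map_top, LinearMap.range_eq_top.2 hA]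
  · rw [eq_top_iff]
    intro β _
    have h1 : A.dualMap β ∈ (LinearMap.ker A).dualAnnihilator := by
      rw [← LinearMap.range_dualMap_eq_dualAnnihilator_ker]
      exact ⟨β, rfl⟩
    have h2 := hL.dualAnnihilator hker h1
    have h3 : ((LinearMap.ker A).dualAnnihilator ∩ dualLat L : Set (Dual ℝ V)) ⊆
        A.dualMap '' (dualLat (L.map A.toAddMonoidHom)) := by
      rintro ζ ⟨hζ, hζL⟩
      obtain ⟨τ, rfl⟩ := exists_factor (A := A) (ζ := ζ) fun v hv =>
        (Submodule.mem_dualAnnihilator ζ).1 hζ v hv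
      refine ⟨τ, ?_, rfl⟩
      rintro _ ⟨v, hv, rfl⟩
      exact hζL v hv
    have h4 := Submodule.span_mono h3 h2
    rw [Submodule.span_image] at h4
    obtain ⟨τ, hτ, e⟩ := h4
    rwa [← LinearMap.dualMap_injective_of_surjective hA e]

end Quotient

/-! ### Maximal proper faces. -/

section Base

variable {V : Type*} [AddCommGroup V] [Module ℝ V] [FiniteDimensional ℝ V]
  {L : AddSubgroup V} {X F : PointedCone ℝ V} {Γ : Subgroup (V ≃ₗ[ℝ] V)}

theorem Sys.face_span_le (h : Sys L X Γ) (hF : F.IsFaceOf X) :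
    Submodule.span ℝ (F : Set V) ≤
      Submodule.span ℝ ((Submodule.span ℝ (F : Set V) : Set V) ∩ L : Set V) := by
  refine Submodule.span_le.2 fun v hv => ?_
  have h1 := face_hull hF h.gen
  have h2 : F ≤ (Submodule.span ℝ ((Submodule.span ℝ (F : Set V) : Set V) ∩ L : Set V)
      ).restrictScalars _ := by
    rw [h1]
    refine Submodule.span_le.2 fun w hw => Submodule.subset_span ⟨?_, hw.2⟩
    exact Submodule.subset_span (h1 ▸ hw.1)
  exact h2 hv

/-- The affine action of the pointwise stabilizer of a face on the quotient by its span. -/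
def quotAct {U : Type*} [AddCommGroup U] [Module ℝ U] (A : V →ₗ[ℝ] U)
    (Δ : Subgroup (V ≃ₗ[ℝ] V)) (ξ₀ : Dual ℝ V) : Set ((U ≃ₗ[ℝ] U) × Dual ℝ U) :=
  {s | ∃ γ ∈ Δ, (∀ v, s.1 (A v) = A (γ v)) ∧ ∀ v, s.2 (A v) = ξ₀ (γ v) - ξ₀ v}

/-- The family of forms on the quotient induced by `fam`. -/
def quotFam {U : Type*} [AddCommGroup U] [Module ℝ U] (A : V →ₗ[ℝ] U) (T : Set (Dual ℝ V))
    (ξ₀ : Dual ℝ V) : Set (Dual ℝ U) :=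
  {τ | τ ∘ₗ A + ξ₀ ∈ T}

/-- Forms with the same restriction to `F` as `ξ₀` descend to the quotient after subtracting `ξ₀`,
at the price of an affine action. The covering comes from `star`; maximality of `F` ensures that the
nonzero images of its generators lie in the image of the core. -/
theorem Sys.cocompact (h : Sys L X Γ) (hF : F.IsFaceOf X) (hne : F ≠ X)
    (hmax : ∀ G : PointedCone ℝ V, G.IsFaceOf X → F ≤ G → G ≠ F → G = X)
    {U : Type*} [NormedAddCommGroup U] [NormedSpace ℝ U] [FiniteDimensional ℝ U]
    {A : V →ₗ[ℝ] U} (hA : Function.Surjective A)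
    (hker : LinearMap.ker A = Submodule.span ℝ (F : Set V)) {ξ₀ : Dual ℝ V}
    (hξ₀ : ξ₀ ∈ posForms L X) :
    Cocompact (A '' core X) (quotAct A (fixer Γ F) ξ₀) (quotFam A (fam L X F ξ₀) ξ₀) := by
  classical
  have hA0 : ∀ v, A v = 0 ↔ v ∈ Submodule.span ℝ (F : Set V) := fun v => by
    rw [← hker, LinearMap.mem_ker]
  obtain ⟨r, -, hr⟩ := h.exists_face_core hF
  have hD : ∀ x ∈ X, A x ≠ 0 → A x ∈ A '' core X := by
    intro x hx hx0
    have hxF : x ∉ F := fun hm => hx0 ((hA0 x).2 (Submodule.subset_span hm))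
    have hy : r + x ∈ X := X.add_mem (hF.le hr.1) hx
    have hrm : r ∈ minFace X (r + x) hy := (mem_minFace hy).2
      ⟨hF.le hr.1, 1, one_pos, by simpa using hx⟩
    have hxm : x ∈ minFace X (r + x) hy := (mem_minFace hy).2 ⟨hx, 1, one_pos, by
      simpa using hF.le hr.1⟩
    have h1 := hmax _ (minFace_isFaceOf hy)
      (face_eq_of_mem_core_le hF (minFace_isFaceOf hy) hrm hr) fun e => hxF (e ▸ hxm)
    refine ⟨r + x, (minFace_eq_iff hy).1 h1, ?_⟩
    rw [map_add, (hA0 r).2 (Submodule.subset_span hr.1), zero_add]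
  have hopen : IsOpenCone (A '' core X) := by
    refine ⟨isOpen_of_absorb ?_ ?_, ?_, ?_, ?_, ?_⟩
    · rintro _ ⟨x, hx, rfl⟩ _ ⟨y, hy, rfl⟩ a b ha hb hab
      refine ⟨a • x + b • y, ?_, by simp⟩
      rcases eq_or_lt_of_le ha with h0 | h0
      · have : b = 1 := by linarith
        simpa [← h0, this] using hy
      · exact core_add (core_smul hx h0) (X.smul_mem hb hy.1)
    · rintro _ ⟨x, hx, rfl⟩ u
      obtain ⟨v, rfl⟩ := hA u
      obtain ⟨ε, hε, h1⟩ := core_absorb hx (v := v) (h.span_top ▸ Submodule.mem_top)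
      exact ⟨ε, hε, fun t ht => ⟨_, h1 t ht, by simp⟩⟩
    · obtain ⟨c, -, hc⟩ := h.exists_core
      exact ⟨_, c, hc, rfl⟩
    · rintro _ ⟨x, hx, rfl⟩ _ ⟨y, hy, rfl⟩
      exact ⟨x + y, core_add hx hy.1, map_add _ _ _⟩
    · rintro _ ⟨x, hx, rfl⟩ t ht
      exact ⟨t • x, core_smul hx ht, map_smul _ _ _⟩
    · rintro ⟨x, hx, hx0⟩
      exact not_mem_core_of_face_ne hF hne hx ((hA0 x).1 hx0)
  have hinj : ∀ τ τ' : Dual ℝ U, τ ∘ₗ A = τ' ∘ₗ A → τ = τ' := fun τ τ' e =>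
    LinearMap.dualMap_injective_of_surjective hA e
  refine { hopen with
    map_mem := ?_, symm_mem := ?_, cover := ?_, T_nonempty := ?_, T_fin := ?_, S_fin := ?_
    act := ?_, act_surj := ?_ }
  · rintro s ⟨γ, hγ, h1, -⟩ _ ⟨x, hx, rfl⟩
    exact ⟨γ x, h.map_core (fixer_le hγ) hx, (h1 x).symm⟩
  · rintro s ⟨γ, hγ, h1, -⟩ _ ⟨x, hx, rfl⟩
    refine ⟨γ.symm x, h.map_core (symm_mem (fixer_le hγ)) hx, ?_⟩
    rw [LinearEquiv.eq_symm_apply, h1, LinearEquiv.apply_symm_apply]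
  · obtain ⟨Q, hQ, hcov⟩ := h.star hF
    refine ⟨(Q.image A).filter (· ≠ 0), ?_, ?_⟩
    · intro u hu
      obtain ⟨hu, hu0⟩ := Finset.mem_filter.1 (Finset.mem_coe.1 hu)
      obtain ⟨q, hq, rfl⟩ := Finset.mem_image.1 hu
      exact hD q (hQ hq).1 hu0
    · rintro _ ⟨x, hx, rfl⟩
      obtain ⟨γ, hγ, p, hp, hxp⟩ := hcov x hx
      have hγ0 : ∀ v, A v = 0 ↔ A (γ v) = 0 := by
        intro v
        rw [hA0, hA0]
        refine ⟨fun hv => by rwa [fixer_span hγ hv], fun hv => ?_⟩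
        have := fixer_span (symm_mem hγ) hv
        rw [LinearEquiv.symm_apply_apply] at this
        rwa [this]
      obtain ⟨g, hg⟩ := exists_induced hA γ hγ0
      obtain ⟨c, hc⟩ := exists_factor (A := A) (ζ := ξ₀ ∘ₗ γ.toLinearMap - ξ₀) fun v hv => by
        have := fixer_span hγ ((hA0 v).1 hv)
        simp [this]
      refine ⟨(g, c), ⟨γ, hγ, hg, fun v => LinearMap.congr_fun hc v⟩, A p, ?_, ?_⟩
      · obtain ⟨a, ha, rfl⟩ := (mem_hull_finset Q).1 hp
        rw [map_sum]
        refine Submodule.sum_mem _ fun v hv => ?_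
        rw [map_smul]
        by_cases h0 : A v = 0
        · rw [h0, smul_zero]; exact Submodule.zero_mem _
        · exact PointedCone.smul_mem _ (ha v) (PointedCone.subset_hull
            (Finset.mem_coe.2 (Finset.mem_filter.2 ⟨Finset.mem_image_of_mem _ hv, h0⟩)))
      · change g (A p) = A x
        rw [hg, ← sub_eq_zero, ← map_sub, hA0, ← neg_sub]
        exact Submodule.neg_mem _ hxp
  · exact ⟨0, by simpa [quotFam, fam] using hξ₀⟩
  · rintro _ ⟨x, hx, rfl⟩ M
    have h1 := h.finite_fam (F := F) (ξ₀ := ξ₀) hx (Submodule.zero_mem _) (M + ξ₀ x)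
    refine Set.Finite.of_finite_image (f := fun τ : Dual ℝ U => τ ∘ₗ A + ξ₀) (h1.subset ?_)
      fun τ _ τ' _ e => hinj _ _ (add_right_cancel e)
    rintro _ ⟨τ, ⟨hτ, hM⟩, rfl⟩
    refine ⟨hτ, ?_⟩
    rw [add_zero]
    exact add_le_add_left hM _
  · intro τ hτ τ' hτ'
    have h1 := h.finite_group (ξ := τ ∘ₗ A + ξ₀) hτ.1 (Set.finite_singleton (τ' ∘ₗ A + ξ₀))
    have h2 : ∀ γ : V ≃ₗ[ℝ] V, {s : (U ≃ₗ[ℝ] U) × Dual ℝ U |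
        (∀ v, s.1 (A v) = A (γ v)) ∧ ∀ v, s.2 (A v) = ξ₀ (γ v) - ξ₀ v}.Finite := by
      intro γ
      refine Set.Subsingleton.finite ?_
      rintro s ⟨h1, h2⟩ s' ⟨h1', h2'⟩
      refine Prod.ext (LinearEquiv.ext fun u => ?_) (LinearMap.ext fun u => ?_)
      · obtain ⟨v, rfl⟩ := hA u
        rw [h1, h1']
      · obtain ⟨v, rfl⟩ := hA u
        rw [h2, h2']
    refine (h1.biUnion fun γ _ => h2 γ).subset ?_
    rintro s ⟨⟨γ, hγ, h1, h2⟩, hs⟩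
    refine Set.mem_biUnion (x := γ) ⟨fixer_le hγ, ?_⟩ ⟨h1, h2⟩
    refine LinearMap.ext fun v => ?_
    have h3 := LinearMap.congr_fun hs (A v)
    simp only [LinearMap.add_apply, LinearMap.comp_apply, LinearEquiv.coe_coe, h1, h2] at h3 ⊢
    linarith
  · rintro s ⟨γ, hγ, h1, h2⟩ τ hτ
    have h3 := h.comp_fam hγ hτ
    change (τ ∘ₗ s.1.toLinearMap + s.2) ∘ₗ A + ξ₀ ∈ fam L X F ξ₀
    convert h3 using 1
    refine LinearMap.ext fun v => ?_
    simp only [LinearMap.add_apply, LinearMap.comp_apply, LinearEquiv.coe_coe, h1, h2]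
    ring
  · rintro s ⟨γ, hγ, h1, h2⟩ τ hτ
    have h3 := h.comp_fam (symm_mem hγ) hτ
    refine ⟨(τ - s.2) ∘ₗ s.1.symm.toLinearMap, ?_, ?_⟩
    · change ((τ - s.2) ∘ₗ s.1.symm.toLinearMap) ∘ₗ A + ξ₀ ∈ fam L X F ξ₀
      convert h3 using 1
      refine LinearMap.ext fun v => ?_
      obtain ⟨w, rfl⟩ := γ.surjective v
      simp only [LinearMap.add_apply, LinearMap.comp_apply, LinearEquiv.coe_coe, ← h1,
        LinearEquiv.symm_apply_apply, LinearMap.sub_apply, h2]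
      ring
    · refine LinearMap.ext fun u => ?_
      simp

/-- A maximal proper face lies in the zero set of a nonzero integral form. -/
theorem Sys.exists_of_maximal (h : Sys L X Γ) (hF : F.IsFaceOf X) (hne : F ≠ X)
    (hmax : ∀ G : PointedCone ℝ V, G.IsFaceOf X → F ≤ G → G ≠ F → G = X) :
    ∃ β ∈ dualLat L, (∀ x ∈ X, 0 ≤ β x) ∧ (∀ v ∈ F, β v = 0) ∧ ∃ x ∈ X, β x ≠ 0 := by
  obtain ⟨n, A, hA, hker⟩ := exists_coords (Submodule.span ℝ (F : Set V))
  obtain ⟨ξ₀, hξ₀⟩ := h.unit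
  have hco := h.cocompact hF hne hmax hA hker hξ₀
  have hlat := h.lat.map hA (by rw [hker]; exact h.face_span_le hF)
  obtain ⟨β, hβ, hβD, hβ0⟩ := hco.exists_integral hlat (by
    rintro s ⟨γ, hγ, h1, -⟩ _ ⟨v, hv, rfl⟩
    exact ⟨γ v, h.mapL γ (fixer_le hγ) v hv, (h1 v).symm⟩)
  obtain ⟨c, -, hc⟩ := h.exists_core
  refine ⟨β ∘ₗ A, fun v hv => hβ _ ⟨v, hv, rfl⟩, fun x hx => ?_, fun v hv => ?_, c, hc.1,
    (hco.dual_pos hβD hβ0 ⟨c, hc, rfl⟩).ne'⟩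
  · by_contra! hlt
    obtain ⟨N, hN⟩ := exists_nat_gt (β (A c) / -(β (A x)))
    have h1 := hβD _ ⟨(N : ℝ) • x + c, by
      rw [add_comm]; exact core_add hc (X.smul_mem N.cast_nonneg hx), rfl⟩
    rw [LinearMap.comp_apply] at hlt
    rw [div_lt_iff₀ (by linarith)] at hN
    simp only [map_add, map_smul, smul_eq_mul] at h1
    linarith
  · have : A v = 0 := by
      rw [← LinearMap.mem_ker, hker]
      exact Submodule.subset_span hv
    rw [LinearMap.comp_apply, this, map_zero]

end Base

end RatCone

namespace RatCone

/-! ### The least face strictly above a face. -/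

section MinimalOverface

variable {V : Type*} [AddCommGroup V] [Module ℝ V] [FiniteDimensional ℝ V]
  {L : AddSubgroup V} {X F F₁ : PointedCone ℝ V} {Γ : Subgroup (V ≃ₗ[ℝ] V)}

/-- Some member of a fixed finite set of integral forms killing `W` has a nonzero integer value at
`w`, so the coefficients outside `W` cannot all be small. -/
theorem exists_large_coeff (hL : IsLat L) {W : Submodule ℝ V}
    (hW : W ≤ Submodule.span ℝ (W ∩ L : Set V)) (P : Finset V) :
    ∃ c : ℝ, 0 < c ∧ ∀ w ∈ L, w ∉ W → ∀ a : V → ℝ, (∀ p, 0 ≤ a p) →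
      ∑ p ∈ P, a p • p - w ∈ W → ∃ p ∈ P, p ∉ W ∧ c ≤ a p := by
  obtain ⟨b, hb, hspan, hli⟩ :=
    exists_linearIndependent ℝ (W.dualAnnihilator ∩ dualLat L : Set (Dual ℝ V))
  have hfin : b.Finite := hli.setFinite
  lift b to Finset (Dual ℝ V) using hfin
  refine ⟨(∑ α ∈ b, ∑ p ∈ P, |α p| + 1)⁻¹, by positivity, fun w hw hwW a ha hsum => ?_⟩
  obtain ⟨α, hα, hαw⟩ : ∃ α ∈ b, α w ≠ 0 := by
    by_contra! hz
    apply hwW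
    rw [← Subspace.dualAnnihilator_dualCoannihilator_eq (W := W), Submodule.mem_dualCoannihilator]
    intro φ hφ
    have h1 := hL.dualAnnihilator hW hφ
    rw [← hspan] at h1
    clear hφ
    induction h1 using Submodule.span_induction with
    | mem x hx => exact hz x hx
    | zero => simp
    | add x y _ _ hx hy => rw [LinearMap.add_apply, hx, hy, add_zero]
    | smul c x _ hx => rw [LinearMap.smul_apply, hx, smul_zero]
  have hαW : ∀ v ∈ W, α v = 0 := fun v hv => (Submodule.mem_dualAnnihilator α).1 (hb hα).1 v hv
  by_contra! hno
  obtain ⟨n, hn⟩ := (hb hα).2 w hw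
  have h1 : 1 ≤ |α w| := by
    rw [hn] at hαw ⊢
    rw [← Int.cast_abs]
    exact_mod_cast Int.one_le_abs (by exact_mod_cast hαw)
  have h2 : α w = ∑ p ∈ P, a p * α p := by
    have := hαW _ hsum
    rw [map_sub, sub_eq_zero] at this
    rw [← this, map_sum]
    simp
  have h3 : |α w| ≤ ∑ p ∈ P, (∑ α ∈ b, ∑ p ∈ P, |α p| + 1)⁻¹ * |α p| := by
    rw [h2]
    refine (Finset.abs_sum_le_sum_abs _ _).trans (Finset.sum_le_sum fun p hp => ?_)
    by_cases hpW : p ∈ W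
    · rw [hαW p hpW]; simp
    · rw [abs_mul, abs_of_nonneg (ha p)]
      exact mul_le_mul_of_nonneg_right (hno p hp hpW).le (abs_nonneg _)
  rw [← Finset.mul_sum] at h3
  have h4 : ∑ p ∈ P, |α p| ≤ ∑ α ∈ b, ∑ p ∈ P, |α p| :=
    Finset.single_le_sum (f := fun α : Dual ℝ V => ∑ p ∈ P, |α p|)
      (fun _ _ => Finset.sum_nonneg fun _ _ => abs_nonneg _) hα
  have h5 := h1.trans h3
  rw [inv_mul_eq_div, le_div_iff₀ (by positivity)] at h5
  linarith

/-- The points in the core of `X` up to the span of `F`. -/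
def coreAdd (X F : PointedCone ℝ V) : Set V :=
  {y | ∃ c ∈ core X, y - c ∈ Submodule.span ℝ (F : Set V)}

theorem coreAdd_add {y v : V} (hy : y ∈ coreAdd X F) (hv : v ∈ Submodule.span ℝ (F : Set V)) :
    y + v ∈ coreAdd X F := by
  obtain ⟨c, hc, h⟩ := hy
  refine ⟨c, hc, ?_⟩
  rw [add_sub_right_comm]
  exact Submodule.add_mem _ h hv

theorem fam_apply_add {ξ ξ₀ : Dual ℝ V} (hξ : ξ ∈ fam L X F ξ₀) {y v : V}
    (hv : v ∈ Submodule.span ℝ (F : Set V)) : ξ (y + v) = ξ y + ξ₀ v := by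
  rw [map_add, eq_on_span hξ.2 hv]

theorem isActive_add {ξ ξ₀ : Dual ℝ V} {y v : V} (h : IsActive (fam L X F ξ₀) y ξ)
    (hv : v ∈ Submodule.span ℝ (F : Set V)) : IsActive (fam L X F ξ₀) (y + v) ξ :=
  ⟨h.1, fun ζ hζ => by
    rw [fam_apply_add h.1 hv, fam_apply_add hζ hv]
    exact add_le_add_left (h.2 ζ hζ) _⟩

theorem mem_minFace_add_of_core (hF : F.IsFaceOf X) {r : V} (hr : r ∈ core F) {x : V}
    (hx : x ∈ X) : ∃ hy : r + x ∈ X, F ≤ minFace X (r + x) hy ∧ x ∈ minFace X (r + x) hy := by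
  have hy : r + x ∈ X := X.add_mem (hF.le hr.1) hx
  refine ⟨hy, face_eq_of_mem_core_le hF (minFace_isFaceOf hy) ((mem_minFace hy).2
      ⟨hF.le hr.1, 1, one_pos, by simpa using hx⟩) hr, (mem_minFace hy).2 ⟨hx, 1, one_pos, by
      simpa using hF.le hr.1⟩⟩

section

variable (h : Sys L X Γ) (hF : F.IsFaceOf X) (hF₁ : F₁.IsFaceOf X)
  (hmin : ∀ G : PointedCone ℝ V, G.IsFaceOf X → F ≤ G → G ≠ F → F₁ ≤ G)
include h hF

theorem Sys.coreAdd_map {γ : V ≃ₗ[ℝ] V} (hγ : γ ∈ fixer Γ F) {y : V} (hy : y ∈ coreAdd X F) :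
    γ y ∈ coreAdd X F := by
  obtain ⟨c, hc, hv⟩ := hy
  refine ⟨γ c, h.map_core (fixer_le hγ) hc, ?_⟩
  rw [← map_sub, fixer_span hγ hv]
  exact hv

theorem Sys.exists_active_coreAdd {ξ₀ : Dual ℝ V} (hξ₀ : ξ₀ ∈ posForms L X) {y : V}
    (hy : y ∈ coreAdd X F) : ∃ ξ, IsActive (fam L X F ξ₀) y ξ := by
  obtain ⟨c, hc, hv⟩ := hy
  refine exists_isActive (T := fam L X F ξ₀) ⟨ξ₀, hξ₀, fun _ _ => rfl⟩ fun M => ?_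
  have := h.finite_fam (ξ₀ := ξ₀) hc hv M
  rwa [add_sub_cancel] at this

theorem Sys.finite_active_coreAdd {ξ₀ : Dual ℝ V} {Q : Finset V} (hQ : (Q : Set V) ⊆ X ∩ L) :
    {ξ | ∃ y ∈ coreAdd X F, y ∈ PointedCone.hull ℝ (Q : Set V) ∧
      IsActive (fam L X F ξ₀) y ξ}.Finite := by
  refine finite_isActive (fun ξ hξ p hp => dualLat_nat hξ.1.1 hξ.1.2.1 (hQ hp).1 (hQ hp).2) ?_
  rintro y ⟨c, hc, hv⟩ M
  have := h.finite_fam (ξ₀ := ξ₀) hc hv M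
  rwa [add_sub_cancel] at this

include hF₁ hmin

/-- The pullback of `F₁` by `γ` is a face strictly above `F`, so it contains the least such face. -/
theorem Sys.map_overface (hlt : F < F₁) {γ : V ≃ₗ[ℝ] V} (hγ : γ ∈ fixer Γ F) {v : V}
    (hv : v ∈ F₁) : γ v ∈ F₁ := by
  obtain ⟨w, hw, hwF⟩ := SetLike.exists_of_lt hlt
  let G : PointedCone ℝ V := F₁.comap γ.toLinearMap
  have hmem : ∀ u, u ∈ G ↔ γ u ∈ F₁ := fun u => PointedCone.mem_comap
  have hG : G.IsFaceOf X := by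
    refine ⟨fun u hu => ?_, ?_⟩
    · have := h.mapX _ (symm_mem (fixer_le hγ)) _ (hF₁.le ((hmem u).1 hu))
      rwa [LinearEquiv.symm_apply_apply] at this
    · intro x y a hx hy ha hm
      rw [hmem] at hm ⊢
      rw [map_add, map_smul] at hm
      exact hF₁.mem_of_smul_add_mem (h.mapX _ (fixer_le hγ) _ hx) (h.mapX _ (fixer_le hγ) _ hy)
        ha hm
  have hFG : F ≤ G := fun u hu => by
    rw [hmem, hγ.2 u hu]
    exact hlt.le hu
  refine (hmem v).1 (hmin G hG hFG (fun e => hwF ?_) hv)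
  have h1 : γ.symm w ∈ G := by
    rw [hmem, LinearEquiv.apply_symm_apply]
    exact hw
  rw [e] at h1
  have h2 := hγ.2 _ h1
  rw [LinearEquiv.apply_symm_apply] at h2
  rwa [h2]

theorem Sys.map_overface_span (hlt : F < F₁) {γ : V ≃ₗ[ℝ] V} (hγ : γ ∈ fixer Γ F) {v : V}
    (hv : v ∈ Submodule.span ℝ (F₁ : Set V)) : γ v ∈ Submodule.span ℝ (F₁ : Set V) := by
  have : Submodule.span ℝ (F₁ : Set V) ≤
      (Submodule.span ℝ (F₁ : Set V)).comap γ.toLinearMap :=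
    Submodule.span_le.2 fun u hu =>
      Submodule.subset_span (h.map_overface hF hF₁ hmin hlt hγ hu)
  exact this hv

/-- The face generated by `y` and a core point of `F` is strictly larger than `F`, because `x` is
not in the span of `F₁`. Hence it contains `F₁`, then `x`, and so it is all of `X`. -/
theorem Sys.mem_coreAdd (hlt : F < F₁) (hne : F₁ ≠ X) {x u y : V} (hx : x ∈ core X)
    (hu : u ∈ Submodule.span ℝ (F₁ : Set V)) (hy : y ∈ X)
    (hxy : x + u - y ∈ Submodule.span ℝ (F : Set V)) : x + u ∈ coreAdd X F := by
  obtain ⟨r, -, hr⟩ := h.exists_face_core hF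
  obtain ⟨hm, hle, hym⟩ := mem_minFace_add_of_core hF hr hy
  have hFF : Submodule.span ℝ (F : Set V) ≤ Submodule.span ℝ (F₁ : Set V) :=
    Submodule.span_mono hlt.le
  have hx₁ : x ∉ Submodule.span ℝ (F₁ : Set V) := not_mem_core_of_face_ne hF₁ hne hx
  have h1 := hmin _ (minFace_isFaceOf hm) hle fun e => hx₁ (by
    rw [e] at hym
    have := Submodule.add_mem _ (hFF hxy) (hFF (Submodule.subset_span hym))
    rw [sub_add_cancel] at this
    simpa using Submodule.sub_mem _ this hu)
  have hxm : x ∈ minFace X (r + y) hm := by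
    refine face_mem_of_mem_span (minFace_isFaceOf hm) hx.1 ?_
    have e : x = (x + u - y) + y - u := by abel
    rw [e]
    exact Submodule.sub_mem _ (Submodule.add_mem _ (Submodule.span_mono hle hxy)
      (Submodule.subset_span hym)) (Submodule.span_mono h1 hu)
  have hcore := (minFace_eq_iff hm).1 (face_eq_of_mem_core (minFace_isFaceOf hm) hxm hx)
  refine ⟨r + y, hcore, ?_⟩
  rw [show x + u - (r + y) = x + u - y - r by abel]
  exact Submodule.sub_mem _ hxy (Submodule.subset_span hr.1)

/-- For `p` outside `F`, the point `r + p` generates a face strictly above `F`, hence one containing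
`z`. -/
theorem Sys.exists_dominating {z r : V} (hz : z ∈ F₁) (hr : r ∈ core F) {P : Finset V}
    (hP : (P : Set V) ⊆ X) :
    ∃ N : ℕ, 0 < N ∧ ∀ p ∈ P, p ∉ F → N • (r + p) - z ∈ X := by
  have key : ∀ p ∈ P, p ∉ F → ∃ N : ℕ, ∀ n ≥ N, n • (r + p) - z ∈ X := by
    intro p hp hpF
    obtain ⟨hm, hle, hpm⟩ := mem_minFace_add_of_core hF hr (hP hp)
    have h1 := hmin _ (minFace_isFaceOf hm) hle fun e => hpF (e ▸ hpm)
    obtain ⟨-, ε, hε, h2⟩ := (mem_minFace hm).1 (h1 hz)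
    obtain ⟨N, hN⟩ := exists_nat_ge ε⁻¹
    refine ⟨N, fun n hn => ?_⟩
    have h3 : ε⁻¹ ≤ n := hN.trans (by exact_mod_cast hn)
    have h4 := X.add_mem (X.smul_mem (inv_nonneg.2 hε.le) h2)
      (X.smul_mem (sub_nonneg.2 h3) hm)
    rw [smul_sub, smul_smul, inv_mul_cancel₀ hε.ne', one_smul, sub_smul] at h4
    convert h4 using 1
    rw [Nat.cast_smul_eq_nsmul]
    abel
  choose! N hN using key
  refine ⟨∑ p ∈ P, N p + 1, Nat.succ_pos _, fun p hp hpF => hN p hp hpF _ ?_⟩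
  have := Finset.single_le_sum (f := N) (fun _ _ => Nat.zero_le _) hp
  omega

end

end MinimalOverface

end RatCone

namespace RatCone

/-! ### Excluding a proper least overface. -/

section MinimalOverface

variable {V : Type*} [AddCommGroup V] [Module ℝ V] [FiniteDimensional ℝ V]
  {L : AddSubgroup V} {X F F₁ : PointedCone ℝ V} {Γ : Subgroup (V ≃ₗ[ℝ] V)}
  (h : Sys L X Γ) (hF : F.IsFaceOf X) (hF₁ : F₁.IsFaceOf X)
  (hmin : ∀ G : PointedCone ℝ V, G.IsFaceOf X → F ≤ G → G ≠ F → F₁ ≤ G)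
include h hF hF₁ hmin

/-- Modulo the span of `F`, the point `x + u` is a translate of `p`, and in `p` some generator
outside the span of `F₁` has coefficient at least `c`. That generator, together with `r`, dominates
`z`, so the fixed amount `c / N` of `z` can be subtracted from `p` inside one finitely generated
cone. -/
theorem Sys.exists_step (hlt : F < F₁) (hne : F₁ ≠ X) {x z r : V} (hx : x ∈ core X) (hxL : x ∈ L)
    (hz : z ∈ F₁) (hzL : z ∈ L) (hr : r ∈ core F) (hrL : r ∈ L) :
    ∃ Q Q' : Finset V, (Q : Set V) ⊆ X ∩ L ∧ (Q' : Set V) ⊆ X ∩ L ∧ ∃ τ : ℝ, 0 < τ ∧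
      ∃ c : ℝ, ∀ u ∈ Submodule.span ℝ (F₁ : Set V), x + u ∈ coreAdd X F →
        ∃ γ ∈ fixer Γ F, ∃ p ∈ PointedCone.hull ℝ (Q : Set V),
          x + u - γ p ∈ Submodule.span ℝ (F : Set V) ∧
          p - τ • z + c • r ∈ PointedCone.hull ℝ (Q' : Set V) := by
  classical
  have hFF : Submodule.span ℝ (F : Set V) ≤ Submodule.span ℝ (F₁ : Set V) :=
    Submodule.span_mono hlt.le
  obtain ⟨Q, hQ, hcov⟩ := h.star hF
  obtain ⟨c, hc, hcoef⟩ := exists_large_coeff h.lat (h.face_span_le hF₁) Q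
  obtain ⟨N, hN, hdom⟩ := h.exists_dominating hF hF₁ hmin hz hr (P := Q) fun q hq => (hQ hq).1
  have hN' : (0 : ℝ) < N := by exact_mod_cast hN
  refine ⟨Q, Q ∪ (Q.filter (· ∉ F)).image fun p => N • (r + p) - z, hQ, ?_, c / N,
    by positivity, c, ?_⟩
  · intro q hq
    rcases Finset.mem_union.1 (Finset.mem_coe.1 hq) with hq | hq
    · exact hQ hq
    · obtain ⟨p, hp, rfl⟩ := Finset.mem_image.1 hq
      obtain ⟨hp, hpF⟩ := Finset.mem_filter.1 hp
      exact ⟨hdom p hp hpF, L.sub_mem (L.nsmul_mem (L.add_mem hrL (hQ hp).2) _) hzL⟩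
  · rintro u hu ⟨y, hy, hv⟩
    obtain ⟨γ, hγ, p, hp, hyp⟩ := hcov y hy
    have hxp : x + u - γ p ∈ Submodule.span ℝ (F : Set V) := by
      have := Submodule.add_mem _ hv hyp
      rwa [sub_add_sub_cancel] at this
    refine ⟨γ, hγ, p, hp, hxp, ?_⟩
    obtain ⟨a, ha, rfl⟩ := (mem_hull_finset Q).1 hp
    have hγs := symm_mem hγ
    have hx₁ : γ.symm x ∉ Submodule.span ℝ (F₁ : Set V) := fun hm => by
      have := h.map_overface_span hF hF₁ hmin hlt hγ hm
      rw [LinearEquiv.apply_symm_apply] at this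
      exact not_mem_core_of_face_ne hF₁ hne hx this
    obtain ⟨p, hp, hp₁, hpc⟩ := hcoef _ (h.mapL _ (fixer_le hγs) x hxL) hx₁ a ha (by
      have h1 := h.map_overface_span hF hF₁ hmin hlt hγs (Submodule.sub_mem _ hu (hFF hxp))
      have e : u - (x + u - γ (∑ p ∈ Q, a p • p)) = γ (∑ p ∈ Q, a p • p) - x := by abel
      rwa [e, map_sub, LinearEquiv.symm_apply_apply] at h1)
    have hpF : p ∉ F := fun hm => hp₁ (hFF (Submodule.subset_span hm))
    have e : ∑ p ∈ Q, a p • p - (c / N) • z + c • r = (∑ q ∈ Q.erase p, a q • q) +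
        ((a p - c) • p + (c / N) • (N • (r + p) - z)) := by
      rw [← Finset.add_sum_erase _ _ hp, ← Nat.cast_smul_eq_nsmul ℝ N, smul_sub, smul_smul,
        div_mul_cancel₀ _ hN'.ne']
      module
    rw [e]
    have hsub : ∀ q ∈ Q, q ∈ PointedCone.hull ℝ
        ((Q ∪ (Q.filter (· ∉ F)).image fun p => N • (r + p) - z : Finset V) : Set V) :=
      fun q hq => PointedCone.subset_hull (Finset.mem_coe.2 (Finset.mem_union_left _ hq))
    refine Submodule.add_mem _ (Submodule.sum_mem _ fun q hq => PointedCone.smul_mem _ (ha q)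
      (hsub q (Finset.mem_of_mem_erase hq))) (Submodule.add_mem _
      (PointedCone.smul_mem _ (sub_nonneg.2 hpc) (hsub p hp))
      (PointedCone.smul_mem _ (by positivity) (PointedCone.subset_hull ?_)))
    exact Finset.mem_coe.2 (Finset.mem_union_right _ (Finset.mem_image_of_mem _
      (Finset.mem_filter.2 ⟨hp, hpF⟩)))

/-- On every level set of `η`, some active form is bounded at `z`. -/
theorem Sys.exists_active_bounded (hlt : F < F₁) (hne : F₁ ≠ X) {η : Dual ℝ V}
    (hint : ∀ v ∈ F₁, v ∈ L → ∃ n : ℤ, η v = n) (hη : ∀ v ∈ F₁, 0 ≤ η v)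
    (hηF : ∀ v ∈ F₁, η v = 0 ↔ v ∈ F) {ξ₀ : Dual ℝ V} (hξ₀ : ξ₀ ∈ posForms L X) {x z : V}
    (hx : x ∈ core X) (hxL : x ∈ L) (hz : z ∈ core F₁) (hzL : z ∈ L) :
    ∃ τ : ℝ, 0 < τ ∧ ∃ M : ℝ, ∀ u ∈ Submodule.span ℝ (F₁ : Set V), x + u ∈ coreAdd X F →
      (∃ u' ∈ Submodule.span ℝ (F₁ : Set V), x + u' ∈ coreAdd X F ∧ η u' = η u ∧
        ∃ ξ, IsActive (fam L X F ξ₀) (x + u') ξ ∧ ξ z ≤ M) ∧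
      ∃ u' ∈ Submodule.span ℝ (F₁ : Set V), x + u' ∈ coreAdd X F ∧ η u' ≤ η u - τ := by
  have hFF : Submodule.span ℝ (F : Set V) ≤ Submodule.span ℝ (F₁ : Set V) :=
    Submodule.span_mono hlt.le
  obtain ⟨r, hrL, hr⟩ := h.exists_face_core hF
  obtain ⟨Q, Q', hQ, hQ', τ, hτ, c, hstep⟩ :=
    h.exists_step hF hF₁ hmin hlt hne hx hxL hz.1 hzL hr hrL
  have hηs : ∀ v ∈ Submodule.span ℝ (F : Set V), η v = 0 := fun v hv => by
    have : Submodule.span ℝ (F : Set V) ≤ LinearMap.ker η :=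
      Submodule.span_le.2 fun w hw => (hηF w (hlt.le hw)).2 hw
    exact this hv
  have hrs : r ∈ Submodule.span ℝ (F : Set V) := Submodule.subset_span hr.1
  -- `γ z` is a lattice point of `F₁` outside `F`, so the integral form `η` is a positive integer
  -- there.
  have hone : ∀ γ ∈ fixer Γ F, 1 ≤ η (γ z) := by
    intro γ hγ
    have hγz := h.map_overface hF hF₁ hmin hlt hγ hz.1
    obtain ⟨n, hn⟩ := hint _ hγz (h.mapL _ (fixer_le hγ) z hzL)
    have h0 : η (γ z) ≠ 0 := fun h0 => by
      have h1 := (hηF _ hγz).1 h0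
      have h2 := (symm_mem hγ).2 _ h1
      rw [LinearEquiv.symm_apply_apply] at h2
      rw [← h2] at h1
      exact hlt.ne (face_eq_of_mem_core
        ⟨hlt.le, fun hx hy ha hm => hF.mem_of_smul_add_mem (hF₁.le hx) (hF₁.le hy) ha hm⟩ h1 hz)
    have h1 := hη _ hγz
    rw [hn] at h0 h1 ⊢
    have h2 : 0 ≤ n := by exact_mod_cast h1
    have h3 : n ≠ 0 := by exact_mod_cast h0
    exact_mod_cast (by omega : 1 ≤ n)
  have hzone : 1 ≤ η z := hone 1 (Subgroup.one_mem _)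
  obtain ⟨B, hB⟩ := ((h.finite_active_coreAdd hF (ξ₀ := ξ₀) hQ').image fun ξ => ξ z).bddAbove
  let B' := max B 0
  have hB0 : 0 ≤ B' := le_max_right _ _
  -- moving inwards
  have hdesc : ∀ u ∈ Submodule.span ℝ (F₁ : Set V), ∀ γ ∈ fixer Γ F, ∀ p : V,
      x + u - γ p ∈ Submodule.span ℝ (F : Set V) →
      p - τ • z + c • r ∈ PointedCone.hull ℝ (Q' : Set V) →
      u - τ • γ z ∈ Submodule.span ℝ (F₁ : Set V) ∧ x + (u - τ • γ z) ∈ coreAdd X F ∧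
      p - τ • z + c • r ∈ coreAdd X F := by
    intro u hu γ hγ p hp hq
    have hu' : u - τ • γ z ∈ Submodule.span ℝ (F₁ : Set V) := Submodule.sub_mem _ hu
      (Submodule.smul_mem _ _ (Submodule.subset_span (h.map_overface hF hF₁ hmin hlt hγ hz.1)))
    have hqX : p - τ • z + c • r ∈ X :=
      (Submodule.span_le.2 fun q hq => (hQ' hq).1 : PointedCone.hull ℝ (Q' : Set V) ≤ X) hq
    have e : x + (u - τ • γ z) - γ (p - τ • z + c • r) = x + u - γ p - c • r := by
      rw [map_add, map_sub, map_smul, map_smul, hγ.2 r hr.1]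
      abel
    have hm : x + (u - τ • γ z) - γ (p - τ • z + c • r) ∈ Submodule.span ℝ (F : Set V) := by
      rw [e]
      exact Submodule.sub_mem _ hp (Submodule.smul_mem _ _ hrs)
    have h1 := h.mem_coreAdd hF hF₁ hmin hlt hne hx hu' (h.mapX _ (fixer_le hγ) _ hqX) hm
    refine ⟨hu', h1, ?_⟩
    have h2 := coreAdd_add h1 (Submodule.neg_mem _ hm)
    rw [neg_sub, add_sub_cancel] at h2
    have h3 := h.coreAdd_map hF (symm_mem hγ) h2
    rwa [LinearEquiv.symm_apply_apply] at h3
  -- The threshold is chosen for the exchange below: subtracting `τ` times `γ z` costs at most `τ *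
  -- B'`, and adding `s * η (γ z)` copies of `z` restores the level of `η` and leaves a net gain of
  -- at least `s = τ / η z`.
  refine ⟨τ, hτ, ξ₀ z + η z * B' + 1, fun u hu hxu => ⟨?_, ?_⟩⟩
  · by_contra! hno
    let s := τ / η z
    have hs : 0 < s := by positivity
    have hsτ : s * η z = τ := div_mul_cancel₀ _ (by positivity)
    -- If every active form on the level exceeds the threshold at `z`, each exchange raises the
    -- envelope at `x + u'` minus `ξ₀ u'` by `s`. But this quantity never exceeds `ξ₀ x`.
    have hgain : ∀ n : ℕ, ∃ u' ∈ Submodule.span ℝ (F₁ : Set V), x + u' ∈ coreAdd X F ∧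
        η u' = η u ∧ ∀ ξ, IsActive (fam L X F ξ₀) (x + u') ξ →
          ∀ ξ', IsActive (fam L X F ξ₀) (x + u) ξ' →
            ξ' (x + u) - ξ₀ u + n * s ≤ ξ (x + u') - ξ₀ u' := by
      intro n
      induction n with
      | zero =>
        refine ⟨u, hu, hxu, rfl, fun ξ hξ ξ' hξ' => ?_⟩
        have := hξ'.2 ξ hξ.1
        simp only [Nat.cast_zero, zero_mul, add_zero]
        linarith
      | succ n ih =>
        obtain ⟨u₁, hu₁, hxu₁, hηu₁, hval⟩ := ih
        obtain ⟨γ, hγ, p, hp, hxp, hq⟩ := hstep u₁ hu₁ hxu₁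
        obtain ⟨hd1, hd2, hd3⟩ := hdesc u₁ hu₁ γ hγ p hxp hq
        have hγ1 := hone γ hγ
        have hzs : z ∈ Submodule.span ℝ (F₁ : Set V) := Submodule.subset_span hz.1
        have hu₂ : u₁ - τ • γ z + (s * η (γ z)) • z ∈ Submodule.span ℝ (F₁ : Set V) :=
          Submodule.add_mem _ hd1 (Submodule.smul_mem _ _ hzs)
        have hηu₂ : η (u₁ - τ • γ z + (s * η (γ z)) • z) = η u := by
          rw [map_add, map_sub, map_smul, map_smul, smul_eq_mul, smul_eq_mul, hηu₁, ← hsτ]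
          ring
        have hxu₂ : x + (u₁ - τ • γ z + (s * η (γ z)) • z) ∈ coreAdd X F := by
          obtain ⟨y, hy, hv⟩ := hd2
          refine ⟨y + (s * η (γ z)) • z, core_add hy (X.smul_mem (by positivity)
            (hF₁.le hz.1)), ?_⟩
          rwa [← add_assoc, add_sub_add_right_eq_sub]
        refine ⟨_, hu₂, hxu₂, hηu₂, fun ξ hξ ξ' hξ' => ?_⟩
        have hM := hno _ hu₂ hxu₂ hηu₂ ξ hξ
        obtain ⟨ξ₁, hξ₁⟩ := h.exists_active_coreAdd hF hξ₀ hxu₁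
        have hrec := hval ξ₁ hξ₁ ξ' hξ'
        obtain ⟨ξ₂, hξ₂⟩ := h.exists_active_coreAdd hF hξ₀ (h.coreAdd_map hF hγ hd3)
        have hξ₂B : ξ₂ (γ z) ≤ B' := by
          refine le_trans (hB ⟨ξ₂ ∘ₗ γ.toLinearMap, ⟨_, hd3, hq, ?_⟩, rfl⟩) (le_max_left _ _)
          exact h.active_fam_comp hγ hξ₂
        have h1 := hξ₂.2 ξ hξ.1
        have h2 := hξ₁.2 ξ₂ hξ₂.1
        have e1 : ξ₂ (x + u₁) = ξ₂ (γ p) + ξ₀ (x + u₁ - γ p) := by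
          rw [← fam_apply_add hξ₂.1 hxp, add_sub_cancel]
        have hvr : x + u₁ - γ p - c • r ∈ Submodule.span ℝ (F : Set V) :=
          Submodule.sub_mem _ hxp (Submodule.smul_mem _ _ hrs)
        have e2 : ξ (x + (u₁ - τ • γ z + (s * η (γ z)) • z)) = ξ (γ (p - τ • z + c • r)) +
            ξ₀ (x + u₁ - γ p - c • r) + s * η (γ z) * ξ z := by
          have e : x + (u₁ - τ • γ z + (s * η (γ z)) • z) = γ (p - τ • z + c • r) +
              (x + u₁ - γ p - c • r) + (s * η (γ z)) • z := by
            rw [map_add, map_sub, map_smul, map_smul, hγ.2 r hr.1]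
            abel
          rw [e, map_add, fam_apply_add hξ.1 hvr, map_smul, smul_eq_mul]
        have e3 : ξ₂ (γ (p - τ • z + c • r)) = ξ₂ (γ p) - τ * ξ₂ (γ z) + c * ξ₀ r := by
          rw [map_add, map_sub, map_smul, map_smul, hγ.2 r hr.1, map_add, map_sub, map_smul,
            map_smul, hξ₂.1.2 r hr.1]
          rfl
        rw [e2]
        rw [e1] at h2
        rw [e3] at h1
        simp only [map_add, map_sub, map_smul, smul_eq_mul] at h1 h2 hrec ⊢
        push_cast
        have hξ₀z : 0 ≤ ξ₀ (γ z) := hξ₀.2.1 _ (h.mapX _ (fixer_le hγ) _ (hF₁.le hz.1))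
        have h3 : s * η (γ z) * (ξ₀ z + η z * B' + 1) ≤ s * η (γ z) * ξ z :=
          mul_le_mul_of_nonneg_left hM.le (by positivity)
        have h4 : τ * ξ₂ (γ z) ≤ τ * B' := mul_le_mul_of_nonneg_left hξ₂B hτ.le
        have h5 : s * (η z * B' + 1) * 1 ≤ s * (η z * B' + 1) * η (γ z) :=
          mul_le_mul_of_nonneg_left hγ1 (by positivity)
        have h6 : τ * B' = s * (η z * B') := by rw [← hsτ]; ring
        have h7 : 0 ≤ τ * ξ₀ (γ z) := by positivity
        linarith
    obtain ⟨ξ₁, hξ₁⟩ := h.exists_active_coreAdd hF hξ₀ hxu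
    obtain ⟨n, hn⟩ := exists_nat_gt ((ξ₀ x - (ξ₁ (x + u) - ξ₀ u)) / s)
    obtain ⟨u', -, hxu', -, hval⟩ := hgain n
    obtain ⟨ξ, hξ⟩ := h.exists_active_coreAdd hF hξ₀ hxu'
    have h1 := hval ξ hξ ξ₁ hξ₁
    have h2 := hξ.2 ξ₀ ⟨hξ₀, fun _ _ => rfl⟩
    rw [div_lt_iff₀ hs] at hn
    simp only [map_add] at h1 h2 hn
    linarith
  · obtain ⟨γ, hγ, p, hp, hxp, hq⟩ := hstep u hu hxu
    obtain ⟨hd1, hd2, hd3⟩ := hdesc u hu γ hγ p hxp hq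
    refine ⟨_, hd1, hd2, ?_⟩
    rw [map_sub, map_smul, smul_eq_mul]
    have := mul_le_mul_of_nonneg_left (hone γ hγ) hτ.le
    linarith

/-- A proper unique minimal overface of `F` does not carry an integral form that exposes `F`. -/
theorem Sys.not_exposed_of_unique (hlt : F < F₁) (hne : F₁ ≠ X) {η : Dual ℝ V}
    (hint : ∀ v ∈ F₁, v ∈ L → ∃ n : ℤ, η v = n) (hη : ∀ v ∈ F₁, 0 ≤ η v)
    (hηF : ∀ v ∈ F₁, η v = 0 ↔ v ∈ F) : False := by
  classical
  have hFF : Submodule.span ℝ (F : Set V) ≤ Submodule.span ℝ (F₁ : Set V) :=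
    Submodule.span_mono hlt.le
  obtain ⟨ξ₀, hξ₀⟩ := h.unit
  obtain ⟨x, hxL, hx⟩ := h.exists_core
  obtain ⟨z, hzL, hz⟩ := h.exists_face_core hF₁
  obtain ⟨τ, hτ, M, hM⟩ :=
    h.exists_active_bounded hF hF₁ hmin hlt hne hint hη hηF hξ₀ hx hxL hz hzL
  have hseq : ∀ n : ℕ, ∃ u ∈ Submodule.span ℝ (F₁ : Set V), x + u ∈ coreAdd X F ∧
      η u ≤ -(n * τ) := by
    intro n
    induction n with
    | zero => exact ⟨0, Submodule.zero_mem _, ⟨x, hx, by simp⟩, by simp⟩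
    | succ n ih =>
      obtain ⟨u, hu, hxu, hηu⟩ := ih
      obtain ⟨u', hu', hxu', hle⟩ := (hM u hu hxu).2
      refine ⟨u', hu', hxu', ?_⟩
      push_cast
      linarith
  have hseq' : ∀ n : ℕ, ∃ u ∈ Submodule.span ℝ (F₁ : Set V), x + u ∈ coreAdd X F ∧
      η u ≤ -(n * τ) ∧ ∃ ξ, IsActive (fam L X F ξ₀) (x + u) ξ ∧ ξ z ≤ M := by
    intro n
    obtain ⟨u, hu, hxu, hηu⟩ := hseq n
    obtain ⟨u', hu', hxu', e, ξ, hξ, hξz⟩ := (hM u hu hxu).1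
    exact ⟨u', hu', hxu', e ▸ hηu, ξ, hξ, hξz⟩
  choose u hu hxu hηu ξ hξ hξz using hseq'
  -- the restrictions to the overface take finitely many values
  obtain ⟨b, hbF, hbspan, hli⟩ := exists_linearIndependent ℝ (F₁ ∩ L : Set V)
  have hbfin : b.Finite := hli.setFinite
  lift b to Finset V using hbfin
  have hspan : Submodule.span ℝ (F₁ : Set V) ≤ Submodule.span ℝ (b : Set V) := by
    rw [hbspan]
    refine Submodule.span_le.2 fun v hv => ?_
    have h1 : F₁ ≤ (Submodule.span ℝ (F₁ ∩ L : Set V)).restrictScalars _ := by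
      conv_lhs => rw [face_hull hF₁ h.gen]
      exact Submodule.span_le.2 fun w hw => Submodule.subset_span hw
    exact h1 hv
  have hfinval : {f : b → ℝ | ∀ v : b, f v ∈ {t : ℝ | ∃ n, t = ξ n v}}.Finite := by
    refine Set.Finite.pi' fun v => ?_
    obtain ⟨N, hN, hNv⟩ := core_dom hz (hbF v.2).1
    refine finite_int_le (l := 0) (u := N * M) ?_ ?_ ?_
    · rintro _ ⟨n, rfl⟩
      exact (hξ n).1.1.1 _ (hbF v.2).2
    · rintro _ ⟨n, rfl⟩
      exact (hξ n).1.1.2.1 _ (hF₁.le (hbF v.2).1)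
    · rintro _ ⟨n, rfl⟩
      have h1 := (hξ n).1.1.2.1 _ (hF₁.le hNv)
      rw [map_sub, map_smul, smul_eq_mul] at h1
      have h2 := mul_le_mul_of_nonneg_left (hξz n) hN.le
      linarith
  obtain ⟨ρ, -, hρ⟩ := exists_forall_frequently hfinval
    (p := fun f n => ∀ v : b, f v = ξ n v) (n₀ := 0)
    fun n _ => ⟨fun v => ξ n v, fun v => ⟨n, rfl⟩, fun _ => rfl⟩
  have hagree : ∀ n m, (∀ v : b, ρ v = ξ n v) → (∀ v : b, ρ v = ξ m v) →
      ∀ w ∈ Submodule.span ℝ (F₁ : Set V), ξ n w = ξ m w := by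
    intro n m hn hm w hw
    have : Submodule.span ℝ (b : Set V) ≤ LinearMap.ker (ξ n - ξ m) :=
      Submodule.span_le.2 fun v hv => by
        rw [SetLike.mem_coe, LinearMap.mem_ker, LinearMap.sub_apply, ← hn ⟨v, hv⟩, ← hm ⟨v, hv⟩,
          sub_self]
    exact sub_eq_zero.1 (this (hspan hw))
  obtain ⟨n₀, -, hn₀⟩ := hρ 0
  have hlex : ∀ n m, (∀ v : b, ρ v = ξ n v) → (∀ v : b, ρ v = ξ m v) → ξ n x ≤ ξ m x := by
    intro n m hn hm
    have h1 := (hξ n).2 _ (hξ m).1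
    rw [map_add, map_add, hagree n m hn hm _ (hu n)] at h1
    linarith
  -- The selected forms agree on the span of `F₁`, so at these points they differ only in their
  -- value at `x`, which must be the same. Hence one form is active at all of the points.
  have hact : ∀ n, (∀ v : b, ρ v = ξ n v) → IsActive (fam L X F ξ₀) (x + u n) (ξ n₀) := by
    intro n hn
    refine ⟨(hξ n₀).1, fun ζ hζ => ?_⟩
    have h1 := (hξ n).2 ζ hζ
    rw [map_add, ← hagree n n₀ hn hn₀ _ (hu n)]
    rw [map_add] at h1
    have := hlex n₀ n hn₀ hn
    linarith
  -- finitely many translates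
  obtain ⟨Q, hQ, hcov⟩ := h.star hF
  have hgrp := h.finite_group (hξ n₀).1.1 (h.finite_active_coreAdd hF (ξ₀ := ξ₀) hQ)
  obtain ⟨γ, ⟨hγ, hγF⟩, hfreq⟩ := exists_forall_frequently
    (S := {γ : V ≃ₗ[ℝ] V | (γ ∈ Γ ∧ ξ n₀ ∘ₗ γ.toLinearMap ∈ {ξ | ∃ y ∈ coreAdd X F,
      y ∈ PointedCone.hull ℝ (Q : Set V) ∧ IsActive (fam L X F ξ₀) y ξ}) ∧ γ ∈ fixer Γ F})
    (hgrp.subset fun γ hγ => hγ.1)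
    (p := fun γ k => ∃ n ≥ k, ∃ p ∈ PointedCone.hull ℝ (Q : Set V),
      x + u n - γ p ∈ Submodule.span ℝ (F : Set V)) (n₀ := 0) (by
      intro k _
      obtain ⟨n, hnk, hn⟩ := hρ k
      obtain ⟨y, hy, hv⟩ := hxu n
      obtain ⟨γ, hγ, p, hp, hyp⟩ := hcov y hy
      have hxp : x + u n - γ p ∈ Submodule.span ℝ (F : Set V) := by
        have := Submodule.add_mem _ hv hyp
        rwa [sub_add_sub_cancel] at this
      refine ⟨γ, ⟨⟨fixer_le hγ, p, ?_, hp, ?_⟩, hγ⟩, n, hnk, p, hp, hxp⟩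
      · have h1 := coreAdd_add (hxu n) (Submodule.neg_mem _ hxp)
        rw [neg_sub, add_sub_cancel] at h1
        have h2 := h.coreAdd_map hF (symm_mem hγ) h1
        rwa [LinearEquiv.symm_apply_apply] at h2
      · have h1 := isActive_add (hact n hn) (Submodule.neg_mem _ hxp)
        rw [neg_sub, add_sub_cancel] at h1
        exact h.active_fam_comp hγ h1)
  -- Modulo the span of `F₁`, with `η` recorded, the points `x + u n` run off in the direction `(0,
  -- -1)` inside one finitely generated cone. That direction then comes from a point of `X`, which
  -- must lie in `F₁` and have `η = -1`.
  let Φ : V →ₗ[ℝ] (V ⧸ Submodule.span ℝ (F₁ : Set V)) × ℝ :=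
    (Submodule.mkQ _).prod η
  have hΦF : ∀ v ∈ Submodule.span ℝ (F : Set V), Φ v = 0 := fun v hv => by
    have h1 : η v = 0 := by
      have : Submodule.span ℝ (F : Set V) ≤ LinearMap.ker η :=
        Submodule.span_le.2 fun w hw => (hηF w (hlt.le hw)).2 hw
      exact this hv
    have h2 : Submodule.mkQ (Submodule.span ℝ (F₁ : Set V)) v = 0 :=
      (Submodule.Quotient.mk_eq_zero _).2 (hFF hv)
    exact Prod.ext h2 h1
  have hmem : ((0, -1) : (V ⧸ Submodule.span ℝ (F₁ : Set V)) × ℝ) ∈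
      PointedCone.hull ℝ ((Q.image fun q => Φ (γ q) : Finset _) : Set _) := by
    refine mem_hull_of_frequently _ (c := Φ x) fun N => ?_
    obtain ⟨k, hk⟩ := exists_nat_ge (N / τ)
    obtain ⟨k', hk', n, hn, p, hp, hxp⟩ := hfreq k
    refine ⟨-(η (u n)), ?_, ?_⟩
    · have h1 := hηu n
      have h2 : (k : ℝ) ≤ n := by exact_mod_cast hk'.trans hn
      have h3 : N ≤ k * τ := (div_le_iff₀ hτ).1 hk
      have h4 := mul_le_mul_of_nonneg_right h2 hτ.le
      linarith
    · have e : Φ x + -(η (u n)) • ((0, -1) : (V ⧸ Submodule.span ℝ (F₁ : Set V)) × ℝ) =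
          Φ (γ p) := by
        have h1 := hΦF _ hxp
        rw [map_sub, sub_eq_zero, map_add] at h1
        rw [← h1]
        congr 1
        refine Prod.ext ?_ ?_
        · rw [Prod.smul_fst, smul_zero]
          exact ((Submodule.Quotient.mk_eq_zero _).2 (hu n)).symm
        · rw [Prod.smul_snd, smul_eq_mul, neg_mul_neg, mul_one]
          rfl
      rw [e]
      obtain ⟨a, ha, rfl⟩ := (mem_hull_finset Q).1 hp
      simp only [map_sum, map_smul]
      exact Submodule.sum_mem _ fun v hv => PointedCone.smul_mem _ (ha v)
        (PointedCone.subset_hull (Finset.mem_coe.2 (Finset.mem_image_of_mem _ hv)))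
  obtain ⟨q, hq, hΦq⟩ : ∃ q ∈ X, Φ q = (0, -1) := by
    generalize ((0, -1) : (V ⧸ Submodule.span ℝ (F₁ : Set V)) × ℝ) = y at hmem
    induction hmem using Submodule.span_induction with
    | mem y hy =>
      obtain ⟨v, hv, rfl⟩ := Finset.mem_image.1 (Finset.mem_coe.1 hy)
      exact ⟨γ v, h.mapX _ hγ.1 _ (hQ hv).1, rfl⟩
    | zero => exact ⟨0, X.zero_mem, map_zero _⟩
    | add y y' _ _ hy hy' =>
      obtain ⟨p, hp, rfl⟩ := hy
      obtain ⟨p', hp', rfl⟩ := hy'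
      exact ⟨p + p', X.add_mem hp hp', map_add _ _ _⟩
    | smul a y _ hy =>
      obtain ⟨p, hp, rfl⟩ := hy
      exact ⟨(a : ℝ) • p, X.smul_mem a.2 hp, map_smul _ _ _⟩
  have hq₁ : q ∈ F₁ := face_mem_of_mem_span hF₁ hq
    ((Submodule.Quotient.mk_eq_zero _).1 (congrArg Prod.fst hΦq))
  have h1 := hη q hq₁
  have h2 : η q = -1 := congrArg Prod.snd hΦq
  linarith

end MinimalOverface

end RatCone

namespace RatCone

/-! ### The system induced on the span of a face. -/

section Subsystem

variable {V : Type*} [AddCommGroup V] [Module ℝ V]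
  {L : AddSubgroup V} {X F G : PointedCone ℝ V} {Γ : Subgroup (V ≃ₗ[ℝ] V)}

theorem mem_hull_comap {W : Submodule ℝ V} {S : Set V} (hS : S ⊆ W) {x : W}
    (hx : (x : V) ∈ PointedCone.hull ℝ S) : x ∈ PointedCone.hull ℝ (W.subtype ⁻¹' S) := by
  have key : ∀ v ∈ PointedCone.hull ℝ S, ∃ hv : v ∈ W,
      (⟨v, hv⟩ : W) ∈ PointedCone.hull ℝ (W.subtype ⁻¹' S) := by
    intro v hv
    induction hv using Submodule.span_induction with
    | mem v hv => exact ⟨hS hv, PointedCone.subset_hull hv⟩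
    | zero => exact ⟨W.zero_mem, Submodule.zero_mem _⟩
    | add v w _ _ hv hw =>
      obtain ⟨h1, h2⟩ := hv
      obtain ⟨h1', h2'⟩ := hw
      exact ⟨W.add_mem h1 h1', Submodule.add_mem _ h2 h2'⟩
    | smul a v _ hv =>
      obtain ⟨h1, h2⟩ := hv
      exact ⟨W.smul_mem (a : ℝ) h1, Submodule.smul_mem _ a h2⟩
  exact (key x hx).2

/-- A cone, viewed inside a subspace. -/
def restr (W : Submodule ℝ V) (Y : PointedCone ℝ V) : PointedCone ℝ W :=
  Y.comap W.subtype

theorem mem_core_restr {W : Submodule ℝ V} {Y : PointedCone ℝ V} (hY : ∀ y ∈ Y, y ∈ W) {x : W} :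
    x ∈ core (restr W Y) ↔ (x : V) ∈ core Y := by
  constructor
  · rintro ⟨h1, h2⟩
    refine ⟨h1, fun y hy => ?_⟩
    obtain ⟨ε, hε, h3⟩ := h2 ⟨y, hY y hy⟩ hy
    exact ⟨ε, hε, h3⟩
  · rintro ⟨h1, h2⟩
    refine ⟨h1, fun y hy => ?_⟩
    obtain ⟨ε, hε, h3⟩ := h2 y hy
    exact ⟨ε, hε, h3⟩

theorem restr_isFaceOf {W : Submodule ℝ V} (hF : F.IsFaceOf G) :
    (restr W F).IsFaceOf (restr W G) where
  le _ hx := hF.le hx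
  mem_of_smul_add_mem hx hy ha h := hF.mem_of_smul_add_mem hx hy ha h

/-- The group induced on a subspace by its stabilizer. -/
def stabOn (W : Submodule ℝ V) (Γ : Subgroup (V ≃ₗ[ℝ] V)) : Subgroup (W ≃ₗ[ℝ] W) where
  carrier := {g | ∃ γ ∈ Γ, ∀ v : W, (g v : V) = γ v}
  one_mem' := ⟨1, Γ.one_mem, fun _ => rfl⟩
  mul_mem' := by
    rintro g g' ⟨γ, hγ, h⟩ ⟨γ', hγ', h'⟩
    refine ⟨γ * γ', Γ.mul_mem hγ hγ', fun v => ?_⟩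
    change ((g (g' v) : W) : V) = γ (γ' v)
    rw [h, h']
  inv_mem' := by
    rintro g ⟨γ, hγ, h⟩
    refine ⟨γ⁻¹, Γ.inv_mem hγ, fun v => ?_⟩
    change ((g.symm v : W) : V) = γ.symm v
    rw [LinearEquiv.eq_symm_apply, ← h, LinearEquiv.apply_symm_apply]

variable [FiniteDimensional ℝ V]

theorem face_comap (h : Sys L X Γ) {γ : V ≃ₗ[ℝ] V} (hγ : γ ∈ Γ) (hG : G.IsFaceOf X) :
    (G.comap γ.toLinearMap : PointedCone ℝ V).IsFaceOf X where
  le u hu := by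
    have := h.mapX _ (symm_mem hγ) _ (hG.le (show γ u ∈ G from hu))
    rwa [LinearEquiv.symm_apply_apply] at this
  mem_of_smul_add_mem := by
    intro x y a hx hy ha hm
    have hm' : γ (a • x + y) ∈ G := hm
    rw [map_add, map_smul] at hm'
    exact hG.mem_of_smul_add_mem (h.mapX _ hγ _ hx) (h.mapX _ hγ _ hy) ha hm'

theorem Sys.map_face_of_core (h : Sys L X Γ) {γ : V ≃ₗ[ℝ] V} (hγ : γ ∈ Γ) (hG : G.IsFaceOf X)
    {y : V} (hy : y ∈ core G) (hγy : γ y ∈ G) {v : V} (hv : v ∈ G) : γ v ∈ G :=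
  face_eq_of_mem_core_le hG (face_comap h hγ hG) (show γ y ∈ G from hγy) hy hv

theorem exists_stabOn {W : Submodule ℝ V} (hW : Submodule.span ℝ (G : Set V) = W)
    {γ : V ≃ₗ[ℝ] V} (hγ : γ ∈ Γ) (h1 : ∀ v ∈ G, γ v ∈ G)
    (h2 : ∀ v ∈ G, γ.symm v ∈ G) :
    ∃ g ∈ stabOn W Γ, ∀ v, (g v : V) = γ v := by
  have h3 : W.map γ.toLinearMap = W := by
    rw [← hW, Submodule.map_span]
    congr 1
    ext v
    constructor
    · rintro ⟨w, hw, rfl⟩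
      exact h1 w hw
    · intro hv
      exact ⟨γ.symm v, h2 v hv, γ.apply_symm_apply v⟩
  exact ⟨γ.ofSubmodules _ _ h3, ⟨γ, hγ, fun v => rfl⟩, fun v => rfl⟩

/-- A lattice, intersected with a subspace. -/
def restrLat (W : Submodule ℝ V) (L : AddSubgroup V) : AddSubgroup W :=
  L.comap W.subtype.toAddMonoidHom

theorem restr_gen {W : Submodule ℝ V} (hGW : ∀ y ∈ G, y ∈ W)
    (hG : G = PointedCone.hull ℝ (G ∩ L : Set V)) :
    restr W G = PointedCone.hull ℝ (restr W G ∩ restrLat W L : Set W) := by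
  ext x
  constructor
  · intro hx
    have hx' : (x : V) ∈ G := hx
    rw [hG] at hx'
    have h1 := mem_hull_comap (fun y hy => hGW y hy.1) hx'
    refine Submodule.span_mono ?_ h1
    exact fun y hy => ⟨hy.1, hy.2⟩
  · intro hx
    have h1 : PointedCone.hull ℝ (restr W G ∩ restrLat W L : Set W) ≤ restr W G :=
      Submodule.span_le.2 fun y hy => hy.1
    exact h1 hx

theorem restr_span {W : Submodule ℝ V} (hW : Submodule.span ℝ (G : Set V) = W) :
    Submodule.span ℝ (restr W G : Set W) = ⊤ := by
  have hGW : ∀ y ∈ G, y ∈ W := fun y hy => hW ▸ Submodule.subset_span hy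
  rw [eq_top_iff]
  rintro x -
  obtain ⟨a, ha, b, hb, e⟩ := mem_span_iff_sub.1 (show (x : V) ∈ Submodule.span ℝ (G : Set V) from
    hW ▸ x.2)
  exact mem_span_iff_sub.2 ⟨⟨a, hGW a ha⟩, ha, ⟨b, hGW b hb⟩, hb, Subtype.ext e⟩

theorem le_span_of_hull {Y : PointedCone ℝ V} (hY : Y = PointedCone.hull ℝ (Y ∩ L : Set V)) {x : V}
    (hx : x ∈ Y) : x ∈ Submodule.span ℝ (L : Set V) := by
  have hle : PointedCone.hull ℝ (Y ∩ L : Set V) ≤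
      (Submodule.span ℝ (L : Set V)).restrictScalars _ :=
    Submodule.span_le.2 fun y hy => Submodule.subset_span hy.2
  exact hle (hY ▸ hx)

/-- The system induced on the span of a face. -/
theorem Sys.sub (h : Sys L X Γ) (hG : G.IsFaceOf X) {W : Submodule ℝ V}
    (hW : Submodule.span ℝ (G : Set V) = W) :
    Sys (restrLat W L) (restr W G) (stabOn W Γ) := by
  classical
  have hGW : ∀ y ∈ G, y ∈ W := fun y hy => hW ▸ Submodule.subset_span hy
  have hgen := restr_gen hGW (face_hull hG h.gen)
  have hspan := restr_span hW
  have hext : ∀ α : Dual ℝ W, ∃ β : Dual ℝ V,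
      β ∘ₗ W.subtype = α := fun α => LinearMap.exists_extend α
  refine ⟨⟨?_, ?_⟩, hgen, hspan, ?_, ?_, ?_, ?_⟩
  · rw [← top_le_iff, ← hspan, Submodule.span_le]
    exact fun x hx => le_span_of_hull hgen hx
  · rw [eq_top_iff]
    rintro α -
    obtain ⟨β, rfl⟩ := hext α
    have hβ : β ∈ Submodule.span ℝ (dualLat L : Set (Dual ℝ V)) := by
      rw [h.lat.dual_span]; exact Submodule.mem_top
    induction hβ using Submodule.span_induction with
    | mem β hβ => exact Submodule.subset_span fun v hv => hβ _ hv
    | zero => rw [LinearMap.zero_comp]; exact Submodule.zero_mem _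
    | add x y _ _ hx hy => rw [LinearMap.add_comp]; exact Submodule.add_mem _ hx hy
    | smul c x _ hx => rw [LinearMap.smul_comp]; exact Submodule.smul_mem _ _ hx
  · obtain ⟨ξ, hξL, hξ0, hξ⟩ := h.unit
    refine ⟨ξ ∘ₗ W.subtype, fun v hv => hξL _ hv,
      fun v hv => hξ0 _ (hG.le hv), fun α => ?_⟩
    obtain ⟨β, rfl⟩ := hext α
    obtain ⟨N, hN⟩ := hξ β
    exact ⟨N, fun x hx => hN _ (hG.le hx)⟩
  · rintro g ⟨γ, hγ, hg⟩ v hv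
    change ((g v : _) : V) ∈ L
    rw [hg]
    exact h.mapL γ hγ _ hv
  · rintro g ⟨γ, hγ, hg⟩ v hv
    refine face_mem_of_mem_span hG ?_ (hW ▸ (g v).2)
    change ((g v : W) : V) ∈ X
    rw [hg]
    exact h.mapX γ hγ _ (hG.le hv)
  · obtain ⟨P, hP, hcov⟩ := h.cover
    -- A point of `core G` is a translate of a positive combination of some `I ⊆ P`, and the same
    -- element moves the sum of `I` into `core G`. One element `δ I` is fixed for each such `I`; any
    -- other differs from it by an element preserving `G`.
    have hch : ∀ I : Finset V, ∃ δ : V ≃ₗ[ℝ] V, (∃ γ ∈ Γ, γ (∑ p ∈ I, p) ∈ core G) →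
        δ ∈ Γ ∧ δ (∑ p ∈ I, p) ∈ core G := fun I => by
      by_cases hI : ∃ γ ∈ Γ, γ (∑ p ∈ I, p) ∈ core G
      · obtain ⟨γ, hγ, h1⟩ := hI
        exact ⟨γ, fun _ => ⟨hγ, h1⟩⟩
      · exact ⟨1, fun h1 => absurd h1 hI⟩
    choose δ hδ using hch
    have hsummand : ∀ I ⊆ P, ∀ γ ∈ Γ, γ (∑ p ∈ I, p) ∈ G → ∀ p ∈ I, γ p ∈ G := by
      intro I hI γ hγ hm p hp
      rw [← Finset.add_sum_erase _ _ hp, map_add] at hm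
      refine hG.mem_of_smul_add_mem (a := 1) (h.mapX γ hγ _ (hP (hI hp)).1)
        (h.mapX γ hγ _ (X.sum_mem fun q hq => (hP (hI (Finset.mem_of_mem_erase hq))).1))
        one_pos (by rwa [one_smul])
    let Q : Finset V := P.powerset.biUnion fun I =>
      if (∃ γ ∈ Γ, γ (∑ p ∈ I, p) ∈ core G) then I.image (δ I) else ∅
    have hQ : ∀ q, q ∈ Q ↔ ∃ I ⊆ P, (∃ γ ∈ Γ, γ (∑ p ∈ I, p) ∈ core G) ∧ ∃ p ∈ I, δ I p = q := by
      intro q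
      rw [Finset.mem_biUnion]
      constructor
      · rintro ⟨I, hI, hq⟩
        split_ifs at hq with hI'
        · obtain ⟨p, hp, e⟩ := Finset.mem_image.1 hq
          exact ⟨I, Finset.mem_powerset.1 hI, hI', p, hp, e⟩
        · simp at hq
      · rintro ⟨I, hI, hI', p, hp, e⟩
        refine ⟨I, Finset.mem_powerset.2 hI, ?_⟩
        rw [if_pos hI']
        exact Finset.mem_image.2 ⟨p, hp, e⟩
    have hQG : (Q : Set V) ⊆ G ∩ L := by
      intro q hq
      obtain ⟨I, hI, hI', p, hp, rfl⟩ := (hQ q).1 hq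
      obtain ⟨hδΓ, hδc⟩ := hδ I hI'
      exact ⟨hsummand I hI _ hδΓ hδc.1 p hp, h.mapL _ hδΓ _ (hP (hI hp)).2⟩
    refine ⟨Q.preimage W.subtype
      W.subtype_injective.injOn, ?_, ?_⟩
    · intro q hq
      exact hQG (Finset.mem_preimage.1 (Finset.mem_coe.1 hq))
    · intro x hx
      rw [mem_core_restr hGW] at hx
      obtain ⟨γ, hγ, p, hp, hγp⟩ := h.full_cover hP hcov (hG.le hx.1)
      obtain ⟨a, ha, rfl⟩ := (mem_hull_finset P).1 hp
      let I := P.filter fun p => a p ≠ 0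
      have hIP : I ⊆ P := Finset.filter_subset _ _
      have hsum : ∑ p ∈ P, a p • p = ∑ p ∈ I, a p • p := by
        refine (Finset.sum_subset hIP fun p hp hpI => ?_).symm
        have : a p = 0 := by
          by_contra h0
          exact hpI (Finset.mem_filter.2 ⟨hp, h0⟩)
        rw [this, zero_smul]
      rw [hsum] at hγp
      have hIG : ∀ p ∈ I, γ p ∈ G := by
        intro p hp
        have hpos : 0 < a p := lt_of_le_of_ne (ha p) (Ne.symm (Finset.mem_filter.1 hp).2)
        have hm : γ (∑ p ∈ I, a p • p) ∈ G := hγp ▸ hx.1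
        rw [← Finset.add_sum_erase _ _ hp, map_add, map_smul] at hm
        exact hG.mem_of_smul_add_mem (h.mapX γ hγ _ (hP (hIP hp)).1)
          (h.mapX γ hγ _ (X.sum_mem fun q hq => X.smul_mem (ha q)
            (hP (hIP (Finset.mem_of_mem_erase hq))).1)) hpos hm
      have hrI : γ (∑ p ∈ I, p) ∈ core G := by
        have hb : 0 < ∑ p ∈ I, a p + 1 :=
          add_pos_of_nonneg_of_pos (Finset.sum_nonneg fun p _ => ha p) one_pos
        refine mem_core_of_sub_mem hb hx ?_
        rw [← hγp, map_sum, map_sum, Finset.smul_sum, ← Finset.sum_sub_distrib]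
        refine G.sum_mem fun p hp => ?_
        rw [map_smul, ← sub_smul]
        refine G.smul_mem ?_ (hIG p hp)
        have := Finset.single_le_sum (f := a) (fun q _ => ha q) hp
        linarith
      have hI' : ∃ γ ∈ Γ, γ (∑ p ∈ I, p) ∈ core G := ⟨γ, hγ, hrI⟩
      obtain ⟨hδΓ, hδc⟩ := hδ I hI'
      have hmem : γ * (δ I)⁻¹ ∈ Γ := Γ.mul_mem hγ (Γ.inv_mem hδΓ)
      have hcomp : ∀ v, (γ * (δ I)⁻¹) (δ I v) = γ v := fun v => by
        change γ ((δ I).symm (δ I v)) = γ v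
        rw [LinearEquiv.symm_apply_apply]
      obtain ⟨g, hg, hgv⟩ := exists_stabOn hW hmem
        (fun v hv => h.map_face_of_core hmem hG hδc (by rw [hcomp]; exact hrI.1) hv)
        (fun v hv => h.map_face_of_core (symm_mem hmem) hG hrI (by
          rw [← hcomp, LinearEquiv.symm_apply_apply]; exact hδc.1) hv)
      have hsumG : ∑ p ∈ I, a p • δ I p ∈ G := G.sum_mem fun p hp =>
        G.smul_mem (ha p) (hsummand I hIP _ hδΓ hδc.1 p hp)
      refine ⟨g, hg, ⟨∑ p ∈ I, a p • δ I p, hGW _ hsumG⟩, ?_, ?_⟩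
      · rw [Finset.coe_preimage]
        refine mem_hull_comap (fun q hq => hGW q (hQG hq).1) ?_
        exact Submodule.sum_mem _ fun p hp => PointedCone.smul_mem _ (ha p)
          (PointedCone.subset_hull (Finset.mem_coe.2 ((hQ _).2 ⟨I, hIP, hI', p, hp, rfl⟩)))
      · refine Subtype.ext ?_
        rw [hgv]
        change (γ * (δ I)⁻¹) (∑ p ∈ I, a p • δ I p) = x
        rw [map_sum]
        simp only [map_smul, hcomp]
        rw [← hγp, map_sum]
        simp only [map_smul]

end Subsystem

end RatCone

namespace RatCone

/-! ### Every face is exposed by an integral form. -/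

section Exposed

variable {V : Type*} [AddCommGroup V] [Module ℝ V]

/-- The integral forms which are nonnegative on `X` and vanish exactly on `F`. -/
def exposing (L : AddSubgroup V) (X F : PointedCone ℝ V) : Set (Dual ℝ V) :=
  {ξ | ξ ∈ dualLat L ∧ (∀ x ∈ X, 0 ≤ ξ x) ∧ ∀ x ∈ X, ξ x = 0 ↔ x ∈ F}

end Exposed

/-- Every face of a system is exposed by an integral form. -/
theorem exists_exposing_aux.{u} (n : ℕ) : ∀ {V : Type u} [AddCommGroup V] [Module ℝ V]
    [FiniteDimensional ℝ V] {L : AddSubgroup V} {X F : PointedCone ℝ V}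
    {Γ : Subgroup (V ≃ₗ[ℝ] V)}, finrank ℝ V ≤ n → Sys L X Γ → F.IsFaceOf X →
      (exposing L X F).Nonempty := by
  induction n using Nat.strong_induction_on with
  | _ n ihn =>
  intro V _ _ _ L X F Γ hn h hF
  -- The outer induction is on the dimension of `V`, the inner one on the codimension of the span of
  -- `F`. Below, `F₁` is a face of least dimension strictly above `F`.
  induction hm : finrank ℝ V - finrank ℝ (Submodule.span ℝ (F : Set V)) using
    Nat.strong_induction_on generalizing F with
  | _ m ih =>
  by_cases hFX : F = X
  · subst hFX
    exact ⟨0, (dualLat L).zero_mem, fun _ _ => le_rfl, fun x hx => by simpa using hx⟩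
  have hex : ∃ G : PointedCone ℝ V, G.IsFaceOf X ∧ F < G :=
    ⟨X, PointedCone.IsFaceOf.refl X, lt_of_le_of_ne hF.le hFX⟩
  obtain ⟨F₁, ⟨hF₁, hlt⟩, hleast⟩ := exists_minimalFor_of_wellFoundedLT
    (fun G : PointedCone ℝ V => G.IsFaceOf X ∧ F < G)
    (fun G => finrank ℝ (Submodule.span ℝ (G : Set V))) hex
  have hrec : ∀ G : PointedCone ℝ V, G.IsFaceOf X → F < G → (exposing L X G).Nonempty := by
    intro G hG hFG
    refine ih _ ?_ hG rfl
    have h1 := finrank_face_lt hF hG.le hFG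
    have h2 := Submodule.finrank_le (Submodule.span ℝ (G : Set V))
    omega
  by_cases hG : ∃ G : PointedCone ℝ V, G.IsFaceOf X ∧ F < G ∧ ¬ F₁ ≤ G
  · obtain ⟨G, hG, hFG, hnle⟩ := hG
    -- Least dimension of `F₁` forces this, and the sum of two exposing forms exposes the
    -- intersection.
    have hinf : F₁ ⊓ G = F := by
      by_contra hne
      have hI : (F₁ ⊓ G).IsFaceOf X := ⟨inf_le_left.trans hF₁.le, fun hx hy ha hm =>
        ⟨hF₁.mem_of_smul_add_mem hx hy ha hm.1, hG.mem_of_smul_add_mem hx hy ha hm.2⟩⟩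
      have hlt' : F < F₁ ⊓ G := lt_of_le_of_ne (le_inf hlt.le hFG.le) (Ne.symm hne)
      have h1 : F₁ ⊓ G < F₁ := lt_of_le_of_ne inf_le_left fun e => hnle (inf_eq_left.1 e)
      have h2 := finrank_face_lt hI hF₁.le h1
      have h3 := hleast ⟨hI, hlt'⟩ h2.le
      simp only at h3
      omega
    obtain ⟨ξ, hξL, hξ0, hξ⟩ := hrec F₁ hF₁ hlt
    obtain ⟨ζ, hζL, hζ0, hζ⟩ := hrec G hG hFG
    refine ⟨ξ + ζ, (dualLat L).add_mem hξL hζL, fun x hx => add_nonneg (hξ0 x hx) (hζ0 x hx),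
      fun x hx => ?_⟩
    rw [← hinf, LinearMap.add_apply, add_eq_zero_iff_of_nonneg (hξ0 x hx) (hζ0 x hx), hξ x hx,
      hζ x hx]
    rfl
  · push Not at hG
    have hmin : ∀ G : PointedCone ℝ V, G.IsFaceOf X → F ≤ G → G ≠ F → F₁ ≤ G :=
      fun G hG' hle hne => hG G hG' (lt_of_le_of_ne hle (Ne.symm hne))
    by_cases hX : F₁ = X
    · subst hX
      obtain ⟨β, hβL, hβ0, hβF, x, hx, hβx⟩ := h.exists_of_maximal hF hFX fun G hG hle hne =>
        le_antisymm hG.le (hmin G hG hle hne)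
      refine ⟨β, hβL, hβ0, fun x hx => ⟨fun h0 => ?_, hβF x⟩⟩
      have hz := zeroFace_isFaceOf hβ0
      have hFz : F ≤ zeroFace F₁ β := fun v hv => mem_zeroFace.2 ⟨hF.le hv, hβF v hv⟩
      have : zeroFace F₁ β = F := by
        by_contra hne
        exact hβx (mem_zeroFace.1 (hmin _ hz hFz hne ‹_›)).2
      rw [← this]
      exact mem_zeroFace.2 ⟨hx, h0⟩
    -- Inside the smaller space spanned by `F₁` the face `F` is exposed by the outer induction; this
    -- is impossible for a proper least overface.
    · exfalso
      have hsub := h.sub hF₁ rfl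
      have hlt₁ : finrank ℝ (Submodule.span ℝ (F₁ : Set V)) < finrank ℝ V := by
        have := finrank_face_lt hF₁ le_rfl (lt_of_le_of_ne hF₁.le hX)
        rwa [h.span_top, finrank_top] at this
      have hface : F.IsFaceOf F₁ := ⟨hlt.le, fun hx hy ha hm =>
        hF.mem_of_smul_add_mem (hF₁.le hx) (hF₁.le hy) ha hm⟩
      obtain ⟨η, hηL, hη0, hη⟩ := ihn _ (lt_of_lt_of_le hlt₁ hn) le_rfl hsub (restr_isFaceOf hface)
      obtain ⟨η', rfl⟩ := LinearMap.exists_extend η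
      have hmem : ∀ v ∈ F₁, v ∈ Submodule.span ℝ (F₁ : Set V) :=
        fun v hv => Submodule.subset_span hv
      exact h.not_exposed_of_unique hF hF₁ hmin hlt hX (η := η')
        (fun v hv hvL => hηL ⟨v, hmem v hv⟩ hvL) (fun v hv => hη0 ⟨v, hmem v hv⟩ hv)
        (fun v hv => hη ⟨v, hmem v hv⟩ hv)

theorem Sys.exists_exposing {V : Type*} [AddCommGroup V] [Module ℝ V] [FiniteDimensional ℝ V]
    {L : AddSubgroup V} {X F : PointedCone ℝ V} {Γ : Subgroup (V ≃ₗ[ℝ] V)} (h : Sys L X Γ)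
    (hF : F.IsFaceOf X) : (exposing L X F).Nonempty :=
  exists_exposing_aux _ le_rfl h hF

end RatCone

namespace RatCone

/-! ### Integral forms vanishing on a face, and their domination by exposing forms. -/

section Dag

variable {V : Type*} [AddCommGroup V] [Module ℝ V]
  {L : AddSubgroup V} {X F G : PointedCone ℝ V} {Γ : Subgroup (V ≃ₗ[ℝ] V)}

/-- The integral forms which are nonnegative on `X` and vanish on `F`. -/
def dag (L : AddSubgroup V) (X F : PointedCone ℝ V) : Set (Dual ℝ V) :=
  {ξ | ξ ∈ dualLat L ∧ (∀ x ∈ X, 0 ≤ ξ x) ∧ ∀ x ∈ F, ξ x = 0}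

/-- The annihilator of `dag L X F`. -/
def upper (L : AddSubgroup V) (X F : PointedCone ℝ V) : Submodule ℝ V :=
  (Submodule.span ℝ (dag L X F)).dualCoannihilator

theorem mem_upper {v : V} : v ∈ upper L X F ↔ ∀ ξ ∈ dag L X F, ξ v = 0 := by
  rw [upper, Submodule.mem_dualCoannihilator]
  refine ⟨fun h ξ hξ => h ξ (Submodule.subset_span hξ), fun h ξ hξ => ?_⟩
  induction hξ using Submodule.span_induction with
  | mem x hx => exact h x hx
  | zero => simp
  | add x y _ _ hx hy => rw [LinearMap.add_apply, hx, hy, add_zero]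
  | smul a x _ hx => rw [LinearMap.smul_apply, hx, smul_zero]

theorem exposing_subset_dag (hF : F ≤ X) : exposing L X F ⊆ dag L X F :=
  fun _ hξ => ⟨hξ.1, hξ.2.1, fun x hx => (hξ.2.2 x (hF hx)).2 hx⟩

theorem dag_anti (hFG : F ≤ G) : dag L X G ⊆ dag L X F :=
  fun _ hξ => ⟨hξ.1, hξ.2.1, fun x hx => hξ.2.2 x (hFG hx)⟩

theorem span_le_upper : Submodule.span ℝ (F : Set V) ≤ upper L X F :=
  Submodule.span_le.2 fun _ hv => mem_upper.2 fun _ hξ => hξ.2.2 _ hv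

theorem dag_add {ξ ζ : Dual ℝ V} (hξ : ξ ∈ dag L X F) (hζ : ζ ∈ dag L X F) :
    ξ + ζ ∈ dag L X F :=
  ⟨(dualLat L).add_mem hξ.1 hζ.1, fun x hx => add_nonneg (hξ.2.1 x hx) (hζ.2.1 x hx),
    fun x hx => by rw [LinearMap.add_apply, hξ.2.2 x hx, hζ.2.2 x hx, add_zero]⟩

theorem zero_mem_dag : (0 : Dual ℝ V) ∈ dag L X F :=
  ⟨(dualLat L).zero_mem, fun _ _ => le_rfl, fun _ _ => rfl⟩

variable [FiniteDimensional ℝ V]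

theorem span_dag : Submodule.span ℝ (dag L X F) = (upper L X F).dualAnnihilator :=
  Subspace.dualCoannihilator_dualAnnihilator_eq.symm

theorem upper_rational (hL : IsLat L) :
    upper L X F ≤ Submodule.span ℝ (upper L X F ∩ L : Set V) := by
  intro v hv
  have h1 := hL.kernel (S := dag L X F) (fun ξ hξ => hξ.1) (mem_upper.1 hv)
  refine Submodule.span_mono ?_ h1
  exact fun w hw => ⟨mem_upper.2 hw.1, hw.2⟩

/-- An integral core point of the cone generated by `dag L X F` works, since the span of that cone
is the whole annihilator of `upper L X F`. -/
theorem exists_dag_dominating : ∃ β ∈ dag L X F, ∀ α ∈ (upper L X F).dualAnnihilator,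
    ∃ N : ℝ, 0 < N ∧ ∀ x ∈ X, α x ≤ N * β x := by
  obtain ⟨β, hβ, hc⟩ := exists_mem_core_hull (dag L X F)
  refine ⟨β, ?_, fun α hα => ?_⟩
  · have : AddSubmonoid.closure (dag L X F) ≤
        { carrier := dag L X F, add_mem' := dag_add, zero_mem' := zero_mem_dag } :=
      AddSubmonoid.closure_le.2 fun _ h => h
    exact this hβ
  · rw [← span_dag] at hα
    obtain ⟨N, hN, hm⟩ := mem_core_of_smul_sub hc (y := -α)
      (Submodule.neg_mem _ (Submodule.span_mono PointedCone.subset_hull hα))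
    refine ⟨N, hN, fun x hx => ?_⟩
    have h0 : 0 ≤ (N • β + -α) x := by
      have h1 := hm.1
      generalize N • β + -α = ζ at h1
      induction h1 using Submodule.span_induction with
      | mem ζ hζ => exact hζ.2.1 x hx
      | zero => simp
      | add ζ ζ' _ _ h h' => exact add_nonneg h h'
      | smul a ζ _ h => exact mul_nonneg a.2 h
    simp only [LinearMap.add_apply, LinearMap.smul_apply, LinearMap.neg_apply, smul_eq_mul] at h0
    linarith

variable (h : Sys L X Γ)
include h

theorem Sys.dag_comp {γ : V ≃ₗ[ℝ] V} (hγ : γ ∈ fixer Γ F) {ξ : Dual ℝ V} (hξ : ξ ∈ dag L X F) :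
    ξ ∘ₗ γ.toLinearMap ∈ dag L X F :=
  ⟨fun v hv => hξ.1 _ (h.mapL _ (fixer_le hγ) v hv),
    fun x hx => hξ.2.1 _ (h.mapX _ (fixer_le hγ) x hx), fun x hx => by
      rw [LinearMap.comp_apply, LinearEquiv.coe_coe, hγ.2 x hx, hξ.2.2 x hx]⟩

theorem Sys.exposing_comp {γ : V ≃ₗ[ℝ] V} (hγ : γ ∈ fixer Γ F) {ξ : Dual ℝ V}
    (hξ : ξ ∈ exposing L X F) : ξ ∘ₗ γ.toLinearMap ∈ exposing L X F :=
  ⟨fun v hv => hξ.1 _ (h.mapL _ (fixer_le hγ) v hv),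
    fun x hx => hξ.2.1 _ (h.mapX _ (fixer_le hγ) x hx), fun x hx => by
      rw [LinearMap.comp_apply, LinearEquiv.coe_coe, hξ.2.2 _ (h.mapX _ (fixer_le hγ) x hx)]
      refine ⟨fun hm => ?_, fun hm => by rwa [hγ.2 x hm]⟩
      have := (symm_mem hγ).2 _ hm
      rw [LinearEquiv.symm_apply_apply] at this
      rwa [this]⟩

theorem Sys.upper_map {γ : V ≃ₗ[ℝ] V} (hγ : γ ∈ fixer Γ F) {v : V} :
    v ∈ upper L X F ↔ γ v ∈ upper L X F := by
  rw [mem_upper, mem_upper]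
  refine ⟨fun hv ξ hξ => hv _ (h.dag_comp hγ hξ), fun hv ξ hξ => ?_⟩
  have := hv _ (h.dag_comp (symm_mem hγ) hξ)
  simpa using this

/-- An exposing form of `F` dominates all forms of `dag L X F`. -/
theorem Sys.exposing_dominates (hF : F.IsFaceOf X) {ξ : Dual ℝ V} (hξ : ξ ∈ exposing L X F)
    {α : Dual ℝ V} (hα : α ∈ (upper L X F).dualAnnihilator) :
    ∃ N : ℝ, 0 < N ∧ ∀ x ∈ X, α x ≤ N * ξ x := by
  obtain ⟨β, hβ, hdom⟩ := exists_dag_dominating (L := L) (X := X) (F := F)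
  have hdag : ∀ ζ ∈ dag L X F, ζ ∈ (upper L X F).dualAnnihilator := fun ζ hζ =>
    span_dag (L := L) (X := X) (F := F) ▸ Submodule.subset_span hζ
  suffices hmain : ∃ t : ℝ, 0 < t ∧ ∀ x ∈ X, β x ≤ t * ξ x by
    obtain ⟨t, ht, hle⟩ := hmain
    obtain ⟨N, hN, hNα⟩ := hdom α hα
    refine ⟨N * t, by positivity, fun x hx => (hNα x hx).trans ?_⟩
    rw [mul_assoc]
    exact mul_le_mul_of_nonneg_left (hle x hx) hN.le
  obtain ⟨Q, hQ, hcov⟩ := h.star hF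
  obtain ⟨c, hc⟩ := (Q.finite_toSet.image β).bddAbove
  have hc' : ∀ q ∈ Q, β q ≤ max c 0 := fun q hq => (hc ⟨q, hq, rfl⟩).trans (le_max_left _ _)
  have hc0 : 0 ≤ max c 0 := le_max_right _ _
  generalize max c 0 = c at hc' hc0
  -- `ξ ∘ γ` also exposes `F`, so it is at least 1 at each generator in `Q` outside `F`, where `β`
  -- is at most `c`; on `F` the form `β` vanishes.
  have hstar : ∀ x ∈ core X, ∃ γ ∈ fixer Γ F, β (γ.symm x) ≤ c * ξ x := by
    intro x hx
    obtain ⟨γ, hγ, p, hp, hv⟩ := hcov x hx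
    have hγξ := h.exposing_comp hγ hξ
    have h1 : ∀ ζ ∈ dag L X F, ζ x = ζ (γ p) := fun ζ hζ => by
      rw [← sub_eq_zero, ← map_sub]
      exact mem_upper.1 (span_le_upper hv) ζ hζ
    refine ⟨γ, hγ, ?_⟩
    have h2 := h1 _ (h.dag_comp (symm_mem hγ) hβ)
    simp only [LinearMap.comp_apply, LinearEquiv.coe_coe, LinearEquiv.symm_apply_apply] at h2
    rw [h2, h1 ξ (exposing_subset_dag hF.le hξ)]
    obtain ⟨a, ha, rfl⟩ := (mem_hull_finset Q).1 hp
    rw [map_sum, map_sum, map_sum, Finset.mul_sum]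
    refine Finset.sum_le_sum fun q hq => ?_
    rw [map_smul, map_smul, map_smul, smul_eq_mul, smul_eq_mul, mul_left_comm]
    refine mul_le_mul_of_nonneg_left ?_ (ha q)
    by_cases hqF : q ∈ F
    · rw [hβ.2.2 q hqF]
      exact mul_nonneg hc0 (hγξ.2.1 q (hQ hq).1)
    · obtain ⟨n, hn⟩ := dualLat_nat hγξ.1 hγξ.2.1 (hQ hq).1 (hQ hq).2
      have hn' : ξ (γ q) = n := hn
      have hn0 : n ≠ 0 := by
        rintro rfl
        exact hqF ((hγξ.2.2 q (hQ hq).1).1 (by simpa using hn))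
      have h3 : (1 : ℝ) ≤ n := by exact_mod_cast Nat.one_le_iff_ne_zero.2 hn0
      rw [hn']
      exact (hc' q hq).trans (le_mul_of_one_le_right hc0 h3)
  obtain ⟨x, hxL, hx⟩ := h.exists_core
  have hξx := hξ.2.1 x hx.1
  -- finitely many translates of `β` are bounded at `x`
  obtain ⟨N, hN, hNβ⟩ : ∃ N : ℝ, 0 < N ∧ ∀ γ ∈ fixer Γ F, β (γ.symm x) ≤ c * (ξ x + 1) →
      ∀ y ∈ X, β y ≤ N * β (γ.symm y) := by
    have hfin := finite_forms h.gen h.span_top hx (c * (ξ x + 1))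
    have hex : ∀ ζ : Dual ℝ V, ∃ N : ℝ, 0 < N ∧ ∀ γ ∈ fixer Γ F, ζ = β ∘ₗ γ.symm.toLinearMap →
        ∀ y ∈ X, β y ≤ N * ζ y := by
      intro ζ
      by_cases hζ : ∃ γ ∈ fixer Γ F, ζ = β ∘ₗ γ.symm.toLinearMap
      · obtain ⟨γ, hγ, rfl⟩ := hζ
        obtain ⟨N, hN, hle⟩ := hdom _ (hdag _ (h.dag_comp hγ hβ))
        refine ⟨N, hN, fun _ _ _ y hy => ?_⟩
        have := hle _ (h.mapX _ (symm_mem (fixer_le hγ)) y hy)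
        simpa using this
      · exact ⟨1, one_pos, fun γ hγ e => absurd ⟨γ, hγ, e⟩ hζ⟩
    choose N hN hNle using hex
    obtain ⟨B, hB⟩ := (hfin.image N).bddAbove
    refine ⟨max B 1, lt_max_of_lt_right one_pos, fun γ hγ hle y hy => ?_⟩
    have hd := h.dag_comp (symm_mem hγ) hβ
    have h1 : N (β ∘ₗ γ.symm.toLinearMap) ≤ B := hB ⟨_, ⟨hd.1, hd.2.1, hle⟩, rfl⟩
    refine (hNle _ γ hγ rfl y hy).trans (mul_le_mul_of_nonneg_right (h1.trans (le_max_left _ _)) ?_)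
    exact hd.2.1 y hy
  -- If `β y > t * ξ y`, then `y` is scaled so that `β` has value `t` and `ξ` at most 1. Applied to
  -- `x + s y`, `hstar` bounds a translate of `β` at `x`, so this translate is one of finitely many
  -- and dominates `β` up to `N`; the summand 1 makes the conclusion contradictory.
  let t := N * (c * (ξ x + 1)) + 1
  have ht : 0 < t := by positivity
  have hcore : ∀ y ∈ core X, β y ≤ t * ξ y := by
    intro y hy
    by_contra! hlt
    have hξy := hξ.2.1 y hy.1
    have hβy : 0 < β y := lt_of_le_of_lt (by positivity) hlt
    let s := t / β y
    have hs : 0 < s := by positivity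
    have hsβ : s * β y = t := div_mul_cancel₀ _ hβy.ne'
    have hsξ : s * ξ y ≤ 1 := by
      rw [div_mul_eq_mul_div, div_le_one hβy]
      exact hlt.le
    obtain ⟨γ, hγ, hle⟩ := hstar _ (core_add hx (X.smul_mem hs.le hy.1))
    have hd := h.dag_comp (symm_mem hγ) hβ
    have h1 : 0 ≤ β (γ.symm y) := hd.2.1 y hy.1
    have h2 : 0 ≤ β (γ.symm x) := hd.2.1 x hx.1
    simp only [map_add, map_smul, smul_eq_mul] at hle
    have h3 : c * (ξ x + s * ξ y) ≤ c * (ξ x + 1) := mul_le_mul_of_nonneg_left (by linarith) hc0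
    have h4 : 0 ≤ s * β (γ.symm y) := by positivity
    have h5 := hNβ γ hγ (by linarith) y hy.1
    have h6 : t ≤ N * (s * β (γ.symm y)) := by
      rw [← hsβ]
      have := mul_le_mul_of_nonneg_left h5 hs.le
      linarith
    have h7 : N * (s * β (γ.symm y)) ≤ N * (c * (ξ x + 1)) :=
      mul_le_mul_of_nonneg_left (by linarith) hN.le
    simp only [t] at h6
    linarith
  refine ⟨t, ht, fun y hy => ?_⟩
  by_contra! hlt
  obtain ⟨n, hn⟩ := exists_nat_gt ((t * ξ x - β x) / (β y - t * ξ y))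
  have h1 := hcore _ (core_add hx (X.smul_mem n.cast_nonneg hy))
  rw [div_lt_iff₀ (by linarith)] at hn
  simp only [map_add, map_smul, smul_eq_mul] at h1
  linarith

end Dag

/-! ### The system induced on the quotient by `upper L X F`. -/

section Quot

variable {V U : Type*} [AddCommGroup V] [Module ℝ V] [FiniteDimensional ℝ V] [AddCommGroup U]
  [Module ℝ U] [FiniteDimensional ℝ U]
  {L : AddSubgroup V} {X F G : PointedCone ℝ V} {Γ : Subgroup (V ≃ₗ[ℝ] V)} {A : V →ₗ[ℝ] U}

/-- The group induced on a quotient. -/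
def quotGroup (A : V →ₗ[ℝ] U) (Δ : Subgroup (V ≃ₗ[ℝ] V)) :
    Subgroup (U ≃ₗ[ℝ] U) where
  carrier := {g | ∃ γ ∈ Δ, ∀ v, g (A v) = A (γ v)}
  one_mem' := ⟨1, Δ.one_mem, fun _ => rfl⟩
  mul_mem' := by
    rintro g g' ⟨γ, hγ, h⟩ ⟨γ', hγ', h'⟩
    refine ⟨γ * γ', Δ.mul_mem hγ hγ', fun v => ?_⟩
    change g (g' (A v)) = A (γ (γ' v))
    rw [h', h]
  inv_mem' := by
    rintro g ⟨γ, hγ, h⟩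
    refine ⟨γ⁻¹, Δ.inv_mem hγ, fun v => ?_⟩
    change g.symm (A v) = A (γ.symm v)
    rw [LinearEquiv.symm_apply_eq, h, LinearEquiv.apply_symm_apply]

theorem map_gen {S : Set V} (hX : X = PointedCone.hull ℝ (X ∩ S : Set V)) :
    X.map A = PointedCone.hull ℝ (X.map A ∩ A '' S : Set U) := by
  refine le_antisymm ?_ (Submodule.span_le.2 fun u hu => hu.1)
  rintro _ ⟨x, hx, rfl⟩
  rw [SetLike.mem_coe, hX] at hx
  induction hx using Submodule.span_induction with
  | mem x hx => exact PointedCone.subset_hull ⟨⟨x, hx.1, rfl⟩, x, hx.2, rfl⟩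
  | zero => rw [map_zero]; exact Submodule.zero_mem _
  | add x y _ _ hx hy => rw [map_add]; exact Submodule.add_mem _ hx hy
  | smul a x _ hx => rw [map_smul]; exact Submodule.smul_mem _ _ hx

theorem core_map {c : V} (hc : c ∈ core X) {u : U} :
    u ∈ core (X.map A) ↔ ∃ x ∈ core X, A x = u := by
  constructor
  · rintro ⟨-, h⟩
    obtain ⟨ε, hε, x, hx, e⟩ := h (A c) ⟨c, hc.1, rfl⟩
    refine ⟨x + ε • c, ?_, ?_⟩
    · rw [add_comm]
      exact core_add (core_smul hc hε) hx
    · change A x = _ at e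
      rw [map_add, map_smul, e, sub_add_cancel]
  · rintro ⟨x, hx, rfl⟩
    refine ⟨⟨x, hx.1, rfl⟩, ?_⟩
    rintro _ ⟨y, hy, rfl⟩
    obtain ⟨ε, hε, h⟩ := hx.2 y hy
    exact ⟨ε, hε, _, h, by
      change A (x - ε • y) = A x - ε • A y
      rw [map_sub, map_smul]⟩

/-- The system induced on the quotient by `upper L X F`. -/
theorem Sys.quot (h : Sys L X Γ) (hF : F.IsFaceOf X) (hA : Function.Surjective A)
    (hker : LinearMap.ker A = upper L X F) :
    Sys (L.map A.toAddMonoidHom) (X.map A) (quotGroup A (fixer Γ F)) := by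
  classical
  have hA0 : ∀ v, A v = 0 ↔ v ∈ upper L X F := fun v => by rw [← hker, LinearMap.mem_ker]
  refine ⟨h.lat.map hA (by rw [hker]; exact upper_rational h.lat), map_gen h.gen, ?_, ?_, ?_, ?_,
    ?_⟩
  · rw [eq_top_iff]
    rintro u -
    obtain ⟨v, rfl⟩ := hA u
    have hv : v ∈ Submodule.span ℝ (X : Set V) := by rw [h.span_top]; exact Submodule.mem_top
    have := Submodule.mem_map_of_mem (f := A) hv
    rw [Submodule.map_span] at this
    exact this
  · obtain ⟨β, hβ, hdom⟩ := exists_dag_dominating (L := L) (X := X) (F := F)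
    obtain ⟨τ, rfl⟩ := exists_factor (A := A) (ζ := β) fun v hv => mem_upper.1 ((hA0 v).1 hv) β hβ
    refine ⟨τ, ?_, ?_, fun α => ?_⟩
    · rintro _ ⟨v, hv, rfl⟩
      exact hβ.1 v hv
    · rintro _ ⟨v, hv, rfl⟩
      exact hβ.2.1 v hv
    · obtain ⟨N, -, hN⟩ := hdom (α ∘ₗ A) ((Submodule.mem_dualAnnihilator _).2 fun v hv => by
        rw [LinearMap.comp_apply, (hA0 v).2 hv, map_zero])
      refine ⟨N, ?_⟩
      rintro _ ⟨v, hv, rfl⟩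
      exact hN v hv
  · rintro g ⟨γ, hγ, hg⟩ _ ⟨v, hv, rfl⟩
    exact ⟨γ v, h.mapL γ (fixer_le hγ) v hv, (hg v).symm⟩
  · rintro g ⟨γ, hγ, hg⟩ _ ⟨v, hv, rfl⟩
    exact ⟨γ v, h.mapX γ (fixer_le hγ) v hv, (hg v).symm⟩
  · obtain ⟨Q, hQ, hcov⟩ := h.star hF
    obtain ⟨c, -, hc⟩ := h.exists_core
    refine ⟨Q.image A, ?_, ?_⟩
    · intro u hu
      obtain ⟨q, hq, rfl⟩ := Finset.mem_image.1 (Finset.mem_coe.1 hu)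
      exact ⟨⟨q, (hQ hq).1, rfl⟩, q, (hQ hq).2, rfl⟩
    · intro u hu
      obtain ⟨x, hx, rfl⟩ := (core_map hc).1 hu
      obtain ⟨γ, hγ, p, hp, hxp⟩ := hcov x hx
      obtain ⟨g, hg⟩ := exists_induced hA γ fun v => by rw [hA0, hA0]; exact h.upper_map hγ
      refine ⟨g, ⟨γ, hγ, hg⟩, A p, ?_, ?_⟩
      · obtain ⟨a, ha, rfl⟩ := (mem_hull_finset Q).1 hp
        simp only [map_sum, map_smul]
        exact Submodule.sum_mem _ fun v hv => PointedCone.smul_mem _ (ha v)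
          (PointedCone.subset_hull (Finset.mem_coe.2 (Finset.mem_image_of_mem _ hv)))
      · rw [hg, ← sub_eq_zero, ← map_sub, hA0, ← neg_sub]
        exact Submodule.neg_mem _ (span_le_upper hxp)

end Quot

end RatCone

namespace RatCone

/-! ### Lines on which units and exposing forms are constant. -/

section Line

variable {V : Type*} [AddCommGroup V] [Module ℝ V] [FiniteDimensional ℝ V]
  {L : AddSubgroup V} {X F G : PointedCone ℝ V} {Γ : Subgroup (V ≃ₗ[ℝ] V)}

theorem mem_hull_of_limit (P : Finset V) {x v : V} {T : ℝ}
    (h : ∀ N : ℕ, ∃ n ≥ N, x + (T - T / (n + 1)) • v ∈ PointedCone.hull ℝ (P : Set V)) :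
    x + T • v ∈ PointedCone.hull ℝ (P : Set V) := by
  by_contra hq
  obtain ⟨ξ, hξ, hlt⟩ := farkas P hq
  obtain ⟨N, hN⟩ := exists_nat_gt ((|T * ξ v|) / (-ξ (x + T • v)))
  obtain ⟨n, hn, hm⟩ := h N
  have h1 := hull_nonneg hξ hm
  have h2 : (N : ℝ) ≤ n := by exact_mod_cast hn
  rw [div_lt_iff₀ (by linarith)] at hN
  have h3 : (0 : ℝ) < n + 1 := by positivity
  have h4 : ξ (x + (T - T / (n + 1)) • v) = ξ (x + T • v) - (T * ξ v) / (n + 1) := by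
    simp only [map_add, map_smul, smul_eq_mul]
    field_simp
    ring
  rw [h4, sub_nonneg, div_le_iff₀ h3] at h1
  have h5 := neg_abs_le (T * ξ v)
  have h6 : (N : ℝ) * -ξ (x + T • v) ≤ (n + 1) * -ξ (x + T • v) :=
    mul_le_mul_of_nonneg_right (by linarith) (by linarith)
  linarith

/-- A vector killed by an invariant family of units and by exposing forms of all proper faces
is zero. -/
theorem Sys.eq_zero_of_units (h : Sys L X Γ) {Z : Set (Dual ℝ V)} (hZ : Z ⊆ posForms L X)
    (hne : Z.Nonempty) (hZΓ : ∀ γ ∈ Γ, ∀ ζ ∈ Z, ζ ∘ₗ γ.toLinearMap ∈ Z) {k : V}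
    (hk : ∀ ζ ∈ Z, ζ k = 0)
    (hface : ∀ H : PointedCone ℝ V, H.IsFaceOf X → H ≠ X → ∃ β ∈ exposing L X H, β k = 0) :
    k = 0 := by
  obtain ⟨z, -, hz⟩ := h.exists_core
  -- An exposing form of a proper face is constant along the line, so on meeting the face it would
  -- vanish at the core point `z`.
  have hcore : ∀ t : ℝ, z + t • k ∈ X → z + t • k ∈ core X := by
    intro t ht
    rw [← minFace_eq_iff ht]
    by_contra hH
    obtain ⟨β, hβ, hβk⟩ := hface _ (minFace_isFaceOf ht) hH
    have h1 := (hβ.2.2 _ ht).2 (self_mem_minFace ht)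
    rw [map_add, map_smul, hβk, smul_zero, add_zero] at h1
    exact hH (face_eq_of_mem_core (minFace_isFaceOf ht) ((hβ.2.2 z hz.1).1 h1) hz)
  -- The forms of `Z` are constant along the line, so `ω` is active at all of its core points, and
  -- these lie in finitely many translates.
  obtain ⟨ω, hω⟩ := exists_isActive (T := Z) hne (y := z) fun M =>
    (h.finite_posForms hz M).subset fun ξ hξ => ⟨hZ hξ.1, hξ.2⟩
  obtain ⟨P, hP, hcov⟩ := h.cover
  have hfin : {ξ | ∃ y ∈ core X, y ∈ PointedCone.hull ℝ (P : Set V) ∧ IsActive Z y ξ}.Finite :=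
    finite_isActive (fun ξ hξ p hp => dualLat_nat (hZ hξ).1 (hZ hξ).2.1 (hP hp).1 (hP hp).2)
      fun y hy M => (h.finite_posForms hy M).subset fun ξ hξ => ⟨hZ hξ.1, hξ.2⟩
  have hgrp := h.finite_group (hZ hω.1) hfin
  have hray : ∀ t : ℝ, 0 ≤ t → z + t • k ∈ X := by
    intro t₀ ht₀
    by_contra hmem
    let S : Set ℝ := {t | 0 ≤ t ∧ z + t • k ∈ X}
    have h0S : (0 : ℝ) ∈ S := ⟨le_rfl, by simpa using hz.1⟩
    have hdown : ∀ s ∈ S, ∀ t, 0 ≤ t → t ≤ s → t ∈ S := by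
      rintro s ⟨hs, hsX⟩ t ht hts
      refine ⟨ht, ?_⟩
      rcases eq_or_lt_of_le hs with h0 | h0
      · have : t = 0 := le_antisymm (h0 ▸ hts) ht
        simpa [this] using hz.1
      · have e : z + t • k = (1 - t / s) • z + (t / s) • (z + s • k) := by
          rw [smul_add, smul_smul, div_mul_cancel₀ _ h0.ne']
          module
        rw [e]
        exact X.add_mem (X.smul_mem (sub_nonneg.2 ((div_le_one h0).2 hts)) hz.1)
          (X.smul_mem (by positivity) hsX)
    have hbdd : BddAbove S := ⟨t₀, fun s hs => by
      by_contra! hlt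
      exact hmem (hdown s hs t₀ ht₀ hlt.le).2⟩
    let T := sSup S
    have hT0 : 0 ≤ T := le_csSup hbdd h0S
    -- The ray cannot escape through a missing endpoint: one translate of the polyhedral cone
    -- contains points tending to it, and finitely generated cones are closed.
    have hTS : T ∈ S := by
      refine ⟨hT0, ?_⟩
      rcases eq_or_lt_of_le hT0 with hT | hT
      · rw [← hT]; exact h0S.2
      have hseq : ∀ n : ℕ, z + (T - T / (n + 1)) • k ∈ X := by
        intro n
        have h1 : T / (n + 1) ≤ T := div_le_self hT0 (by linarith [n.cast_nonneg (α := ℝ)])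
        have h2 : 0 < T / ((n : ℝ) + 1) := by positivity
        obtain ⟨s, hs, hlt⟩ := exists_lt_of_lt_csSup ⟨0, h0S⟩ (show T - T / (n + 1) < sSup S by
          change _ < T; linarith)
        exact (hdown s hs _ (by linarith) hlt.le).2
      obtain ⟨γ, ⟨hγ, -⟩, hfreq⟩ := exists_forall_frequently hgrp
        (p := fun γ n => γ.symm z + (T - T / (n + 1)) • γ.symm k ∈ PointedCone.hull ℝ (P : Set V))
        (n₀ := 0) (by
          intro n _
          have hc := hcore _ (hseq n)
          obtain ⟨γ, hγ, p, hp, e⟩ := hcov _ hc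
          have e' : γ.symm (z + (T - T / (n + 1)) • k) = p := by
            rw [LinearEquiv.symm_apply_eq, e]
          refine ⟨γ, ⟨hγ, p, ?_, hp, hZΓ γ hγ ω hω.1, fun ζ hζ => ?_⟩, ?_⟩
          · rw [← e']; exact h.map_core (symm_mem hγ) hc
          · rw [LinearMap.comp_apply, LinearEquiv.coe_coe, e, map_add, map_smul, hk ω hω.1,
              smul_zero, add_zero]
            have h1 := hZΓ _ (symm_mem hγ) ζ hζ
            have h2 := hω.2 _ h1
            have h3 := hk _ h1
            simp only [LinearMap.comp_apply, LinearEquiv.coe_coe] at h2 h3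
            rwa [← e', map_add, map_smul, map_add, map_smul, h3, smul_zero, add_zero]
          · rw [← map_smul, ← map_add, e']; exact hp)
      have hm := mem_hull_of_limit P hfreq
      rw [← map_smul, ← map_add] at hm
      have hmX := (Submodule.span_le.2 fun q hq => (hP hq).1 :
        PointedCone.hull ℝ (P : Set V) ≤ X) hm
      have := h.mapX γ hγ _ hmX
      rwa [LinearEquiv.apply_symm_apply] at this
    obtain ⟨ε, hε, hab⟩ := core_absorb (hcore T hTS.2) (v := k)
      (h.span_top ▸ Submodule.mem_top)
    have h1 := (hab ε (abs_of_pos hε).le).1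
    rw [add_assoc, ← add_smul] at h1
    have h2 := le_csSup hbdd (show T + ε ∈ S from ⟨by linarith, h1⟩)
    change T + ε ≤ T at h2
    linarith
  obtain ⟨ζ, hζ⟩ := hne
  -- A unit bounds `α` on the ray by a constant, because it does not change in the direction `k`.
  have hle : ∀ α : Dual ℝ V, α k ≤ 0 := by
    intro α
    obtain ⟨N, hN⟩ := (hZ hζ).2.2 α
    by_contra! hpos
    obtain ⟨n, hn⟩ := exists_nat_gt ((N * ζ z - α z) / α k)
    have h1 := hN _ (hray n n.cast_nonneg)
    rw [div_lt_iff₀ hpos] at hn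
    simp only [map_add, map_smul, smul_eq_mul, hk ζ hζ, mul_zero, add_zero] at h1
    linarith
  refine (Module.forall_dual_apply_eq_zero_iff ℝ k).1 fun α => le_antisymm (hle α) ?_
  have := hle (-α)
  simpa using this

/-- A vector in the span of `G` killed by the integral forms on `V` that are nonnegative on `X` and
vanish on `F` is killed by the integral forms on the span of `G` that are nonnegative on `G` and
vanish on `F`. -/
theorem Sys.upper_restr (h : Sys L X Γ) (hF : F.IsFaceOf X) (hG : G.IsFaceOf X) (hFG : F ≤ G)
    {W : Submodule ℝ V} (hW : Submodule.span ℝ (G : Set V) = W) {k : W}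
    (hk : (k : V) ∈ upper L X F) : k ∈ upper (restrLat W L) (restr W G) (restr W F) := by
  have hsub := h.sub hG hW
  have hFG' : F.IsFaceOf G := ⟨hFG, fun hx hy ha hm =>
    hF.mem_of_smul_add_mem (hG.le hx) (hG.le hy) ha hm⟩
  have hFW := restr_isFaceOf (W := W) hFG'
  have hGW : ∀ y ∈ G, y ∈ W := fun y hy => hW ▸ Submodule.subset_span hy
  obtain ⟨n, A, hA, hker⟩ :=
    exists_coords (upper (restrLat W L) (restr W G) (restr W F))
  have hA0 : ∀ v, A v = 0 ↔ v ∈ upper (restrLat W L) (restr W G) (restr W F) := fun v => by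
    rw [← hker, LinearMap.mem_ker]
  have hq := hsub.quot hFW hA hker
  have hexp : ∀ G₂ : PointedCone ℝ V, G₂ ≤ G → ∀ ξ ∈ exposing L X G₂,
      ξ ∘ₗ W.subtype ∈ exposing (restrLat W L) (restr W G) (restr W G₂) := fun G₂ _ ξ hξ =>
    ⟨fun v hv => hξ.1 _ hv, fun v hv => hξ.2.1 _ (hG.le hv), fun v hv => hξ.2.2 _ (hG.le hv)⟩
  have hfac : ∀ ζ ∈ dag (restrLat W L) (restr W G) (restr W F),
      ∃ τ : Dual ℝ (Fin n → ℝ), τ ∘ₗ A = ζ := fun ζ hζ =>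
    exists_factor fun v hv => mem_upper.1 ((hA0 v).1 hv) ζ hζ
  rw [← hA0]
  -- In the quotient, the forms induced by exposing forms of `F` on `V` are units by
  -- `exposing_dominates`. Each proper face of the quotient cone pulls back to a face of `X` between
  -- `F` and `G`, exposed by a form on `V` that vanishes on `F`. All of these forms kill `k`.
  refine hq.eq_zero_of_units
    (Z := {τ | ∃ ξ ∈ exposing L X F, τ ∘ₗ A = ξ ∘ₗ W.subtype}) ?_ ?_ ?_ ?_ ?_
  · rintro τ ⟨ξ, hξ, e⟩
    have hξW := hexp F hFG ξ hξ
    refine ⟨?_, ?_, fun α => ?_⟩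
    · rintro _ ⟨v, hv, rfl⟩
      obtain ⟨m, hm⟩ := hξW.1 v hv
      exact ⟨m, by rw [← hm, ← e]; rfl⟩
    · rintro _ ⟨v, hv, rfl⟩
      have := hξW.2.1 v hv
      rw [← e] at this
      exact this
    · obtain ⟨N, -, hN⟩ := hsub.exposing_dominates hFW hξW (α := α ∘ₗ A)
        ((Submodule.mem_dualAnnihilator _).2 fun v hv => by
          rw [LinearMap.comp_apply, (hA0 v).2 hv, map_zero])
      refine ⟨N, ?_⟩
      rintro _ ⟨v, hv, rfl⟩
      have := hN v hv
      rw [← e] at this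
      exact this
  · obtain ⟨ξ, hξ⟩ := h.exists_exposing hF
    obtain ⟨τ, hτ⟩ := hfac _ (exposing_subset_dag hFW.le (hexp F hFG ξ hξ))
    exact ⟨τ, ξ, hξ, hτ⟩
  · rintro g ⟨g', ⟨⟨γ, hγ, hg'γ⟩, hg'F⟩, hg⟩ τ ⟨ξ, hξ, e⟩
    have hγF : γ ∈ fixer Γ F := ⟨hγ, fun v hv => by
      have := hg'F ⟨v, hGW v (hFG hv)⟩ hv
      rw [← hg'γ ⟨v, hGW v (hFG hv)⟩, this]⟩
    refine ⟨ξ ∘ₗ γ.toLinearMap, h.exposing_comp hγF hξ, LinearMap.ext fun v => ?_⟩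
    have h1 := LinearMap.congr_fun e (g' v)
    simp only [LinearMap.comp_apply, LinearEquiv.coe_coe, Submodule.subtype_apply] at h1 ⊢
    rw [hg, h1, hg'γ]
  · rintro τ ⟨ξ, hξ, e⟩
    have h1 := LinearMap.congr_fun e k
    simp only [LinearMap.comp_apply, Submodule.subtype_apply] at h1
    rw [h1]
    exact mem_upper.1 hk ξ (exposing_subset_dag hF.le hξ)
  · intro H hH _
    let G₂ : PointedCone ℝ V := (H.comap A).map W.subtype ⊓ G
    have hG₂ : ∀ v : W, (v : V) ∈ G₂ ↔ (v : V) ∈ G ∧ A v ∈ H := by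
      intro v
      constructor
      · rintro ⟨⟨w, hw, e⟩, hv⟩
        have : w = v := Subtype.ext e
        subst this
        exact ⟨hv, hw⟩
      · rintro ⟨hv, hv'⟩
        exact ⟨⟨v, hv', rfl⟩, hv⟩
    have hG₂G : G₂ ≤ G := inf_le_right
    have hG₂X : G₂.IsFaceOf X := by
      refine PointedCone.IsFaceOf.trans ⟨hG₂G, ?_⟩ hG
      intro x y a hx hy ha hm
      have h1 := (hG₂ ⟨a • x + y, hGW _ (hG₂G hm)⟩).1 hm
      refine (hG₂ ⟨x, hGW x hx⟩).2 ⟨hx, ?_⟩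
      refine hH.mem_of_smul_add_mem (y := A ⟨y, hGW y hy⟩) (a := a) ⟨⟨x, hGW x hx⟩, hx, rfl⟩
        ⟨⟨y, hGW y hy⟩, hy, rfl⟩ ha ?_
      have h2 := h1.2
      have e : (⟨a • x + y, hGW _ (hG₂G hm)⟩ : W) = a • ⟨x, hGW x hx⟩ + ⟨y, hGW y hy⟩ := rfl
      rwa [e, map_add, map_smul] at h2
    have hFG₂ : F ≤ G₂ := fun v hv => by
      refine (hG₂ ⟨v, hGW v (hFG hv)⟩).2 ⟨hFG hv, ?_⟩
      have h1 : A ⟨v, hGW v (hFG hv)⟩ = 0 := (hA0 _).2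
        (span_le_upper (Submodule.subset_span (show (⟨v, hGW v (hFG hv)⟩ : W) ∈ restr W F from hv)))
      rw [h1]
      exact H.zero_mem
    obtain ⟨β, hβ⟩ := h.exists_exposing hG₂X
    have hβW := hexp G₂ hG₂G β hβ
    have hβF : β ∈ dag L X F := dag_anti hFG₂ (exposing_subset_dag hG₂X.le hβ)
    obtain ⟨τ, hτ⟩ := hfac (β ∘ₗ W.subtype) ⟨hβW.1, hβW.2.1, fun x hx => hβF.2.2 _ hx⟩
    refine ⟨τ, ⟨?_, ?_, ?_⟩, ?_⟩
    · rintro _ ⟨v, hv, rfl⟩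
      obtain ⟨m, hm⟩ := hβW.1 v hv
      exact ⟨m, by rw [← hm, ← hτ]; rfl⟩
    · rintro _ ⟨v, hv, rfl⟩
      have := hβW.2.1 v hv
      rw [← hτ] at this
      exact this
    · rintro _ ⟨v, hv, rfl⟩
      have h1 : τ (A v) = β (v : V) := LinearMap.congr_fun hτ v
      change τ (A v) = 0 ↔ A v ∈ H
      rw [h1, hβ.2.2 _ (hG.le (show (v : V) ∈ G from hv)), hG₂ v]
      exact ⟨fun h => h.2, fun h => ⟨hv, h⟩⟩
    · have h1 : τ (A k) = β (k : V) := LinearMap.congr_fun hτ k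
      rw [h1]
      exact mem_upper.1 hk β hβF

end Line

/-! ### Biduality for lattice points. -/

section Bidual

variable {U : Type*} [NormedAddCommGroup U] [NormedSpace ℝ U] [FiniteDimensional ℝ U]
  {L : AddSubgroup U} {X : PointedCone ℝ U} {Γ : Subgroup (U ≃ₗ[ℝ] U)}

/-- A lattice point on which all nonnegative integral forms are nonnegative lies in the cone. -/
theorem Sys.mem_of_integral_nonneg (h : Sys L X Γ) {q : U} (hqL : q ∈ L)
    (hq : ∀ ξ ∈ dualLat L, (∀ x ∈ X, 0 ≤ ξ x) → 0 ≤ ξ q) : q ∈ X := by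
  obtain ⟨c, -, hc⟩ := h.exists_core
  -- Adding a small multiple of a unit moves `τ` into the core of the dual cone, where it is a
  -- positive combination of integral forms.
  have hreal : ∀ τ : Dual ℝ U, (∀ x ∈ X, 0 ≤ τ x) → 0 ≤ τ q := by
    intro τ hτ
    obtain ⟨ω, hω⟩ := h.unit
    let Y : PointedCone ℝ (Dual ℝ U) :=
      { carrier := {ξ | ∀ x ∈ X, 0 ≤ ξ x}
        add_mem' := fun ha hb x hx => add_nonneg (ha x hx) (hb x hx)
        zero_mem' := fun _ _ => le_rfl
        smul_mem' := fun a ξ hξ x hx => mul_nonneg a.2 (hξ x hx) }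
    have hY : ∀ ξ, ξ ∈ Y ↔ ∀ x ∈ X, 0 ≤ ξ x := fun _ => Iff.rfl
    have hωY : ω ∈ core Y := by
      refine mem_core_of_dom hω.2.1 fun α _ => ?_
      obtain ⟨N, hN, hle⟩ := posForms_nonneg_bound hω α
      refine ⟨N + 1, by positivity, fun x hx => ?_⟩
      have h1 := hle x hx
      have h2 := le_abs_self (α x)
      have h3 := hω.2.1 x hx
      rw [LinearMap.sub_apply, LinearMap.smul_apply, smul_eq_mul]
      linarith
    have hspan : Submodule.span ℝ (Y : Set (Dual ℝ U)) = ⊤ := by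
      rw [eq_top_iff]
      rintro α -
      obtain ⟨N, hN, hle⟩ := posForms_nonneg_bound hω α
      refine mem_span_iff_sub.2 ⟨α + N • ω, fun x hx => ?_, N • ω,
        Y.smul_mem hN hω.2.1, by abel⟩
      have h1 := hle x hx
      have h2 := neg_abs_le (α x)
      rw [LinearMap.add_apply, LinearMap.smul_apply, smul_eq_mul]
      linarith
    have hε : ∀ ε : ℝ, 0 < ε → 0 ≤ τ q + ε * ω q := by
      intro ε hε
      have hm := mem_hull_lattice (Y := Y) (L := dualLat L) (core_add (core_smul hωY hε) hτ) (by
        rw [hspan, Submodule.top_coe, Set.univ_inter, h.lat.dual_span]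
        exact Submodule.mem_top)
      have hn : 0 ≤ (ε • ω + τ) q := by
        generalize ε • ω + τ = ζ at hm
        induction hm using Submodule.span_induction with
        | mem ζ hζ => exact hq ζ hζ.2 hζ.1
        | zero => simp
        | add ζ ζ' _ _ h h' => exact add_nonneg h h'
        | smul a ζ _ h => exact mul_nonneg a.2 h
      rw [LinearMap.add_apply, LinearMap.smul_apply, smul_eq_mul] at hn
      linarith
    by_contra! hlt
    have h1 := hε (-τ q / (2 * (|ω q| + 1))) (div_pos (by linarith) (by positivity))
    have h2 : -τ q / (2 * (|ω q| + 1)) * ω q ≤ -τ q / (2 * (|ω q| + 1)) * (|ω q| + 1) :=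
      mul_le_mul_of_nonneg_left (by linarith [le_abs_self (ω q)])
        (div_nonneg (by linarith) (by positivity))
    have h3 : -τ q / (2 * (|ω q| + 1)) * (|ω q| + 1) = -τ q / 2 := by
      have : |ω q| + 1 ≠ 0 := by positivity
      field_simp
    linarith
  refine h.mem_of_lattice_ray hqL (c := c) fun n => ?_
  by_cases h0 : (0 : U) ∈ core X
  · obtain ⟨ε, hε, hab⟩ := core_absorb h0 (v := c + (n : ℝ) • q) (h.span_top ▸ Submodule.mem_top)
    have h1 := core_smul (hab ε (abs_of_pos hε).le) (inv_pos.2 hε)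
    rwa [zero_add, smul_smul, inv_mul_cancel₀ hε.ne', one_smul] at h1
  · have hD : IsOpenCone (core X) := by
      refine ⟨isOpen_of_absorb ?_ fun d hd u => ?_, ⟨c, hc⟩, fun x hx y hy => core_add hx hy.1,
        fun x hx t ht => core_smul hx ht, h0⟩
      · intro x hx y hy a b ha hb hab
        rcases eq_or_lt_of_le ha with h0 | h0
        · have : b = 1 := by linarith
          simpa [← h0, this] using hy
        · exact core_add (core_smul hx h0) (X.smul_mem hb hy.1)
      · exact core_absorb hd (h.span_top ▸ Submodule.mem_top)
    by_contra hmem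
    obtain ⟨β, hβ, hle, hβ0⟩ := hD.separate hmem
    have hβc := hD.dual_pos hβ hβ0 hc
    have hβX : ∀ x ∈ X, 0 ≤ β x := by
      intro x hx
      by_contra! hlt
      obtain ⟨m, hm⟩ := exists_nat_gt (β c / -(β x))
      have h1 := hβ _ (core_add hc (X.smul_mem m.cast_nonneg hx))
      rw [div_lt_iff₀ (by linarith)] at hm
      rw [map_add, map_smul, smul_eq_mul] at h1
      linarith
    have h1 := hreal β hβX
    rw [map_add, map_smul, smul_eq_mul] at hle
    have : 0 ≤ (n : ℝ) * β q := by positivity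
    linarith

end Bidual

end RatCone

namespace RatCone

/-! ### Faces of the dual cone. -/

section DualFaces

variable {V : Type*} [AddCommGroup V] [Module ℝ V]
  {L : AddSubgroup V} {X F G : PointedCone ℝ V} {Γ : Subgroup (V ≃ₗ[ℝ] V)}

/-- The cone spanned by the integral forms that are nonnegative on `X` and vanish on `F`. -/
def dagCone (L : AddSubgroup V) (X F : PointedCone ℝ V) : PointedCone ℝ (Dual ℝ V) :=
  PointedCone.hull ℝ (dag L X F)

theorem dagCone_nonneg {ξ : Dual ℝ V} (hξ : ξ ∈ dagCone L X F) {x : V} (hx : x ∈ X) : 0 ≤ ξ x := by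
  induction hξ using Submodule.span_induction with
  | mem ζ hζ => exact hζ.2.1 x hx
  | zero => simp
  | add ζ ζ' _ _ h h' => exact add_nonneg h h'
  | smul a ζ _ h => exact mul_nonneg a.2 h

theorem dagCone_eq_zero {ξ : Dual ℝ V} (hξ : ξ ∈ dagCone L X F) {v : V} (hv : v ∈ upper L X F) :
    ξ v = 0 := by
  induction hξ using Submodule.span_induction with
  | mem ζ hζ => exact mem_upper.1 hv ζ hζ
  | zero => simp
  | add ζ ζ' _ _ h h' => rw [LinearMap.add_apply, h, h', add_zero]
  | smul a ζ _ h =>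
    change (a : ℝ) * ζ v = 0
    rw [h, mul_zero]

theorem dag_subset_dagCone : dag L X F ⊆ dagCone L X F := PointedCone.subset_hull

theorem dagCone_bot_gen :
    dagCone L X ⊥ = PointedCone.hull ℝ (dagCone L X ⊥ ∩ dualLat L : Set (Dual ℝ V)) := by
  refine le_antisymm (Submodule.span_mono fun ξ hξ => ⟨dag_subset_dagCone hξ, hξ.1⟩)
    (Submodule.span_le.2 fun ξ hξ => hξ.1)

theorem mem_dag_of_mem_dagCone {ξ : Dual ℝ V} (h1 : ξ ∈ dagCone L X ⊥) (h2 : ξ ∈ dualLat L)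
    (h3 : ∀ x ∈ F, ξ x = 0) : ξ ∈ dag L X F :=
  ⟨h2, fun _ hx => dagCone_nonneg h1 hx, h3⟩

theorem dagCone_le : dagCone L X F ≤ dagCone L X ⊥ := Submodule.span_mono (dag_anti bot_le)

/-- All generators are nonnegative at `r`, so in a combination that vanishes at `r` each term does
too; vanishing at a core point of `F` means vanishing on `F`. -/
theorem mem_dagCone_of_zero (hFX : F ≤ X) {r : V} (hr : r ∈ core F) {ξ : Dual ℝ V}
    (hξ : ξ ∈ dagCone L X ⊥) (h0 : ξ r = 0) : ξ ∈ dagCone L X F := by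
  have key : ∀ ξ ∈ dagCone L X ⊥, 0 ≤ ξ r ∧ (ξ r = 0 → ξ ∈ dagCone L X F) := by
    intro ξ hξ
    have hn : ∀ ξ ∈ dagCone L X ⊥, 0 ≤ ξ r := fun ξ hξ => dagCone_nonneg hξ (hFX hr.1)
    refine ⟨hn ξ hξ, ?_⟩
    induction hξ using Submodule.span_induction with
    | mem ζ hζ =>
      intro h0
      refine dag_subset_dagCone ⟨hζ.1, hζ.2.1, fun x hx => ?_⟩
      obtain ⟨N, hN, hm⟩ := core_dom hr hx
      have h1 := hζ.2.1 _ (hFX hm)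
      rw [map_sub, map_smul, h0, smul_zero, zero_sub] at h1
      have h2 := hζ.2.1 x (hFX hx)
      linarith
    | zero => exact fun _ => Submodule.zero_mem _
    | add ζ ζ' h1 h2 h h' =>
      intro h0
      rw [LinearMap.add_apply, add_eq_zero_iff_of_nonneg (hn _ h1) (hn _ h2)] at h0
      exact Submodule.add_mem _ (h h0.1) (h' h0.2)
    | smul a ζ h1 h =>
      intro h0
      by_cases ha : a = 0
      · rw [ha, zero_smul]; exact Submodule.zero_mem _
      · refine Submodule.smul_mem _ a (h ?_)
        have h0' : (a : ℝ) * ζ r = 0 := h0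
        exact (mul_eq_zero.1 h0').resolve_left fun h => ha (Subtype.ext h)
  exact (key ξ hξ).2 h0

theorem dagCone_isFaceOf (hFX : F ≤ X) {r : V} (hr : r ∈ core F) :
    (dagCone L X F).IsFaceOf (dagCone L X ⊥) where
  le := dagCone_le
  mem_of_smul_add_mem := by
    intro ξ ζ a hξ hζ ha hm
    refine mem_dagCone_of_zero hFX hr hξ ?_
    have h0 : (a • ξ + ζ) r = 0 :=
      dagCone_eq_zero hm (span_le_upper (Submodule.subset_span hr.1))
    have h1 := dagCone_nonneg hξ (hFX hr.1)
    have h2 := dagCone_nonneg hζ (hFX hr.1)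
    rw [LinearMap.add_apply, LinearMap.smul_apply, smul_eq_mul] at h0
    nlinarith [mul_nonneg ha.le h1]

variable [FiniteDimensional ℝ V]

/-- Every face of the dual cone is the annihilator of a face. -/
theorem Sys.exists_face_of_dual (h : Sys L X Γ) {H : PointedCone ℝ (Dual ℝ V)}
    (hH : H.IsFaceOf (dagCone L X ⊥)) :
    ∃ F : PointedCone ℝ V, F.IsFaceOf X ∧ dagCone L X F = H := by
  have hHgen := face_hull hH dagCone_bot_gen
  obtain ⟨ξ, hξL, hξ⟩ := exists_mem_core hHgen
  have hξX : ∀ x ∈ X, 0 ≤ ξ x := fun x hx => dagCone_nonneg (hH.le hξ.1) hx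
  have hF := zeroFace_isFaceOf hξX
  refine ⟨zeroFace X ξ, hF, le_antisymm ?_ ?_⟩
  · refine Submodule.span_le.2 fun ζ hζ => ?_
    have hexp : ξ ∈ exposing L X (zeroFace X ξ) :=
      ⟨hξL, hξX, fun x hx => ⟨fun h0 => mem_zeroFace.2 ⟨hx, h0⟩, fun hm => (mem_zeroFace.1 hm).2⟩⟩
    -- The core form `ξ` of `H` exposes its zero face and therefore dominates `ζ`. Then `n • ξ`
    -- splits into `ζ` and another element of the dual cone, so `ζ` lies in the face `H`.
    obtain ⟨N, -, hN⟩ := h.exposing_dominates hF hexp (α := ζ) (by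
      rw [← span_dag]; exact Submodule.subset_span hζ)
    obtain ⟨n, hn⟩ := exists_nat_ge N
    have h1 : n • ξ - ζ ∈ dagCone L X ⊥ := by
      refine dag_subset_dagCone ⟨(dualLat L).sub_mem ((dualLat L).nsmul_mem hξL n) hζ.1,
        fun x hx => ?_, fun x hx => ?_⟩
      · have h2 := hN x hx
        have h3 := mul_le_mul_of_nonneg_right hn (hξX x hx)
        rw [LinearMap.sub_apply, LinearMap.smul_apply, nsmul_eq_mul]
        linarith
      · rw [(Submodule.mem_bot _).1 hx, map_zero]
    have h2 : ζ ∈ dagCone L X ⊥ := dag_subset_dagCone (dag_anti bot_le hζ)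
    refine hH.mem_of_smul_add_mem (a := 1) h2 h1 one_pos ?_
    rw [one_smul, add_sub_cancel]
    exact H.nsmul_mem hξ.1 n
  · rw [hHgen]
    refine Submodule.span_mono fun ζ hζ => ?_
    refine mem_dag_of_mem_dagCone (hH.le hζ.1) hζ.2 fun x hx => ?_
    obtain ⟨hx, hx0⟩ := mem_zeroFace.1 hx
    obtain ⟨N, hN, hm⟩ := core_dom hξ hζ.1
    have h1 := dagCone_nonneg (hH.le hm) hx
    have h2 := dagCone_nonneg (hH.le hζ.1) hx
    rw [LinearMap.sub_apply, LinearMap.smul_apply, hx0, smul_zero, zero_sub] at h1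
    linarith

/-- A form which is nonnegative on the face `G` and vanishes on the part of its span killed by
`dag L X F` is nonnegative at every point of the span where the forms of `dag L X F` are. -/
theorem Sys.nonneg_of_dag_nonneg (h : Sys L X Γ) (hF : F.IsFaceOf X) (hG : G.IsFaceOf X)
    (hFG : F ≤ G) {ξ : Dual ℝ V} (hξG : ∀ v ∈ G, 0 ≤ ξ v)
    (hξ : ∀ v ∈ Submodule.span ℝ (G : Set V), v ∈ upper L X F → ξ v = 0) {x : V}
    (hxG : x ∈ Submodule.span ℝ (G : Set V)) (hx : ∀ ζ ∈ dag L X F, 0 ≤ ζ x) : 0 ≤ ξ x := by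
  obtain ⟨n, A, hA, hker⟩ := exists_coords (upper L X F)
  have hA0 : ∀ v, A v = 0 ↔ v ∈ upper L X F := fun v => by rw [← hker, LinearMap.mem_ker]
  have hq := h.quot hF hA hker
  obtain ⟨ξG, hξG'⟩ := h.exists_exposing hG
  have hξGF : ξG ∈ dag L X F := dag_anti hFG (exposing_subset_dag hG.le hξG')
  have hspanG : ∀ w ∈ Submodule.span ℝ (G : Set V), ξG w = 0 := fun w hw =>
    mem_upper.1 (span_le_upper hw) ξG (exposing_subset_dag hG.le hξG')
  -- `Y` is cut out by the forms vanishing on `F` in the image of the span of `G`. By biduality in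
  -- the quotient system its lattice points come from `G`, and its core points, such as small
  -- perturbations of `A x`, are positive combinations of lattice points.
  let Y : PointedCone ℝ (Fin n → ℝ) := PointedCone.ofConeComb
    {u | (∃ w ∈ Submodule.span ℝ (G : Set V), A w = u) ∧
      ∀ τ : Dual ℝ (Fin n → ℝ), τ ∘ₗ A ∈ dag L X F → 0 ≤ τ u}
    ⟨0, ⟨0, Submodule.zero_mem _, map_zero _⟩, fun τ _ => by simp⟩ (by
      rintro _ ⟨⟨w, hw, rfl⟩, h1⟩ _ ⟨⟨w', hw', rfl⟩, h2⟩ a ha b hb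
      refine ⟨⟨a • w + b • w', Submodule.add_mem _ (Submodule.smul_mem _ _ hw)
        (Submodule.smul_mem _ _ hw'), by simp⟩, fun τ hτ => ?_⟩
      rw [map_add, map_smul, map_smul]
      exact add_nonneg (mul_nonneg ha (h1 τ hτ)) (mul_nonneg hb (h2 τ hτ)))
  have hY : ∀ u, u ∈ Y ↔ (∃ w ∈ Submodule.span ℝ (G : Set V), A w = u) ∧
      ∀ τ : Dual ℝ (Fin n → ℝ), τ ∘ₗ A ∈ dag L X F → 0 ≤ τ u := fun _ => Iff.rfl
  have hGY : ∀ g ∈ G, A g ∈ Y := fun g hg =>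
    (hY _).2 ⟨⟨g, Submodule.subset_span hg, rfl⟩, fun τ hτ => hτ.2.1 g (hG.le hg)⟩
  -- lattice points of `Y` come from `G`
  have hlat : ∀ u ∈ Y, u ∈ L.map A.toAddMonoidHom → ∃ g ∈ G, A g = u := by
    intro u hu huL
    obtain ⟨⟨w, hw, hwu⟩, hpos⟩ := (hY u).1 hu
    obtain ⟨y, hy, rfl⟩ := hq.mem_of_integral_nonneg huL (by
      intro τ hτ hτX
      refine hpos τ ⟨fun v hv => hτ _ ⟨v, hv, rfl⟩, fun v hv => hτX _ ⟨v, hv, rfl⟩, fun v hv => ?_⟩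
      rw [LinearMap.comp_apply, (hA0 v).2 (span_le_upper (Submodule.subset_span hv)), map_zero])
    refine ⟨y, ?_, rfl⟩
    rw [← hξG'.2.2 y hy]
    have h1 : w - y ∈ upper L X F := by
      rw [← hA0, map_sub, hwu]
      exact sub_self _
    have h2 := mem_upper.1 h1 ξG hξGF
    rw [map_sub, hspanG w hw] at h2
    linarith
  obtain ⟨z, -, hz⟩ := h.exists_face_core hG
  have hzY : A z ∈ core Y := by
    refine ⟨hGY z hz.1, fun u hu => ?_⟩
    obtain ⟨⟨w, hw, rfl⟩, -⟩ := (hY u).1 hu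
    obtain ⟨ε, hε, hab⟩ := core_absorb hz (v := -w) (Submodule.neg_mem _ hw)
    refine ⟨ε, hε, ?_⟩
    have := hGY _ (hab ε (abs_of_pos hε).le).1
    rwa [map_add, map_smul, map_neg, smul_neg, ← sub_eq_add_neg] at this
  have hxY : A x ∈ Y := by
    refine (hY _).2 ⟨⟨x, hxG, rfl⟩, fun τ hτ => hx _ hτ⟩
  have hε : ∀ ε : ℝ, 0 < ε → 0 ≤ ξ x + ε * ξ z := by
    intro ε hε
    have hmem : ε • A z + A x ∈ PointedCone.hull ℝ (Y ∩ L.map A.toAddMonoidHom : Set _) := by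
      refine mem_hull_lattice (core_add (core_smul hzY hε) hxY) ?_
      have hw : ε • z + x ∈ Submodule.span ℝ (G : Set V) :=
        Submodule.add_mem _ (Submodule.smul_mem _ _ (Submodule.subset_span hz.1)) hxG
      rw [← map_smul, ← map_add]
      have hsub : Submodule.span ℝ (G : Set V) ≤ (Submodule.span ℝ
          ((Submodule.span ℝ (Y : Set (Fin n → ℝ)) : Set (Fin n → ℝ)) ∩
            L.map A.toAddMonoidHom : Set (Fin n → ℝ))).comap A := by
        have hGL : Submodule.span ℝ (G : Set V) ≤ Submodule.span ℝ (G ∩ L : Set V) := by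
          refine Submodule.span_le.2 fun v hv => ?_
          have h1 : G ≤ (Submodule.span ℝ (G ∩ L : Set V)).restrictScalars _ := by
            conv_lhs => rw [face_hull hG h.gen]
            exact Submodule.span_le.2 fun w hw => Submodule.subset_span hw
          exact h1 hv
        refine hGL.trans (Submodule.span_le.2 fun v hv => ?_)
        exact Submodule.subset_span ⟨Submodule.subset_span (hGY v hv.1), v, hv.2, rfl⟩
      exact hsub hw
    have hexG : ∀ u ∈ PointedCone.hull ℝ (Y ∩ L.map A.toAddMonoidHom : Set _),
        ∃ g ∈ G, A g = u := by
      intro u hu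
      induction hu using Submodule.span_induction with
      | mem u hu => exact hlat u hu.1 hu.2
      | zero => exact ⟨0, G.zero_mem, map_zero _⟩
      | add u u' _ _ h1 h2 =>
        obtain ⟨g, hg, rfl⟩ := h1
        obtain ⟨g', hg', rfl⟩ := h2
        exact ⟨g + g', G.add_mem hg hg', map_add _ _ _⟩
      | smul a u _ h1 =>
        obtain ⟨g, hg, rfl⟩ := h1
        exact ⟨(a : ℝ) • g, G.smul_mem a.2 hg, map_smul _ _ _⟩
    obtain ⟨g, hg, e⟩ := hexG _ hmem
    have h1 : ε • z + x - g ∈ upper L X F := by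
      rw [← hA0, map_sub, map_add, map_smul, e, sub_self]
    have h2 := hξ _ (Submodule.sub_mem _ (Submodule.add_mem _ (Submodule.smul_mem _ _
      (Submodule.subset_span hz.1)) hxG) (Submodule.subset_span hg)) h1
    have h3 := hξG g hg
    rw [map_sub, map_add, map_smul, smul_eq_mul] at h2
    linarith
  have hz0 := hξG z hz.1
  by_contra! hlt
  have h1 := hε (-ξ x / (2 * (ξ z + 1))) (div_pos (by linarith) (by positivity))
  have h2 : -ξ x / (2 * (ξ z + 1)) * ξ z ≤ -ξ x / (2 * (ξ z + 1)) * (ξ z + 1) :=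
    mul_le_mul_of_nonneg_left (by linarith) (div_nonneg (by linarith) (by positivity))
  have h3 : -ξ x / (2 * (ξ z + 1)) * (ξ z + 1) = -ξ x / 2 := by
    have : ξ z + 1 ≠ 0 := by positivity
    field_simp
  linarith

end DualFaces

/-! ### Faces of projected cones. -/

section Projection

variable {V U : Type*} [AddCommGroup V] [Module ℝ V] [AddCommGroup U] [Module ℝ U]

open PolyCone in
-- A face in the sense of segments is stable under scaling: a point `y` of it lies inside a segment
-- from `t • y` to a further multiple of `y`, or to the origin.
theorem isFace_iff {X : PointedCone ℝ V} {Y : Set V} :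
    IsFace (X : Set V) Y ↔ ∃ F : PointedCone ℝ V, F.IsFaceOf X ∧ (F : Set V) = Y := by
  constructor
  · rintro ⟨⟨y₀, hy₀⟩, hconv, hsub, hext⟩
    have hseg : ∀ x ∈ X, ∀ y ∈ X, ∀ a b : ℝ, 0 < a → 0 < b → a + b = 1 → a • x + b • y ∈ Y →
        x ∈ Y := fun x hx y hy a b ha hb hab hm => hext hx hy hm ⟨a, b, ha, hb, hab, rfl⟩
    have hsmul : ∀ y ∈ Y, ∀ t : ℝ, 0 ≤ t → t • y ∈ Y := by
      intro y hy t ht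
      rcases lt_trichotomy t 1 with h1 | h1 | h1
      · refine hseg (t • y) (X.smul_mem ht (hsub hy)) ((2 : ℝ) • y)
          (X.smul_mem zero_le_two (hsub hy)) (1 / (2 - t)) ((1 - t) / (2 - t))
          (div_pos one_pos (by linarith)) (div_pos (by linarith) (by linarith)) ?_ ?_
        · rw [← add_div, div_eq_one_iff_eq (by linarith)]; ring
        · rw [smul_smul, smul_smul, ← add_smul]
          have : 1 / (2 - t) * t + (1 - t) / (2 - t) * 2 = 1 := by
            have : (2 - t) ≠ 0 := by linarith
            field_simp
            ring
          rwa [this, one_smul]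
      · rwa [h1, one_smul]
      · refine hseg (t • y) (X.smul_mem ht (hsub hy)) 0 X.zero_mem (1 / t) (1 - 1 / t)
          (by positivity) ?_ (by ring) ?_
        · rw [sub_pos, div_lt_one (by linarith)]; exact h1
        · rw [smul_zero, add_zero, smul_smul, one_div_mul_cancel (by linarith), one_smul]
          exact hy
    refine ⟨PointedCone.ofConeComb Y ⟨y₀, hy₀⟩ ?_, ⟨fun x hx => hsub hx, ?_⟩, rfl⟩
    · intro x hx y hy a ha b hb
      have h1 := hconv (hsmul x hx (2 * a) (by linarith)) (hsmul y hy (2 * b) (by linarith))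
        (a := 1 / 2) (b := 1 / 2) (by norm_num) (by norm_num) (by norm_num)
      rw [smul_smul, smul_smul] at h1
      convert h1 using 3 <;> ring
    · intro x y a hx hy ha hm
      have hm' : a • x + y ∈ Y := hm
      have h1 : (2 * a) • x ∈ Y := hseg _ (X.smul_mem (by positivity) hx) ((2 : ℝ) • y)
        (X.smul_mem zero_le_two hy) (1 / 2) (1 / 2) (by norm_num) (by norm_num) (by norm_num) (by
          rw [smul_smul, smul_smul]
          convert hm' using 2
          · congr 1; ring
          · norm_num)
      have h2 := hsmul _ h1 (2 * a)⁻¹ (by positivity)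
      rw [smul_smul, inv_mul_cancel₀ (by positivity), one_smul] at h2
      exact h2
  · rintro ⟨F, hF, rfl⟩
    exact ⟨⟨0, F.zero_mem⟩, PointedCone.convex F, hF.isExtreme⟩

open PolyCone in
/-- Projections along a subspace containing a face `F`, which separate the faces containing `F`
from their complements, induce a bijection on faces. -/
theorem bijOn_faces {X F : PointedCone ℝ V} (A : V →ₗ[ℝ] U) (hFX : F ≤ X) (hFA : ∀ v ∈ F, A v = 0)
    (hsep : ∀ G : PointedCone ℝ V, G.IsFaceOf X → F ≤ G → ∀ x ∈ X, ∀ g ∈ G, A x = A g → x ∈ G) :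
    Set.BijOn (fun G : Set V => A '' G) {G | IsFace (X : Set V) G ∧ (F : Set V) ⊆ G}
      {H | IsFace (A '' (X : Set V)) H} := by
  have hmap : A '' (X : Set V) = (X.map A : PointedCone ℝ U) := rfl
  refine ⟨?_, ?_, ?_⟩
  · rintro G ⟨hG, hFG⟩
    obtain ⟨G, hGX, rfl⟩ := isFace_iff.1 hG
    rw [Set.mem_ofPred_eq, hmap, isFace_iff]
    refine ⟨G.map A, ⟨?_, ?_⟩, rfl⟩
    · rintro _ ⟨g, hg, rfl⟩
      exact ⟨g, hGX.le hg, rfl⟩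
    · rintro _ _ a ⟨x, hx, rfl⟩ ⟨y, hy, rfl⟩ ha ⟨g, hg, e⟩
      have e' : A g = a • A x + A y := e
      refine ⟨x, hGX.mem_of_smul_add_mem hx hy ha ?_, rfl⟩
      exact hsep G hGX hFG _ (X.add_mem (X.smul_mem ha.le hx) hy) g hg (by
        rw [map_add, map_smul, e'])
  · rintro G ⟨hG, hFG⟩ G' ⟨hG', hFG'⟩ e
    obtain ⟨G, hGX, rfl⟩ := isFace_iff.1 hG
    obtain ⟨G', hGX', rfl⟩ := isFace_iff.1 hG'
    have key : ∀ G G' : PointedCone ℝ V, G.IsFaceOf X → G'.IsFaceOf X → F ≤ G' →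
        A '' (G : Set V) = A '' (G' : Set V) → G ≤ G' := by
      intro G G' hG hG' hF e g hg
      obtain ⟨g', hg', e'⟩ : A g ∈ A '' (G' : Set V) := e ▸ ⟨g, hg, rfl⟩
      exact hsep G' hG' hF g (hG.le hg) g' hg' e'.symm
    rw [le_antisymm (key G G' hGX hGX' hFG' e) (key G' G hGX' hGX hFG e.symm)]
  · intro H hH
    rw [Set.mem_ofPred_eq, hmap, isFace_iff] at hH
    obtain ⟨H, hH, rfl⟩ := hH
    let G : PointedCone ℝ V := H.comap A ⊓ X
    have hG : ∀ v, v ∈ G ↔ A v ∈ H ∧ v ∈ X := fun _ => Iff.rfl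
    refine ⟨G, ⟨isFace_iff.2 ⟨G, ⟨inf_le_right, ?_⟩, rfl⟩, fun v hv => ?_⟩, ?_⟩
    · intro x y a hx hy ha hm
      refine (hG x).2 ⟨?_, hx⟩
      have h1 := ((hG _).1 hm).1
      rw [map_add, map_smul] at h1
      exact hH.mem_of_smul_add_mem ⟨x, hx, rfl⟩ ⟨y, hy, rfl⟩ ha h1
    · refine (hG v).2 ⟨?_, hFX hv⟩
      rw [hFA v hv]
      exact H.zero_mem
    · ext u
      constructor
      · rintro ⟨v, hv, rfl⟩
        exact ((hG v).1 hv).1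
      · intro hu
        obtain ⟨x, hx, rfl⟩ := hH.le hu
        exact ⟨x, (hG x).2 ⟨hu, hx⟩, rfl⟩

end Projection

end RatCone

namespace RatCone

/-! ### Convex hulls as cones, and denominators. -/

section Hull

variable {E : Type*} [AddCommGroup E] [Module ℝ E]

/-- Stability under natural multiples suffices, because `t • v` lies between `0` and `n • v` as soon
as `n ≥ t`. -/
theorem convexHull_eq_hull {S : Set E} (h0 : 0 ∈ S) (hS : ∀ v ∈ S, ∀ n : ℕ, n • v ∈ S) :
    convexHull ℝ S = (PointedCone.hull ℝ S : Set E) := by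
  refine Set.Subset.antisymm
    (convexHull_min PointedCone.subset_hull (PointedCone.convex _)) fun x hx => ?_
  have hsmul : ∀ x ∈ convexHull ℝ S, ∀ t : ℝ, 0 ≤ t → t • x ∈ convexHull ℝ S := by
    intro x hx t ht
    refine convexHull_min (t := (fun z => t • z) ⁻¹' convexHull ℝ S) (fun v hv => ?_)
      ((convex_convexHull ℝ S).smul_preimage t) hx
    obtain ⟨n, hn⟩ := exists_nat_ge t
    change t • v ∈ convexHull ℝ S
    rcases Nat.eq_zero_or_pos n with hn0 | hn0
    · have : t = 0 := le_antisymm (by simpa [hn0] using hn) ht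
      rw [this, zero_smul]
      exact subset_convexHull ℝ S h0
    have hn0' : (0 : ℝ) < n := by exact_mod_cast hn0
    have e : t • v = (1 - t / n) • (0 : E) + (t / n) • (n • v) := by
      rw [smul_zero, zero_add, ← Nat.cast_smul_eq_nsmul ℝ, smul_smul, div_mul_cancel₀ _ hn0'.ne']
    rw [e]
    exact convex_convexHull ℝ S (subset_convexHull ℝ S h0) (subset_convexHull ℝ S (hS v hv n))
      (sub_nonneg.2 ((div_le_one hn0').2 hn)) (by positivity) (by ring)
  induction hx using Submodule.span_induction with
  | mem x hx => exact subset_convexHull ℝ S hx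
  | zero => exact subset_convexHull ℝ S h0
  | add x y _ _ hx hy =>
    have h1 := convex_convexHull ℝ S (hsmul x hx 2 zero_le_two) (hsmul y hy 2 zero_le_two)
      (a := 1 / 2) (b := 1 / 2) (by norm_num) (by norm_num) (by norm_num)
    rw [smul_smul, smul_smul] at h1
    norm_num at h1
    exact h1
  | smul a x _ hx => exact hsmul x hx a a.2

theorem hull_eq_of_smul {S S' : Set E} (h : S' ⊆ S)
    (hS : ∀ v ∈ S, ∃ n : ℕ, 0 < n ∧ n • v ∈ S') :
    PointedCone.hull ℝ S' = PointedCone.hull ℝ S := by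
  refine le_antisymm (Submodule.span_mono h) (Submodule.span_le.2 fun v hv => ?_)
  obtain ⟨n, hn, hm⟩ := hS v hv
  have hn' : (0 : ℝ) < n := by exact_mod_cast hn
  have h1 := PointedCone.smul_mem (PointedCone.hull ℝ S') (inv_nonneg.2 hn'.le)
    (PointedCone.subset_hull hm)
  rwa [← Nat.cast_smul_eq_nsmul ℝ, smul_smul, inv_mul_cancel₀ hn'.ne', one_smul] at h1

variable [FiniteDimensional ℝ E]

/-- A form with rational values on a lattice has an integral multiple. -/
theorem IsLat.exists_smul_integral {L : AddSubgroup E} (hL : IsLat L) {ξ : Dual ℝ E}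
    (hξ : ∀ v ∈ L, ∃ q : ℚ, ξ v = q) : ∃ n : ℕ, 0 < n ∧ n • ξ ∈ dualLat L := by
  obtain ⟨b, hb⟩ := exists_basis_of_span hL.span_eq
  obtain ⟨d, hd, hco⟩ := hL.exists_coord b hb
  choose q hq using fun i => hξ (b i) (hb i)
  let D : ℕ := ∏ i, (q i).den
  have hD : 0 < D := Finset.prod_pos fun i _ => (q i).pos
  have hDq : ∀ i, ∃ m : ℤ, (D : ℝ) * q i = m := by
    intro i
    obtain ⟨e, he⟩ : (q i).den ∣ D := Finset.dvd_prod_of_mem _ (Finset.mem_univ i)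
    refine ⟨e * (q i).num, ?_⟩
    have h1 : ((q i).den : ℝ) * q i = (q i).num := by
      have := Rat.den_mul_eq_num (q i)
      exact_mod_cast this
    rw [he]
    push_cast
    rw [mul_comm ((q i).den : ℝ), mul_assoc, h1]
  choose m hm using hDq
  have hsum : ξ = ∑ i, ξ (b i) • b.coord i := by
    refine b.ext fun j => ?_
    simp
  have hmem : (d * D) • ξ ∈ dualLat L := by
    have e : (d * (D : ℤ)) • ξ = ∑ i, m i • d • b.coord i := by
      conv_lhs => rw [hsum]
      rw [Finset.smul_sum]
      refine Finset.sum_congr rfl fun i _ => ?_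
      rw [← Int.cast_smul_eq_zsmul ℝ, ← Int.cast_smul_eq_zsmul ℝ (m i),
        ← Int.cast_smul_eq_zsmul ℝ d, smul_smul, smul_smul, ← hm i, hq i]
      congr 1
      push_cast
      ring
    rw [e]
    exact AddSubgroup.sum_mem _ fun i _ => AddSubgroup.zsmul_mem _ (hco i) _
  refine ⟨(d * D).natAbs, Int.natAbs_pos.2 (mul_ne_zero hd (by exact_mod_cast hD.ne')), ?_⟩
  rcases Int.natAbs_eq (d * D) with e | e
  · rw [e, natCast_zsmul] at hmem
    exact hmem
  · rw [e, neg_smul, natCast_zsmul] at hmem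
    simpa using (dualLat L).neg_mem hmem

end Hull

/-! ### Lattices in the rational structure, and closures of open cones. -/

section Bridge

open PolyCone

variable {V : Type*} [NormedAddCommGroup V] [NormedSpace ℝ V] [FiniteDimensional ℝ V]

theorem exists_lattice_basis {L : Submodule ℤ V} [DiscreteTopology L] [IsZLattice ℝ L] :
    ∃ (n : ℕ) (b : Basis (Fin n) ℝ V), Submodule.span ℤ (Set.range b) = L := by
  have : Module.Finite ℤ L := ZLattice.module_finite ℝ L
  have : Module.Free ℤ L := ZLattice.module_free ℝ L
  exact ⟨_, (Module.finBasis ℤ L).ofZLatticeBasis ℝ L, Module.Basis.ofZLatticeBasis_span ℝ L _⟩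

theorem isLat_of_basis {n : ℕ} (b : Basis (Fin n) ℝ V) {L : Submodule ℤ V}
    (hb : Submodule.span ℤ (Set.range b) = L) : IsLat L.toAddSubgroup := by
  have hbL : ∀ i, b i ∈ L := fun i => hb ▸ Submodule.subset_span ⟨i, rfl⟩
  constructor
  · rw [← top_le_iff, ← b.span_eq]
    exact Submodule.span_mono (by rintro _ ⟨i, rfl⟩; exact hbL i)
  · rw [← top_le_iff, ← b.dualBasis.span_eq]
    refine Submodule.span_mono ?_
    rintro _ ⟨i, rfl⟩ v hv
    have hv' : v ∈ Submodule.span ℤ (Set.range b) := hb ▸ hv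
    induction hv' using Submodule.span_induction with
    | mem x hx =>
      obtain ⟨j, rfl⟩ := hx
      rw [Basis.dualBasis_apply_self]
      exact ⟨if j = i then 1 else 0, by split_ifs <;> simp⟩
    | zero => exact ⟨0, by simp⟩
    | add x y hx hy h1 h2 =>
      obtain ⟨k, hk⟩ := h1 (by rw [← hb]; exact hx)
      obtain ⟨l, hl⟩ := h2 (by rw [← hb]; exact hy)
      exact ⟨k + l, by rw [map_add, hk, hl]; push_cast; rfl⟩
    | smul a x hx h1 =>
      obtain ⟨k, hk⟩ := h1 (by rw [← hb]; exact hx)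
      exact ⟨a * k, by rw [map_zsmul, hk, zsmul_eq_mul]; push_cast; rfl⟩

/-- A lattice basis is independent over `ℚ` and has as many elements as a basis of the rational
structure, so it spans the latter; denominators are then cleared. -/
theorem exists_nsmul_mem [Module ℚ V] {VQ : Submodule ℚ V} (hVQ : IsRationalStructure VQ) {n : ℕ}
    (b : Basis (Fin n) ℝ V) {L : Submodule ℤ V} (hb : Submodule.span ℤ (Set.range b) = L)
    (hL : (L : Set V) ⊆ VQ) {v : V} (hv : v ∈ VQ) : ∃ k : ℕ, 0 < k ∧ k • v ∈ L := by
  obtain ⟨b₀, rfl⟩ := hVQ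
  have hbL : ∀ i, b i ∈ L := fun i => hb ▸ Submodule.subset_span ⟨i, rfl⟩
  have hli : LinearIndependent ℚ b := b.linearIndependent.restrict_scalars' ℚ
  have hli₀ : LinearIndependent ℚ b₀ := b₀.linearIndependent.restrict_scalars' ℚ
  have hle : Submodule.span ℚ (Set.range b) ≤ Submodule.span ℚ (Set.range b₀) := by
    rw [Submodule.span_le]
    rintro _ ⟨i, rfl⟩
    exact hL (hbL i)
  have heq : Submodule.span ℚ (Set.range b) = Submodule.span ℚ (Set.range b₀) := by
    have : Module.Finite ℚ (Submodule.span ℚ (Set.range b₀)) :=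
      Module.Finite.span_of_finite ℚ (Set.finite_range _)
    refine Submodule.eq_of_le_of_finrank_eq hle ?_
    rw [finrank_span_eq_card hli, finrank_span_eq_card hli₀, Fintype.card_fin, Fintype.card_fin,
      finrank_eq_card_basis b, Fintype.card_fin]
  rw [← heq] at hv
  induction hv using Submodule.span_induction with
  | mem x hx =>
    obtain ⟨i, rfl⟩ := hx
    exact ⟨1, one_pos, by rw [one_smul]; exact hbL i⟩
  | zero => exact ⟨1, one_pos, by rw [smul_zero]; exact L.zero_mem⟩
  | add x y _ _ hx hy =>
    obtain ⟨k, hk, h1⟩ := hx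
    obtain ⟨l, hl, h2⟩ := hy
    refine ⟨k * l, Nat.mul_pos hk hl, ?_⟩
    rw [smul_add]
    refine L.add_mem ?_ ?_
    · rw [mul_comm, mul_smul]; exact L.toAddSubgroup.nsmul_mem h1 l
    · rw [mul_smul]; exact L.toAddSubgroup.nsmul_mem h2 k
  | smul q x _ hx =>
    obtain ⟨k, hk, h1⟩ := hx
    refine ⟨q.den * k, Nat.mul_pos q.pos hk, ?_⟩
    have e : (q.den * k) • q • x = q.num • k • x := by
      rw [← Nat.cast_smul_eq_nsmul ℚ, ← Int.cast_smul_eq_zsmul ℚ, ← Nat.cast_smul_eq_nsmul ℚ k,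
        smul_smul, smul_smul]
      congr 1
      push_cast
      rw [mul_right_comm, Rat.den_mul_eq_num]
    rw [e]
    exact L.smul_mem _ h1

theorem zero_mem_closure {C : Set V} (hC : IsOpenNondegenerateCone C) : (0 : V) ∈ closure C := by
  obtain ⟨x, hx⟩ := hC.nonempty
  have h1 : Filter.Tendsto (fun n : ℕ => (1 / ((n : ℝ) + 1)) • x) Filter.atTop (nhds ((0 : ℝ) • x)) :=
    tendsto_one_div_add_atTop_nhds_zero_nat.smul_const x
  rw [zero_smul] at h1
  exact mem_closure_of_tendsto h1 (Filter.Eventually.of_forall fun n =>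
    hC.smul_mem x hx _ (by positivity))

theorem smul_mem_closure {C : Set V} (hC : IsOpenNondegenerateCone C) {x : V}
    (hx : x ∈ closure C) {t : ℝ} (ht : 0 ≤ t) : t • x ∈ closure C := by
  rcases eq_or_lt_of_le ht with rfl | h0
  · rw [zero_smul]; exact zero_mem_closure hC
  · exact map_mem_closure (continuous_const_smul t) hx fun y hy => hC.smul_mem y hy t h0

/-- The closure of an open nondegenerate cone. -/
def closureCone {C : Set V} (hC : IsOpenNondegenerateCone C) : PointedCone ℝ V :=
  PointedCone.ofConeComb (closure C) ⟨0, zero_mem_closure hC⟩ (by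
    intro x hx y hy a ha b hb
    have h1 := hC.convex.closure (smul_mem_closure hC hx (t := 2 * a) (by linarith))
      (smul_mem_closure hC hy (t := 2 * b) (by linarith))
      (a := 1 / 2) (b := 1 / 2) (by norm_num) (by norm_num) (by norm_num)
    rw [smul_smul, smul_smul] at h1
    convert h1 using 3 <;> ring)

theorem exists_absorb {C : Set V} (hC : IsOpen C) {x : V} (hx : x ∈ C) (v : V) :
    ∃ ε : ℝ, 0 < ε ∧ x + ε • v ∈ C := by
  have h1 : Filter.Tendsto (fun t : ℝ => x + t • v) (nhds 0) (nhds x) := by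
    have : Continuous fun t : ℝ => x + t • v := by fun_prop
    simpa using this.tendsto 0
  obtain ⟨δ, hδ, hb⟩ := Metric.eventually_nhds_iff.1 (h1.eventually (hC.mem_nhds hx))
  refine ⟨δ / 2, by positivity, hb ?_⟩
  rw [dist_zero_right, Real.norm_of_nonneg (by positivity)]
  linarith

theorem mem_core_closureCone {C : Set V} (hC : IsOpenNondegenerateCone C) {x : V} (hx : x ∈ C) :
    x ∈ core (closureCone hC) := by
  refine ⟨subset_closure hx, fun y _ => ?_⟩
  obtain ⟨ε, hε, h⟩ := exists_absorb hC.isOpen hx (-y)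
  refine ⟨ε, hε, ?_⟩
  rw [smul_neg, ← sub_eq_add_neg] at h
  exact subset_closure h

theorem span_closureCone {C : Set V} (hC : IsOpenNondegenerateCone C) :
    Submodule.span ℝ (closureCone hC : Set V) = ⊤ := by
  obtain ⟨x, hx⟩ := hC.nonempty
  rw [eq_top_iff]
  rintro v -
  obtain ⟨ε, hε, h⟩ := exists_absorb hC.isOpen hx v
  have h1 := Submodule.sub_mem _ (Submodule.subset_span (R := ℝ)
    (show x + ε • v ∈ (closureCone hC : Set V) from subset_closure h))
    (Submodule.subset_span (R := ℝ) (show x ∈ (closureCone hC : Set V) from subset_closure hx))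
  rw [add_sub_cancel_left] at h1
  have h2 := Submodule.smul_mem _ ε⁻¹ h1
  rwa [smul_smul, inv_mul_cancel₀ hε.ne', one_smul] at h2

theorem nonneg_closure {C : Set V} {ξ : Dual ℝ V} (hξ : ∀ x ∈ C, 0 ≤ ξ x) {x : V}
    (hx : x ∈ closure C) : 0 ≤ ξ x := by
  have hcl : IsClosed {x | 0 ≤ ξ x} :=
    isClosed_le continuous_const ξ.continuous_of_finiteDimensional
  exact closure_minimal (fun x hx => hξ x hx) hcl hx

/-- The dual cone, as a cone of linear forms. -/
def dualPC (C : Set V) : PointedCone ℝ (Dual ℝ V) where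
  carrier := {ξ | ∀ x ∈ C, 0 ≤ ξ x}
  add_mem' := fun ha hb x hx => add_nonneg (ha x hx) (hb x hx)
  zero_mem' := fun _ _ => le_rfl
  smul_mem' := fun a _ hξ x hx => mul_nonneg a.2 (hξ x hx)

/-- A vector killed by every form of the dual cone is a lineality direction of `C`, and
nondegeneracy excludes these. -/
theorem span_dualPC {C : Set V} (hC : IsOpenNondegenerateCone C) :
    Submodule.span ℝ (dualPC C : Set (Dual ℝ V)) = ⊤ := by
  by_contra hne
  obtain ⟨f, hf, hle⟩ := Submodule.exists_le_ker_of_lt_top _ (lt_top_iff_ne_top.2 hne)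
  obtain ⟨v, rfl⟩ := (evalEquiv ℝ V).surjective f
  have hv : v ≠ 0 := by rintro rfl; exact hf (map_zero _)
  obtain ⟨x, hx⟩ := hC.nonempty
  obtain ⟨t, ht⟩ := hC.no_line x v hv
  -- If the origin lay in the open cone `C`, then `C` would be the whole space; this case is
  -- excluded separately because `IsOpenCone` omits the origin.
  by_cases h0 : (0 : V) ∈ C
  · obtain ⟨ε, hε, h1⟩ := exists_absorb hC.isOpen h0 (x + t • v)
    have h2 := hC.smul_mem _ h1 ε⁻¹ (by positivity)
    rw [zero_add, smul_smul, inv_mul_cancel₀ hε.ne', one_smul] at h2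
    exact ht h2
  · have hD : IsOpenCone C := by
      refine ⟨hC.isOpen, hC.nonempty, fun x hx y hy => ?_, hC.smul_mem, h0⟩
      have h1 := hC.convex (hC.smul_mem x hx 2 two_pos) (hC.smul_mem y hy 2 two_pos)
        (a := 1 / 2) (b := 1 / 2) (by norm_num) (by norm_num) (by norm_num)
      rw [smul_smul, smul_smul] at h1
      norm_num at h1
      exact h1
    exact ht (hD.add_lin hx (Submodule.smul_mem _ t (mem_lin.2 fun β hβ =>
      hle (Submodule.subset_span (show β ∈ (dualPC C : Set (Dual ℝ V)) from hβ)))))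

end Bridge

end RatCone

namespace RatCone

/-! ### The system attached to a polyhedral triple. -/

section System

open PolyCone

variable {V : Type*} [NormedAddCommGroup V] [NormedSpace ℝ V] [FiniteDimensional ℝ V]

theorem convex_core {E : Type*} [AddCommGroup E] [Module ℝ E] {Y : PointedCone ℝ E} :
    Convex ℝ (core Y) := by
  intro ξ hξ ζ hζ a b ha hb hab
  rcases eq_or_lt_of_le ha with rfl | ha'
  · rw [zero_add] at hab
    subst hab
    rwa [zero_smul, one_smul, zero_add]
  · exact core_add (core_smul hξ ha') (Y.smul_mem hb hζ.1)

theorem core_subset_intrinsicInterior {G : PointedCone ℝ V} :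
    core G ⊆ intrinsicInterior ℝ (G : Set V) := by
  intro x hx
  let W := Submodule.span ℝ (G : Set V)
  have hGW : ∀ y ∈ G, y ∈ W := fun y hy => Submodule.subset_span hy
  have hopen : IsOpen (core (restr W G)) :=
    isOpen_of_absorb convex_core fun d hd u => core_absorb hd (by
      rw [restr_span rfl]
      trivial)
  have hφ : ∀ y : affineSpan ℝ (G : Set V), (y : V) ∈ W := fun y =>
    affineSpan_le_toAffineSubspace_span y.2
  let φ : affineSpan ℝ (G : Set V) → W := fun y => ⟨y, hφ y⟩
  have hc : Continuous φ := continuous_subtype_val.subtype_mk _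
  exact mem_intrinsicInterior.2 ⟨⟨x, subset_affineSpan ℝ _ hx.1⟩,
    mem_interior.2 ⟨φ ⁻¹' core (restr W G),
      fun y hy => ((mem_core_restr (x := φ y) hGW).1 hy).1, hopen.preimage hc,
        (mem_core_restr hGW).2 hx⟩, rfl⟩

/-- A real core point of the dual cone is a positive combination of integral forms of that cone. An
integral core point of the cone they generate dominates it, and hence every form of the dual cone.
-/
theorem exists_core_dualPC {C : Set V} (hC : IsOpenNondegenerateCone C) {L : AddSubgroup V}
    (hL : IsLat L) : ∃ ξ ∈ dualLat L, ξ ∈ core (dualPC C) := by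
  obtain ⟨r, -, hr⟩ := exists_mem_core_hull (dualPC C : Set (Dual ℝ V))
  have e : PointedCone.hull ℝ (dualPC C : Set (Dual ℝ V)) = dualPC C := Submodule.span_eq _
  rw [e] at hr
  have h1 := mem_hull_lattice (L := dualLat L) hr (by
    rw [span_dualPC hC, Submodule.top_coe, Set.univ_inter, hL.dual_span]
    exact Submodule.mem_top)
  obtain ⟨ξ, hξ, hξc⟩ := exists_mem_core_hull (dualPC C ∩ dualLat L : Set (Dual ℝ V))
  obtain ⟨N, hN, h2⟩ := core_dom hξc h1
  have hle : PointedCone.hull ℝ (dualPC C ∩ dualLat L : Set (Dual ℝ V)) ≤ dualPC C :=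
    Submodule.span_le.2 Set.inter_subset_left
  have hξL : ξ ∈ dualLat L :=
    (AddSubmonoid.closure_le (S := (dualLat L).toAddSubmonoid)).2 Set.inter_subset_right hξ
  refine ⟨ξ, hξL, mem_core_of_dom (hle hξc.1) fun y hy => ?_⟩
  obtain ⟨M, hM, h3⟩ := core_dom hr hy
  refine ⟨M * N, by positivity, ?_⟩
  have h4 := (dualPC C).add_mem ((dualPC C).smul_mem hM.le (hle h2)) h3
  convert h4 using 1
  module

/-- The cone generated by the lattice points of the closure of `C`. -/
def latticeCone (C : Set V) (L : AddSubgroup V) : PointedCone ℝ V :=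
  PointedCone.hull ℝ (closure C ∩ L)

theorem latticeCone_subset {C : Set V} (hC : IsOpenNondegenerateCone C) {L : AddSubgroup V} :
    (latticeCone C L : Set V) ⊆ closure C := by
  have : latticeCone C L ≤ closureCone hC := Submodule.span_le.2 Set.inter_subset_left
  exact this

theorem subset_latticeCone {C : Set V} (hC : IsOpenNondegenerateCone C) {L : AddSubgroup V}
    (hL : IsLat L) : C ⊆ latticeCone C L := by
  intro x hx
  have h1 := mem_hull_lattice (L := L) (mem_core_closureCone hC hx) (by
    rw [span_closureCone hC, Submodule.top_coe, Set.univ_inter, hL.span_eq]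
    exact Submodule.mem_top)
  exact h1

theorem latticeCone_nonneg_iff {C : Set V} (hC : IsOpenNondegenerateCone C) {L : AddSubgroup V}
    (hL : IsLat L) {ξ : Dual ℝ V} : (∀ x ∈ latticeCone C L, 0 ≤ ξ x) ↔ ∀ x ∈ C, 0 ≤ ξ x :=
  ⟨fun h x hx => h x (subset_latticeCone hC hL hx),
    fun h _ hx => nonneg_closure h (latticeCone_subset hC hx)⟩

theorem posForms_latticeCone {C : Set V} (hC : IsOpenNondegenerateCone C) {L : AddSubgroup V}
    (hL : IsLat L) : (posForms L (latticeCone C L)).Nonempty := by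
  obtain ⟨ξ, hξL, hξ⟩ := exists_core_dualPC hC hL
  refine ⟨ξ, hξL, (latticeCone_nonneg_iff hC hL).2 hξ.1, fun α => ?_⟩
  obtain ⟨N, -, h⟩ := mem_core_of_smul_sub hξ (y := -α) (by rw [span_dualPC hC]; trivial)
  refine ⟨N, fun x hx => ?_⟩
  have h1 := (latticeCone_nonneg_iff hC hL).2 h.1 x hx
  rw [LinearMap.add_apply, LinearMap.smul_apply, LinearMap.neg_apply, smul_eq_mul] at h1
  linarith

theorem latticeCone_sys {C : Set V} (hC : IsOpenNondegenerateCone C) {L : AddSubgroup V}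
    (hL : IsLat L) {Γ : Subgroup (V ≃ₗ[ℝ] V)} (hΓC : ∀ γ ∈ Γ, γ '' C = C)
    (hΓL : ∀ γ ∈ Γ, ∀ v ∈ L, γ v ∈ L) {P : Set V} (hP : IsPolyhedralCone P)
    (hPX : P ⊆ latticeCone C L) (hcov : ⋃ γ ∈ Γ, γ '' P = latticeCone C L) :
    Sys L (latticeCone C L) Γ where
  lat := hL
  gen := by
    refine le_antisymm (Submodule.span_mono fun x hx => ⟨Submodule.subset_span hx, hx.2⟩)
      (Submodule.span_le.2 Set.inter_subset_left)
  span_top := by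
    obtain ⟨x, hx⟩ := hC.nonempty
    rw [eq_top_iff]
    rintro v -
    obtain ⟨ε, hε, h⟩ := exists_absorb hC.isOpen hx v
    have h1 := Submodule.sub_mem _
      (Submodule.subset_span (R := ℝ) (subset_latticeCone hC hL h))
      (Submodule.subset_span (R := ℝ) (subset_latticeCone hC hL hx))
    rw [add_sub_cancel_left] at h1
    exact (Submodule.smul_mem_iff _ hε.ne').1 h1
  unit := posForms_latticeCone hC hL
  mapL := hΓL
  mapX := by
    intro γ hγ
    have h1 : latticeCone C L ≤ (latticeCone C L).comap γ.toLinearMap := by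
      refine Submodule.span_le.2 fun x hx => Submodule.subset_span ⟨?_, hΓL γ hγ x hx.2⟩
      refine map_mem_closure γ.toLinearMap.continuous_of_finiteDimensional hx.1 fun y hy => ?_
      rw [← hΓC γ hγ]
      exact ⟨y, hy, rfl⟩
    exact fun x hx => h1 hx
  cover := by
    obtain ⟨S, rfl⟩ := hP
    -- The generators of the given polyhedral cone need not be lattice points. Each is a positive
    -- combination of finitely many, and the larger cone spanned by these still covers.
    obtain ⟨T, hT, hST⟩ := Submodule.subset_span_finite_of_subset_span
      (Submodule.subset_span.trans hPX : (S : Set V) ⊆ latticeCone C L)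
    refine ⟨T, fun x hx => ⟨Submodule.subset_span (hT hx), (hT hx).2⟩, fun x hx => ?_⟩
    have h1 : x ∈ ⋃ γ ∈ Γ, γ '' (PointedCone.hull ℝ (S : Set V) : Set V) := hcov ▸ hx.1
    simp only [Set.mem_iUnion] at h1
    obtain ⟨γ, hγ, p, hp, rfl⟩ := h1
    exact ⟨γ, hγ, p, Submodule.span_le.2 hST hp, rfl⟩

theorem ratHull_eq [Module ℚ V] {VQ : Submodule ℚ V} {C : Set V} (hC : IsOpenNondegenerateCone C)
    {L : AddSubgroup V} (hLQ : (L : Set V) ⊆ VQ) (hQL : ∀ v ∈ VQ, ∃ k : ℕ, 0 < k ∧ k • v ∈ L) :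
    ratHull VQ C = latticeCone C L := by
  have hn : ∀ v ∈ closure C, ∀ n : ℕ, n • v ∈ closure C := by
    intro v hv n
    rw [← Nat.cast_smul_eq_nsmul ℝ]
    exact smul_mem_closure hC hv n.cast_nonneg
  have h0 : (0 : V) ∈ closure C ∩ VQ := ⟨zero_mem_closure hC, VQ.zero_mem⟩
  rw [ratHull, latticeCone, convexHull_eq_hull h0
    fun v hv n => ⟨hn v hv.1 n, VQ.toAddSubmonoid.nsmul_mem hv.2 n⟩,
    hull_eq_of_smul (Set.inter_subset_inter_right (closure C) hLQ)]
  intro v hv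
  obtain ⟨k, hk, hm⟩ := hQL v hv.2
  exact ⟨k, hk, hn v hv.1 k, hm⟩

theorem exists_rat_of_dualLat {E : Type*} [AddCommGroup E] [Module ℝ E] {L : AddSubgroup E}
    {ξ : Dual ℝ E} (hξ : ξ ∈ dualLat L) {v : E} {k : ℕ} (hk : 0 < k) (hv : k • v ∈ L) :
    ∃ q : ℚ, ξ v = q := by
  obtain ⟨n, hn⟩ := hξ _ hv
  have hk' : (k : ℝ) ≠ 0 := by exact_mod_cast hk.ne'
  rw [map_nsmul, nsmul_eq_mul] at hn
  refine ⟨n / k, ?_⟩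
  push_cast
  rw [eq_div_iff hk', mul_comm]
  exact hn

theorem isClosed_dualCone {C : Set V} : IsClosed (dualCone C) := by
  have : dualCone C = ⋂ x ∈ C, {ξ : StrongDual ℝ V | 0 ≤ ξ x} := by
    ext ξ
    simp [dualCone]
  rw [this]
  exact isClosed_biInter fun x _ =>
    isClosed_le continuous_const (ContinuousLinearMap.apply ℝ ℝ x).continuous

theorem convex_dualCone {C : Set V} : Convex ℝ (dualCone C) := by
  intro ξ hξ ζ hζ a b ha hb _ x hx
  exact add_nonneg (mul_nonneg ha (hξ x hx)) (mul_nonneg hb (hζ x hx))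

/-- The dual cone is closed and convex, and its algebraic core is a nonempty open set. -/
theorem closure_openDual {C : Set V} (hC : IsOpenNondegenerateCone C) :
    closure (openDual C) = dualCone C := by
  rw [openDual, convex_dualCone.closure_interior_eq_closure_of_nonempty_interior,
    isClosed_dualCone.closure_eq]
  obtain ⟨r, -, hr⟩ := exists_mem_core_hull (dualPC C : Set (Dual ℝ V))
  have e : PointedCone.hull ℝ (dualPC C : Set (Dual ℝ V)) = dualPC C := Submodule.span_eq _
  rw [e] at hr
  let D : Set (StrongDual ℝ V) := {ξ | (ξ : Dual ℝ V) ∈ core (dualPC C)}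
  have hD : IsOpen D := by
    refine isOpen_of_absorb ?_ fun ξ hξ ζ => ?_
    · exact convex_core.linear_preimage (LinearMap.toContinuousLinearMap.symm.toLinearMap)
    · exact core_absorb (v := (ζ : Dual ℝ V)) hξ (by rw [span_dualPC hC]; trivial)
  exact ⟨LinearMap.toContinuousLinearMap r,
    mem_interior.2 ⟨D, fun ξ hξ => hξ.1, hD, by simpa [D] using hr⟩⟩

/-- Integral forms are rational and rational forms have integral multiples, so the rational points
and the integral points of the dual cone generate the same cone. -/
theorem mem_dualRatHull_iff [Module ℚ V] {VQ : Submodule ℚ V} {C : Set V}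
    (hC : IsOpenNondegenerateCone C) {L : AddSubgroup V} (hL : IsLat L)
    (hLQ : (L : Set V) ⊆ VQ) (hQL : ∀ v ∈ VQ, ∃ k : ℕ, 0 < k ∧ k • v ∈ L)
    {ξ : StrongDual ℝ V} :
    ξ ∈ dualRatHull VQ C ↔ (ξ : Dual ℝ V) ∈ dagCone L (latticeCone C L) ⊥ := by
  have hint : ∀ ξ : StrongDual ℝ V, (ξ : Dual ℝ V) ∈ dualLat L → ξ ∈ dualRat VQ := by
    intro ξ hξ v hv
    obtain ⟨k, hk, hm⟩ := hQL v hv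
    exact exists_rat_of_dualLat hξ hk hm
  have hsub : dualCone C ∩ {ξ : StrongDual ℝ V | (ξ : Dual ℝ V) ∈ dualLat L} ⊆
      dualCone C ∩ dualRat VQ := Set.inter_subset_inter_right _ hint
  have hn : ∀ ξ ∈ dualCone C, ∀ n : ℕ, n • ξ ∈ dualCone C := fun ξ hξ n x hx =>
    nsmul_nonneg (hξ x hx) n
  have hS : dualRatHull VQ C =
      (PointedCone.hull ℝ (dualCone C ∩ {ξ | (ξ : Dual ℝ V) ∈ dualLat L}) :
        Set (StrongDual ℝ V)) := by
    rw [dualRatHull, ratHull, closure_openDual hC, convexHull_eq_hull,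
      hull_eq_of_smul hsub]
    · intro ξ hξ
      obtain ⟨n, hn0, hn1⟩ := hL.exists_smul_integral (ξ := (ξ : Dual ℝ V))
        fun v hv => hξ.2 v (hLQ hv)
      exact ⟨n, hn0, hn ξ hξ.1 n, hn1⟩
    · exact ⟨fun _ _ => le_rfl, fun _ _ => ⟨0, by simp⟩⟩
    · refine fun ξ hξ n => ⟨hn ξ hξ.1 n, fun v hv => ?_⟩
      obtain ⟨q, hq⟩ := hξ.2 v hv
      refine ⟨n * q, ?_⟩
      change n • ξ v = _
      rw [hq, nsmul_eq_mul]
      push_cast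
      rfl
  let T : StrongDual ℝ V →ₗ[ℝ] Dual ℝ V := LinearMap.toContinuousLinearMap.symm.toLinearMap
  let T' : Dual ℝ V →ₗ[ℝ] StrongDual ℝ V := LinearMap.toContinuousLinearMap.toLinearMap
  rw [hS]
  constructor
  · have hle : PointedCone.hull ℝ (dualCone C ∩ {ξ | (ξ : Dual ℝ V) ∈ dualLat L}) ≤
        (dagCone L (latticeCone C L) ⊥).comap T :=
      Submodule.span_le.2 fun ξ hξ => Submodule.subset_span
        ⟨hξ.2, (latticeCone_nonneg_iff hC hL).2 hξ.1, fun x hx => by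
          rw [(Submodule.mem_bot _).1 hx, map_zero]⟩
    exact fun h => hle h
  · have hle : dagCone L (latticeCone C L) ⊥ ≤
        (PointedCone.hull ℝ (dualCone C ∩ {ξ | (ξ : Dual ℝ V) ∈ dualLat L})).comap T' :=
      Submodule.span_le.2 fun ξ hξ => Submodule.subset_span
        ⟨(latticeCone_nonneg_iff hC hL).1 hξ.2.1, hξ.1⟩
    intro h
    have := hle h
    exact this

/-- The lattice `L` and the cone `X` compute the cones `C₊` and `C°₊`. -/
structure IsModel [Module ℚ V] (VQ : Submodule ℚ V) (C : Set V) (Γ : Subgroup (V ≃ₗ[ℝ] V))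
    (L : AddSubgroup V) (X : PointedCone ℝ V) : Prop where
  sys : Sys L X Γ
  ratHull_eq : ratHull VQ C = X
  subset : (L : Set V) ⊆ VQ
  exists_nsmul : ∀ v ∈ VQ, ∃ k : ℕ, 0 < k ∧ k • v ∈ L
  mem_dualRatHull : ∀ ξ : StrongDual ℝ V, ξ ∈ dualRatHull VQ C ↔ (ξ : Dual ℝ V) ∈ dagCone L X ⊥

theorem exists_isModel [Module ℚ V] {VQ : Submodule ℚ V} {C : Set V} {Γ : Subgroup (V ≃ₗ[ℝ] V)}
    (h : IsPolyhedralTriple VQ C Γ) :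
    ∃ (L : AddSubgroup V) (X : PointedCone ℝ V), IsModel VQ C Γ L X := by
  obtain ⟨L, ⟨⟨hd, hz⟩, hLQ⟩, hΓL⟩ := h.stabilizes_lattice
  obtain ⟨n, b, hb⟩ := exists_lattice_basis (L := L)
  have hL := isLat_of_basis b hb
  have hQL : ∀ v ∈ VQ, ∃ k : ℕ, 0 < k ∧ k • v ∈ L.toAddSubgroup := fun v hv =>
    exists_nsmul_mem h.rational b hb hLQ hv
  have hX := ratHull_eq (L := L.toAddSubgroup) h.cone hLQ hQL
  obtain ⟨P, hP, hPX, hcov⟩ := h.polyhedral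
  rw [hX] at hPX hcov
  refine ⟨L.toAddSubgroup, latticeCone C L.toAddSubgroup,
    latticeCone_sys h.cone hL h.stabilizes_cone (fun γ hγ v hv => ?_) hP hPX hcov, hX, hLQ, hQL,
    fun _ => mem_dualRatHull_iff h.cone hL hLQ hQL⟩
  have : γ v ∈ (L : Set V) := by
    rw [← hΓL γ hγ]
    exact ⟨v, hv, rfl⟩
  exact this

end System

end RatCone

namespace RatCone

/-! ### The four statements, read off from the system. -/

section Model

open PolyCone

variable {V : Type*} [NormedAddCommGroup V] [NormedSpace ℝ V] [FiniteDimensional ℝ V] [Module ℚ V]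
  {VQ : Submodule ℚ V} {C : Set V} {Γ : Subgroup (V ≃ₗ[ℝ] V)} {L : AddSubgroup V}
  {X F G : PointedCone ℝ V}

/-- A cone of linear forms, as a cone of continuous linear forms. -/
noncomputable def continuousForms (K : PointedCone ℝ (Dual ℝ V)) : PointedCone ℝ (StrongDual ℝ V) :=
  K.comap (LinearMap.toContinuousLinearMap.symm.toLinearMap : StrongDual ℝ V →ₗ[ℝ] Dual ℝ V)

namespace IsModel

variable (h : IsModel VQ C Γ L X)
include h

theorem isFace_iff {Y : Set V} :
    IsFace (ratHull VQ C) Y ↔ ∃ F : PointedCone ℝ V, F.IsFaceOf X ∧ (F : Set V) = Y := by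
  rw [h.ratHull_eq, RatCone.isFace_iff]

theorem dagger_eq (hF : F.IsFaceOf X) :
    dagger VQ C (F : Set V) = continuousForms (dagCone L X F) := by
  ext ξ
  obtain ⟨r, -, hr⟩ := h.sys.exists_face_core hF
  constructor
  · rintro ⟨h1, h2⟩
    exact mem_dagCone_of_zero hF.le hr ((h.mem_dualRatHull ξ).1 h1) (h2 r hr.1)
  · intro hξ
    exact ⟨(h.mem_dualRatHull ξ).2 (dagCone_le hξ), fun x hx =>
      dagCone_eq_zero hξ (span_le_upper (Submodule.subset_span hx))⟩

theorem mem_dagger (hF : F.IsFaceOf X) {ξ : StrongDual ℝ V} :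
    ξ ∈ dagger VQ C (F : Set V) ↔ (ξ : Dual ℝ V) ∈ dagCone L X F := by
  rw [h.dagger_eq hF]
  rfl

theorem mem_dagger_of_dag (hF : F.IsFaceOf X) {ξ : Dual ℝ V} (hξ : ξ ∈ dag L X F) :
    LinearMap.toContinuousLinearMap ξ ∈ dagger VQ C (F : Set V) :=
  (h.mem_dagger hF).2 (dag_subset_dagCone hξ)

theorem mem_upperSpace (hF : F.IsFaceOf X) {v : V} :
    v ∈ upperSpace VQ C (F : Set V) ↔ v ∈ upper L X F := by
  constructor
  · exact fun hv => mem_upper.2 fun ξ hξ => hv _ (h.mem_dagger_of_dag hF hξ)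
  · exact fun hv ξ hξ => dagCone_eq_zero ((h.mem_dagger hF).1 hξ) hv

theorem codagger_dagger (hF : F.IsFaceOf X) :
    codagger VQ C (dagger VQ C (F : Set V)) = F := by
  ext x
  constructor
  · rintro ⟨h1, h2⟩
    rw [h.ratHull_eq] at h1
    obtain ⟨ξ, hξ⟩ := h.sys.exists_exposing hF
    exact (hξ.2.2 x h1).1 (h2 _ (h.mem_dagger_of_dag hF (exposing_subset_dag hF.le hξ)))
  · intro hx
    exact ⟨h.ratHull_eq ▸ hF.le hx, fun ξ hξ => hξ.2 x hx⟩

theorem isExposed (hF : F.IsFaceOf X) : IsExposed ℝ (ratHull VQ C) (F : Set V) := by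
  obtain ⟨ξ, hξ⟩ := h.sys.exists_exposing hF
  -- Exposed sets are defined by maximizing a form, hence the sign.
  refine fun _ => ⟨-LinearMap.toContinuousLinearMap ξ, ?_⟩
  rw [h.ratHull_eq]
  ext x
  constructor
  · intro hx
    refine ⟨hF.le hx, fun y hy => neg_le_neg ?_⟩
    change ξ x ≤ ξ y
    rw [(hξ.2.2 x (hF.le hx)).2 hx]
    exact hξ.2.1 y hy
  · rintro ⟨h1, h2⟩
    have h3 : ξ x ≤ ξ 0 := neg_le_neg_iff.1 (h2 0 X.zero_mem)
    rw [map_zero] at h3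
    exact (hξ.2.2 x h1).1 (le_antisymm h3 (hξ.2.1 x h1))

theorem dualRatHull_eq : dualRatHull VQ C = continuousForms (dagCone L X ⊥) :=
  Set.ext h.mem_dualRatHull

theorem isFace_dual_iff {H : Set (StrongDual ℝ V)} : IsFace (dualRatHull VQ C) H ↔
    ∃ F : PointedCone ℝ V, F.IsFaceOf X ∧ dagger VQ C (F : Set V) = H := by
  rw [h.dualRatHull_eq, RatCone.isFace_iff]
  constructor
  · rintro ⟨K, hK, rfl⟩
    let T : Dual ℝ V →ₗ[ℝ] StrongDual ℝ V := LinearMap.toContinuousLinearMap.toLinearMap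
    have hK' : (K.comap T : PointedCone ℝ (Dual ℝ V)).IsFaceOf (dagCone L X ⊥) :=
      { le := fun ξ hξ => hK.le (show T ξ ∈ K from hξ)
        mem_of_smul_add_mem := by
          intro ξ ζ a hξ hζ ha hm
          have hm' : T (a • ξ + ζ) ∈ K := hm
          rw [map_add, map_smul] at hm'
          exact hK.mem_of_smul_add_mem (x := T ξ) (y := T ζ) hξ hζ ha hm' }
    obtain ⟨F, hF, hFK⟩ := h.sys.exists_face_of_dual hK'
    refine ⟨F, hF, ?_⟩
    rw [h.dagger_eq hF, hFK]
    rfl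
  · rintro ⟨F, hF, rfl⟩
    obtain ⟨r, -, hr⟩ := h.sys.exists_face_core hF
    have hd := dagCone_isFaceOf (L := L) hF.le hr
    refine ⟨continuousForms (dagCone L X F), ⟨fun ξ hξ => hd.le hξ, ?_⟩, (h.dagger_eq hF).symm⟩
    intro ξ ζ a hξ hζ ha hm
    exact hd.mem_of_smul_add_mem (x := (ξ : Dual ℝ V)) (y := (ζ : Dual ℝ V)) hξ hζ ha hm

theorem bijOn_dagger :
    Set.BijOn (dagger VQ C) {F | IsFace (ratHull VQ C) F} {H | IsFace (dualRatHull VQ C) H} := by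
  refine ⟨fun Y hY => ?_, fun Y hY Y' hY' e => ?_, fun H hH => ?_⟩
  · obtain ⟨F, hF, rfl⟩ := h.isFace_iff.1 hY
    exact h.isFace_dual_iff.2 ⟨F, hF, rfl⟩
  · obtain ⟨F, hF, rfl⟩ := h.isFace_iff.1 hY
    obtain ⟨F', hF', rfl⟩ := h.isFace_iff.1 hY'
    rw [← h.codagger_dagger hF, ← h.codagger_dagger hF', e]
  · obtain ⟨F, hF, rfl⟩ := h.isFace_dual_iff.1 hH
    exact ⟨F, h.isFace_iff.2 ⟨F, hF, rfl⟩, rfl⟩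

theorem subset_iff_dagger (hF : F.IsFaceOf X) (hG : G.IsFaceOf X) :
    (F : Set V) ⊆ G ↔ dagger VQ C (G : Set V) ⊆ dagger VQ C (F : Set V) := by
  refine ⟨fun hFG ξ hξ => ⟨hξ.1, fun x hx => hξ.2 x (hFG hx)⟩, fun hs => ?_⟩
  rw [← h.codagger_dagger hF, ← h.codagger_dagger hG]
  exact fun x hx => ⟨hx.1, fun ξ hξ => hx.2 ξ (hs hξ)⟩

/-- Integral forms on `V` restrict to rational forms on the span of `G`, which gives one inclusion.
The other is `upper_restr`, after clearing denominators. -/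
theorem rational_zero_set (hF : F.IsFaceOf X) (hG : G.IsFaceOf X) (hFG : F ≤ G)
    (x : lowerSpace (G : Set V)) :
    (∀ ξ : Dual ℝ (lowerSpace (G : Set V)), IsRationalForm VQ (G : Set V) ξ →
      (∀ v : lowerSpace (G : Set V), (v : V) ∈ (G : Set V) → 0 ≤ ξ v) →
      (∀ v : lowerSpace (G : Set V), (v : V) ∈ (F : Set V) → ξ v = 0) → ξ x = 0) ↔
    (x : V) ∈ upperSpace VQ C (F : Set V) := by
  rw [h.mem_upperSpace hF]
  constructor
  · refine fun hx => mem_upper.2 fun ζ hζ => hx (ζ ∘ₗ (lowerSpace (G : Set V)).subtype)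
      (fun v hv => ?_) (fun v hv => hζ.2.1 v (hG.le hv)) fun v hv => hζ.2.2 v hv
    obtain ⟨k, hk, hm⟩ := h.exists_nsmul v hv
    exact exists_rat_of_dualLat hζ.1 hk hm
  · intro hx ξ hξ hξG hξF
    have hs := h.sys.sub hG rfl
    obtain ⟨n, hn, hnξ⟩ := hs.lat.exists_smul_integral fun v hv => hξ v (h.subset hv)
    have hmem : n • ξ ∈ dag (restrLat (lowerSpace (G : Set V)) L)
        (restr (lowerSpace (G : Set V)) G) (restr (lowerSpace (G : Set V)) F) := by
      refine ⟨hnξ, fun v hv => nsmul_nonneg (hξG v hv) n, fun v hv => ?_⟩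
      rw [LinearMap.smul_apply, hξF v hv, smul_zero]
    have h0 := mem_upper.1 (h.sys.upper_restr hF hG hFG rfl hx) _ hmem
    rw [LinearMap.smul_apply, nsmul_eq_mul] at h0
    exact (mul_eq_zero.1 h0).resolve_left (by exact_mod_cast hn.ne')

theorem bijOn_lowerProj (hF : F.IsFaceOf X) :
    Set.BijOn (fun G => lowerProj (F : Set V) '' G)
      {G | IsFace (ratHull VQ C) G ∧ (F : Set V) ⊆ G}
      {H | IsFace (lowerProj (F : Set V) '' ratHull VQ C) H} := by
  rw [h.ratHull_eq]
  refine bijOn_faces _ hF.le (fun v hv => ?_) fun G hG hFG x hx g hg e => ?_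
  · exact (Submodule.Quotient.mk_eq_zero _).2 (Submodule.subset_span hv)
  · have h1 : x - g ∈ lowerSpace (F : Set V) := (Submodule.Quotient.eq _).1 e
    refine face_mem_of_mem_span hG hx ?_
    rw [← sub_add_cancel x g]
    exact Submodule.add_mem _ (Submodule.span_mono hFG h1) (Submodule.subset_span hg)

/-- A form exposing `G` vanishes on `F`, so it kills `V^F` and still detects membership in `G` after
the projection. -/
theorem bijOn_upperProj (hF : F.IsFaceOf X) :
    Set.BijOn (fun G => upperProj VQ C (F : Set V) '' G)
      {G | IsFace (ratHull VQ C) G ∧ (F : Set V) ⊆ G}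
      {H | IsFace (upperProj VQ C (F : Set V) '' ratHull VQ C) H} := by
  rw [h.ratHull_eq]
  refine bijOn_faces _ hF.le (fun v hv => ?_) fun G hG hFG x hx g hg e => ?_
  · exact (Submodule.Quotient.mk_eq_zero _).2
      ((h.mem_upperSpace hF).2 (span_le_upper (Submodule.subset_span hv)))
  · have h1 := (h.mem_upperSpace hF).1 ((Submodule.Quotient.eq _).1 e)
    obtain ⟨ξ, hξ⟩ := h.sys.exists_exposing hG
    have h2 := mem_upper.1 h1 ξ (dag_anti hFG (exposing_subset_dag hG.le hξ))
    rw [map_sub, (hξ.2.2 g (hG.le hg)).2 hg, sub_zero] at h2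
    exact (hξ.2.2 x hx).1 h2

theorem mem_dualUpperSpace (hG : G.IsFaceOf X) {ξ : StrongDual ℝ V} :
    ξ ∈ dualUpperSpace VQ C (dagger VQ C (G : Set V)) ↔
      ∀ x ∈ lowerSpace (G : Set V), ξ x = 0 := by
  change ξ ∈ coannih _ ↔ _
  rw [h.codagger_dagger hG]
  refine ⟨fun hξ x hx => ?_, fun hξ x hx => hξ x (Submodule.subset_span hx)⟩
  exact LinearMap.eqOn_span (f := (ξ : Dual ℝ V)) (g := 0) (fun y hy => hξ y hy) hx

theorem mkQ_eq_iff (hG : G.IsFaceOf X) {ξ ζ : StrongDual ℝ V} :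
    dualUpperProj VQ C (dagger VQ C (G : Set V)) ξ =
      dualUpperProj VQ C (dagger VQ C (G : Set V)) ζ ↔
      ∀ x ∈ lowerSpace (G : Set V), ξ x = ζ x := by
  rw [Submodule.mkQ_apply, Submodule.mkQ_apply, Submodule.Quotient.eq, h.mem_dualUpperSpace hG]
  exact forall₂_congr fun x _ => sub_eq_zero (a := ξ x) (b := ζ x)

/-- The closure of the image of `F†` modulo the forms vanishing on `G`. -/
theorem closure_image_dagger (hF : F.IsFaceOf X) (hG : G.IsFaceOf X) (hFG : F ≤ G) :
    closure (dualUpperProj VQ C (dagger VQ C (G : Set V)) '' dagger VQ C (F : Set V)) =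
      dualUpperProj VQ C (dagger VQ C (G : Set V)) ''
        {ξ | (∀ x ∈ G, 0 ≤ ξ x) ∧
          ∀ x ∈ lowerSpace (G : Set V), x ∈ upperSpace VQ C (F : Set V) → ξ x = 0} := by
  set N := dualUpperSpace VQ C (dagger VQ C (G : Set V)) with hN
  set S : Set (StrongDual ℝ V) := {ξ | (∀ x ∈ G, 0 ≤ ξ x) ∧
    ∀ x ∈ lowerSpace (G : Set V), x ∈ upperSpace VQ C (F : Set V) → ξ x = 0} with hS
  have hev : ∀ x : V, Continuous fun ξ : StrongDual ℝ V => ξ x := fun x =>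
    (ContinuousLinearMap.apply ℝ ℝ x).continuous
  have hSc : IsClosed S := by
    have e : S = (⋂ x ∈ G, {ξ : StrongDual ℝ V | 0 ≤ ξ x}) ∩
        ⋂ x ∈ lowerSpace (G : Set V), ⋂ _ : x ∈ upperSpace VQ C (F : Set V),
          {ξ : StrongDual ℝ V | ξ x = 0} := by
      ext ξ
      simp [hS]
    rw [e]
    exact (isClosed_biInter fun x _ => isClosed_le continuous_const (hev x)).inter
      (isClosed_biInter fun x _ => isClosed_iInter fun _ => isClosed_eq (hev x) continuous_const)
  -- The conditions defining `S` involve only the restriction to the span of `G`, so `S` is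
  -- saturated and its image is closed.
  have hsat : N.mkQ ⁻¹' (N.mkQ '' S) = S := by
    refine Set.Subset.antisymm ?_ (Set.subset_preimage_image _ _)
    rintro ξ ⟨ζ, hζ, e⟩
    have e' := (h.mkQ_eq_iff hG).1 e
    refine ⟨fun x hx => ?_, fun x hx hxF => ?_⟩
    · rw [← e' x (Submodule.subset_span hx)]
      exact hζ.1 x hx
    · rw [← e' x hx]
      exact hζ.2 x hx hxF
  have himg : IsClosed (N.mkQ '' S) := by
    rw [← N.isQuotientMap_mkQ.isClosed_preimage, hsat]
    exact hSc
  refine Set.Subset.antisymm (closure_minimal (Set.image_mono fun ξ hξ => ?_) himg) ?_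
  · have hξ' := (h.mem_dagger hF).1 hξ
    exact ⟨fun x hx => dagCone_nonneg hξ' (hG.le hx), fun x _ hx => hx ξ hξ⟩
  let K : PointedCone ℝ (StrongDual ℝ V) :=
    continuousForms (dagCone L X F) ⊔ PointedCone.ofSubmodule N
  have hKN : ∀ ζ ∈ N, ζ ∈ K := fun ζ hζ =>
    (le_sup_right : PointedCone.ofSubmodule N ≤ K) hζ
  have hKD : ∀ ζ ∈ dagger VQ C (F : Set V), ζ ∈ K := fun ζ hζ =>
    (le_sup_left : continuousForms (dagCone L X F) ≤ K) ((h.mem_dagger hF).1 hζ)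
  have hKimg : N.mkQ '' K ⊆ N.mkQ '' dagger VQ C (F : Set V) := by
    rintro _ ⟨ξ, hξ, rfl⟩
    obtain ⟨a, ha, b, hb, rfl⟩ := Submodule.mem_sup.1 hξ
    have hb0 : N.mkQ b = 0 := (Submodule.Quotient.mk_eq_zero N).2 hb
    exact ⟨a, (h.mem_dagger hF).2 ha, by rw [map_add, hb0, add_zero]⟩
  -- A functional separating `ξ` from `K` is evaluation at a point `x`. Nonnegativity on the
  -- subspace `N` puts `x` in the span of `G`, and nonnegativity on `F†` makes `ξ x` nonnegative by
  -- `nonneg_of_dag_nonneg`.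
  have hSK : S ⊆ closure K := by
    intro ξ hξ
    by_contra hξK
    obtain ⟨f, u, hfξ, hfK⟩ := geometric_hahn_banach_point_closed (PointedCone.convex K).closure
      isClosed_closure hξK
    have hu : u < 0 := by simpa using hfK 0 (subset_closure K.zero_mem)
    have hf : ∀ ζ ∈ K, 0 ≤ f ζ := by
      intro ζ hζ
      by_contra! hneg
      have h1 := hfK _ (subset_closure (K.smul_mem (div_pos_of_neg_of_neg hu hneg).le hζ))
      rw [map_smul, smul_eq_mul, div_mul_cancel₀ _ hneg.ne] at h1
      exact h1.false
    obtain ⟨x, hx⟩ := (evalEquiv ℝ V).surjective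
      ((f : StrongDual ℝ V →ₗ[ℝ] ℝ) ∘ₗ
        (LinearMap.toContinuousLinearMap.toLinearMap : Dual ℝ V →ₗ[ℝ] StrongDual ℝ V))
    have hfx : ∀ ζ : Dual ℝ V, f (LinearMap.toContinuousLinearMap ζ) = ζ x := fun ζ =>
      (LinearMap.congr_fun hx ζ).symm
    have hxG : x ∈ lowerSpace (G : Set V) := by
      by_contra hxG
      obtain ⟨ζ, hζx, hζ⟩ := Submodule.exists_le_ker_of_notMem hxG
      have hζN : LinearMap.toContinuousLinearMap ζ ∈ N :=
        (h.mem_dualUpperSpace hG).2 fun y hy => hζ hy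
      have h1 := hf _ (hKN _ hζN)
      have h2 := hf _ (hKN _ (N.neg_mem hζN))
      rw [map_neg] at h2
      rw [hfx] at h1 h2
      exact hζx (le_antisymm (neg_nonneg.1 h2) h1)
    have h1 : 0 ≤ ξ x := h.sys.nonneg_of_dag_nonneg hF hG hFG (ξ := (ξ : Dual ℝ V)) hξ.1
      (fun v hv hvF => hξ.2 v hv ((h.mem_upperSpace hF).2 hvF)) hxG fun ζ hζ => by
        rw [← hfx]
        exact hf _ (hKD _ (h.mem_dagger_of_dag hF hζ))
    have h2 := hfx (ξ : Dual ℝ V)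
    have h3 : f ξ = ξ x := h2
    linarith
  calc N.mkQ '' S ⊆ N.mkQ '' closure K := Set.image_mono hSK
    _ ⊆ closure (N.mkQ '' K) := image_closure_subset_closure_image N.continuous_mkQ
    _ ⊆ _ := closure_mono hKimg

/-- A form on the image of `V_G` is pulled back to `V` through a retraction of `V` onto `V_G`. The
choice does not matter, since classes modulo `(V*)^{G†}` depend only on the restriction to `V_G`;
the image of the dual cone is then the description in `closure_image_dagger`. -/
theorem exists_dual_identification (hF : F.IsFaceOf X) (hG : G.IsFaceOf X) (hFG : F ≤ G) :
    ∃ e : Dual ℝ ((lowerSpace (G : Set V)).map (upperProj VQ C (F : Set V))) →ₗ[ℝ]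
        StrongDual ℝ V ⧸ dualUpperSpace VQ C (dagger VQ C (G : Set V)),
      Function.Injective e ∧
      (∀ (η : Dual ℝ ((lowerSpace (G : Set V)).map (upperProj VQ C (F : Set V))))
        (ξ : StrongDual ℝ V), e η = dualUpperProj VQ C (dagger VQ C (G : Set V)) ξ ↔
          ∀ (x : V) (hx : x ∈ lowerSpace (G : Set V)),
            ξ x = η ⟨upperProj VQ C (F : Set V) x, Submodule.mem_map_of_mem hx⟩) ∧
      e '' {η | ∀ w : (lowerSpace (G : Set V)).map (upperProj VQ C (F : Set V)),
          (w : V ⧸ upperSpace VQ C (F : Set V)) ∈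
            upperProj VQ C (F : Set V) '' intrinsicInterior ℝ (G : Set V) → 0 ≤ η w} =
        closure (dualUpperProj VQ C (dagger VQ C (G : Set V)) '' dagger VQ C (F : Set V)) := by
  let W := lowerSpace (G : Set V)
  let p := upperProj VQ C (F : Set V)
  obtain ⟨r, hr⟩ := W.subtype.exists_leftInverse_of_injective W.ker_subtype
  let g : V →ₗ[ℝ] W.map p := p.submoduleMap W ∘ₗ r
  have hg : ∀ x (hx : x ∈ W), g x = ⟨p x, Submodule.mem_map_of_mem hx⟩ := by
    intro x hx
    have h1 : r x = ⟨x, hx⟩ := LinearMap.congr_fun hr (⟨x, hx⟩ : W)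
    change p.submoduleMap W (r x) = _
    rw [h1]
    rfl
  have hgsurj : ∀ w : W.map p, ∃ x ∈ W, g x = w := by
    rintro ⟨_, x, hx, rfl⟩
    exact ⟨x, hx, hg x hx⟩
  let T : Dual ℝ V →ₗ[ℝ] StrongDual ℝ V := LinearMap.toContinuousLinearMap.toLinearMap
  let N := dualUpperSpace VQ C (dagger VQ C (G : Set V))
  let e : Dual ℝ (W.map p) →ₗ[ℝ] StrongDual ℝ V ⧸ N := N.mkQ ∘ₗ T ∘ₗ g.dualMap
  have hchar : ∀ (η : Dual ℝ (W.map p)) (ξ : StrongDual ℝ V), e η = N.mkQ ξ ↔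
      ∀ x (hx : x ∈ W), ξ x = η ⟨p x, Submodule.mem_map_of_mem hx⟩ := by
    intro η ξ
    refine (h.mkQ_eq_iff hG).trans (forall₂_congr fun x hx => ?_)
    rw [← hg x hx]
    exact eq_comm
  refine ⟨e, fun η η' he => ?_, hchar, ?_⟩
  · have h1 := (hchar η (T (η' ∘ₗ g))).1 he
    ext w
    obtain ⟨x, hx, rfl⟩ := hgsurj w
    rw [hg x hx, ← h1 x hx, ← hg x hx]
    rfl
  rw [h.closure_image_dagger hF hG hFG]
  ext q
  constructor
  · rintro ⟨η, hη, rfl⟩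
    refine ⟨T (η ∘ₗ g), ⟨fun x hx => ?_, fun x hx hxF => ?_⟩, rfl⟩
    · obtain ⟨c, -, hc⟩ := h.sys.exists_face_core hG
      have hpos : ∀ y ∈ core G, 0 ≤ η (g y) := fun y hy => by
        rw [hg y (Submodule.subset_span hy.1)]
        exact hη _ ⟨y, core_subset_intrinsicInterior hy, rfl⟩
      change 0 ≤ η (g x)
      -- Nonnegativity is given only on the relative interior; an arbitrary point of `G` is reached
      -- by adding a vanishing multiple of a core point.
      refine le_of_forall_pos_le_add fun ε hε => ?_
      have hd : 0 < η (g c) + 1 := by linarith [hpos c hc]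
      have h1 := hpos _ (core_add (core_smul hc (div_pos hε hd)) hx)
      rw [map_add, map_add, map_smul, map_smul, smul_eq_mul] at h1
      have h2 : ε / (η (g c) + 1) * η (g c) ≤ ε := by
        rw [div_mul_eq_mul_div, div_le_iff₀ hd]
        linarith
      linarith
    · change η (g x) = 0
      have h1 : p x = 0 := (Submodule.Quotient.mk_eq_zero _).2 hxF
      have h2 : g x = 0 := by
        rw [hg x hx]
        exact Subtype.ext h1
      rw [h2, map_zero]
  · rintro ⟨ξ, ⟨hξG, hξF⟩, rfl⟩
    obtain ⟨η, hη⟩ := exists_factor (A := p.submoduleMap W)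
      (ζ := (ξ : Dual ℝ V) ∘ₗ W.subtype) fun v hv => by
        refine hξF v v.2 ((Submodule.Quotient.mk_eq_zero _).1 ?_)
        exact congrArg Subtype.val hv
    have hηx : ∀ x (hx : x ∈ W), ξ x = η ⟨p x, Submodule.mem_map_of_mem hx⟩ := fun x hx =>
      (LinearMap.congr_fun hη (⟨x, hx⟩ : W)).symm
    refine ⟨η, ?_, (hchar η ξ).2 hηx⟩
    rintro ⟨w, hw⟩ ⟨x, hx, rfl⟩
    have hxG := intrinsicInterior_subset hx
    have h1 := hξG x hxG
    rw [hηx x (Submodule.subset_span hxG)] at h1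
    exact h1

end IsModel

end Model

end RatCone

open PolyCone in
theorem proposition5 {V : Type*} [NormedAddCommGroup V] [NormedSpace ℝ V] [FiniteDimensional ℝ V]
    [Module ℚ V] (VQ : Submodule ℚ V) (C : Set V) (Γ : Subgroup (V ≃ₗ[ℝ] V))
    (h : IsPolyhedralTriple VQ C Γ) :
    -- the common zero set of the rational forms on `V_G` that are `≥ 0` on `G` and `0` on `F`
    (∀ F G : Set V, IsFace (ratHull VQ C) F → IsFace (ratHull VQ C) G → F ⊆ G →
      ∀ x : lowerSpace G,
        (∀ ξ : Module.Dual ℝ (lowerSpace G), IsRationalForm VQ G ξ →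
            (∀ v : lowerSpace G, (v : V) ∈ G → 0 ≤ ξ v) →
            (∀ v : lowerSpace G, (v : V) ∈ F → ξ v = 0) → ξ x = 0) ↔
          (x : V) ∈ upperSpace VQ C F) ∧
    -- the bijection between faces, and exposedness
    (Set.BijOn (dagger VQ C) {F | IsFace (ratHull VQ C) F} {H | IsFace (dualRatHull VQ C) H} ∧
      (∀ F F' : Set V, IsFace (ratHull VQ C) F → IsFace (ratHull VQ C) F' →
        (F ⊆ F' ↔ dagger VQ C F' ⊆ dagger VQ C F)) ∧
      (∀ F : Set V, IsFace (ratHull VQ C) F →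
        codagger VQ C (dagger VQ C F) = F ∧ IsExposed ℝ (ratHull VQ C) F)) ∧
    -- the faces containing `F` and the faces of the two projected cones
    (∀ F : Set V, IsFace (ratHull VQ C) F →
      Set.BijOn (fun G => lowerProj F '' G) {G | IsFace (ratHull VQ C) G ∧ F ⊆ G}
          {H | IsFace (lowerProj F '' ratHull VQ C) H} ∧
        Set.BijOn (fun G => upperProj VQ C F '' G) {G | IsFace (ratHull VQ C) G ∧ F ⊆ G}
          {H | IsFace (upperProj VQ C F '' ratHull VQ C) H}) ∧
    -- the dual of the image of the relative interior of `G`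
    (∀ F G : Set V, IsFace (ratHull VQ C) F → IsFace (ratHull VQ C) G → F ⊆ G →
      ∃ e : Module.Dual ℝ ((lowerSpace G).map (upperProj VQ C F)) →ₗ[ℝ]
          StrongDual ℝ V ⧸ dualUpperSpace VQ C (dagger VQ C G),
        Function.Injective e ∧
        (∀ (η : Module.Dual ℝ ((lowerSpace G).map (upperProj VQ C F))) (ξ : StrongDual ℝ V),
          e η = dualUpperProj VQ C (dagger VQ C G) ξ ↔
            ∀ (x : V) (hx : x ∈ lowerSpace G),
              ξ x = η ⟨upperProj VQ C F x, Submodule.mem_map_of_mem hx⟩) ∧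
        e '' {η | ∀ w : (lowerSpace G).map (upperProj VQ C F),
            (w : V ⧸ upperSpace VQ C F) ∈ upperProj VQ C F '' intrinsicInterior ℝ G → 0 ≤ η w} =
          closure (dualUpperProj VQ C (dagger VQ C G) '' dagger VQ C F)) := by
  obtain ⟨L, X, hm⟩ := RatCone.exists_isModel h
  refine ⟨fun F G hF hG hFG => ?_, ⟨hm.bijOn_dagger, fun F F' hF hF' => ?_, fun F hF => ?_⟩,
    fun F hF => ?_, fun F G hF hG hFG => ?_⟩
  · obtain ⟨F, hF₁, rfl⟩ := hm.isFace_iff.1 hF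
    obtain ⟨G, hG₁, rfl⟩ := hm.isFace_iff.1 hG
    exact hm.rational_zero_set hF₁ hG₁ hFG
  · obtain ⟨F, hF₁, rfl⟩ := hm.isFace_iff.1 hF
    obtain ⟨F', hF₁', rfl⟩ := hm.isFace_iff.1 hF'
    exact hm.subset_iff_dagger hF₁ hF₁'
  · obtain ⟨F, hF₁, rfl⟩ := hm.isFace_iff.1 hF
    exact ⟨hm.codagger_dagger hF₁, hm.isExposed hF₁⟩
  · obtain ⟨F, hF₁, rfl⟩ := hm.isFace_iff.1 hF
    exact ⟨hm.bijOn_lowerProj hF₁, hm.bijOn_upperProj hF₁⟩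
  · obtain ⟨F, hF₁, rfl⟩ := hm.isFace_iff.1 hF
    obtain ⟨G, hG₁, rfl⟩ := hm.isFace_iff.1 hG
    exact hm.exists_dual_identification hF₁ hG₁ hFG
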